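/- **Theorem (Optimal convergence in the $H^1$-norm).** *Domain and coefficient.* Let $\Omega\subset\mathbb{R}^3$ be a bounded open set with Lipschitz boundary, let $p\ge 2$, and let $c\in\mathcal{C}^p(\overline\Omega)$ satisfy $c_0\le c\le c_1$ on $\Omega$ with constants $c_0,c_1>0$. *Reference element.* Let $\tilde e$ be the closed tetrahedron with vertices $(0,0,0),(1,0,0),(0,1,0),(0,0,1)$, and let $\mathcal{P}_k$ be the space of polynomials of degree at most $k$ in three variables. Let $\tilde U$ be a linear space of polynomials such that $p$ is the largest degree with $\mathcal{P}_p\subset\tilde U$. Let $\tilde{\mathcal Q},\tilde{\mathcal Q}'\subset\tilde e$ be finite sets with real weights $\{\tilde\omega_x\}_{x\in\tilde{\mathcal Q}}$ and $\{\tilde\omega'_x\}_{x\in\tilde{\mathcal Q}'}$. Assume: - C1: every real-valued function on $\tilde{\mathcal Q}$ is interpolated by exactly one element of $\tilde U$; - C2: $\tilde U$ and $\tilde{\mathcal Q}$ are invariant under all affine maps that map $\tilde e$ onto itself; - C3: if $\tilde u\in\tilde U$ vanishes at all points of $\tilde{\mathcal Q}\cap\tilde f$, where $\tilde f$ is a face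 of $\tilde e$, then $\tilde u=0$ on $\tilde f$; - C4: $\tilde\omega_x>0$ for all $x\in\tilde{\mathcal Q}$; - C5: $\int_{\tilde e}rq=\sum_{x\in\tilde{\mathcal Q}}\tilde\omega_x r(x)q(x)$ for all $r\in\mathcal{P}_{p-2}$, $q\in\tilde U$; - C6: $\tilde\omega'_x>0$ for all $x\in\tilde{\mathcal Q}'$; - C7: the only $\tilde u\in\tilde U$ with $\nabla\tilde u=0$ at all points of $\tilde{\mathcal Q}'$ are the constants; - C8: $\int_{\tilde e}r\,\partial_iq=\sum_{x\in\tilde{\mathcal Q}'}\tilde\omega'_x r(x)\,\partial_iq(x)$ for all $r\in\mathcal{P}_{p-1}$, $q\in\tilde U$, $i=1,2,3$. *Discretisation.* Let $\mathcal{T}_h$ be a finite conforming mesh of tetrahedra $e=\phi_e(\tilde e)$, with $\phi_e$ affine and invertible, whose union is $\overline\Omega$; here $h$ is the smallest $r$ such that each element is contained in a ball of radius $r$. Assume that $\mathcal{T}_h$ is shape regular with constant $\gamma$: each element $e$ contains a ball of some radius $\rho_e>0$ with $\operatorname{diam}e\le\gamma\rho_e$. Put $$U_h=\{w\in H^1_0(\Omega)\;|\;w\circ\phi_e\in\tilde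 U\text{ for all }e\in\mathcal{T}_h\},\qquad (v,w)_{\mathcal{Q}_h}=\sum_{e\in\mathcal{T}_h}\frac{|e|}{|\tilde e|}\sum_{x\in\tilde{\mathcal Q}}\tilde\omega_x\,v(\phi_e(x))\,w(\phi_e(x)),$$ $$(c\nabla u,\nabla w)_{\mathcal{Q}_h'}=\sum_{e\in\mathcal{T}_h}\frac{|e|}{|\tilde e|}\sum_{x\in\tilde{\mathcal Q}'}\tilde\omega'_x\,c(\phi_e(x))\,\nabla(u|_e)(\phi_e(x))\cdot\nabla(w|_e)(\phi_e(x)).$$ *Claim.* There is a constant $C>0$, depending only on $\Omega$, $c$, $p$, $\tilde U$, the two quadrature rules and $\gamma$, such that the following holds for every such mesh and all integers $k_u,k_v\ge 2$. If $v\in\mathcal{C}^0(\overline\Omega)\cap H^{k_v}(\Omega)$, if $u\in H^1_0(\Omega)\cap H^{k_u}(\Omega)$ satisfies $$(c\nabla u,\nabla w)=(v,w)\quad\text{for all }w\in H^1_0(\Omega),$$ with $(\cdot,\cdot)$ the $L^2(\Omega)$ inner product, and if $u_h\in U_h$ satisfies $$(c\nabla u_h,\nabla w)_{\mathcal{Q}_h'}=(v,w)_{\mathcal{Q}_h}\quad\text{for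 all }w\in U_h,$$ then $$\|u-u_h\|_1\le C\,h^{\min(p,k_u-1,k_v)}\bigl(\|u\|_{\min(p+1,k_u)}+\|v\|_{\min(p,k_v)}\bigr),$$ where $\|w\|_k^2=\sum_{|\alpha|\le k}\|D^\alpha w\|_{L^2(\Omega)}^2$ is the norm of $H^k(\Omega)$. -/

import Mathlib

open MeasureTheory Set
open scoped NNReal ContDiff

noncomputable section

namespace MassLumped

/-- Three-dimensional Euclidean space. -/
abbrev E3 : Type := EuclideanSpace ℝ (Fin 3)

/-! ### Domains and Sobolev spaces -/

/-- `Ω` is open and, near each boundary point and in suitable orthonormal coordinates, it is the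
region strictly below the graph of a Lipschitz function of the first two coordinates. -/
def IsLipschitzDomain (Ω : Set E3) : Prop :=
  IsOpen Ω ∧ ∀ x ∈ frontier Ω, ∃ (R : E3 ≃ᵃⁱ[ℝ] E3) (g : EuclideanSpace ℝ (Fin 2) → ℝ) (K : ℝ≥0)
    (V : Set E3), LipschitzWith K g ∧ IsOpen V ∧ x ∈ V ∧
      ∀ y ∈ V, (y ∈ Ω ↔ R y 2 < g !₂[R y 0, R y 1])

/-- Functions in `C^∞_c(Ω)`. -/
def IsTestFunction (Ω : Set E3) (f : E3 → ℝ) : Prop :=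
  ContDiff ℝ ∞ f ∧ HasCompactSupport f ∧ tsupport f ⊆ Ω

/-- The classical partial derivative `∂ᵢ f`. -/
def partialDeriv (i : Fin 3) (f : E3 → ℝ) : E3 → ℝ :=
  fun x => fderiv ℝ f x (EuclideanSpace.single i 1)

/-- The classical partial derivative `D^α f = ∂₁^{α₁} ∂₂^{α₂} ∂₃^{α₃} f`. -/
def multiDeriv (α : Fin 3 → ℕ) (f : E3 → ℝ) : E3 → ℝ :=
  (partialDeriv 0)^[α 0] ((partialDeriv 1)^[α 1] ((partialDeriv 2)^[α 2] f))

/-- `g ∈ L²(Ω)` is the weak derivative `D^α u` on `Ω`. -/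
def IsWeakDeriv (Ω : Set E3) (α : Fin 3 → ℕ) (u g : E3 → ℝ) : Prop :=
  MemLp g 2 (volume.restrict Ω) ∧
    ∀ f, IsTestFunction Ω f →
      ∫ x in Ω, u x * multiDeriv α f x = (-1) ^ (∑ i, α i) * ∫ x in Ω, g x * f x

/-- The square-integrable weak derivative `D^α u` on `Ω` (unique almost everywhere); it is `0` by
convention if there is none. -/
def weakDeriv (Ω : Set E3) (α : Fin 3 → ℕ) (u : E3 → ℝ) : E3 → ℝ :=
  open Classical in if h : ∃ g, IsWeakDeriv Ω α u g then h.choose else 0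

/-- `u ∈ H^k(Ω)`: `u` and all its weak derivatives of order at most `k` are in `L²(Ω)`. -/
def MemH (Ω : Set E3) (k : ℕ) (u : E3 → ℝ) : Prop :=
  MemLp u 2 (volume.restrict Ω) ∧
    ∀ α : Fin 3 → ℕ, ∑ i, α i ≤ k → ∃ g, IsWeakDeriv Ω α u g

/-- The multi-indices of order at most `k`. -/
def multiIndices (k : ℕ) : Finset (Fin 3 → ℕ) :=
  (Fintype.piFinset fun _ => Finset.range (k + 1)).filter fun α => ∑ i, α i ≤ k

/-- The norm `‖u‖_k` of `H^k(Ω)`. -/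
def normH (Ω : Set E3) (k : ℕ) (u : E3 → ℝ) : ℝ :=
  Real.sqrt (∑ α ∈ multiIndices k, ∫ x in Ω, weakDeriv Ω α u x ^ 2)

/-- `u ∈ H¹₀(Ω)`: `u` lies in the closure of `C^∞_c(Ω)` in `H¹(Ω)`. -/
def MemH10 (Ω : Set E3) (u : E3 → ℝ) : Prop :=
  MemH Ω 1 u ∧ ∀ ε > 0, ∃ f, IsTestFunction Ω f ∧ normH Ω 1 (u - f) < ε

/-- `c ∈ C^p(closure Ω)`: `c` is `C^p` on the open set `Ω`, `c` is continuous on the closure, and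
all derivatives of order at most `p` extend continuously to the closure. -/
def IsCkClosure (Ω : Set E3) (p : ℕ) (c : E3 → ℝ) : Prop :=
  ContDiffOn ℝ p c Ω ∧ ContinuousOn c (closure Ω) ∧
    ∀ m ≤ p, ∃ G : E3 → ContinuousMultilinearMap ℝ (fun _ : Fin m => E3) ℝ,
      ContinuousOn G (closure Ω) ∧ ∀ x ∈ Ω, G x = iteratedFDeriv ℝ m c x

/-! ### The reference element -/

/-- The four barycentric coordinates with respect to the reference tetrahedron. -/
def bary (x : E3) : Fin 4 → ℝ := ![x 0, x 1, x 2, 1 - x 0 - x 1 - x 2]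

/-- The closed reference tetrahedron with vertices `(0,0,0)`, `(1,0,0)`, `(0,1,0)`, `(0,0,1)`. -/
def refTet : Set E3 := {x | ∀ k, 0 ≤ bary x k}

/-- The vertices of the reference tetrahedron. -/
def refVertices : Set E3 := insert 0 (range fun i : Fin 3 => EuclideanSpace.single i (1 : ℝ))

/-- The four closed faces of the reference tetrahedron. -/
def refFace (k : Fin 4) : Set E3 := {x ∈ refTet | bary x k = 0}

/-- The value of a polynomial in three variables at a point. -/
def pval (q : MvPolynomial (Fin 3) ℝ) (x : E3) : ℝ := MvPolynomial.eval (fun i => x i) q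

/-- The polynomials of degree at most `k`. -/
abbrev Poly (k : ℕ) : Submodule ℝ (MvPolynomial (Fin 3) ℝ) :=
  MvPolynomial.restrictTotalDegree (Fin 3) ℝ k

/-- The data of a mass-lumped element: a polynomial space `U` on the reference tetrahedron, nodes
`Q` with weights `wt` (interpolation and mass matrix), and points `Q'` with weights `wt'` (stiffness
matrix). Weights are only relevant at the points of the respective set. -/
structure RefElement where
  U : Submodule ℝ (MvPolynomial (Fin 3) ℝ)
  Q : Finset E3
  wt : E3 → ℝ
  Q' : Finset E3
  wt' : E3 → ℝ
  Q_subset : ∀ x ∈ Q, x ∈ refTet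
  Q'_subset : ∀ x ∈ Q', x ∈ refTet

/-- `p` is the degree of the element: the largest degree such that `P_p ⊆ U`. -/
def RefElement.HasDegree (R : RefElement) (p : ℕ) : Prop :=
  IsGreatest {k | Poly k ≤ R.U} p

/-- The eight conditions on a mass-lumped element of degree `p ≥ 2`, for scalar problems. -/
structure RefElement.Conditions (R : RefElement) (p : ℕ) : Prop where
  /-- Unisolvence of `U` on the nodes. -/
  c1 : Function.Bijective fun (q : R.U) (x : R.Q) => pval q x
  /-- Invariance of the nodes and of `U` under the affine maps of the tetrahedron onto itself. -/
  c2 : ∀ s : E3 →ᵃ[ℝ] E3, s '' refTet = refTet →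
    s '' (R.Q : Set E3) = R.Q ∧ ∀ q ∈ R.U, ∃ r ∈ R.U, ∀ x, pval r x = pval q (s x)
  /-- Face conformity. -/
  c3 : ∀ k, ∀ q ∈ R.U, (∀ x ∈ R.Q, x ∈ refFace k → pval q x = 0) → ∀ x ∈ refFace k, pval q x = 0
  /-- Positivity of the weights. -/
  c4 : ∀ x ∈ R.Q, 0 < R.wt x
  /-- Exactness on `P_{p-2} ⊗ U`. -/
  c5 : ∀ r ∈ Poly (p - 2), ∀ q ∈ R.U,
    ∫ x in refTet, pval (r * q) x = ∑ x ∈ R.Q, R.wt x * pval (r * q) x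
  /-- Positivity of the weights for the stiffness matrix. -/
  c6 : ∀ x ∈ R.Q', 0 < R.wt' x
  /-- Only constants have vanishing gradient at all points of `Q'`. -/
  c7 : ∀ q ∈ R.U, (∀ x ∈ R.Q', ∀ i, pval (MvPolynomial.pderiv i q) x = 0) →
    ∃ a : ℝ, q = MvPolynomial.C a
  /-- Exactness on `P_{p-1} ⊗ DU`. -/
  c8 : ∀ r ∈ Poly (p - 1), ∀ q ∈ R.U, ∀ i,
    ∫ x in refTet, pval (r * MvPolynomial.pderiv i q) x =
      ∑ x ∈ R.Q', R.wt' x * pval (r * MvPolynomial.pderiv i q) x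

/-! ### Meshes and the discrete problem -/

/-- A conforming tetrahedral mesh of `Ω`, given by the affine reference-to-physical maps of its
elements. -/
structure TetMesh (Ω : Set E3) where
  N : ℕ
  φ : Fin N → (E3 ≃ᵃ[ℝ] E3)
  cover : ⋃ e, φ e '' refTet = closure Ω
  disjoint_interior : ∀ e e', e ≠ e' →
    Disjoint (interior (φ e '' refTet)) (interior (φ e' '' refTet))
  /-- Two elements meet in the (possibly empty) simplex spanned by their common vertices. -/
  conforming : ∀ e e', e ≠ e' →
    φ e '' refTet ∩ φ e' '' refTet = convexHull ℝ (φ e '' refVertices ∩ φ e' '' refVertices)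

namespace TetMesh

variable {Ω : Set E3} (T : TetMesh Ω)

/-- The closed element with index `e`. -/
def elem (e : Fin T.N) : Set E3 := T.φ e '' refTet

/-- The mesh size: the smallest `r` such that each element is contained in a ball of radius `r`. -/
def h : ℝ := sInf {r | 0 ≤ r ∧ ∀ e, ∃ z, T.elem e ⊆ Metric.closedBall z r}

/-- Shape regularity with constant `γ`: the diameter of each element is at most `γ` times the
radius of some ball inside it. -/
def ShapeRegular (γ : ℝ) : Prop :=
  ∀ e, ∃ z ρ, 0 < ρ ∧ Metric.closedBall z ρ ⊆ T.elem e ∧ Metric.diam (T.elem e) ≤ γ * ρ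

/-- The volume ratio of an element and the reference tetrahedron. -/
def volRatio (e : Fin T.N) : ℝ := volume.real (T.elem e) / volume.real refTet

/-- `w ∈ U_h = H¹₀(Ω) ∩ U(T_h, U)`. Members are taken as pointwise functions, whose pull-back
agrees with a polynomial of `U` everywhere on the closed reference tetrahedron. -/
def MemUh (U : Submodule ℝ (MvPolynomial (Fin 3) ℝ)) (w : E3 → ℝ) : Prop :=
  MemH10 Ω w ∧ ∀ e, ∃ q ∈ U, ∀ x ∈ refTet, w (T.φ e x) = pval q x

/-- The discrete product `(u, w)_{Q_h}`. -/
def massForm (R : RefElement) (u w : E3 → ℝ) : ℝ :=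
  ∑ e, ∑ x ∈ R.Q, T.volRatio e * R.wt x * (u (T.φ e x) * w (T.φ e x))

/-- The discrete stiffness form `(c ∇u, ∇w)_{Q'_h}`. The gradients are those of the restrictions to
the closed element, so they are also meaningful at quadrature points on element boundaries. -/
def stiffForm (R : RefElement) (c u w : E3 → ℝ) : ℝ :=
  ∑ e, ∑ x ∈ R.Q', T.volRatio e * R.wt' x *
    (c (T.φ e x) * inner ℝ (gradientWithin u (T.elem e) (T.φ e x))
      (gradientWithin w (T.elem e) (T.φ e x)))

/-- `u_h ∈ U_h` solves `(c ∇u_h, ∇w)_{Q'_h} = (v, w)_{Q_h}` for all `w ∈ U_h`. -/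
def IsDiscreteSolution (R : RefElement) (c v uh : E3 → ℝ) : Prop :=
  T.MemUh R.U uh ∧ ∀ w, T.MemUh R.U w → T.stiffForm R c uh w = T.massForm R v w

end TetMesh

/-- `u ∈ H¹₀(Ω)` solves `(c ∇u, ∇w) = (v, w)` for all `w ∈ H¹₀(Ω)`. -/
def IsWeakSolution (Ω : Set E3) (c v u : E3 → ℝ) : Prop :=
  MemH10 Ω u ∧ ∀ w, MemH10 Ω w →
    ∫ x in Ω, c x * ∑ i, weakDeriv Ω (Pi.single i 1) u x * weakDeriv Ω (Pi.single i 1) w x =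
      ∫ x in Ω, v x * w x

end MassLumped

end

open MeasureTheory Set
open scoped NNReal ContDiff

noncomputable section

namespace MassLumped

/-! ### Test functions and weak derivatives -/

/-! The argument is Strang's. Let `I` be the nodal interpolant of `u` and `w = uh - I`. Positivity
of the weights (C6) and the lower bound of `c` make the discrete stiffness form coercive in the
energy that sums the squared gradients at the stiffness quadrature points
(`exists_stiffForm_coercive`). By C7 this energy controls the whole gradient of a discrete function
(`exists_pderiv_bound`), and Friedrichs' inequality (`exists_friedrichs`) then controls its `L²`
norm. Testing the discrete equation with `w` bounds the energy of `w` by the residual of `I`. The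
weak equation turns this residual into a sum over elements of mass quadrature errors for `v w` and
of differences between the exact stiffness integral for `u` and the quadrature for `I`
(`exists_consistency_bound`).

Both local errors have optimal order because only a well-chosen part of the integrand must be
integrated exactly. In the mass form, let `π` and `π'` approximate `v` with degrees `k - 1` and `k -
2`, and let `a` be a value of `w` on the element. Then `v w = (v - π) w + (π - π') (w - a) + π' (w -
a) + a π`. The last two products are integrated exactly by C5, and the first two are of order `k`
(`exists_mass_error_bound`). In the stiffness form, `∂ᵢπ` is telescoped through approximations of
increasing degree, and the increment of degree `m` is paired with a Taylor polynomial of `c` of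
complementary degree, so that C8 applies (`exists_stiff_poly_error_bound`). Constants come from
finite-dimensional estimates on the reference tetrahedron, and the scaling to an element brings in
only `γ` and an upper bound for the mesh size.

The Sobolev inequalities are proved on convex sets by mollification and integration along segments:
Poincaré's inequality (`poincare_mean_zero`), which yields polynomial approximation
(`bramble_hilbert`), and, for two weak derivatives, a supremum bound (`ae_sup_le`) and a Hölder
continuous representative (`exists_continuous_representative`).

It remains to see that the interpolant of `u` lies in `H¹₀`, and this is done without traces. The
continuous representatives on the elements agree at every common point and vanish off `Ω`. Indeed,
two different limits at a point would make the Poincaré double integral over a ball of radius `r` at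
least of order `r ^ 6`, whereas the gradient energy, being of order `r ^ 2`, allows only `r ^ 7`
(`limit_unique`). C1, C2 and C3 carry the agreement from the nodes to whole faces
(`interp_conforming`, `interp_boundary`). The glued function is Lipschitz and vanishes outside `Ω`,
hence belongs to `H¹₀` (`memH10_of_lipschitz`). -/

theorem contDiff_partialDeriv {f : E3 → ℝ} (hf : ContDiff ℝ ∞ f) (i : Fin 3) :
    ContDiff ℝ ∞ (partialDeriv i f) :=
  (hf.fderiv_right (m := ∞) (by simp)).clm_apply contDiff_const

theorem IsTestFunction.partialDeriv {Ω : Set E3} {f : E3 → ℝ} (hf : IsTestFunction Ω f)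
    (i : Fin 3) : IsTestFunction Ω (partialDeriv i f) := by
  refine ⟨contDiff_partialDeriv hf.1 i, hf.2.1.fderiv_apply (𝕜 := ℝ) _, ?_⟩
  refine (closure_mono ?_).trans ((tsupport_fderiv_subset ℝ (f := f)).trans hf.2.2)
  intro x hx
  simp only [Function.mem_support, MassLumped.partialDeriv] at hx ⊢
  intro h0; rw [h0] at hx; simp at hx

theorem partialDeriv_comm {f : E3 → ℝ} (hf : ContDiff ℝ ∞ f) (i j : Fin 3) :
    partialDeriv i (partialDeriv j f) = partialDeriv j (partialDeriv i f) := by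
  funext x
  have hd : DifferentiableAt ℝ (fderiv ℝ f) x :=
    (hf.fderiv_right (m := ∞) (by simp)).differentiable (by simp) x
  have key : ∀ a b : E3, fderiv ℝ (fun y => fderiv ℝ f y a) x b = fderiv ℝ (fderiv ℝ f) x b a := by
    intro a b
    rw [fderiv_clm_apply hd (differentiableAt_const a)]
    simp
  have hs : IsSymmSndFDerivAt ℝ f x :=
    (hf.contDiffAt (x := x)).isSymmSndFDerivAt (by simpa using ENat.LEInfty.out)
  unfold partialDeriv
  rw [key, key, hs.eq]

theorem iterate_partialDeriv_comm {f : E3 → ℝ} (hf : ContDiff ℝ ∞ f) (i j : Fin 3) (n : ℕ) :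
    (partialDeriv j)^[n] (partialDeriv i f) = partialDeriv i ((partialDeriv j)^[n] f) := by
  induction n generalizing f with
  | zero => rfl
  | succ n ih =>
    rw [Function.iterate_succ_apply, Function.iterate_succ_apply, partialDeriv_comm hf j i,
      ih (contDiff_partialDeriv hf j)]

theorem contDiff_iterate_partialDeriv {f : E3 → ℝ} (hf : ContDiff ℝ ∞ f) (j : Fin 3) (n : ℕ) :
    ContDiff ℝ ∞ ((partialDeriv j)^[n] f) := by
  induction n generalizing f with
  | zero => exact hf
  | succ n ih => exact ih (contDiff_partialDeriv hf j)

theorem multiDeriv_partialDeriv {f : E3 → ℝ} (hf : ContDiff ℝ ∞ f) (α : Fin 3 → ℕ) (i : Fin 3) :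
    multiDeriv α (partialDeriv i f) = multiDeriv (α + Pi.single i 1) f := by
  unfold multiDeriv
  have h2 := contDiff_iterate_partialDeriv hf 2 (α 2)
  have h1 := contDiff_iterate_partialDeriv h2 1 (α 1)
  fin_cases i
  · simp [iterate_partialDeriv_comm hf, iterate_partialDeriv_comm h2,
      Function.iterate_succ_apply]
  · simp [iterate_partialDeriv_comm hf, Function.iterate_succ_apply]
  · simp [Function.iterate_succ_apply]

@[simp] theorem multiDeriv_zero (f : E3 → ℝ) : multiDeriv 0 f = f := rfl

@[simp] theorem multiDeriv_single (f : E3 → ℝ) (i : Fin 3) :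
    multiDeriv (Pi.single i 1) f = partialDeriv i f := by
  fin_cases i <;> simp [multiDeriv]

theorem IsTestFunction.mono {O Ω : Set E3} (h : O ⊆ Ω) {f : E3 → ℝ} (hf : IsTestFunction O f) :
    IsTestFunction Ω f := ⟨hf.1, hf.2.1, hf.2.2.trans h⟩

theorem IsTestFunction.eq_zero {Ω : Set E3} {f : E3 → ℝ} (hf : IsTestFunction Ω f) {x : E3}
    (hx : x ∉ Ω) : f x = 0 :=
  image_eq_zero_of_notMem_tsupport fun h => hx (hf.2.2 h)

theorem IsTestFunction.memLp {Ω : Set E3} {f : E3 → ℝ} (hf : IsTestFunction Ω f)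
    (μ : Measure E3) [IsFiniteMeasureOnCompacts μ] : MemLp f 2 μ :=
  hf.1.continuous.memLp_of_hasCompactSupport hf.2.1

theorem multiDeriv_iterate {Ω : Set E3} {f : E3 → ℝ} (hf : IsTestFunction Ω f) (j : Fin 3)
    (n : ℕ) : IsTestFunction Ω ((MassLumped.partialDeriv j)^[n] f) := by
  induction n generalizing f with
  | zero => exact hf
  | succ n ih => exact ih (hf.partialDeriv j)

theorem IsTestFunction.multiDeriv {Ω : Set E3} {f : E3 → ℝ} (hf : IsTestFunction Ω f)
    (α : Fin 3 → ℕ) : IsTestFunction Ω (multiDeriv α f) :=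
  multiDeriv_iterate (multiDeriv_iterate (multiDeriv_iterate hf 2 _) 1 _) 0 _

theorem setIntegral_mul_testFunction {O Ω : Set E3} (h : O ⊆ Ω)
    (g : E3 → ℝ) {f : E3 → ℝ} (hf : IsTestFunction O f) :
    ∫ x in Ω, g x * f x = ∫ x in O, g x * f x := by
  rw [setIntegral_eq_integral_of_forall_compl_eq_zero,
    setIntegral_eq_integral_of_forall_compl_eq_zero]
  · intro x hx; rw [hf.eq_zero hx, mul_zero]
  · intro x hx; rw [hf.eq_zero fun h' => hx (h h'), mul_zero]

theorem IsWeakDeriv.mono {O Ω : Set E3} (h : O ⊆ Ω) {α : Fin 3 → ℕ}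
    {u g : E3 → ℝ} (hu : IsWeakDeriv Ω α u g) : IsWeakDeriv O α u g := by
  refine ⟨hu.1.mono_measure (Measure.restrict_mono_set _ h), fun f hf => ?_⟩
  have := hu.2 f (hf.mono h)
  rwa [setIntegral_mul_testFunction h _ hf,
    setIntegral_mul_testFunction h _ (hf.multiDeriv α)] at this

/-- The difference of two candidates is locally integrable and annihilates every test function, so
the fundamental lemma of the calculus of variations applies. -/
theorem IsWeakDeriv.unique {Ω : Set E3} (hΩ : IsOpen Ω) {α : Fin 3 → ℕ} {u g g' : E3 → ℝ}
    (h : IsWeakDeriv Ω α u g) (h' : IsWeakDeriv Ω α u g') :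
    g =ᵐ[volume.restrict Ω] g' := by
  have hloc : LocallyIntegrableOn (g - g') Ω volume := by
    have : MemLp (g - g') 2 (volume.restrict Ω) := h.1.sub h'.1
    exact locallyIntegrableOn_of_locallyIntegrable_restrict (this.locallyIntegrable (by norm_num))
  have := hΩ.ae_eq_zero_of_integral_contDiff_smul_eq_zero hloc (μ := volume) ?_
  · rw [Filter.EventuallyEq, ae_restrict_iff' hΩ.measurableSet]
    filter_upwards [this] with x hx hxΩ
    have := hx hxΩ
    simpa [sub_eq_zero] using this
  · intro f hf1 hf2 hf3
    have hf : IsTestFunction Ω f := ⟨hf1, hf2, hf3⟩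
    have e1 := h.2 f hf
    have e2 := h'.2 f hf
    have e3 : ∫ x in Ω, g x * f x = ∫ x in Ω, g' x * f x := by
      have hne : ((-1 : ℝ) ^ (∑ i, α i)) ≠ 0 := by positivity
      exact mul_left_cancel₀ hne (e1.symm.trans e2)
    have i1 : Integrable (fun x => g x * f x) (volume.restrict Ω) :=
      h.1.integrable_mul (hf.memLp _)
    have i2 : Integrable (fun x => g' x * f x) (volume.restrict Ω) :=
      h'.1.integrable_mul (hf.memLp _)
    have e4 : ∫ x, f x • (g - g') x = ∫ x in Ω, f x • (g - g') x := by
      rw [setIntegral_eq_integral_of_forall_compl_eq_zero]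
      intro x hx; rw [hf.eq_zero hx, zero_smul]
    rw [e4]
    have e5 : ∫ x in Ω, f x • (g - g') x = ∫ x in Ω, (g x * f x - g' x * f x) := by
      congr 1; funext x; simp; ring
    rw [e5, integral_sub i1 i2, e3, sub_self]

theorem weakDeriv_spec {Ω : Set E3} {α : Fin 3 → ℕ} {u : E3 → ℝ} (h : ∃ g, IsWeakDeriv Ω α u g) :
    IsWeakDeriv Ω α u (weakDeriv Ω α u) := by
  unfold weakDeriv
  rw [dif_pos h]
  exact h.choose_spec

theorem IsWeakDeriv.ae_eq {Ω : Set E3} (hΩ : IsOpen Ω) {α : Fin 3 → ℕ} {u g : E3 → ℝ}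
    (h : IsWeakDeriv Ω α u g) : weakDeriv Ω α u =ᵐ[volume.restrict Ω] g :=
  (weakDeriv_spec ⟨g, h⟩).unique hΩ h

theorem isWeakDeriv_zero {Ω : Set E3} {u : E3 → ℝ} (hu : MemLp u 2 (volume.restrict Ω)) :
    IsWeakDeriv Ω 0 u u := ⟨hu, fun f _ => by simp⟩

theorem IsWeakDeriv.sub {Ω : Set E3} {α : Fin 3 → ℕ} {u v g k : E3 → ℝ}
    (hu : MemLp u 2 (volume.restrict Ω)) (hv : MemLp v 2 (volume.restrict Ω))
    (h : IsWeakDeriv Ω α u g) (h' : IsWeakDeriv Ω α v k) :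
    IsWeakDeriv Ω α (u - v) (g - k) := by
  refine ⟨h.1.sub h'.1, fun f hf => ?_⟩
  have i1 : Integrable (fun x => u x * multiDeriv α f x) (volume.restrict Ω) :=
    hu.integrable_mul ((hf.multiDeriv α).memLp _)
  have i2 : Integrable (fun x => v x * multiDeriv α f x) (volume.restrict Ω) :=
    hv.integrable_mul ((hf.multiDeriv α).memLp _)
  have i3 : Integrable (fun x => g x * f x) (volume.restrict Ω) := h.1.integrable_mul (hf.memLp _)
  have i4 : Integrable (fun x => k x * f x) (volume.restrict Ω) := h'.1.integrable_mul (hf.memLp _)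
  simp only [Pi.sub_apply, sub_mul]
  rw [integral_sub i1 i2, integral_sub i3 i4, h.2 f hf, h'.2 f hf]
  ring

/-- Testing with `∂ᵢ f` and cancelling the common sign shows that higher weak derivatives are
iterated first-order ones. This is how first-order inequalities become applicable to the derivatives
of a Sobolev function. -/
theorem IsWeakDeriv.chain {Ω : Set E3} {α : Fin 3 → ℕ} {i : Fin 3} {u g g' : E3 → ℝ}
    (h : IsWeakDeriv Ω α u g) (h' : IsWeakDeriv Ω (α + Pi.single i 1) u g') :
    IsWeakDeriv Ω (Pi.single i 1) g g' := by
  refine ⟨h'.1, fun f hf => ?_⟩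
  have e1 := h.2 _ (hf.partialDeriv i)
  rw [multiDeriv_partialDeriv hf.1, h'.2 f hf] at e1
  have hs : ∑ j, (α + Pi.single i 1 : Fin 3 → ℕ) j = (∑ j, α j) + 1 := by
    simp [Finset.sum_add_distrib]
  have hne : ((-1 : ℝ) ^ (∑ j, α j)) ≠ 0 := by positivity
  rw [hs, pow_succ, mul_assoc] at e1
  rw [multiDeriv_single, ← mul_left_cancel₀ hne e1]
  simp

/-- `g ∈ L²(O)` has the square-integrable weak gradient `G` on `O`. -/
def HasWeakGrad (O : Set E3) (g : E3 → ℝ) (G : Fin 3 → E3 → ℝ) : Prop :=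
  MemLp g 2 (volume.restrict O) ∧ ∀ i, IsWeakDeriv O (Pi.single i 1) g (G i)

theorem HasWeakGrad.mono {O Ω : Set E3} (h : O ⊆ Ω) {g : E3 → ℝ}
    {G : Fin 3 → E3 → ℝ} (hg : HasWeakGrad Ω g G) : HasWeakGrad O g G :=
  ⟨hg.1.mono_measure (Measure.restrict_mono_set _ h), fun i => (hg.2 i).mono h⟩

theorem HasWeakGrad.integral_eq {O : Set E3} {g : E3 → ℝ} {G : Fin 3 → E3 → ℝ}
    (h : HasWeakGrad O g G) {f : E3 → ℝ} (hf : IsTestFunction O f) (i : Fin 3) :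
    ∫ x in O, g x * partialDeriv i f x = - ∫ x in O, G i x * f x := by
  have := (h.2 i).2 f hf
  simpa [Fintype.sum_pi_single'] using this

theorem hasWeakGrad_of_integral_eq {O : Set E3} {g : E3 → ℝ} {G : Fin 3 → E3 → ℝ}
    (hg : MemLp g 2 (volume.restrict O)) (hG : ∀ i, MemLp (G i) 2 (volume.restrict O))
    (h : ∀ i f, IsTestFunction O f →
      ∫ x in O, g x * partialDeriv i f x = - ∫ x in O, G i x * f x) : HasWeakGrad O g G :=
  ⟨hg, fun i => ⟨hG i, fun f hf => by simpa [Fintype.sum_pi_single'] using h i f hf⟩⟩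

/-! ### Mollification -/

open ContinuousLinearMap in
/-- The standard mollifier at scale `1 / (n + 1)`. -/
def mollifier (n : ℕ) : ContDiffBump (0 : E3) where
  -- The outer radius is half the radius used in `innerSet`, so the closed support of a translated
  -- kernel fits into the open ball. The fixed ratio of the two radii is what almost everywhere
  -- convergence requires.
  rIn := 1 / (4 * (n + 1))
  rOut := 1 / (2 * (n + 1))
  rIn_pos := by positivity
  rIn_lt_rOut := by
    apply one_div_lt_one_div_of_lt <;> [positivity; nlinarith [(Nat.cast_nonneg n : (0:ℝ) ≤ n)]]

/-- The function `g` on `O`, extended by zero and mollified at scale `1 / (n + 1)`. -/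
def mollify (O : Set E3) (n : ℕ) (g : E3 → ℝ) : E3 → ℝ :=
  convolution ((mollifier n).normed volume) (O.indicator g) (ContinuousLinearMap.lsmul ℝ ℝ) volume

/-- The points of `O` at distance at least `1 / (n + 1)` from the complement. -/
def innerSet (O : Set E3) (n : ℕ) : Set E3 := {x | Metric.ball x (1 / ((n : ℝ) + 1)) ⊆ O}

theorem innerSet_subset (O : Set E3) (n : ℕ) : innerSet O n ⊆ O :=
  fun x hx => hx (Metric.mem_ball_self (by positivity))

theorem isClosed_innerSet (O : Set E3) (n : ℕ) : IsClosed (innerSet O n) := by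
  have : innerSet O n = (Metric.thickening (1 / ((n : ℝ) + 1)) Oᶜ)ᶜ := by
    ext x
    simp only [innerSet, mem_ofPred_eq, mem_compl_iff, Metric.mem_thickening_iff, not_exists,
      not_and, not_lt, subset_def, Metric.mem_ball]
    constructor
    · intro h z hz
      by_contra! hlt
      exact hz (h z (by rwa [dist_comm]))
    · intro h z hz
      by_contra hzO
      have := h z hzO
      rw [dist_comm] at this
      linarith
  rw [this]
  exact Metric.isOpen_thickening.isClosed_compl

/-- Translating both end points by the displacement of a point from the convex combination keeps
them in `O`. Convexity survives the shrinking, so inequalities for smooth functions on convex sets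
apply to mollified functions. -/
theorem convex_innerSet {O : Set E3} (hO : Convex ℝ O) (n : ℕ) : Convex ℝ (innerSet O n) := by
  intro x hx y hy a b ha hb hab z hz
  have h1 : x + (z - (a • x + b • y)) ∈ O := by
    apply hx; rw [Metric.mem_ball, dist_eq_norm] at hz ⊢; simpa using hz
  have h2 : y + (z - (a • x + b • y)) ∈ O := by
    apply hy; rw [Metric.mem_ball, dist_eq_norm] at hz ⊢; simpa using hz
  have := hO h1 h2 ha hb hab
  convert this using 1
  have hb' : b = 1 - a := by linarith
  rw [hb']; module

theorem monotone_innerSet (O : Set E3) : Monotone (innerSet O) := by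
  intro m n hmn x hx
  refine (Metric.ball_subset_ball ?_).trans hx
  apply one_div_le_one_div_of_le (by positivity)
  have : (m : ℝ) ≤ n := by exact_mod_cast hmn
  linarith

theorem eventually_mem_innerSet {O : Set E3} (hO : IsOpen O) {x : E3} (hx : x ∈ O) :
    ∀ᶠ n in Filter.atTop, x ∈ innerSet O n := by
  obtain ⟨ε, hε, h⟩ := Metric.isOpen_iff.1 hO x hx
  filter_upwards [tendsto_one_div_add_atTop_nhds_zero_nat.eventually (gt_mem_nhds hε)] with n hn
  exact (Metric.ball_subset_ball hn.le).trans h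

theorem iUnion_innerSet {O : Set E3} (hO : IsOpen O) : ⋃ n, innerSet O n = O := by
  apply Subset.antisymm (iUnion_subset fun n => innerSet_subset O n)
  intro x hx
  obtain ⟨n, hn⟩ := (eventually_mem_innerSet hO hx).exists
  exact mem_iUnion.2 ⟨n, hn⟩

/-- Pointwise estimates on the inner sets divide by their volume; this keeps them uniform at the
cost of a factor two. -/
theorem eventually_half_le_volume_innerSet {O : Set E3} (hO : IsOpen O) (hb : volume O ≠ ⊤) :
    ∀ᶠ n in Filter.atTop, volume.real O / 2 ≤ volume.real (innerSet O n) := by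
  have h := tendsto_measure_iUnion_atTop (μ := volume) (monotone_innerSet O)
  rw [iUnion_innerSet hO] at h
  have h' : Filter.Tendsto (fun n => volume.real (innerSet O n)) Filter.atTop
      (nhds (volume.real O)) := (ENNReal.tendsto_toReal hb).comp h
  rcases eq_or_lt_of_le (measureReal_nonneg : 0 ≤ volume.real O) with h0 | h0
  · filter_upwards with n
    rw [← h0]; simp [measureReal_nonneg]
  · filter_upwards [h'.eventually (lt_mem_nhds (by linarith : volume.real O / 2 < volume.real O))]
      with n hn using hn.le

section

variable {O : Set E3} (hO : IsOpen O) {g : E3 → ℝ} (hg : MemLp g 2 (volume.restrict O))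
include hO hg

theorem memLp_indicator : MemLp (O.indicator g) 2 volume :=
  (memLp_indicator_iff_restrict hO.measurableSet).2 hg

theorem locallyIntegrable_indicator : LocallyIntegrable (O.indicator g) volume :=
  (memLp_indicator hO hg).locallyIntegrable (by norm_num)

theorem contDiff_mollify (n : ℕ) : ContDiff ℝ ∞ (mollify O n g) :=
  (mollifier n).hasCompactSupport_normed.contDiff_convolution_left _
    (mollifier n).contDiff_normed (locallyIntegrable_indicator hO hg)

theorem ae_tendsto_mollify :
    ∀ᵐ x ∂volume.restrict O, Filter.Tendsto (fun n => mollify O n g x) Filter.atTop (nhds (g x)) := by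
  have h1 : Filter.Tendsto (fun n => (mollifier n).rOut) Filter.atTop (nhds 0) := by
    have := (tendsto_one_div_add_atTop_nhds_zero_nat (𝕜 := ℝ)).const_mul (1 / 2)
    rw [mul_zero] at this
    refine this.congr fun n => ?_
    simp only [mollifier]; field_simp
  have h2 : ∀ᶠ n in Filter.atTop, (mollifier n).rOut ≤ 2 * (mollifier n).rIn := by
    refine .of_forall fun n => le_of_eq ?_
    simp only [mollifier]; field_simp; norm_num
  have := ContDiffBump.ae_convolution_tendsto_right_of_locallyIntegrable (μ := volume) h1 h2
    (locallyIntegrable_indicator hO hg)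
  rw [ae_restrict_iff' hO.measurableSet]
  filter_upwards [this] with x hx hxO
  rwa [indicator_of_mem hxO] at hx

end

/-! ### Cauchy–Schwarz, the `L²` bound for mollification, and derivatives of mollified functions -/

theorem sq_lintegral_mul_le {α : Type*} [MeasurableSpace α] (μ : Measure α) {f g : α → ENNReal}
    (hf : AEMeasurable f μ) (hg : AEMeasurable g μ) :
    (∫⁻ a, f a * g a ∂μ) ^ 2 ≤ (∫⁻ a, f a ^ 2 ∂μ) * ∫⁻ a, g a ^ 2 ∂μ := by
  have h := ENNReal.lintegral_mul_le_Lp_mul_Lq μ Real.HolderConjugate.two_two hf hg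
  have h2 := pow_le_pow_left' h 2
  refine h2.trans (le_of_eq ?_)
  rw [mul_pow, ← ENNReal.rpow_natCast, ← ENNReal.rpow_natCast, ← ENNReal.rpow_mul,
    ← ENNReal.rpow_mul]
  norm_num

/-- Jensen's inequality for averages with respect to a density of integral one. -/
theorem sq_enorm_integral_mul_le {ρ h : E3 → ℝ} (hρ : Continuous ρ) (hρ0 : ∀ t, 0 ≤ ρ t)
    (hρi : Integrable ρ) (hρ1 : ∫ t, ρ t = 1) (hh : AEStronglyMeasurable h volume) :
    ‖∫ t, ρ t * h t‖ₑ ^ 2 ≤ ∫⁻ t, ENNReal.ofReal (ρ t) * ‖h t‖ₑ ^ 2 := by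
  have h1 : ‖∫ t, ρ t * h t‖ₑ ≤
      ∫⁻ t, ENNReal.ofReal (√(ρ t)) * (ENNReal.ofReal (√(ρ t)) * ‖h t‖ₑ) := by
    refine (enorm_integral_le_lintegral_enorm _).trans (le_of_eq ?_)
    congr 1; funext t
    rw [← mul_assoc, ← ENNReal.ofReal_mul (Real.sqrt_nonneg _), Real.mul_self_sqrt (hρ0 t),
      enorm_mul, Real.enorm_of_nonneg (hρ0 t)]
  have m1 : AEMeasurable (fun t => ENNReal.ofReal (√(ρ t))) volume :=
    (ENNReal.measurable_ofReal.comp hρ.sqrt.measurable).aemeasurable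
  have h2 := sq_lintegral_mul_le volume m1 (m1.mul hh.enorm)
  refine (pow_le_pow_left' h1 2).trans (h2.trans (le_of_eq ?_))
  have e1 : ∀ t, ENNReal.ofReal (√(ρ t)) ^ 2 = ENNReal.ofReal (ρ t) := fun t => by
    rw [← ENNReal.ofReal_pow (Real.sqrt_nonneg _), Real.sq_sqrt (hρ0 t)]
  simp only [Pi.mul_apply, mul_pow, e1]
  rw [← ofReal_integral_eq_lintegral_ofReal hρi (.of_forall hρ0), hρ1]
  simp

section

variable {O : Set E3} (hO : IsOpen O) {g : E3 → ℝ} (hg : MemLp g 2 (volume.restrict O))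
include hO hg

/-- Jensen's inequality for the kernel, Tonelli, and translation invariance of Lebesgue measure. -/
theorem lintegral_mollify_sq_le (n : ℕ) :
    ∫⁻ x, ‖mollify O n g x‖ₑ ^ 2 ≤ ∫⁻ x in O, ‖g x‖ₑ ^ 2 := by
  set ρ := (mollifier n).normed (volume : Measure E3) with hρ
  have hρ0 : ∀ t, 0 ≤ ρ t := fun t => (mollifier n).nonneg_normed t
  have hρc : Continuous ρ := (mollifier n).continuous_normed
  have hρi : Integrable ρ := (mollifier n).integrable_normed
  have hρ1 : ∫ t, ρ t = 1 := (mollifier n).integral_normed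
  have hm := (memLp_indicator hO hg).aestronglyMeasurable
  have hmp : ∀ x : E3, AEStronglyMeasurable (fun t => O.indicator g (x - t)) volume := fun x =>
    hm.comp_quasiMeasurePreserving (quasiMeasurePreserving_sub_left volume x)
  calc ∫⁻ x, ‖mollify O n g x‖ₑ ^ 2
      ≤ ∫⁻ x, ∫⁻ t, ENNReal.ofReal (ρ t) * ‖O.indicator g (x - t)‖ₑ ^ 2 := by
        refine lintegral_mono fun x => ?_
        exact sq_enorm_integral_mul_le hρc hρ0 hρi hρ1 (hmp x)
    _ = ∫⁻ t, ∫⁻ x, ENNReal.ofReal (ρ t) * ‖O.indicator g (x - t)‖ₑ ^ 2 := by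
        apply lintegral_lintegral_swap
        have m1 : AEMeasurable (fun p : E3 × E3 => ENNReal.ofReal (ρ p.2)) (volume.prod volume) :=
          ((ENNReal.measurable_ofReal.comp hρc.measurable).comp measurable_snd).aemeasurable
        have m2 : AEMeasurable (fun p : E3 × E3 => ‖O.indicator g (p.1 - p.2)‖ₑ)
            (volume.prod volume) := (hm.comp_quasiMeasurePreserving
            (quasiMeasurePreserving_sub_of_right_invariant volume volume)).enorm
        exact m1.mul (m2.pow_const 2)
    _ = ∫⁻ t, ENNReal.ofReal (ρ t) * ∫⁻ x, ‖O.indicator g x‖ₑ ^ 2 := by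
        congr 1; funext t
        rw [lintegral_const_mul' _ _ ENNReal.ofReal_ne_top,
          lintegral_sub_right_eq_self (fun x => ‖O.indicator g x‖ₑ ^ 2) t]
    _ = ∫⁻ x, ‖O.indicator g x‖ₑ ^ 2 := by
        rw [lintegral_mul_const _ (hρc.measurable.ennreal_ofReal),
          ← ofReal_integral_eq_lintegral_ofReal hρi (.of_forall hρ0), hρ1]
        simp
    _ = ∫⁻ x in O, ‖g x‖ₑ ^ 2 := by
        rw [← lintegral_indicator hO.measurableSet]
        congr 1; funext x
        by_cases hx : x ∈ O <;> simp [hx]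

/-- For `x` in the inner set the function `y ↦ ρ (x - y)` is a test function on `O`. Differentiating
the kernel and moving the derivative onto `g` is therefore the definition of the weak derivative;
the two signs cancel. -/
theorem partialDeriv_mollify {G : Fin 3 → E3 → ℝ} (hG : HasWeakGrad O g G) {n : ℕ} {x : E3}
    (hx : x ∈ innerSet O n) (i : Fin 3) :
    partialDeriv i (mollify O n g) x = mollify O n (G i) x := by
  set ρ := (mollifier n).normed (volume : Measure E3) with hρ
  have hρs : ContDiff ℝ ∞ ρ := (mollifier n).contDiff_normed
  have hρs1 : ContDiff ℝ 1 ρ := (mollifier n).contDiff_normed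
  have hρc : HasCompactSupport ρ := (mollifier n).hasCompactSupport_normed
  have hli := locallyIntegrable_indicator hO hg
  have hd := hρc.hasFDerivAt_convolution_left (ContinuousLinearMap.lsmul ℝ ℝ) hρs1 hli x
  have h1 : partialDeriv i (mollify O n g) x =
      ∫ t, fderiv ℝ ρ (x - t) (EuclideanSpace.single i 1) * O.indicator g t := by
    unfold partialDeriv mollify
    rw [hd.fderiv, convolution_eq_swap, ContinuousLinearMap.integral_apply]
    · rfl
    · have := (hρc.fderiv ℝ).convolutionExists_left
        ((ContinuousLinearMap.lsmul ℝ ℝ).precompL E3) (hρs1.continuous_fderiv one_ne_zero) hli x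
      exact this.integrable_swap
  set f : E3 → ℝ := fun y => ρ (x - y) with hf
  have hft : IsTestFunction O f := by
    refine ⟨hρs.comp (contDiff_const.sub contDiff_id), ?_, ?_⟩
    · exact hρc.comp_homeomorph (Homeomorph.subLeft x)
    · have : tsupport f ⊆ Metric.closedBall x (mollifier n).rOut := by
        apply closure_minimal _ Metric.isClosed_closedBall
        intro y hy
        have : x - y ∈ tsupport ρ := subset_tsupport _ hy
        rw [hρ, ContDiffBump.tsupport_normed_eq, Metric.mem_closedBall, dist_zero_right] at this
        rwa [Metric.mem_closedBall, dist_comm, dist_eq_norm]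
      refine this.trans (Subset.trans (Metric.closedBall_subset_ball ?_) hx)
      simp only [mollifier]
      apply one_div_lt_one_div_of_lt <;> [positivity; nlinarith [(Nat.cast_nonneg n : (0:ℝ) ≤ n)]]
  have hfd : ∀ y, partialDeriv i f y = - fderiv ℝ ρ (x - y) (EuclideanSpace.single i 1) := by
    intro y
    have h1 : HasFDerivAt ρ (fderiv ℝ ρ (x - y)) (x - y) :=
      (hρs1.differentiable one_ne_zero _).hasFDerivAt
    have h2 : HasFDerivAt (fun y : E3 => x - y) (-ContinuousLinearMap.id ℝ E3) y :=
      (hasFDerivAt_id y).const_sub x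
    have := (h1.comp y h2).fderiv
    unfold partialDeriv
    change fderiv ℝ (ρ ∘ fun y => x - y) y _ = _
    rw [this]; simp
  have key := hG.integral_eq hft i
  rw [h1]
  have e1 : ∫ t, fderiv ℝ ρ (x - t) (EuclideanSpace.single i 1) * O.indicator g t =
      - ∫ y in O, g y * partialDeriv i f y := by
    rw [← integral_indicator hO.measurableSet, ← integral_neg]
    congr 1; funext y
    by_cases hy : y ∈ O <;> simp [hy, hfd, mul_comm]
  rw [e1, key, neg_neg]
  unfold mollify
  rw [convolution_eq_swap, ← integral_indicator hO.measurableSet]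
  congr 1; funext y
  by_cases hy : y ∈ O <;> simp [hy, hf, mul_comm, ← hρ]

end

/-! ### Integral inequalities for smooth functions on convex sets -/

theorem lintegral_comp_affine {s : ℝ} (hs : 0 < s) (b : E3) {H : E3 → ENNReal}
    (hH : Measurable H) :
    ∫⁻ z, H (s • z + b) = ENNReal.ofReal (s ^ (-3 : ℝ)) * ∫⁻ z, H z := by
  have h1 : ∫⁻ z, H (s • z + b) =
      ∫⁻ y, H (y + b) ∂(Measure.map (fun z : E3 => s • z) volume) := by
    exact (lintegral_map (hH.comp (measurable_add_const b)) (measurable_const_smul s)).symm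
  rw [h1, Measure.map_addHaar_smul volume hs.ne', lintegral_smul_measure,
    lintegral_add_right_eq_self]
  congr 2
  rw [finrank_euclideanSpace_fin, abs_of_pos (by positivity), Real.rpow_neg hs.le]
  norm_cast

/-- A contraction of a convex set towards one of its points stays inside the set, and the change of
variables costs the third power of the factor, the dimension being three. -/
theorem setLIntegral_comp_homothety_le {K : Set E3} (hK : Convex ℝ K) (hKm : MeasurableSet K)
    {ξ : E3} (hξ : ξ ∈ K) {s : ℝ} (hs : 0 < s) (hs1 : s ≤ 1) {F : E3 → ENNReal}
    (hF : Measurable F) :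
    ∫⁻ z in K, F (ξ + s • (z - ξ)) ≤ ENNReal.ofReal (s ^ (-3 : ℝ)) * ∫⁻ z in K, F z := by
  calc ∫⁻ z in K, F (ξ + s • (z - ξ))
      ≤ ∫⁻ z, K.indicator F (s • z + (1 - s) • ξ) := by
        rw [← lintegral_indicator hKm]
        refine lintegral_mono fun z => ?_
        by_cases hz : z ∈ K
        · have hm : s • z + (1 - s) • ξ ∈ K := hK hz hξ hs.le (by linarith) (by ring)
          have he : ξ + s • (z - ξ) = s • z + (1 - s) • ξ := by module
          rw [indicator_of_mem hz, indicator_of_mem hm, he]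
        · rw [indicator_of_notMem hz]; exact zero_le
    _ = _ := by
        rw [lintegral_comp_affine hs _ (hF.indicator hKm), lintegral_indicator hKm]

theorem enorm_sub_le_lintegral_fderiv {f : E3 → ℝ} (hf : ContDiff ℝ ∞ f) (x w : E3) {a b : ℝ}
    (hab : a ≤ b) :
    ‖f (x + b • w) - f (x + a • w)‖ₑ ≤
      ‖w‖ₑ * ∫⁻ τ in Ioc a b, ‖fderiv ℝ f (x + τ • w)‖ₑ := by
  have hc : Continuous (fderiv ℝ f) := hf.continuous_fderiv (by simp)
  have hd : ∀ τ ∈ uIcc a b, HasDerivAt (fun τ : ℝ => f (x + τ • w)) (fderiv ℝ f (x + τ • w) w) τ := by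
    intro τ _
    have h1 : HasDerivAt (fun τ : ℝ => x + τ • w) w τ := by
      simpa using ((hasDerivAt_id τ).smul_const w).const_add x
    exact ((hf.differentiable (by simp) _).hasFDerivAt).comp_hasDerivAt τ h1
  have hcont : Continuous fun τ : ℝ => fderiv ℝ f (x + τ • w) w := by fun_prop
  have h := intervalIntegral.integral_eq_sub_of_hasDerivAt hd (hcont.intervalIntegrable _ _)
  rw [← h, intervalIntegral.integral_of_le hab]
  refine (enorm_integral_le_lintegral_enorm _).trans ?_
  rw [← lintegral_const_mul' _ _ enorm_ne_top]
  refine lintegral_mono fun τ => ?_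
  rw [mul_comm]
  exact ContinuousLinearMap.le_opENorm _ _

/-- Cauchy–Schwarz along the segment after inserting `τ ^ (-r/2) * τ ^ (r/2)`. The free weight `r`
is later adapted to the blow-up of the gradient integrals as `τ` tends to zero. -/
theorem sq_enorm_sub_le_lintegral_fderiv {f : E3 → ℝ} (hf : ContDiff ℝ ∞ f) (x w : E3) {a b : ℝ}
    (ha : 0 ≤ a) (hab : a ≤ b) (r : ℝ) :
    ‖f (x + b • w) - f (x + a • w)‖ₑ ^ 2 ≤
      ‖w‖ₑ ^ 2 * ((∫⁻ τ in Ioc a b, ENNReal.ofReal (τ ^ (-r))) *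
        ∫⁻ τ in Ioc a b, ENNReal.ofReal (τ ^ r) * ‖fderiv ℝ f (x + τ • w)‖ₑ ^ 2) := by
  have hc : Continuous (fderiv ℝ f) := hf.continuous_fderiv (by simp)
  refine (pow_le_pow_left' (enorm_sub_le_lintegral_fderiv hf x w hab) 2).trans ?_
  rw [mul_pow]
  gcongr
  have hm : ∀ q : ℝ, Measurable fun τ : ℝ => ENNReal.ofReal (τ ^ q) := fun q =>
    (measurable_id.pow_const q).ennreal_ofReal
  have hN : Measurable fun τ : ℝ => ‖fderiv ℝ f (x + τ • w)‖ₑ :=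
    (show Continuous fun τ : ℝ => fderiv ℝ f (x + τ • w) by fun_prop).enorm.measurable
  have := sq_lintegral_mul_le (volume.restrict (Ioc a b)) (hm (-(r / 2))).aemeasurable
    ((hm (r / 2)).mul hN).aemeasurable
  have e1 : ∀ τ ∈ Ioc a b, ∀ q : ℝ, ENNReal.ofReal (τ ^ (q / 2)) ^ 2 = ENNReal.ofReal (τ ^ q) := by
    intro τ hτ q
    have h0 : 0 < τ := ha.trans_lt hτ.1
    rw [← ENNReal.ofReal_pow (by positivity), ← Real.rpow_natCast, ← Real.rpow_mul h0.le]
    congr 2; push_cast; ring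
  calc _ = (∫⁻ τ in Ioc a b, ENNReal.ofReal (τ ^ (-(r / 2))) *
        (ENNReal.ofReal (τ ^ (r / 2)) * ‖fderiv ℝ f (x + τ • w)‖ₑ)) ^ 2 := by
        congr 1
        refine setLIntegral_congr_fun measurableSet_Ioc fun τ hτ => ?_
        have h0 : 0 < τ := ha.trans_lt hτ.1
        rw [← mul_assoc, ← ENNReal.ofReal_mul (by positivity), ← Real.rpow_add h0]
        simp
    _ ≤ _ := this
    _ = _ := by
        congr 1
        · refine setLIntegral_congr_fun measurableSet_Ioc fun τ hτ => ?_
          rw [← e1 τ hτ (-r), neg_div]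
        · refine setLIntegral_congr_fun measurableSet_Ioc fun τ hτ => ?_
          simp only [Pi.mul_apply]
          rw [mul_pow, ← e1 τ hτ r]

/-- When the gradient integral along the homotheties grows like `τ ^ (-2r)`, the weight `τ ^ r`
leaves `τ ^ (-r)`, the same integrand as in the other Cauchy–Schwarz factor; hence the square. It is
used with `r = 3/2` when one derivative is available and with `r = 1/2` when two are. -/
theorem lintegral_sq_sub_homothety_le {K : Set E3} 
    {D : ℝ} {f : E3 → ℝ} (hf : ContDiff ℝ ∞ f) {ξ : E3} 
    (hKm : MeasurableSet K) (hD : ∀ z ∈ K, ‖z - ξ‖ ≤ D) {a b : ℝ} (ha : 0 ≤ a) (hab : a ≤ b) {r : ℝ}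
    {B : ENNReal} (hB : ∀ τ ∈ Ioc a b, ∫⁻ z in K, ‖fderiv ℝ f (ξ + τ • (z - ξ))‖ₑ ^ 2 ≤
      ENNReal.ofReal (τ ^ (-(2 * r))) * B) :
    ∫⁻ z in K, ‖f (ξ + b • (z - ξ)) - f (ξ + a • (z - ξ))‖ₑ ^ 2 ≤
      ENNReal.ofReal D ^ 2 * (∫⁻ τ in Ioc a b, ENNReal.ofReal (τ ^ (-r))) ^ 2 * B := by
  have hc : Continuous (fderiv ℝ f) := hf.continuous_fderiv (by simp)
  set J := ∫⁻ τ in Ioc a b, ENNReal.ofReal (τ ^ (-r)) with hJ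
  have hm : ∀ q : ℝ, Measurable fun τ : ℝ => ENNReal.ofReal (τ ^ q) := fun q =>
    (measurable_id.pow_const q).ennreal_ofReal
  have hN : Measurable fun p : E3 × ℝ => ‖fderiv ℝ f (ξ + p.2 • (p.1 - ξ))‖ₑ ^ 2 :=
    (show Continuous fun p : E3 × ℝ => fderiv ℝ f (ξ + p.2 • (p.1 - ξ)) by
      fun_prop).enorm.measurable.pow_const 2
  calc _ ≤ ∫⁻ z in K, (ENNReal.ofReal D ^ 2 * J) *
        ∫⁻ τ in Ioc a b, ENNReal.ofReal (τ ^ r) * ‖fderiv ℝ f (ξ + τ • (z - ξ))‖ₑ ^ 2 := by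
        refine setLIntegral_mono' hKm fun z hz => ?_
        refine (sq_enorm_sub_le_lintegral_fderiv hf ξ (z - ξ) ha hab r).trans ?_
        rw [← mul_assoc]
        gcongr
        rw [← ofReal_norm]
        exact ENNReal.ofReal_le_ofReal (hD z hz)
    _ = (ENNReal.ofReal D ^ 2 * J) * ∫⁻ z in K, ∫⁻ τ in Ioc a b,
          ENNReal.ofReal (τ ^ r) * ‖fderiv ℝ f (ξ + τ • (z - ξ))‖ₑ ^ 2 := by
        rw [lintegral_const_mul]
        exact Measurable.lintegral_prod_right' (f := fun p : E3 × ℝ => ENNReal.ofReal (p.2 ^ r) *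
          ‖fderiv ℝ f (ξ + p.2 • (p.1 - ξ))‖ₑ ^ 2) (((hm r).comp measurable_snd).mul hN)
    _ = (ENNReal.ofReal D ^ 2 * J) * ∫⁻ τ in Ioc a b, ∫⁻ z in K,
          ENNReal.ofReal (τ ^ r) * ‖fderiv ℝ f (ξ + τ • (z - ξ))‖ₑ ^ 2 := by
        rw [lintegral_lintegral_swap]
        exact (((hm r).comp measurable_snd).mul hN).aemeasurable
    _ ≤ (ENNReal.ofReal D ^ 2 * J) * ∫⁻ τ in Ioc a b, ENNReal.ofReal (τ ^ (-r)) * B := by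
        refine mul_le_mul' le_rfl (setLIntegral_mono' measurableSet_Ioc fun τ hτ => ?_)
        have h0 : 0 < τ := ha.trans_lt hτ.1
        rw [lintegral_const_mul' _ _ ENNReal.ofReal_ne_top]
        refine (mul_le_mul' le_rfl (hB τ hτ)).trans (le_of_eq ?_)
        rw [← mul_assoc, ← ENNReal.ofReal_mul (by positivity), ← Real.rpow_add h0]
        congr 3; ring
    _ = _ := by
        rw [lintegral_mul_const _ (hm _)]
        ring

theorem lintegral_rpow_neg_three_halves_le {s : ℝ} (hs : 0 < s) (hs1 : s ≤ 1) :
    (∫⁻ τ in Ioc s 1, ENNReal.ofReal (τ ^ (-(3 / 2 : ℝ)))) ^ 2 ≤ ENNReal.ofReal (4 * s ^ (-1 : ℝ)) := by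
  have hn : (0 : ℝ) ∉ uIcc s 1 := by rw [uIcc_of_le hs1]; exact fun h => absurd h.1 (by linarith)
  have hi : IntegrableOn (fun τ : ℝ => τ ^ (-(3 / 2 : ℝ))) (Ioc s 1) :=
    (intervalIntegrable_iff_integrableOn_Ioc_of_le hs1).1
      (intervalIntegral.intervalIntegrable_rpow (Or.inr hn))
  rw [← ofReal_integral_eq_lintegral_ofReal hi, ← intervalIntegral.integral_of_le hs1,
    integral_rpow (Or.inr ⟨by norm_num, hn⟩), ← ENNReal.ofReal_pow]
  · apply ENNReal.ofReal_le_ofReal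
    have h2 : s ^ (-1 : ℝ) = (s ^ (-(1 / 2) : ℝ)) ^ 2 := by
      rw [← Real.rpow_natCast, ← Real.rpow_mul hs.le]; norm_num
    have h3 : (1 : ℝ) ≤ s ^ (-(1 / 2) : ℝ) :=
      Real.one_le_rpow_of_pos_of_le_one_of_nonpos hs hs1 (by norm_num)
    rw [h2]
    norm_num at h3 ⊢
    nlinarith
  · have h3 : (1 : ℝ) ≤ s ^ (-(1 / 2) : ℝ) :=
      Real.one_le_rpow_of_pos_of_le_one_of_nonpos hs hs1 (by norm_num)
    norm_num at h3 ⊢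
    linarith
  · filter_upwards [ae_restrict_mem measurableSet_Ioc] with τ hτ
    have : 0 < τ := hs.trans hτ.1
    simp only [Pi.zero_apply]; positivity

theorem lintegral_rpow_neg_half_le {t : ℝ} (ht : 0 < t) :
    (∫⁻ τ in Ioc 0 t, ENNReal.ofReal (τ ^ (-(1 / 2 : ℝ)))) ^ 2 ≤ ENNReal.ofReal (4 * t) := by
  have hi : IntegrableOn (fun τ : ℝ => τ ^ (-(1 / 2 : ℝ))) (Ioc 0 t) :=
    (intervalIntegrable_iff_integrableOn_Ioc_of_le ht.le).1
      (intervalIntegral.intervalIntegrable_rpow' (by norm_num))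
  rw [← ofReal_integral_eq_lintegral_ofReal hi, ← intervalIntegral.integral_of_le ht.le,
    integral_rpow (Or.inl (by norm_num)), ← ENNReal.ofReal_pow]
  · apply ENNReal.ofReal_le_ofReal
    have h2 : (t ^ (1 / 2 : ℝ)) ^ 2 = t := by
      rw [← Real.rpow_natCast, ← Real.rpow_mul ht.le]; norm_num
    norm_num at h2 ⊢
    nlinarith
  · norm_num
    positivity
  · filter_upwards [ae_restrict_mem measurableSet_Ioc] with τ hτ
    have : 0 < τ := hτ.1
    simp only [Pi.zero_apply]; positivity

/-- The squared `L²(O)` norm as an extended nonnegative number. -/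
def lsq (O : Set E3) (g : E3 → ℝ) : ENNReal := ∫⁻ x in O, ‖g x‖ₑ ^ 2

theorem enorm_sq_eq (a : ℝ) : ‖a‖ₑ ^ 2 = ENNReal.ofReal (a ^ 2) := by
  rw [Real.enorm_eq_ofReal_abs, ← ENNReal.ofReal_pow (abs_nonneg a), sq_abs]

theorem enorm_sq_add_le (a b : ℝ) : ‖a + b‖ₑ ^ 2 ≤ 2 * ‖a‖ₑ ^ 2 + 2 * ‖b‖ₑ ^ 2 := by
  have h2 : (2 : ENNReal) = ENNReal.ofReal 2 := by simp
  simp only [enorm_sq_eq]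
  rw [h2, ← ENNReal.ofReal_mul (by norm_num), ← ENNReal.ofReal_mul (by norm_num),
    ← ENNReal.ofReal_add (by positivity) (by positivity)]
  apply ENNReal.ofReal_le_ofReal
  nlinarith [sq_nonneg (a - b)]

theorem enorm_sq_add_add_le (a b c : ℝ) :
    ‖a + b + c‖ₑ ^ 2 ≤ 3 * (‖a‖ₑ ^ 2 + ‖b‖ₑ ^ 2 + ‖c‖ₑ ^ 2) := by
  have h2 : (3 : ENNReal) = ENNReal.ofReal 3 := by simp
  simp only [enorm_sq_eq]
  rw [h2, ← ENNReal.ofReal_add (by positivity) (by positivity),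
    ← ENNReal.ofReal_add (by positivity) (by positivity), ← ENNReal.ofReal_mul (by norm_num)]
  apply ENNReal.ofReal_le_ofReal
  nlinarith [sq_nonneg (a - b), sq_nonneg (a - c), sq_nonneg (b - c)]

theorem enorm_fderiv_sq_le (f : E3 → ℝ) (y : E3) :
    ‖fderiv ℝ f y‖ₑ ^ 2 ≤ ∑ i, ‖partialDeriv i f y‖ₑ ^ 2 := by
  have h1 : ‖fderiv ℝ f y‖ ≤ √(∑ i, partialDeriv i f y ^ 2) := by
    refine ContinuousLinearMap.opNorm_le_bound _ (Real.sqrt_nonneg _) fun v => ?_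
    have hv : v = ∑ i, v i • EuclideanSpace.single i (1 : ℝ) := by
      ext j; simp [Pi.single_apply]
    conv_lhs => rw [hv]
    rw [map_sum]
    simp only [map_smul, smul_eq_mul, Real.norm_eq_abs]
    have := Finset.sum_mul_sq_le_sq_mul_sq Finset.univ v
      (fun i => fderiv ℝ f y (EuclideanSpace.single i (1 : ℝ)))
    rw [EuclideanSpace.norm_eq, ← Real.sqrt_mul (by positivity)]
    apply Real.abs_le_sqrt
    simpa [partialDeriv, mul_comm] using this
  simp only [enorm_sq_eq]
  rw [← ENNReal.ofReal_sum_of_nonneg (fun i _ => sq_nonneg _), ← ofReal_norm,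
    ← ENNReal.ofReal_pow (norm_nonneg _)]
  apply ENNReal.ofReal_le_ofReal
  rw [← Real.sq_sqrt (Finset.sum_nonneg fun i _ => sq_nonneg _ :
    0 ≤ ∑ i, partialDeriv i f y ^ 2)]
  gcongr

section Smooth

variable {K : Set E3} (hK : Convex ℝ K) (hKm : MeasurableSet K) {D : ℝ}
  (hD : ∀ x ∈ K, ∀ z ∈ K, ‖z - x‖ ≤ D) {f : E3 → ℝ} (hf : ContDiff ℝ ∞ f)
include hK hKm hD hf

/-- The increment is integrated along the segment from `x` to `z`. At a point with parameter `τ ≥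
1/2` the variable `z` is substituted, otherwise `x`; either Jacobian is at most `2 ^ 3 = 8`, so no
singularity arises. -/
theorem poincare_smooth :
    ∫⁻ x in K, ∫⁻ z in K, ‖f z - f x‖ₑ ^ 2 ≤
      8 * ENNReal.ofReal D ^ 2 * volume K * ∫⁻ y in K, ‖fderiv ℝ f y‖ₑ ^ 2 := by
  have hc : Continuous (fderiv ℝ f) := hf.continuous_fderiv (by simp)
  set A := ∫⁻ y in K, ‖fderiv ℝ f y‖ₑ ^ 2 with hA
  have hN1 : Measurable fun y : E3 => ‖fderiv ℝ f y‖ₑ ^ 2 := hc.enorm.measurable.pow_const 2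
  have h8 : ∀ τ : ℝ, 1 / 2 ≤ τ → τ ≤ 1 → ENNReal.ofReal (τ ^ (-3 : ℝ)) ≤ 8 := by
    intro τ h1 h2
    have : (8 : ENNReal) = ENNReal.ofReal 8 := by simp
    rw [this]
    apply ENNReal.ofReal_le_ofReal
    calc τ ^ (-3 : ℝ) ≤ (1 / 2 : ℝ) ^ (-3 : ℝ) :=
          Real.rpow_le_rpow_of_nonpos (by norm_num) h1 (by norm_num)
      _ = 8 := by rw [Real.rpow_neg (by norm_num)]; norm_num
  have key : ∀ τ ∈ Ioc (0 : ℝ) 1, ∫⁻ x in K, ∫⁻ z in K, ‖fderiv ℝ f (x + τ • (z - x))‖ₑ ^ 2 ≤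
      8 * A * volume K := by
    intro τ hτ
    rcases le_total (1 / 2) τ with h | h
    · calc _ ≤ ∫⁻ x in K, 8 * A := by
            refine setLIntegral_mono' hKm fun x hx => ?_
            exact (setLIntegral_comp_homothety_le hK hKm hx hτ.1 hτ.2 hN1).trans
              (mul_le_mul' (h8 τ h hτ.2) le_rfl)
        _ = _ := by rw [setLIntegral_const]
    · rw [lintegral_lintegral_swap]
      · calc _ ≤ ∫⁻ z in K, 8 * A := by
              refine setLIntegral_mono' hKm fun z hz => ?_
              have he : ∀ x : E3, x + τ • (z - x) = z + (1 - τ) • (x - z) := fun x => by module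
              simp only [he]
              exact (setLIntegral_comp_homothety_le hK hKm hz (by linarith) (by linarith [hτ.1])
                hN1).trans (mul_le_mul' (h8 _ (by linarith) (by linarith [hτ.1])) le_rfl)
          _ = _ := by rw [setLIntegral_const]
      · exact ((show Continuous fun p : E3 × E3 => fderiv ℝ f (p.1 + τ • (p.2 - p.1)) by
          fun_prop).enorm.measurable.pow_const 2).aemeasurable
  calc _ ≤ ∫⁻ x in K, ∫⁻ z in K, ENNReal.ofReal D ^ 2 *
        ∫⁻ τ in Ioc (0 : ℝ) 1, ‖fderiv ℝ f (x + τ • (z - x))‖ₑ ^ 2 := by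
        refine setLIntegral_mono' hKm fun x hx => setLIntegral_mono' hKm fun z hz => ?_
        have := sq_enorm_sub_le_lintegral_fderiv hf x (z - x) le_rfl (zero_le_one' ℝ) 0
        simp only [neg_zero, Real.rpow_zero, ENNReal.ofReal_one, lintegral_one, one_mul,
          Measure.restrict_apply_univ, Real.volume_Ioc, sub_zero, one_smul, zero_smul,
          add_zero, add_sub_cancel] at this
        refine this.trans ?_
        gcongr
        rw [← ofReal_norm]
        exact ENNReal.ofReal_le_ofReal (hD x hx z hz)
    _ = ENNReal.ofReal D ^ 2 * ∫⁻ x in K, ∫⁻ z in K,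
        ∫⁻ τ in Ioc (0 : ℝ) 1, ‖fderiv ℝ f (x + τ • (z - x))‖ₑ ^ 2 := by
        simp only [lintegral_const_mul' _ _ (ENNReal.pow_ne_top ENNReal.ofReal_ne_top :
          ENNReal.ofReal D ^ 2 ≠ ⊤)]
    _ = ENNReal.ofReal D ^ 2 * ∫⁻ τ in Ioc (0 : ℝ) 1, ∫⁻ x in K, ∫⁻ z in K,
        ‖fderiv ℝ f (x + τ • (z - x))‖ₑ ^ 2 := by
        congr 1
        have hi : ∀ x : E3, ∫⁻ z in K, ∫⁻ τ in Ioc (0 : ℝ) 1, ‖fderiv ℝ f (x + τ • (z - x))‖ₑ ^ 2 =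
            ∫⁻ τ in Ioc (0 : ℝ) 1, ∫⁻ z in K, ‖fderiv ℝ f (x + τ • (z - x))‖ₑ ^ 2 := fun x => by
          refine lintegral_lintegral_swap (f := fun z τ => ‖fderiv ℝ f (x + τ • (z - x))‖ₑ ^ 2) ?_
          exact ((show Continuous fun p : E3 × ℝ => fderiv ℝ f (x + p.2 • (p.1 - x)) by
            fun_prop).enorm.measurable.pow_const 2).aemeasurable
        rw [lintegral_congr hi]
        refine lintegral_lintegral_swap
          (f := fun x τ => ∫⁻ z in K, ‖fderiv ℝ f (x + τ • (z - x))‖ₑ ^ 2) ?_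
        have hm : Measurable fun p : (E3 × ℝ) × E3 =>
            ‖fderiv ℝ f (p.1.1 + p.1.2 • (p.2 - p.1.1))‖ₑ ^ 2 :=
          (show Continuous fun p : (E3 × ℝ) × E3 =>
            fderiv ℝ f (p.1.1 + p.1.2 • (p.2 - p.1.1)) by fun_prop).enorm.measurable.pow_const 2
        exact hm.lintegral_prod_right'.aemeasurable
    _ ≤ ENNReal.ofReal D ^ 2 * ∫⁻ τ in Ioc (0 : ℝ) 1, 8 * A * volume K :=
        mul_le_mul' le_rfl (setLIntegral_mono' measurableSet_Ioc key)
    _ = _ := by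
        rw [setLIntegral_const]; simp; ring

/-- A bare change of variables would lose `s ^ (-3)`. Comparing with the value at scale one along
the ray uses the gradient, whose own loss `τ ^ (-3)` integrates to `2 s ^ (-1/2)` at most, and only
`s ^ (-1)` remains after squaring. This gain plays the role of the Sobolev embedding of `H¹` into
`L⁶`. -/
theorem lintegral_sq_homothety_le {ξ : E3} (hξ : ξ ∈ K) {s : ℝ} (hs : 0 < s) (hs1 : s ≤ 1) :
    ∫⁻ z in K, ‖f (ξ + s • (z - ξ))‖ₑ ^ 2 ≤ ENNReal.ofReal (s ^ (-1 : ℝ)) *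
      (2 * lsq K f + 8 * ENNReal.ofReal D ^ 2 * ∫⁻ y in K, ‖fderiv ℝ f y‖ₑ ^ 2) := by
  have hc : Continuous (fderiv ℝ f) := hf.continuous_fderiv (by simp)
  have hN1 : Measurable fun y : E3 => ‖fderiv ℝ f y‖ₑ ^ 2 := hc.enorm.measurable.pow_const 2
  have h1 := lintegral_sq_sub_homothety_le hf hKm (hD ξ hξ) hs.le hs1 (r := 3 / 2)
    (B := ∫⁻ y in K, ‖fderiv ℝ f y‖ₑ ^ 2) (fun τ hτ => by
      have := setLIntegral_comp_homothety_le hK hKm hξ (hs.trans hτ.1) hτ.2 hN1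
      convert this using 4; norm_num)
  have h2 := lintegral_rpow_neg_three_halves_le hs hs1
  have h1s : 1 ≤ ENNReal.ofReal (s ^ (-1 : ℝ)) := by
    rw [ENNReal.one_le_ofReal]
    exact Real.one_le_rpow_of_pos_of_le_one_of_nonpos hs hs1 (by norm_num)
  have hfc : Continuous f := hf.continuous
  calc _ ≤ ∫⁻ z in K, (2 * ‖f z‖ₑ ^ 2 +
        2 * ‖f (ξ + (1 : ℝ) • (z - ξ)) - f (ξ + s • (z - ξ))‖ₑ ^ 2) := by
        refine lintegral_mono fun z => ?_
        have := enorm_sq_add_le (f z) (-(f (ξ + (1 : ℝ) • (z - ξ)) - f (ξ + s • (z - ξ))))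
        rw [enorm_neg] at this
        simpa using this
    _ = 2 * lsq K f + 2 * ∫⁻ z in K,
        ‖f (ξ + (1 : ℝ) • (z - ξ)) - f (ξ + s • (z - ξ))‖ₑ ^ 2 := by
        rw [lintegral_add_left (by exact (hfc.enorm.measurable.pow_const 2).const_mul 2),
          lintegral_const_mul' _ _ (by simp), lintegral_const_mul' _ _ (by simp), lsq]
    _ ≤ ENNReal.ofReal (s ^ (-1 : ℝ)) * (2 * lsq K f) + 2 * (ENNReal.ofReal D ^ 2 *
        ENNReal.ofReal (4 * s ^ (-1 : ℝ)) * ∫⁻ y in K, ‖fderiv ℝ f y‖ₑ ^ 2) := by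
        refine add_le_add ?_ (mul_le_mul' le_rfl (h1.trans ?_))
        · exact le_mul_of_one_le_left' h1s
        · exact mul_le_mul' (mul_le_mul' le_rfl h2) le_rfl
    _ = _ := by
        rw [ENNReal.ofReal_mul (by norm_num)]
        have : ENNReal.ofReal 4 = 4 := by simp
        rw [this]; ring

variable {B : ENNReal} (hB : ∀ ξ ∈ K, ∀ τ ∈ Ioc (0 : ℝ) 1,
  ∫⁻ z in K, ‖fderiv ℝ f (ξ + τ • (z - ξ))‖ₑ ^ 2 ≤ ENNReal.ofReal (τ ^ (-1 : ℝ)) * B)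
include hB

-- If the gradient itself has the improved loss `τ ^ (-1)`, the radial integral converges down to
-- the centre: `∫₀ᵗ τ ^ (-1/2) = 2 √t`. This makes point values accessible.
omit hK in
theorem lintegral_sq_sub_center_le {x : E3} (hx : x ∈ K) {t : ℝ} (ht : 0 < t) (ht1 : t ≤ 1) :
    ∫⁻ z in K, ‖f (x + t • (z - x)) - f x‖ₑ ^ 2 ≤
      ENNReal.ofReal D ^ 2 * ENNReal.ofReal (4 * t) * B := by
  have h1 := lintegral_sq_sub_homothety_le hf hKm (hD x hx) le_rfl ht.le (r := 1 / 2)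
    (B := B) (fun τ hτ => by
      have := hB x hx τ ⟨hτ.1, hτ.2.trans ht1⟩
      convert this using 3; norm_num)
  simp only [zero_smul, add_zero] at h1
  exact h1.trans (mul_le_mul' (mul_le_mul' le_rfl (lintegral_rpow_neg_half_le ht)) le_rfl)

-- The value at `x` is compared with the values at all `z` in `K` along rays (the case `t = 1` of
-- the previous estimate) and averaged.
omit hK in
theorem sup_smooth {x : E3} (hx : x ∈ K) :
    volume K * ‖f x‖ₑ ^ 2 ≤ 2 * lsq K f + 8 * ENNReal.ofReal D ^ 2 * B := by
  have h1 := lintegral_sq_sub_center_le hKm hD hf hB hx one_pos le_rfl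
  have hfc : Continuous f := hf.continuous
  calc volume K * ‖f x‖ₑ ^ 2 = ∫⁻ z in K, ‖f x‖ₑ ^ 2 := by rw [setLIntegral_const, mul_comm]
    _ ≤ ∫⁻ z in K, (2 * ‖f z‖ₑ ^ 2 + 2 * ‖f (x + (1 : ℝ) • (z - x)) - f x‖ₑ ^ 2) := by
        refine lintegral_mono fun z => ?_
        have := enorm_sq_add_le (f z) (-(f (x + (1 : ℝ) • (z - x)) - f x))
        rw [enorm_neg] at this
        simpa using this
    _ = 2 * lsq K f + 2 * ∫⁻ z in K, ‖f (x + (1 : ℝ) • (z - x)) - f x‖ₑ ^ 2 := by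
        rw [lintegral_add_left (by exact (hfc.enorm.measurable.pow_const 2).const_mul 2),
          lintegral_const_mul' _ _ (by simp), lintegral_const_mul' _ _ (by simp), lsq]
    _ ≤ 2 * lsq K f + 2 * (ENNReal.ofReal D ^ 2 * ENNReal.ofReal (4 * 1) * B) := by gcongr
    _ = _ := by
        have : ENNReal.ofReal (4 * 1) = 4 := by simp
        rw [this]; ring

/-- The points `x` and `y` are both moved a fraction `t` towards a common `z`, and the three
resulting increments are averaged over `z`. The two radial ones shrink with `t`, and the one between
the moved points shrinks with the distance; `t` is balanced later. -/
theorem holder_smooth {x y : E3} (hx : x ∈ K) (hy : y ∈ K) {t : ℝ} (ht : 0 < t) (ht1 : t ≤ 1) :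
    volume K * ‖f x - f y‖ₑ ^ 2 ≤
      3 * (8 * ENNReal.ofReal D ^ 2 * ENNReal.ofReal t + ‖x - y‖ₑ ^ 2 *
        ENNReal.ofReal (t ^ (-1 : ℝ))) * B := by
  have hx1 := lintegral_sq_sub_center_le hKm hD hf hB hx ht ht1
  have hy1 := lintegral_sq_sub_center_le hKm hD hf hB hy ht ht1
  have hfc : Continuous f := hf.continuous
  have hc : Continuous (fderiv ℝ f) := hf.continuous_fderiv (by simp)
  have h3 : ∫⁻ z in K, ‖f (x + t • (z - x)) - f (y + t • (z - y))‖ₑ ^ 2 ≤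
      ‖x - y‖ₑ ^ 2 * ENNReal.ofReal (t ^ (-1 : ℝ)) * B := by
    have hN : Measurable fun p : E3 × ℝ =>
        ‖fderiv ℝ f (y + t • (p.1 - y) + p.2 • ((1 - t) • (x - y)))‖ₑ ^ 2 :=
      (show Continuous fun p : E3 × ℝ => fderiv ℝ f
        (y + t • (p.1 - y) + p.2 • ((1 - t) • (x - y))) by fun_prop).enorm.measurable.pow_const 2
    have hle : ‖(1 - t) • (x - y)‖ₑ ≤ ‖x - y‖ₑ := by
      rw [← ofReal_norm, ← ofReal_norm]
      apply ENNReal.ofReal_le_ofReal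
      rw [norm_smul, Real.norm_eq_abs, abs_of_nonneg (by linarith)]
      exact mul_le_of_le_one_left (norm_nonneg _) (by linarith)
    calc _ ≤ ∫⁻ z in K, ‖x - y‖ₑ ^ 2 * ∫⁻ σ in Ioc (0 : ℝ) 1,
          ‖fderiv ℝ f (y + t • (z - y) + σ • ((1 - t) • (x - y)))‖ₑ ^ 2 := by
          refine lintegral_mono fun z => ?_
          have := sq_enorm_sub_le_lintegral_fderiv hf (y + t • (z - y)) ((1 - t) • (x - y)) le_rfl
            (zero_le_one' ℝ) 0
          simp only [neg_zero, Real.rpow_zero, ENNReal.ofReal_one, lintegral_one, one_mul,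
            Measure.restrict_apply_univ, Real.volume_Ioc, sub_zero, one_smul, zero_smul,
            add_zero] at this
          have he : y + t • (z - y) + (1 - t) • (x - y) = x + t • (z - x) := by module
          rw [he] at this
          exact this.trans (mul_le_mul' (pow_le_pow_left' hle 2) le_rfl)
      _ = ‖x - y‖ₑ ^ 2 * ∫⁻ σ in Ioc (0 : ℝ) 1, ∫⁻ z in K,
          ‖fderiv ℝ f (y + t • (z - y) + σ • ((1 - t) • (x - y)))‖ₑ ^ 2 := by
          rw [lintegral_const_mul' _ _ (ENNReal.pow_ne_top enorm_ne_top), lintegral_lintegral_swap]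
          exact hN.aemeasurable
      _ ≤ ‖x - y‖ₑ ^ 2 * ∫⁻ σ in Ioc (0 : ℝ) 1, ENNReal.ofReal (t ^ (-1 : ℝ)) * B := by
          refine mul_le_mul' le_rfl (setLIntegral_mono' measurableSet_Ioc fun σ hσ => ?_)
          -- The point with parameter `σ` between the two moved points is itself the image of `z`
          -- under the homothety of factor `t` centred at `σ x + (1 - σ) y`, so the hypothesis on
          -- the gradient applies to it.
          have hm : σ • x + (1 - σ) • y ∈ K := hK hx hy hσ.1.le (by linarith [hσ.2]) (by ring)
          have := hB _ hm t ⟨ht, ht1⟩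
          refine le_trans (le_of_eq ?_) this
          congr 1; funext z; congr 3; module
      _ = _ := by rw [setLIntegral_const]; simp; ring
  have hm1 : Measurable fun z => ‖f (x + t • (z - x)) - f x‖ₑ ^ 2 :=
    (show Continuous fun z => f (x + t • (z - x)) - f x by fun_prop).enorm.measurable.pow_const 2
  have hm2 : Measurable fun z => ‖f (y + t • (z - y)) - f y‖ₑ ^ 2 :=
    (show Continuous fun z => f (y + t • (z - y)) - f y by fun_prop).enorm.measurable.pow_const 2
  calc volume K * ‖f x - f y‖ₑ ^ 2 = ∫⁻ z in K, ‖f x - f y‖ₑ ^ 2 := by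
        rw [setLIntegral_const, mul_comm]
    _ ≤ ∫⁻ z in K, 3 * (‖f (x + t • (z - x)) - f x‖ₑ ^ 2 + ‖f (y + t • (z - y)) - f y‖ₑ ^ 2 +
        ‖f (x + t • (z - x)) - f (y + t • (z - y))‖ₑ ^ 2) := by
        refine lintegral_mono fun z => ?_
        have := enorm_sq_add_add_le (-(f (x + t • (z - x)) - f x)) (f (y + t • (z - y)) - f y)
          (f (x + t • (z - x)) - f (y + t • (z - y)))
        rw [enorm_neg] at this
        convert this using 3; ring
    _ = 3 * ((∫⁻ z in K, ‖f (x + t • (z - x)) - f x‖ₑ ^ 2) +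
        (∫⁻ z in K, ‖f (y + t • (z - y)) - f y‖ₑ ^ 2) +
        ∫⁻ z in K, ‖f (x + t • (z - x)) - f (y + t • (z - y))‖ₑ ^ 2) := by
        rw [lintegral_const_mul' _ _ (by simp), lintegral_add_left (by exact hm1.add hm2),
          lintegral_add_left hm1]
    _ ≤ 3 * (ENNReal.ofReal D ^ 2 * ENNReal.ofReal (4 * t) * B +
        ENNReal.ofReal D ^ 2 * ENNReal.ofReal (4 * t) * B +
        ‖x - y‖ₑ ^ 2 * ENNReal.ofReal (t ^ (-1 : ℝ)) * B) := by gcongr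
    _ = _ := by
        rw [ENNReal.ofReal_mul (by norm_num)]
        have : ENNReal.ofReal 4 = 4 := by simp
        rw [this]; ring

end Smooth

/-! ### Integral inequalities for Sobolev functions on convex sets -/

open Filter Topology

theorem lintegral_le_of_ae_tendsto {α : Type*} [MeasurableSpace α] {μ : Measure α}
    {F : ℕ → α → ENNReal} {f : α → ENNReal} (hm : ∀ n, AEMeasurable (F n) μ)
    (h : ∀ᵐ x ∂μ, Tendsto (fun n => F n x) atTop (𝓝 (f x))) {C : ENNReal}
    (hC : ∀ᶠ n in atTop, ∫⁻ x, F n x ∂μ ≤ C) : ∫⁻ x, f x ∂μ ≤ C := by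
  calc ∫⁻ x, f x ∂μ = ∫⁻ x, liminf (fun n => F n x) atTop ∂μ :=
        lintegral_congr_ae (h.mono fun x hx => hx.liminf_eq.symm)
    _ ≤ liminf (fun n => ∫⁻ x, F n x ∂μ) atTop := lintegral_liminf_le' hm
    _ ≤ C := liminf_le_of_frequently_le' hC.frequently

theorem lsq_eq {O : Set E3} {f : E3 → ℝ} (hf : MemLp f 2 (volume.restrict O)) :
    lsq O f = ENNReal.ofReal (∫ x in O, f x ^ 2) := by
  rw [ofReal_integral_eq_lintegral_ofReal hf.integrable_sq (.of_forall fun x => sq_nonneg _), lsq]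
  simp only [enorm_sq_eq]

theorem sum_lsq_eq {O : Set E3} {G : Fin 3 → E3 → ℝ} (hG : ∀ i, MemLp (G i) 2 (volume.restrict O)) :
    ∑ i, lsq O (G i) = ENNReal.ofReal (∑ i, ∫ x in O, G i x ^ 2) := by
  rw [ENNReal.ofReal_sum_of_nonneg fun i _ => integral_nonneg fun x => sq_nonneg _]
  exact Finset.sum_congr rfl fun i _ => lsq_eq (hG i)

section Weak

variable {O : Set E3} (hO : IsOpen O) (hOc : Convex ℝ O) {D : ℝ}
  (hD : ∀ x ∈ O, ∀ z ∈ O, ‖z - x‖ ≤ D) {g : E3 → ℝ} {G : Fin 3 → E3 → ℝ}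
  (hg : HasWeakGrad O g G)
include hO

theorem lsq_mollify_le {g : E3 → ℝ} (hg : MemLp g 2 (volume.restrict O)) (n : ℕ) :
    lsq (innerSet O n) (mollify O n g) ≤ lsq O g :=
  (setLIntegral_le_lintegral _ _).trans (lintegral_mollify_sq_le hO hg n)

include hg

theorem enorm_fderiv_mollify_sq_le {n : ℕ} {y : E3} (hy : y ∈ innerSet O n) :
    ‖fderiv ℝ (mollify O n g) y‖ₑ ^ 2 ≤ ∑ i, ‖mollify O n (G i) y‖ₑ ^ 2 := by
  refine (enorm_fderiv_sq_le _ y).trans (le_of_eq ?_)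
  simp only [partialDeriv_mollify hO hg.1 hg hy]

theorem lintegral_fderiv_mollify_sq_le (n : ℕ) :
    ∫⁻ y in innerSet O n, ‖fderiv ℝ (mollify O n g) y‖ₑ ^ 2 ≤ ∑ i, lsq O (G i) := by
  calc _ ≤ ∫⁻ y in innerSet O n, ∑ i, ‖mollify O n (G i) y‖ₑ ^ 2 :=
        setLIntegral_mono' (isClosed_innerSet O n).measurableSet
          fun y hy => enorm_fderiv_mollify_sq_le hO hg hy
    _ = ∑ i, lsq (innerSet O n) (mollify O n (G i)) := by
        rw [lintegral_finsetSum]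
        · rfl
        · intro i _
          exact (contDiff_mollify hO (hg.2 i).1 n).continuous.enorm.measurable.pow_const 2
    _ ≤ _ := Finset.sum_le_sum fun i _ => lsq_mollify_le hO (hg.2 i).1 n

include hOc hD

/-- The smooth inequality holds for the mollified function on the convex inner sets with a
right-hand side independent of `n`; Fatou's lemma gives the limit. The double-integral form needs no
mean value, and it is reused for Friedrichs' inequality and for the matching of limits. -/
theorem poincare_lintegral :
    ∫⁻ p, ‖g p.2 - g p.1‖ₑ ^ 2 ∂((volume.restrict O).prod (volume.restrict O)) ≤
      8 * ENNReal.ofReal D ^ 2 * volume O * ∑ i, lsq O (G i) := by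
  set f : ℕ → E3 → ℝ := fun n => mollify O n g with hf
  have hfs : ∀ n, ContDiff ℝ ∞ (f n) := fun n => contDiff_mollify hO hg.1 n
  have hKm : ∀ n, MeasurableSet (innerSet O n) := fun n => (isClosed_innerSet O n).measurableSet
  have hcm : ∀ n, Measurable fun p : E3 × E3 => ‖f n p.2 - f n p.1‖ₑ ^ 2 := fun n =>
    (((hfs n).continuous.comp continuous_snd).sub
      ((hfs n).continuous.comp continuous_fst)).enorm.measurable.pow_const 2
  refine lintegral_le_of_ae_tendsto (F := fun n =>
    (innerSet O n ×ˢ innerSet O n).indicator fun p => ‖f n p.2 - f n p.1‖ₑ ^ 2) ?_ ?_ ?_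
  · exact fun n => ((hcm n).indicator ((hKm n).prod (hKm n))).aemeasurable
  · have h1 := ae_tendsto_mollify hO hg.1
    have h2 : ∀ᵐ x ∂volume.restrict O, x ∈ O := ae_restrict_mem hO.measurableSet
    have h3 : ∀ᵐ x ∂volume.restrict O, x ∈ O ∧ Tendsto (fun n => f n x) atTop (𝓝 (g x)) :=
      h2.and h1
    have h4 := Measure.quasiMeasurePreserving_fst (μ := volume.restrict O)
      (ν := volume.restrict O) |>.ae h3
    have h5 := Measure.quasiMeasurePreserving_snd (μ := volume.restrict O)
      (ν := volume.restrict O) |>.ae h3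
    filter_upwards [h4, h5] with p hp1 hp2
    have ht : Tendsto (fun n => ‖f n p.2 - f n p.1‖ₑ ^ 2) atTop (𝓝 (‖g p.2 - g p.1‖ₑ ^ 2)) :=
      ((ENNReal.continuous_pow 2).tendsto _).comp ((hp2.2.sub hp1.2).enorm)
    refine ht.congr' ?_
    filter_upwards [eventually_mem_innerSet hO hp1.1, eventually_mem_innerSet hO hp2.1] with n h1 h2
    rw [indicator_of_mem (show p ∈ innerSet O n ×ˢ innerSet O n from ⟨h1, h2⟩)]
  · refine .of_forall fun n => ?_
    have hsub := innerSet_subset O n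
    calc _ ≤ ∫⁻ p in innerSet O n ×ˢ innerSet O n, ‖f n p.2 - f n p.1‖ₑ ^ 2 := by
          rw [Measure.prod_restrict, ← lintegral_indicator ((hKm n).prod (hKm n))]
          exact setLIntegral_le_lintegral _ _
      _ = ∫⁻ x in innerSet O n, ∫⁻ z in innerSet O n, ‖f n z - f n x‖ₑ ^ 2 := by
          rw [Measure.volume_eq_prod, ← Measure.prod_restrict, lintegral_prod _
            (hcm n).aemeasurable]
      _ ≤ _ := poincare_smooth (convex_innerSet hOc n) (hKm n)
            (fun x hx z hz => hD x (hsub hx) z (hsub hz)) (hfs n)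
      _ ≤ _ := by
          gcongr
          exact lintegral_fderiv_mollify_sq_le hO hg n

/-- For a function of mean zero the cross term vanishes and the double integral is `2 |O| ∫ g ^ 2`,
which turns the factor 8 into 4. -/
theorem poincare_mean_zero (hb : volume O ≠ ⊤) (h0 : ∫ x in O, g x = 0) :
    ∫ x in O, g x ^ 2 ≤ 4 * D ^ 2 * ∑ i, ∫ x in O, G i x ^ 2 := by
  have : IsFiniteMeasure (volume.restrict O) := ⟨by simpa using hb.lt_top⟩
  set μ := (volume.restrict O : Measure E3) with hμ
  have hi : Integrable g μ := hg.1.integrable (by norm_num)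
  have hi2 : Integrable (fun x => g x ^ 2) μ := hg.1.integrable_sq
  have hP := poincare_lintegral hO hOc hD hg
  have i1 : Integrable (fun p : E3 × E3 => g p.2 ^ 2) (μ.prod μ) := hi2.comp_snd μ
  have i2 : Integrable (fun p : E3 × E3 => g p.1 ^ 2) (μ.prod μ) := hi2.comp_fst μ
  have i3 : Integrable (fun p : E3 × E3 => g p.1 * g p.2) (μ.prod μ) := hi.mul_prod hi
  have e0 : ∫ p, (g p.2 - g p.1) ^ 2 ∂(μ.prod μ) = 2 * volume.real O * ∫ x in O, g x ^ 2 := by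
    have : ∀ p : E3 × E3, (g p.2 - g p.1) ^ 2 = (g p.2 ^ 2 + g p.1 ^ 2) - 2 * (g p.1 * g p.2) :=
      fun p => by ring
    simp only [this]
    rw [integral_sub (by exact i1.add i2) (i3.const_mul 2), integral_add i1 i2, integral_const_mul,
      integral_prod_mul, integral_fun_snd (fun x => g x ^ 2), integral_fun_fst (fun x => g x ^ 2)]
    rw [h0]
    simp only [hμ, measureReal_restrict_apply_univ, smul_eq_mul]
    ring
  have i4 : Integrable (fun p : E3 × E3 => (g p.2 - g p.1) ^ 2) (μ.prod μ) := by
    have : ∀ p : E3 × E3, (g p.2 - g p.1) ^ 2 = (g p.2 ^ 2 + g p.1 ^ 2) - 2 * (g p.1 * g p.2) :=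
      fun p => by ring
    simp only [this]
    exact (i1.add i2).sub (i3.const_mul 2)
  simp only [enorm_sq_eq] at hP
  rw [← ofReal_integral_eq_lintegral_ofReal i4 (.of_forall fun x => sq_nonneg _), e0] at hP
  have hsum := sum_lsq_eq fun i => (hg.2 i).1
  rcases O.eq_empty_or_nonempty with rfl | ⟨x₀, hx₀⟩
  · simp [hμ]
  have hD0 : 0 ≤ D := (norm_nonneg _).trans (hD x₀ hx₀ x₀ hx₀)
  have hv : volume O = ENNReal.ofReal (volume.real O) := (ofReal_measureReal hb).symm
  have hvpos : 0 < volume.real O := ENNReal.toReal_pos (hO.measure_pos volume ⟨x₀, hx₀⟩).ne' hb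
  have h8 : (8 : ENNReal) = ENNReal.ofReal 8 := by simp
  rw [hsum, hv, h8, ← ENNReal.ofReal_pow hD0, ← ENNReal.ofReal_mul (by norm_num),
    ← ENNReal.ofReal_mul (by positivity), ← ENNReal.ofReal_mul (by positivity),
    ENNReal.ofReal_le_ofReal_iff (by
      have : 0 ≤ ∑ i, ∫ x in O, G i x ^ 2 :=
        Finset.sum_nonneg fun i _ => integral_nonneg fun x => sq_nonneg _
      positivity)] at hP
  refine le_of_mul_le_mul_left ?_ hvpos
  nlinarith

/-- The domain of integration is the homothetic copy of `O` with centre `ξ` and factor `s`. Its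
Jacobian `s ^ 3` against the loss `s ^ (-1)` leaves `s ^ 2`. The centre may lie on the boundary,
which forces the approximating centres `X n`. -/
theorem lintegral_sq_cone_le {z₀ : E3} {ρ : ℝ} (hρ : 0 < ρ) (hball : Metric.ball z₀ ρ ⊆ O) {ξ : E3}
    (hξ : ξ ∈ closure O) {s : ℝ} (hs : 0 < s) (hs1 : s ≤ 1) :
    ∫⁻ y in {y | ξ + s⁻¹ • (y - ξ) ∈ O}, ‖g y‖ₑ ^ 2 ≤ ENNReal.ofReal (s ^ 2) *
      (2 * lsq O g + 8 * ENNReal.ofReal D ^ 2 * ∑ i, lsq O (G i)) := by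
  set f : ℕ → E3 → ℝ := fun n => mollify O n g with hf
  have hfs : ∀ n, ContDiff ℝ ∞ (f n) := fun n => contDiff_mollify hO hg.1 n
  have hKm : ∀ n, MeasurableSet (innerSet O n) := fun n => (isClosed_innerSet O n).measurableSet
  -- With this choice the ball of radius `1 / (n + 1)` about `X n` is the image of the ball about
  -- `z₀` of radius `ρ` under the contraction by `c n` towards `ξ`; convexity then puts `X n` into
  -- the inner set.
  set c : ℕ → ℝ := fun n => 1 / ((n : ℝ) + 1) * ρ⁻¹ with hc
  set X : ℕ → E3 := fun n => ξ + c n • (z₀ - ξ) with hX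
  have hc0 : Tendsto c atTop (𝓝 0) := by
    have := (tendsto_one_div_add_atTop_nhds_zero_nat (𝕜 := ℝ)).mul_const ρ⁻¹
    rwa [zero_mul] at this
  have hcpos : ∀ n, 0 < c n := fun n => by positivity
  have hXt : Tendsto X atTop (𝓝 ξ) := by
    have := (hc0.smul_const (z₀ - ξ)).const_add ξ
    simpa using this
  have hXmem : ∀ᶠ n in atTop, X n ∈ innerSet O n := by
    filter_upwards [hc0.eventually (gt_mem_nhds one_pos)] with n hn
    intro w hw
    have hw' : z₀ + (c n)⁻¹ • (w - X n) ∈ O := by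
      apply hball
      rw [Metric.mem_ball, dist_eq_norm] at hw ⊢
      rw [add_sub_cancel_left, norm_smul, norm_inv, Real.norm_eq_abs, abs_of_pos (hcpos n)]
      rw [inv_mul_lt_iff₀ (hcpos n)]
      refine hw.trans_le (le_of_eq ?_)
      simp only [hc]; field_simp
    have := hOc.combo_closure_interior_mem_interior hξ (by rwa [hO.interior_eq])
      (by linarith : (0 : ℝ) ≤ 1 - c n) (hcpos n) (by ring)
    rw [hO.interior_eq] at this
    convert this using 1
    rw [smul_add, smul_smul, mul_inv_cancel₀ (hcpos n).ne', hX]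
    module
  set E : ℕ → Set E3 := fun n => {y | X n + s⁻¹ • (y - X n) ∈ innerSet O n} with hE
  have hEm : ∀ n, MeasurableSet (E n) := fun n =>
    (hKm n).preimage (by fun_prop)
  have hcm : ∀ n, Measurable fun y => ‖f n y‖ₑ ^ 2 := fun n =>
    (hfs n).continuous.enorm.measurable.pow_const 2
  have hEo : IsOpen {y | ξ + s⁻¹ • (y - ξ) ∈ O} := hO.preimage (by fun_prop)
  have hEsub : {y | ξ + s⁻¹ • (y - ξ) ∈ O} ⊆ O := by
    intro y hy
    have := hOc.combo_closure_interior_mem_interior hξ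
      (show ξ + s⁻¹ • (y - ξ) ∈ interior O by rwa [hO.interior_eq])
      (by linarith : (0 : ℝ) ≤ 1 - s) hs (by ring)
    rw [hO.interior_eq] at this
    convert this using 1
    rw [smul_add, smul_smul, mul_inv_cancel₀ hs.ne']
    module
  refine lintegral_le_of_ae_tendsto (F := fun n => (E n).indicator fun y => ‖f n y‖ₑ ^ 2) ?_ ?_ ?_
  · exact fun n => ((hcm n).indicator (hEm n)).aemeasurable
  · have h1 : ∀ᵐ y ∂volume.restrict {y | ξ + s⁻¹ • (y - ξ) ∈ O},
        Tendsto (fun n => f n y) atTop (𝓝 (g y)) :=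
      ae_restrict_of_ae_restrict_of_subset hEsub (ae_tendsto_mollify hO hg.1)
    filter_upwards [h1, ae_restrict_mem hEo.measurableSet] with y hy hyE
    refine (((ENNReal.continuous_pow 2).tendsto _).comp hy.enorm).congr' ?_
    have hlim : Tendsto (fun n => X n + s⁻¹ • (y - X n)) atTop (𝓝 (ξ + s⁻¹ • (y - ξ))) :=
      hXt.add ((hXt.const_sub y).const_smul s⁻¹)
    obtain ⟨ε, hε, hεO⟩ := Metric.isOpen_iff.1 hO _ hyE
    filter_upwards [hlim.eventually (Metric.ball_mem_nhds _ (half_pos hε)),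
      tendsto_one_div_add_atTop_nhds_zero_nat.eventually (gt_mem_nhds (half_pos hε))] with n h1 h2
    have : y ∈ E n := by
      intro w hw
      apply hεO
      rw [Metric.mem_ball] at hw ⊢
      linarith [dist_triangle w (X n + s⁻¹ • (y - X n)) (ξ + s⁻¹ • (y - ξ))]
    rw [indicator_of_mem this]
    rfl
  · filter_upwards [hXmem] with n hn
    have hsub := innerSet_subset O n
    have h1 := lintegral_sq_homothety_le (convex_innerSet hOc n) (hKm n)
      (fun x hx z hz => hD x (hsub hx) z (hsub hz)) (hfs n) hn hs hs1
    have h2 := lintegral_comp_affine hs ((1 - s) • X n) ((hcm n).indicator (hEm n))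
    have h3 : ∫⁻ z, (E n).indicator (fun y => ‖f n y‖ₑ ^ 2) (s • z + (1 - s) • X n) =
        ∫⁻ z in innerSet O n, ‖f n (X n + s • (z - X n))‖ₑ ^ 2 := by
      rw [← lintegral_indicator (hKm n)]
      congr 1; funext z
      have he : s • z + (1 - s) • X n = X n + s • (z - X n) := by module
      have he2 : X n + s⁻¹ • (X n + s • (z - X n) - X n) = z := by
        rw [add_sub_cancel_left, smul_smul, inv_mul_cancel₀ hs.ne', one_smul]; abel
      rw [he]
      by_cases hz : z ∈ innerSet O n
      · rw [indicator_of_mem hz, indicator_of_mem (show _ ∈ E n by simpa only [hE, mem_ofPred_eq, he2])]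
      · rw [indicator_of_notMem hz, indicator_of_notMem (show _ ∉ E n by
          simpa only [hE, mem_ofPred_eq, he2])]
    rw [h3] at h2
    rw [h2] at h1
    have hs3 : ENNReal.ofReal (s ^ 3) * ENNReal.ofReal (s ^ (-3 : ℝ)) = 1 := by
      rw [← ENNReal.ofReal_mul (by positivity), Real.rpow_neg hs.le]
      norm_cast
      rw [mul_inv_cancel₀ (by positivity)]; simp
    have hs2 : ENNReal.ofReal (s ^ 3) * ENNReal.ofReal (s ^ (-1 : ℝ)) = ENNReal.ofReal (s ^ 2) := by
      rw [← ENNReal.ofReal_mul (by positivity), Real.rpow_neg_one]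
      congr 1; field_simp
    calc _ ≤ ∫⁻ y, (E n).indicator (fun y => ‖f n y‖ₑ ^ 2) y := setLIntegral_le_lintegral _ _
      _ = ENNReal.ofReal (s ^ 3) * (ENNReal.ofReal (s ^ (-3 : ℝ)) *
            ∫⁻ y, (E n).indicator (fun y => ‖f n y‖ₑ ^ 2) y) := by
          rw [← mul_assoc, hs3, one_mul]
      _ ≤ _ := mul_le_mul' le_rfl h1
      _ = ENNReal.ofReal (s ^ 2) * (2 * lsq (innerSet O n) (f n) + 8 * ENNReal.ofReal D ^ 2 *
            ∫⁻ y in innerSet O n, ‖fderiv ℝ (f n) y‖ₑ ^ 2) := by rw [← mul_assoc, hs2]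
      _ ≤ _ := by
          gcongr
          · exact lsq_mollify_le hO hg.1 n
          · exact lintegral_fderiv_mollify_sq_le hO hg n

end Weak

open Filter Topology

/-! ### Supremum and Hölder bounds from two weak derivatives -/

section Weak

variable {O : Set E3} (hO : IsOpen O) (hOc : Convex ℝ O) {D : ℝ}
  (hD : ∀ x ∈ O, ∀ z ∈ O, ‖z - x‖ ≤ D) {g : E3 → ℝ} {G : Fin 3 → E3 → ℝ}
  {H : Fin 3 → Fin 3 → E3 → ℝ}
  (hg : HasWeakGrad O g G) (hG : ∀ i, HasWeakGrad O (G i) (H i))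

/-- The quantity that controls the oscillation of a function with first and second weak derivatives
`G` and `H`. -/
def oscBound (O : Set E3) (D : ℝ) (G : Fin 3 → E3 → ℝ) (H : Fin 3 → Fin 3 → E3 → ℝ) : ENNReal :=
  ∑ i, (2 * lsq O (G i) + 8 * ENNReal.ofReal D ^ 2 * ∑ j, lsq O (H i j))

include hO hOc hD hg hG

/-- Supplies the hypothesis on the gradient in the smooth supremum and Hölder bounds: each component
of the gradient is a mollified function with a weak gradient of its own, so the `s ^ (-1)` estimate
applies to it. -/
theorem lintegral_fderiv_mollify_homothety_le (n : ℕ) {ξ : E3} (hξ : ξ ∈ innerSet O n) {τ : ℝ}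
    (hτ : τ ∈ Ioc (0 : ℝ) 1) :
    ∫⁻ z in innerSet O n, ‖fderiv ℝ (mollify O n g) (ξ + τ • (z - ξ))‖ₑ ^ 2 ≤
      ENNReal.ofReal (τ ^ (-1 : ℝ)) * oscBound O D G H := by
  have hKm : MeasurableSet (innerSet O n) := (isClosed_innerSet O n).measurableSet
  have hKc := convex_innerSet hOc n
  have hsub := innerSet_subset O n
  calc _ ≤ ∫⁻ z in innerSet O n, ∑ i, ‖mollify O n (G i) (ξ + τ • (z - ξ))‖ₑ ^ 2 := by
        refine setLIntegral_mono' hKm fun z hz => enorm_fderiv_mollify_sq_le hO hg ?_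
        exact hKc.add_smul_sub_mem hξ hz ⟨hτ.1.le, hτ.2⟩
    _ = ∑ i, ∫⁻ z in innerSet O n, ‖mollify O n (G i) (ξ + τ • (z - ξ))‖ₑ ^ 2 := by
        rw [lintegral_finsetSum]
        intro i _
        have := (contDiff_mollify hO (hg.2 i).1 n).continuous
        exact (show Continuous fun z => mollify O n (G i) (ξ + τ • (z - ξ)) by
          fun_prop).enorm.measurable.pow_const 2
    _ ≤ _ := by
        rw [oscBound, Finset.mul_sum]
        refine Finset.sum_le_sum fun i _ => ?_
        refine (lintegral_sq_homothety_le hKc hKm (fun x hx z hz => hD x (hsub hx) z (hsub hz))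
          (contDiff_mollify hO (hg.2 i).1 n) hξ hτ.1 hτ.2).trans ?_
        gcongr
        · exact lsq_mollify_le hO (hg.2 i).1 n
        · exact lintegral_fderiv_mollify_sq_le hO (hG i) n

theorem ae_sup_le (hb : volume O ≠ ⊤) :
    ∀ᵐ x ∂volume.restrict O, ENNReal.ofReal (volume.real O / 2) * ‖g x‖ₑ ^ 2 ≤
      2 * lsq O g + 8 * ENNReal.ofReal D ^ 2 * oscBound O D G H := by
  filter_upwards [ae_tendsto_mollify hO hg.1, ae_restrict_mem hO.measurableSet] with x hx hxO
  have ht : Tendsto (fun n => ENNReal.ofReal (volume.real O / 2) * ‖mollify O n g x‖ₑ ^ 2) atTop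
      (𝓝 (ENNReal.ofReal (volume.real O / 2) * ‖g x‖ₑ ^ 2)) :=
    ENNReal.Tendsto.const_mul (((ENNReal.continuous_pow 2).tendsto _).comp hx.enorm)
      (Or.inr ENNReal.ofReal_ne_top)
  refine le_of_tendsto ht ?_
  filter_upwards [eventually_mem_innerSet hO hxO, eventually_half_le_volume_innerSet hO hb]
    with n hn hv
  have hsub := innerSet_subset O n
  have hv' : ENNReal.ofReal (volume.real O / 2) ≤ volume (innerSet O n) :=
    (ENNReal.ofReal_le_ofReal hv).trans ENNReal.ofReal_toReal_le
  calc _ ≤ volume (innerSet O n) * ‖mollify O n g x‖ₑ ^ 2 := mul_le_mul' hv' le_rfl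
    _ ≤ _ := sup_smooth (isClosed_innerSet O n).measurableSet
        (fun x hx z hz => hD x (hsub hx) z (hsub hz)) (contDiff_mollify hO hg.1 n)
        (fun ξ hξ τ hτ => lintegral_fderiv_mollify_homothety_le hO hOc hD hg hG n hξ hτ) hn
    _ ≤ _ := by gcongr; exact lsq_mollify_le hO hg.1 n

theorem holder_of_tendsto (hb : volume O ≠ ⊤) {x y : E3} (hx : x ∈ O) (hy : y ∈ O)
    (hxt : Tendsto (fun n => mollify O n g x) atTop (𝓝 (g x)))
    (hyt : Tendsto (fun n => mollify O n g y) atTop (𝓝 (g y))) {t : ℝ} (ht : 0 < t) (ht1 : t ≤ 1) :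
    ENNReal.ofReal (volume.real O / 2) * ‖g x - g y‖ₑ ^ 2 ≤
      3 * (8 * ENNReal.ofReal D ^ 2 * ENNReal.ofReal t + ‖x - y‖ₑ ^ 2 *
        ENNReal.ofReal (t ^ (-1 : ℝ))) * oscBound O D G H := by
  have ht' : Tendsto (fun n => ENNReal.ofReal (volume.real O / 2) *
      ‖mollify O n g x - mollify O n g y‖ₑ ^ 2) atTop
      (𝓝 (ENNReal.ofReal (volume.real O / 2) * ‖g x - g y‖ₑ ^ 2)) :=
    ENNReal.Tendsto.const_mul (((ENNReal.continuous_pow 2).tendsto _).comp (hxt.sub hyt).enorm)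
      (Or.inr ENNReal.ofReal_ne_top)
  refine le_of_tendsto ht' ?_
  filter_upwards [eventually_mem_innerSet hO hx, eventually_mem_innerSet hO hy,
    eventually_half_le_volume_innerSet hO hb] with n hn hn' hv
  have hsub := innerSet_subset O n
  have hv' : ENNReal.ofReal (volume.real O / 2) ≤ volume (innerSet O n) :=
    (ENNReal.ofReal_le_ofReal hv).trans ENNReal.ofReal_toReal_le
  refine (mul_le_mul' hv' le_rfl).trans ?_
  exact holder_smooth (convex_innerSet hOc n) (isClosed_innerSet O n).measurableSet
        (fun x hx z hz => hD x (hsub hx) z (hsub hz)) (contDiff_mollify hO hg.1 n)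
        (fun ξ hξ τ hτ => lintegral_fderiv_mollify_homothety_le hO hOc hD hg hG n hξ hτ) hn hn' ht ht1

end Weak

/-- A function on a set that is Hölder continuous with exponent one half extends continuously. -/
theorem exists_continuous_extension {S : Set E3} (hS : S.Nonempty) {g : E3 → ℝ} {C : ℝ}
    (hC : 0 ≤ C) (h : ∀ x ∈ S, ∀ y ∈ S, |g x - g y| ≤ C * √(dist x y)) :
    ∃ k : E3 → ℝ, Continuous k ∧ ∀ x ∈ S, k x = g x := by
  obtain ⟨y₀, hy₀⟩ := hS
  have : Nonempty S := ⟨⟨y₀, hy₀⟩⟩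
  have htri : ∀ x y z : E3, √(dist x z) ≤ √(dist x y) + √(dist y z) := fun x y z =>
    (Real.sqrt_le_sqrt (dist_triangle x y z)).trans (Real.sqrt_le_iff.2 ⟨by positivity, by
      nlinarith [Real.sq_sqrt (dist_nonneg (x := x) (y := y)), Real.sq_sqrt (dist_nonneg (x := y) (y := z)),
        mul_nonneg (Real.sqrt_nonneg (dist x y)) (Real.sqrt_nonneg (dist y z))]⟩)
  -- McShane's extension formula. It works for this modulus because the square root of the distance
  -- still satisfies the triangle inequality.
  set k : E3 → ℝ := fun x => ⨅ y : S, (g y + C * √(dist x y)) with hk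
  have hbdd : ∀ x : E3, BddBelow (range fun y : S => g y + C * √(dist x (y : E3))) := by
    intro x
    refine ⟨g y₀ - C * √(dist x y₀), ?_⟩
    rintro _ ⟨y, rfl⟩
    have h1 := (abs_le.1 (h y y.2 y₀ hy₀)).1
    have h2 := mul_le_mul_of_nonneg_left (htri y x y₀) hC
    rw [dist_comm (y : E3) x] at h2
    dsimp only
    linarith
  have hle : ∀ x x', k x ≤ k x' + C * √(dist x x') := by
    intro x x'
    rw [← sub_le_iff_le_add]
    refine le_ciInf fun y => ?_
    have h1 := ciInf_le (hbdd x) y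
    have h2 := mul_le_mul_of_nonneg_left (htri x x' y) hC
    simp only [hk]
    linarith
  refine ⟨k, ?_, fun x hx => ?_⟩
  · rw [continuous_iff_continuousAt]
    intro x
    rw [ContinuousAt, tendsto_iff_dist_tendsto_zero]
    have hlim : Tendsto (fun x' : E3 => C * √(dist x' x)) (𝓝 x) (𝓝 0) := by
      have : Continuous fun x' : E3 => C * √(dist x' x) := by fun_prop
      simpa using this.tendsto x
    refine squeeze_zero (fun _ => dist_nonneg) (fun x' => ?_) hlim
    rw [Real.dist_eq, abs_le]
    have h1 := hle x' x
    have h2 := hle x x'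
    rw [dist_comm x x'] at h2
    constructor <;> linarith
  · apply le_antisymm
    · have := ciInf_le (hbdd x) ⟨x, hx⟩
      simpa using this
    · refine le_ciInf fun y => ?_
      linarith [(abs_le.1 (h x hx y y.2)).2]

theorem exists_continuous_representative {O : Set E3} (hO : IsOpen O) (hOc : Convex ℝ O)
    (hne : O.Nonempty) (hOb : Bornology.IsBounded O) {g : E3 → ℝ} {G : Fin 3 → E3 → ℝ}
    {H : Fin 3 → Fin 3 → E3 → ℝ} (hg : HasWeakGrad O g G) (hG : ∀ i, HasWeakGrad O (G i) (H i)) :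
    ∃ k : E3 → ℝ, Continuous k ∧ ∀ᵐ x ∂volume.restrict O, g x = k x := by
  have hb : volume O ≠ ⊤ := hOb.measure_lt_top.ne
  set D : ℝ := Metric.diam O + 1 with hDdef
  have hDpos : 0 < D := by have := Metric.diam_nonneg (s := O); linarith
  have hD : ∀ x ∈ O, ∀ z ∈ O, ‖z - x‖ ≤ D := fun x hx z hz => by
    rw [← dist_eq_norm]; linarith [Metric.dist_le_diam_of_mem hOb hz hx]
  set S := {x | x ∈ O ∧ Tendsto (fun n => mollify O n g x) atTop (𝓝 (g x))} with hS
  have hae : ∀ᵐ x ∂volume.restrict O, x ∈ S := by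
    filter_upwards [ae_tendsto_mollify hO hg.1, ae_restrict_mem hO.measurableSet] with x h1 h2
    exact ⟨h2, h1⟩
  have hv : 0 < volume.real O := ENNReal.toReal_pos (hO.measure_pos volume hne).ne' hb
  have hSne : S.Nonempty := by
    by_contra hemp
    rw [not_nonempty_iff_eq_empty] at hemp
    rw [hemp] at hae
    have : volume.restrict O = 0 := by
      rw [← ae_eq_bot, ← eventually_false_iff_eq_bot]
      simpa using hae
    rw [Measure.restrict_eq_zero] at this
    exact (hO.measure_pos volume hne).ne' this
  set B := oscBound O D G H with hB
  have hBtop : B ≠ ⊤ := by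
    rw [hB, oscBound]
    refine ENNReal.sum_ne_top.2 fun i _ => ENNReal.add_ne_top.2 ⟨?_, ?_⟩
    · rw [lsq_eq (hg.2 i).1]; exact ENNReal.mul_ne_top (by simp) ENNReal.ofReal_ne_top
    · refine ENNReal.mul_ne_top (ENNReal.mul_ne_top (by simp) (by simp)) ?_
      refine ENNReal.sum_ne_top.2 fun j _ => ?_
      rw [lsq_eq ((hG i).2 j).1]; exact ENNReal.ofReal_ne_top
  set b := B.toReal with hb'
  have hBb : B = ENNReal.ofReal b := (ENNReal.ofReal_toReal hBtop).symm
  have hb0 : 0 ≤ b := ENNReal.toReal_nonneg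
  have key : ∀ x ∈ S, ∀ y ∈ S, |g x - g y| ≤ √(2 / volume.real O * (27 * D * b)) * √(dist x y) := by
    intro x hx y hy
    rcases eq_or_ne x y with rfl | hxy
    · simp
    have hd : 0 < dist x y := dist_pos.2 hxy
    have hdD : dist x y ≤ D := by rw [dist_eq_norm]; exact hD y hy.1 x hx.1
    -- The choice `t = |x - y| / D` makes both terms proportional to `D |x - y|`, with total factor
    -- `3 * (8 + 1) = 27`, and so gives the exponent one half.
    have ht : 0 < dist x y / D := by positivity
    have ht1 : dist x y / D ≤ 1 := (div_le_one hDpos).2 hdD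
    have h1 := holder_of_tendsto hO hOc hD hg hG hb hx.1 hy.1 hx.2 hy.2 ht ht1
    have e3 : (3 : ENNReal) = ENNReal.ofReal 3 := by simp
    have e8 : (8 : ENNReal) = ENNReal.ofReal 8 := by simp
    rw [← hB, hBb, e3, e8, enorm_sq_eq, ← ofReal_norm, ← ENNReal.ofReal_pow (norm_nonneg _),
      ← ENNReal.ofReal_pow hDpos.le, ← ENNReal.ofReal_mul (by positivity),
      ← ENNReal.ofReal_mul (by positivity), ← ENNReal.ofReal_mul (by positivity),
      ← ENNReal.ofReal_mul (by positivity), ← ENNReal.ofReal_add (by positivity) (by positivity),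
      ← ENNReal.ofReal_mul (by positivity), ← ENNReal.ofReal_mul (by positivity),
      ENNReal.ofReal_le_ofReal_iff (by positivity), ← dist_eq_norm, Real.rpow_neg_one] at h1
    rw [← Real.sqrt_mul (by positivity)]
    apply Real.abs_le_sqrt
    have h2 : 3 * (8 * D ^ 2 * (dist x y / D) + dist x y ^ 2 * (dist x y / D)⁻¹) * b =
        27 * D * b * dist x y := by field_simp; ring
    rw [h2] at h1
    have h3 : (g x - g y) ^ 2 = 2 / volume.real O * (volume.real O / 2 * (g x - g y) ^ 2) := by
      field_simp
    rw [h3, mul_assoc (2 / volume.real O)]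
    gcongr
  obtain ⟨k, hk, hkS⟩ := exists_continuous_extension hSne (Real.sqrt_nonneg _) key
  exact ⟨k, hk, hae.mono fun x hx => (hkS x hx).symm⟩

/-! ### Polynomials and their derivatives -/

open MvPolynomial in
/-- The iterated formal derivative `D^α` of a polynomial. -/
def polyDeriv (α : Fin 3 → ℕ) (q : MvPolynomial (Fin 3) ℝ) : MvPolynomial (Fin 3) ℝ :=
  (pderiv 0)^[α 0] ((pderiv 1)^[α 1] ((pderiv 2)^[α 2] q))

theorem pderiv_comm (i j : Fin 3) (q : MvPolynomial (Fin 3) ℝ) :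
    MvPolynomial.pderiv i (MvPolynomial.pderiv j q) =
      MvPolynomial.pderiv j (MvPolynomial.pderiv i q) := by
  ext m
  simp only [MvPolynomial.coeff_pderiv]
  rw [add_right_comm]
  rcases eq_or_ne i j with rfl | h
  · ring
  · simp [Finsupp.single_eq_of_ne h, Finsupp.single_eq_of_ne h.symm]; ring

theorem iterate_pderiv_comm (i j : Fin 3) (n : ℕ) (q : MvPolynomial (Fin 3) ℝ) :
    (MvPolynomial.pderiv j)^[n] (MvPolynomial.pderiv i q) =
      MvPolynomial.pderiv i ((MvPolynomial.pderiv j)^[n] q) := by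
  induction n generalizing q with
  | zero => rfl
  | succ n ih =>
    rw [Function.iterate_succ_apply, Function.iterate_succ_apply, pderiv_comm j i, ih]

@[simp] theorem polyDeriv_zero (q : MvPolynomial (Fin 3) ℝ) : polyDeriv 0 q = q := rfl

theorem polyDeriv_add_single (α : Fin 3 → ℕ) (i : Fin 3) (q : MvPolynomial (Fin 3) ℝ) :
    polyDeriv (α + Pi.single i 1) q = MvPolynomial.pderiv i (polyDeriv α q) := by
  unfold polyDeriv
  fin_cases i
  · simp [Function.iterate_succ_apply, iterate_pderiv_comm]
  · simp [Function.iterate_succ_apply, iterate_pderiv_comm]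
  · simp [Function.iterate_succ_apply, iterate_pderiv_comm]

theorem polyDeriv_single (i : Fin 3) (q : MvPolynomial (Fin 3) ℝ) :
    polyDeriv (Pi.single i 1) q = MvPolynomial.pderiv i q := by
  have := polyDeriv_add_single 0 i q
  rwa [zero_add] at this

/-- Induction on multi-indices. -/
theorem multiIndex_induction {P : (Fin 3 → ℕ) → Prop} (h0 : P 0)
    (h1 : ∀ α i, P α → P (α + Pi.single i 1)) (α : Fin 3 → ℕ) : P α := by
  induction hn : ∑ i, α i generalizing α with
  | zero =>
    have : α = 0 := by
      funext i; exact Finset.sum_eq_zero_iff.1 hn i (Finset.mem_univ i)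
    rwa [this]
  | succ n ih =>
    obtain ⟨i, hi⟩ : ∃ i, α i ≠ 0 := by
      by_contra! h
      simp [h] at hn
    have hα : α = (α - Pi.single i 1) + Pi.single i 1 := by
      funext j
      rcases eq_or_ne j i with rfl | hj
      · simp; omega
      · simp [hj]
    rw [hα]
    apply h1
    apply ih
    rw [hα] at hn
    simpa [Finset.sum_add_distrib] using hn

theorem polyDeriv_add (α : Fin 3 → ℕ) (p q : MvPolynomial (Fin 3) ℝ) :
    polyDeriv α (p + q) = polyDeriv α p + polyDeriv α q := by
  induction α using multiIndex_induction with
  | h0 => rfl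
  | h1 α i ih => simp only [polyDeriv_add_single, ih, map_add]

/-- The factor is a product of falling factorials. Only the lower bound one matters: it allows
division, and the index shift yields all statements on degrees. -/
theorem exists_coeff_polyDeriv (α : Fin 3 → ℕ) (m : Fin 3 →₀ ℕ) :
    ∃ c : ℝ, 1 ≤ c ∧ ∀ q, (polyDeriv α q).coeff m =
      c * q.coeff (m + Finsupp.equivFunOnFinite.symm α) := by
  induction α using multiIndex_induction generalizing m with
  | h0 =>
    refine ⟨1, le_rfl, fun q => ?_⟩
    have : (Finsupp.equivFunOnFinite.symm (0 : Fin 3 → ℕ)) = 0 := by ext; simp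
    rw [this]; simp
  | h1 α i ih =>
    obtain ⟨c, hc, h⟩ := ih (m + Finsupp.single i 1)
    refine ⟨c * (m i + 1), ?_, fun q => ?_⟩
    · have : (0 : ℝ) ≤ m i := Nat.cast_nonneg _
      nlinarith
    · rw [polyDeriv_add_single, MvPolynomial.coeff_pderiv, h]
      have : m + Finsupp.single i 1 + Finsupp.equivFunOnFinite.symm α =
          m + Finsupp.equivFunOnFinite.symm (α + Pi.single i 1) := by
        ext j
        rcases eq_or_ne j i with rfl | hj
        · simp; ring
        · simp [hj]
      rw [this]; ring

theorem mem_poly_iff {n : ℕ} {q : MvPolynomial (Fin 3) ℝ} :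
    q ∈ Poly n ↔ ∀ m : Fin 3 →₀ ℕ, q.coeff m ≠ 0 → ∑ i, m i ≤ n := by
  rw [MvPolynomial.mem_restrictTotalDegree, MvPolynomial.totalDegree, Finset.sup_le_iff]
  simp only [MvPolynomial.mem_support_iff, Finsupp.sum_fintype, implies_true]

theorem polyDeriv_mem {n : ℕ} {q : MvPolynomial (Fin 3) ℝ} (hq : q ∈ Poly n) (α : Fin 3 → ℕ) :
    polyDeriv α q ∈ Poly (n - ∑ i, α i) := by
  rw [mem_poly_iff] at hq ⊢
  intro m hm
  obtain ⟨c, -, h⟩ := exists_coeff_polyDeriv α m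
  rw [h] at hm
  have := hq _ (right_ne_zero_of_mul hm)
  simp only [Finsupp.coe_add, Pi.add_apply, Finsupp.equivFunOnFinite_symm_apply_apply,
    Finset.sum_add_distrib] at this
  omega

theorem polyDeriv_eq_zero {n : ℕ} {q : MvPolynomial (Fin 3) ℝ} (hq : q ∈ Poly n) {α : Fin 3 → ℕ}
    (hα : n < ∑ i, α i) : polyDeriv α q = 0 := by
  ext m
  obtain ⟨c, -, h⟩ := exists_coeff_polyDeriv α m
  rw [h, MvPolynomial.coeff_zero]
  by_contra hne
  have := mem_poly_iff.1 hq _ (right_ne_zero_of_mul hne)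
  simp only [Finsupp.coe_add, Pi.add_apply, Finsupp.equivFunOnFinite_symm_apply_apply,
    Finset.sum_add_distrib] at this
  omega

theorem eq_C_of_mem_poly_zero {q : MvPolynomial (Fin 3) ℝ} (hq : q ∈ Poly 0) :
    q = MvPolynomial.C (q.coeff 0) := by
  have := (MvPolynomial.mem_restrictTotalDegree _ _ _).1 hq
  exact MvPolynomial.totalDegree_eq_zero_iff_eq_C.1 (by omega)

theorem contDiff_pval (q : MvPolynomial (Fin 3) ℝ) : ContDiff ℝ ∞ (pval q) := by
  induction q using MvPolynomial.induction_on with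
  | C a =>
    have : pval (MvPolynomial.C a) = fun _ => a := by funext x; simp [pval]
    rw [this]; exact contDiff_const
  | add p q hp hq =>
    have : pval (p + q) = fun x => pval p x + pval q x := by funext x; simp [pval]
    rw [this]; exact hp.add hq
  | mul_X p i hp =>
    have : pval (p * MvPolynomial.X i) = fun x => pval p x * x i := by funext x; simp [pval]
    rw [this]
    exact hp.mul (by fun_prop)

theorem continuous_pval (q : MvPolynomial (Fin 3) ℝ) : Continuous (pval q) :=
  (contDiff_pval q).continuous

theorem hasFDerivAt_pval (q : MvPolynomial (Fin 3) ℝ) (x : E3) :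
    HasFDerivAt (pval q) (∑ i, pval (MvPolynomial.pderiv i q) x •
      (EuclideanSpace.proj i : E3 →L[ℝ] ℝ)) x := by
  induction q using MvPolynomial.induction_on with
  | C a =>
    have : pval (MvPolynomial.C a) = fun _ => a := by funext x; simp [pval]
    rw [this]
    simpa [pval] using hasFDerivAt_const a x
  | add p q hp hq =>
    have : pval (p + q) = fun x => pval p x + pval q x := by funext x; simp [pval]
    rw [this]
    refine (hp.add hq).congr_fderiv ?_
    ext v
    simp [pval, Fin.sum_univ_three]
    ring
  | mul_X p i hp =>
    have : pval (p * MvPolynomial.X i) = fun x => pval p x * x i := by funext x; simp [pval]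
    rw [this]
    have hX : HasFDerivAt (fun x : E3 => x i) (EuclideanSpace.proj i : E3 →L[ℝ] ℝ) x :=
      (EuclideanSpace.proj i : E3 →L[ℝ] ℝ).hasFDerivAt
    refine (hp.mul hX).congr_fderiv ?_
    ext v
    fin_cases i <;>
    · simp [pval, Fin.sum_univ_three, MvPolynomial.pderiv_X]
      ring

theorem partialDeriv_pval (q : MvPolynomial (Fin 3) ℝ) (i : Fin 3) :
    partialDeriv i (pval q) = pval (MvPolynomial.pderiv i q) := by
  funext x
  rw [partialDeriv, (hasFDerivAt_pval q x).fderiv]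
  simp

@[simp] theorem pval_add (p q : MvPolynomial (Fin 3) ℝ) (x : E3) :
    pval (p + q) x = pval p x + pval q x := by simp [pval]

@[simp] theorem pval_sub (p q : MvPolynomial (Fin 3) ℝ) (x : E3) :
    pval (p - q) x = pval p x - pval q x := by simp [pval]

@[simp] theorem pval_mul (p q : MvPolynomial (Fin 3) ℝ) (x : E3) :
    pval (p * q) x = pval p x * pval q x := by simp [pval]

@[simp] theorem pval_C (a : ℝ) (x : E3) : pval (MvPolynomial.C a) x = a := by simp [pval]

@[simp] theorem pval_zero (x : E3) : pval 0 x = 0 := by simp [pval]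

@[simp] theorem pval_smul (a : ℝ) (q : MvPolynomial (Fin 3) ℝ) (x : E3) :
    pval (a • q) x = a * pval q x := by simp [pval, MvPolynomial.smul_eval]

theorem pval_sum {ι : Type*} (s : Finset ι) (q : ι → MvPolynomial (Fin 3) ℝ) (x : E3) :
    pval (∑ i ∈ s, q i) x = ∑ i ∈ s, pval (q i) x := by simp [pval]

theorem memLp_of_continuous {O : Set E3} (hO : Bornology.IsBounded O) {f : E3 → ℝ}
    (hf : Continuous f) : MemLp f 2 (volume.restrict O) := by
  have hc : IsCompact (closure O) := hO.isCompact_closure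
  have : MemLp f 2 (volume.restrict (closure O)) := by
    have : IsFiniteMeasure (volume.restrict (closure O)) :=
      ⟨by simpa using hc.measure_lt_top⟩
    obtain ⟨C, hC⟩ := hc.exists_bound_of_continuousOn hf.continuousOn
    refine MemLp.of_bound hf.aestronglyMeasurable C ?_
    filter_upwards [ae_restrict_mem isClosed_closure.measurableSet] with x hx using hC x hx
  exact this.mono_measure (Measure.restrict_mono_set _ subset_closure)

theorem integral_mul_partialDeriv {f ψ : E3 → ℝ} {O : Set E3} (hO : IsOpen O)
    (hψ : ∀ x ∈ O, DifferentiableAt ℝ ψ x)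
    (hψ1 : ContinuousOn ψ O) (hψ2 : ContinuousOn (fun x => fderiv ℝ ψ x) O)
    (hf : IsTestFunction O f) (i : Fin 3) :
    ∫ x in O, ψ x * partialDeriv i f x = - ∫ x in O, partialDeriv i ψ x * f x := by
  rw [setIntegral_eq_integral_of_forall_compl_eq_zero
      (fun x hx => by rw [(hf.partialDeriv i).eq_zero hx, mul_zero]),
    setIntegral_eq_integral_of_forall_compl_eq_zero
      (fun x hx => by rw [hf.eq_zero hx, mul_zero])]
  have hi : ∀ {a b : E3 → ℝ}, ContinuousOn a O → IsTestFunction O b →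
      Integrable (fun x => a x * b x) := by
    intro a b ha hb
    have hc : Continuous fun x => a x * b x := by
      rw [continuous_iff_continuousAt]
      intro x
      by_cases hx : x ∈ O
      · exact ((ha x hx).continuousAt (hO.mem_nhds hx)).mul hb.1.continuous.continuousAt
      · have hx' : x ∈ (tsupport b)ᶜ := fun h => hx (hb.2.2 h)
        have : (fun x => a x * b x) =ᶠ[nhds x] fun _ => 0 := by
          filter_upwards [(isClosed_tsupport b).isOpen_compl.mem_nhds hx'] with y hy
          rw [image_eq_zero_of_notMem_tsupport hy, mul_zero]
        exact continuousAt_const.congr this.symm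
    exact hc.integrable_of_hasCompactSupport hb.2.1.mul_left
  refine integral_mul_fderiv_eq_neg_fderiv_mul_of_integrable ?_ ?_ ?_
    (fun x hx => hψ x (hf.2.2 hx)) (fun x _ => hf.1.differentiable (by simp) x)
  · exact hi (hψ2.clm_apply continuousOn_const) hf
  · exact hi hψ1 (hf.partialDeriv i)
  · exact hi hψ1 hf

theorem IsWeakDeriv.comp_single {Ω : Set E3} {α : Fin 3 → ℕ} {i : Fin 3} {u g g' : E3 → ℝ}
    (h : IsWeakDeriv Ω α u g) (h' : IsWeakDeriv Ω (Pi.single i 1) g g') :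
    IsWeakDeriv Ω (α + Pi.single i 1) u g' := by
  refine ⟨h'.1, fun f hf => ?_⟩
  have e1 := h'.2 f hf
  rw [multiDeriv_single] at e1
  rw [← multiDeriv_partialDeriv hf.1, h.2 _ (hf.partialDeriv i), e1]
  have hs : ∑ j, (α + Pi.single i 1 : Fin 3 → ℕ) j = (∑ j, α j) + 1 := by
    simp [Finset.sum_add_distrib]
  rw [hs]; simp [pow_succ]

theorem isWeakDeriv_pval {O : Set E3} (hO : IsOpen O) (hOb : Bornology.IsBounded O)
    (q : MvPolynomial (Fin 3) ℝ) (α : Fin 3 → ℕ) :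
    IsWeakDeriv O α (pval q) (pval (polyDeriv α q)) := by
  induction α using multiIndex_induction with
  | h0 => exact isWeakDeriv_zero (memLp_of_continuous hOb (continuous_pval q))
  | h1 α i ih =>
    refine ih.comp_single ⟨memLp_of_continuous hOb (continuous_pval _), fun f hf => ?_⟩
    have hs := contDiff_pval (polyDeriv α q)
    rw [multiDeriv_single, integral_mul_partialDeriv hO
      (fun x _ => hs.differentiable (by simp) x) hs.continuous.continuousOn
      (hs.continuous_fderiv (by simp)).continuousOn hf i, partialDeriv_pval, polyDeriv_add_single]
    simp

/-! ### Polynomial approximation of Sobolev functions -/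

theorem mem_multiIndices {k : ℕ} {α : Fin 3 → ℕ} : α ∈ multiIndices k ↔ ∑ i, α i ≤ k := by
  unfold multiIndices
  simp only [Finset.mem_filter, Fintype.mem_piFinset, Finset.mem_range, and_iff_right_iff_imp]
  intro h i
  have := Finset.single_le_sum (f := α) (fun _ _ => Nat.zero_le _) (Finset.mem_univ i)
  omega

theorem integrableOn_pval {O : Set E3} (hOb : Bornology.IsBounded O)
    (q : MvPolynomial (Fin 3) ℝ) : IntegrableOn (pval q) O := by
  have : IsFiniteMeasure (volume.restrict O) := ⟨by simpa using hOb.measure_lt_top⟩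
  exact (memLp_of_continuous hOb (continuous_pval q)).integrable (by norm_num)

/-- Derivatives of order `n` of a polynomial of degree `n` are constants, each a multiple of a
single coefficient, so the coefficients can be read off. -/
theorem exists_homogeneous_means {O : Set E3} (hv : 0 < volume.real O)
    (n : ℕ) (a : (Fin 3 → ℕ) → ℝ) :
    ∃ q ∈ Poly n, ∀ α : Fin 3 → ℕ, ∑ i, α i = n → ∫ x in O, pval (polyDeriv α q) x = a α := by
  choose κ hκ1 hκ using fun α => exists_coeff_polyDeriv α 0
  set e : (Fin 3 → ℕ) → (Fin 3 →₀ ℕ) := fun α => Finsupp.equivFunOnFinite.symm α with he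
  set q : MvPolynomial (Fin 3) ℝ := ∑ β ∈ (multiIndices n).filter (fun β => ∑ i, β i = n),
    MvPolynomial.monomial (e β) (a β / (κ β * volume.real O)) with hq
  have hqn : q ∈ Poly n := by
    refine Submodule.sum_mem _ fun β hβ => ?_
    rw [mem_poly_iff]
    intro m hm
    rw [MvPolynomial.coeff_monomial] at hm
    have : e β = m := by by_contra h; simp [h] at hm
    rw [← this]
    exact (Finset.mem_filter.1 hβ).2.le
  refine ⟨q, hqn, fun α hα => ?_⟩
  have h0 : polyDeriv α q ∈ Poly 0 := by
    have := polyDeriv_mem hqn α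
    rwa [hα, Nat.sub_self] at this
  have hc : q.coeff (e α) = a α / (κ α * volume.real O) := by
    rw [hq, MvPolynomial.coeff_sum, Finset.sum_eq_single α]
    · simp
    · intro β _ hβ
      rw [MvPolynomial.coeff_monomial, if_neg]
      intro h
      exact hβ (Finsupp.equivFunOnFinite.symm.injective h)
    · intro h
      exact absurd (Finset.mem_filter.2 ⟨mem_multiIndices.2 hα.le, hα⟩) h
  rw [eq_C_of_mem_poly_zero h0, hκ α q, zero_add, hc]
  simp only [pval_C, integral_const, measureReal_restrict_apply_univ, smul_eq_mul]
  have := (zero_lt_one.trans_le (hκ1 α)).ne'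
  field_simp

/-- The system for the means is triangular: the part of top degree is fixed first, and the
lower-degree correction does not disturb the top derivatives. -/
theorem exists_poly_means {O : Set E3} (hOb : Bornology.IsBounded O) (hv : 0 < volume.real O)
    (n : ℕ) (a : (Fin 3 → ℕ) → ℝ) :
    ∃ q ∈ Poly n, ∀ α : Fin 3 → ℕ, ∑ i, α i ≤ n → ∫ x in O, pval (polyDeriv α q) x = a α := by
  induction n generalizing a with
  | zero =>
    obtain ⟨q, hq, h⟩ := exists_homogeneous_means hv 0 a
    exact ⟨q, hq, fun α hα => h α (by omega)⟩
  | succ n ih =>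
    obtain ⟨q, hq, h⟩ := exists_homogeneous_means hv (n + 1) a
    obtain ⟨r, hr, h'⟩ := ih (fun α => a α - ∫ x in O, pval (polyDeriv α q) x)
    refine ⟨r + q, Submodule.add_mem _ ?_ hq, fun α hα => ?_⟩
    · rw [mem_poly_iff] at hr ⊢
      exact fun m hm => (hr m hm).trans n.le_succ
    · rw [polyDeriv_add]
      simp only [pval_add]
      rw [integral_add (integrableOn_pval hOb _) (integrableOn_pval hOb _)]
      rcases Nat.lt_or_ge n (∑ i, α i) with hlt | hge
      · rw [polyDeriv_eq_zero hr hlt, h α (by omega)]; simp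
      · rw [h' α hge]; ring

section

variable {O : Set E3} (hO : IsOpen O) (hOc : Convex ℝ O) (hne : O.Nonempty)
  (hOb : Bornology.IsBounded O) {D : ℝ}
  (hD : ∀ x ∈ O, ∀ z ∈ O, ‖z - x‖ ≤ D) {k : ℕ} {u : E3 → ℝ}
  {w : (Fin 3 → ℕ) → E3 → ℝ} (hw : ∀ α : Fin 3 → ℕ, ∑ i, α i ≤ k → IsWeakDeriv O α u (w α))
include hO hOb hw

theorem hasWeakGrad_sub_poly (π : MvPolynomial (Fin 3) ℝ)
    {α : Fin 3 → ℕ} (hα : ∑ i, α i < k) :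
    HasWeakGrad O (w α - pval (polyDeriv α π))
      (fun i => w (α + Pi.single i 1) - pval (polyDeriv (α + Pi.single i 1) π)) := by
  have hs : ∀ i, ∑ j, (α + Pi.single i 1 : Fin 3 → ℕ) j = (∑ j, α j) + 1 := fun i => by
    simp [Finset.sum_add_distrib]
  have hwα := hw α hα.le
  have hp := isWeakDeriv_pval hO hOb π α
  refine ⟨hwα.1.sub hp.1, fun i => ?_⟩
  have h1 := hw (α + Pi.single i 1) (by rw [hs]; omega)
  have h2 := isWeakDeriv_pval hO hOb π (α + Pi.single i 1)
  exact (hwα.chain h1).sub hwα.1 hp.1 (hp.chain h2)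

include hOc hne hD

/-- Take `π` whose derivatives of order below `k` have the same means as those of `u`. Every
difference of derivatives then has mean zero, and Poincaré's inequality is applied repeatedly,
starting from order `k`, where `π` contributes nothing. Each step costs `4 D ^ 2` times the three
partial derivatives. -/
theorem bramble_hilbert {M : ℝ}
    (hM : ∀ β : Fin 3 → ℕ, ∑ i, β i = k → ∫ x in O, w β x ^ 2 ≤ M) :
    ∃ π ∈ Poly (k - 1), ∀ α : Fin 3 → ℕ, ∑ i, α i ≤ k →
      ∫ x in O, (w α x - pval (polyDeriv α π) x) ^ 2 ≤ (12 * D ^ 2) ^ (k - ∑ i, α i) * M := by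
  have hb : volume O ≠ ⊤ := hOb.measure_lt_top.ne
  have : IsFiniteMeasure (volume.restrict O) := ⟨by simpa using hOb.measure_lt_top⟩
  have hv : 0 < volume.real O := ENNReal.toReal_pos (hO.measure_pos volume hne).ne' hb
  have hs : ∀ (α : Fin 3 → ℕ) i, ∑ j, (α + Pi.single i 1 : Fin 3 → ℕ) j = (∑ j, α j) + 1 :=
    fun α i => by simp [Finset.sum_add_distrib]
  -- For `k = 0` the truncated degree `k - 1` is zero and there are no means to match, so the zero
  -- polynomial is taken.
  rcases Nat.eq_zero_or_pos k with rfl | hk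
  · refine ⟨0, Submodule.zero_mem _, fun α hα => ?_⟩
    have h0 : polyDeriv α 0 = 0 := by
      have : α = 0 := by
        funext i; exact Finset.sum_eq_zero_iff.1 (by omega) i (Finset.mem_univ i)
      rw [this, polyDeriv_zero]
    simpa [h0] using hM α (by omega)
  obtain ⟨π, hπ, hmean⟩ := exists_poly_means hOb hv (k - 1) (fun α => ∫ x in O, w α x)
  refine ⟨π, hπ, fun α hα => ?_⟩
  induction hj : k - ∑ i, α i generalizing α with
  | zero =>
    have : ∑ i, α i = k := by omega
    rw [polyDeriv_eq_zero hπ (by omega)]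
    simpa using hM α this
  | succ j ih =>
    have hlt : ∑ i, α i < k := by omega
    have hG := hasWeakGrad_sub_poly hO hOb hw π hlt
    have h0 : ∫ x in O, (w α - pval (polyDeriv α π)) x = 0 := by
      simp only [Pi.sub_apply]
      rw [integral_sub ((hw α hα).1.integrable (by norm_num)) (integrableOn_pval hOb _),
        hmean α (by omega), sub_self]
    have hP := poincare_mean_zero hO hOc hD hG hb h0
    simp only [Pi.sub_apply] at hP
    refine hP.trans ?_
    have hb : ∀ i, ∫ x in O, (w (α + Pi.single i 1) x - pval (polyDeriv (α + Pi.single i 1) π) x) ^ 2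
        ≤ (12 * D ^ 2) ^ j * M := fun i => ih _ (by rw [hs]; omega) (by rw [hs]; omega)
    calc _ ≤ 4 * D ^ 2 * ∑ i : Fin 3, (12 * D ^ 2) ^ j * M :=
          mul_le_mul_of_nonneg_left (Finset.sum_le_sum fun i _ => hb i) (by positivity)
      _ = _ := by simp; ring

/-- The supremum bound is applied to `u - π`, whose derivatives of orders 0, 1 and 2 have just been
estimated. In units of `T = (12 D ^ 2) ^ k M` it gives `2 + 8 = 10`, and half the volume on the left
makes this 20. -/
theorem ae_sq_sub_poly_le (hk : 2 ≤ k) {M : ℝ} (hM : 0 ≤ M)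
    {π : MvPolynomial (Fin 3) ℝ} (hπ : ∀ α : Fin 3 → ℕ, ∑ i, α i ≤ k →
      ∫ x in O, (w α x - pval (polyDeriv α π) x) ^ 2 ≤ (12 * D ^ 2) ^ (k - ∑ i, α i) * M)
    (hu : MemLp u 2 (volume.restrict O)) :
    ∀ᵐ x ∂volume.restrict O,
      (u x - pval π x) ^ 2 ≤ 20 * (12 * D ^ 2) ^ k * M / volume.real O := by
  have hb : volume O ≠ ⊤ := hOb.measure_lt_top.ne
  have hv : 0 < volume.real O := ENNReal.toReal_pos (hO.measure_pos volume hne).ne' hb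
  obtain ⟨x₀, hx₀⟩ := hne
  have hD0 : 0 ≤ D := (norm_nonneg _).trans (hD x₀ hx₀ x₀ hx₀)
  have hs1 : ∀ i, ∑ j, (0 + Pi.single i 1 : Fin 3 → ℕ) j = 1 := fun i => by simp
  have hs2 : ∀ i j, ∑ l, (0 + Pi.single i 1 + Pi.single j 1 : Fin 3 → ℕ) l = 2 :=
    fun i j => by simp [Finset.sum_add_distrib]
  have hG := hasWeakGrad_sub_poly hO hOb hw π (α := 0) (by simp; omega)
  have hH := fun i => hasWeakGrad_sub_poly hO hOb hw π (α := 0 + Pi.single i 1)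
    (by rw [hs1]; omega)
  have hsup := ae_sup_le hO hOc hD hG hH hb
  have hw0 : w 0 =ᵐ[volume.restrict O] u := (hw 0 (by simp)).unique hO (isWeakDeriv_zero hu)
  set T := (12 * D ^ 2) ^ k * M with hT
  obtain ⟨l, rfl⟩ : ∃ l, k = l + 2 := ⟨k - 2, by omega⟩
  set P := (12 * D ^ 2) ^ l * M with hP
  have hP0 : 0 ≤ P := by positivity
  have b0 : lsq O (w 0 - pval (polyDeriv 0 π)) ≤ ENNReal.ofReal T := by
    rw [lsq_eq hG.1]
    exact ENNReal.ofReal_le_ofReal (by simpa using hπ 0 (by simp))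
  have b1 : ∀ i, lsq O (w (0 + Pi.single i 1) - pval (polyDeriv (0 + Pi.single i 1) π)) ≤
      ENNReal.ofReal (12 * D ^ 2 * P) := fun i => by
    rw [lsq_eq (hG.2 i).1]
    refine ENNReal.ofReal_le_ofReal ((hπ _ (by rw [hs1]; omega)).trans (le_of_eq ?_))
    rw [hs1, show l + 2 - 1 = l + 1 by omega, pow_succ, hP]; ring
  have b2 : ∀ i j, lsq O (w (0 + Pi.single i 1 + Pi.single j 1) -
      pval (polyDeriv (0 + Pi.single i 1 + Pi.single j 1) π)) ≤ ENNReal.ofReal P := fun i j => by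
    rw [lsq_eq ((hH i).2 j).1]
    refine ENNReal.ofReal_le_ofReal ((hπ _ (by rw [hs2]; omega)).trans (le_of_eq ?_))
    rw [hs2, show l + 2 - 2 = l by omega, hP]
  filter_upwards [hsup, hw0] with x hx hx0
  have h2 : (2 : ENNReal) = ENNReal.ofReal 2 := by simp
  have h8 : (8 : ENNReal) = ENNReal.ofReal 8 := by simp
  have hosc : oscBound O D (fun i => w (0 + Pi.single i 1) - pval (polyDeriv (0 + Pi.single i 1) π))
      (fun i j => w (0 + Pi.single i 1 + Pi.single j 1) -
        pval (polyDeriv (0 + Pi.single i 1 + Pi.single j 1) π)) ≤ ENNReal.ofReal (144 * D ^ 2 * P) := by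
    unfold oscBound
    calc _ ≤ ∑ i : Fin 3, (2 * ENNReal.ofReal (12 * D ^ 2 * P) + 8 * ENNReal.ofReal D ^ 2 *
          ∑ j : Fin 3, ENNReal.ofReal P) :=
          Finset.sum_le_sum fun i _ => add_le_add (mul_le_mul' le_rfl (b1 i))
            (mul_le_mul' le_rfl (Finset.sum_le_sum fun j _ => b2 i j))
      _ = _ := by
          rw [h2, h8, ← ENNReal.ofReal_sum_of_nonneg (fun _ _ => hP0),
            ← ENNReal.ofReal_pow hD0, ← ENNReal.ofReal_mul (by positivity),
            ← ENNReal.ofReal_mul (by positivity),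
            ← ENNReal.ofReal_mul (by positivity),
            ← ENNReal.ofReal_add (by positivity) (by simp; positivity),
            ← ENNReal.ofReal_sum_of_nonneg (fun _ _ => by simp; positivity)]
          congr 1; simp; ring
  have hfin : ENNReal.ofReal (volume.real O / 2) * ‖u x - pval π x‖ₑ ^ 2 ≤
      ENNReal.ofReal (10 * T) := by
    simp only [Pi.sub_apply, polyDeriv_zero, hx0] at hx
    refine hx.trans ((add_le_add (mul_le_mul' le_rfl b0) (mul_le_mul' le_rfl hosc)).trans
      (le_of_eq ?_))
    rw [h2, h8, ← ENNReal.ofReal_pow hD0, ← ENNReal.ofReal_mul (by positivity),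
      ← ENNReal.ofReal_mul (by positivity), ← ENNReal.ofReal_mul (by positivity),
      ← ENNReal.ofReal_add (by positivity) (by positivity)]
    congr 1
    rw [hT, hP]; ring
  rw [enorm_sq_eq, ← ENNReal.ofReal_mul (by positivity),
    ENNReal.ofReal_le_ofReal_iff (by positivity)] at hfin
  rw [le_div_iff₀ hv, mul_assoc 20, ← hT]
  linarith

end

/-! ### The reference tetrahedron and affine changes of variables -/

theorem mem_refTet {x : E3} :
    x ∈ refTet ↔ 0 ≤ x 0 ∧ 0 ≤ x 1 ∧ 0 ≤ x 2 ∧ x 0 + x 1 + x 2 ≤ 1 := by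
  simp only [refTet, mem_ofPred_eq, Fin.forall_fin_succ, bary]
  simp
  intros
  constructor <;> intro <;> linarith

theorem bary_combo {a b : ℝ} (hab : a + b = 1) (x y : E3) (k : Fin 4) :
    bary (a • x + b • y) k = a * bary x k + b * bary y k := by
  obtain rfl : b = 1 - a := by linarith
  fin_cases k <;> simp [bary] <;> ring

theorem continuous_bary (k : Fin 4) : Continuous fun x => bary x k := by
  fin_cases k <;> simp [bary] <;> fun_prop

theorem convex_refTet : Convex ℝ refTet := by
  intro x hx y hy a b ha hb hab k
  rw [bary_combo hab]
  have := hx k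
  have := hy k
  positivity

theorem isClosed_refTet : IsClosed refTet := by
  have : refTet = ⋂ k, {x | 0 ≤ bary x k} := by ext; simp [refTet]
  rw [this]
  exact isClosed_iInter fun k => isClosed_le continuous_const (continuous_bary k)

theorem abs_sub_le_of_mem_refTet {x y : E3} (hx : x ∈ refTet) (hy : y ∈ refTet) (i : Fin 3) :
    |x i - y i| ≤ 1 := by
  rw [mem_refTet] at hx hy
  rw [abs_le]
  fin_cases i <;> simp <;> constructor <;> linarith [hx.1, hx.2.1, hx.2.2.1, hx.2.2.2, hy.1, hy.2.1,
    hy.2.2.1, hy.2.2.2]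

theorem isBounded_refTet : Bornology.IsBounded refTet := by
  refine (Metric.isBounded_closedBall (x := (0 : E3)) (r := 1)).subset fun x hx => ?_
  rw [mem_closedBall_zero_iff, EuclideanSpace.norm_eq, Real.sqrt_le_iff]
  refine ⟨zero_le_one, ?_⟩
  rw [mem_refTet] at hx
  obtain ⟨h0, h1, h2, h3⟩ := hx
  simp only [Fin.sum_univ_three, Real.norm_eq_abs, sq_abs]
  nlinarith [mul_nonneg h0 h1, mul_nonneg h0 h2, mul_nonneg h1 h2]

theorem isCompact_refTet : IsCompact refTet :=
  Metric.isCompact_of_isClosed_isBounded isClosed_refTet isBounded_refTet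

theorem zero_mem_refTet : (0 : E3) ∈ refTet := by simp [mem_refTet]

theorem single_mem_refTet (i : Fin 3) : EuclideanSpace.single i (1 : ℝ) ∈ refTet := by
  rw [mem_refTet]; fin_cases i <;> simp

theorem box_subset_interior_refTet {x : E3} (hx : ∀ i, x i ∈ Ioo (0 : ℝ) (1 / 4)) :
    x ∈ interior refTet := by
  rw [mem_interior]
  refine ⟨⋂ k, {x | 0 < bary x k}, ?_, ?_, ?_⟩
  · intro y hy k
    exact (mem_iInter.1 hy k).le
  · exact isOpen_iInter_of_finite fun k => isOpen_lt continuous_const (continuous_bary k)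
  · rw [mem_iInter]
    have h0 := hx 0
    have h1 := hx 1
    have h2 := hx 2
    intro k
    simp only [mem_ofPred_eq]
    fin_cases k <;> simp [bary] <;> [exact h0.1; exact h1.1; exact h2.1; linarith [h0.2, h1.2, h2.2]]

theorem interior_refTet_nonempty : (interior refTet).Nonempty :=
  ⟨!₂[1 / 8, 1 / 8, 1 / 8], box_subset_interior_refTet fun i => by
    fin_cases i <;> simp <;> norm_num⟩

theorem volume_refTet_pos : 0 < volume.real refTet :=
  ENNReal.toReal_pos ((isOpen_interior.measure_pos volume interior_refTet_nonempty).trans_le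
    (measure_mono interior_subset)).ne' isBounded_refTet.measure_lt_top.ne

section Affine

variable (φ : E3 ≃ᵃ[ℝ] E3)

theorem continuous_affineEquiv : Continuous φ :=
  (φ : E3 →ᵃ[ℝ] E3).continuous_of_finiteDimensional

/-- An affine bijection of space as a homeomorphism. -/
def affineHomeo : E3 ≃ₜ E3 where
  toEquiv := φ.toEquiv
  continuous_toFun := continuous_affineEquiv φ
  continuous_invFun := continuous_affineEquiv φ.symm

theorem isCompact_image_refTet : IsCompact (φ '' refTet) :=
  isCompact_refTet.image (continuous_affineEquiv φ)

theorem convex_image_refTet : Convex ℝ (φ '' refTet) :=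
  convex_refTet.affine_image (φ : E3 →ᵃ[ℝ] E3)

theorem interior_image_refTet : interior (φ '' refTet) = φ '' interior refTet :=
  ((affineHomeo φ).image_interior refTet).symm

theorem interior_image_refTet_nonempty : (interior (φ '' refTet)).Nonempty := by
  rw [interior_image_refTet]
  exact interior_refTet_nonempty.image _

theorem closure_interior_image_refTet : closure (interior (φ '' refTet)) = φ '' refTet := by
  rw [(convex_image_refTet φ).closure_interior_eq_closure_of_nonempty_interior
    (interior_image_refTet_nonempty φ), (isCompact_image_refTet φ).isClosed.closure_eq]

theorem interior_image_ae_eq : interior (φ '' refTet) =ᵐ[volume] φ '' refTet :=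
  interior_ae_eq_of_null_frontier ((convex_image_refTet φ).addHaar_frontier volume)

theorem affineEquiv_apply (x : E3) : φ x = φ.linear x + φ 0 := by
  have := congrFun ((φ : E3 →ᵃ[ℝ] E3).decomp) x
  simpa using this

theorem hasFDerivAt_affineEquiv (x : E3) :
    HasFDerivAt φ (LinearMap.toContinuousLinearMap (φ.linear : E3 →ₗ[ℝ] E3)) x := by
  have h : (φ : E3 → E3) = fun x =>
      LinearMap.toContinuousLinearMap (φ.linear : E3 →ₗ[ℝ] E3) x + φ 0 := by
    funext x; exact affineEquiv_apply φ x
  rw [h]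
  exact (ContinuousLinearMap.hasFDerivAt _).add_const _

/-- The determinant is identified as the volume ratio by applying the change of variables to the
constant one. -/
theorem setIntegral_image_refTet (f : E3 → ℝ) :
    ∫ x in φ '' refTet, f x =
      volume.real (φ '' refTet) / volume.real refTet * ∫ x in refTet, f (φ x) := by
  have h : ∀ g : E3 → ℝ, ∫ x in φ '' refTet, g x =
      |(LinearMap.toContinuousLinearMap (φ.linear : E3 →ₗ[ℝ] E3)).det| *
        ∫ x in refTet, g (φ x) := fun g => by
    rw [integral_image_eq_integral_abs_det_fderiv_smul volume isClosed_refTet.measurableSet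
      (fun x _ => (hasFDerivAt_affineEquiv φ x).hasFDerivWithinAt) φ.injective.injOn]
    simp [integral_const_mul]
  have h1 := h fun _ => 1
  simp only [integral_const, measureReal_restrict_apply_univ, smul_eq_mul, mul_one] at h1
  rw [h, h1]
  have := volume_refTet_pos.ne'
  field_simp

/-- The composition of a polynomial with an affine map. -/
def polyComp (q : MvPolynomial (Fin 3) ℝ) : MvPolynomial (Fin 3) ℝ :=
  MvPolynomial.aeval (fun i : Fin 3 => ∑ j : Fin 3,
    MvPolynomial.C (φ.linear (EuclideanSpace.single j 1) i) * MvPolynomial.X j +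
      MvPolynomial.C (φ 0 i)) q

@[simp] theorem pval_polyComp (q : MvPolynomial (Fin 3) ℝ) (x : E3) :
    pval (polyComp φ q) x = pval q (φ x) := by
  unfold pval polyComp
  rw [← MvPolynomial.coe_aeval_eq_eval, ← MvPolynomial.coe_aeval_eq_eval]
  simp only [RingHom.coe_coe]
  rw [← AlgHom.comp_apply, MvPolynomial.comp_aeval]
  congr 2
  funext i
  have hx : x = ∑ j, x j • EuclideanSpace.single j (1 : ℝ) := by
    ext j; simp [Pi.single_apply]
  rw [affineEquiv_apply φ x]
  conv_rhs => rw [hx]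
  simp [mul_comm]

theorem polyComp_mem {n : ℕ} {q : MvPolynomial (Fin 3) ℝ} (hq : q ∈ Poly n) :
    polyComp φ q ∈ Poly n := by
  rw [MvPolynomial.as_sum q, polyComp, map_sum]
  refine Submodule.sum_mem _ fun m hm => ?_
  have hmn : ∑ i, m i ≤ n := mem_poly_iff.1 hq m (MvPolynomial.mem_support_iff.1 hm)
  rw [MvPolynomial.aeval_monomial, ← Algebra.smul_def]
  refine Submodule.smul_mem _ _ ?_
  rw [MvPolynomial.mem_restrictTotalDegree, Finsupp.prod_fintype _ _ (by simp)]
  refine (MvPolynomial.totalDegree_finsetProd _ _).trans (le_trans ?_ hmn)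
  refine Finset.sum_le_sum fun i _ => (MvPolynomial.totalDegree_pow _ _).trans ?_
  refine (Nat.mul_le_mul_left _ ?_).trans (mul_one _).le
  refine (MvPolynomial.totalDegree_add _ _).trans (max_le ?_ (by simp))
  refine MvPolynomial.totalDegree_finsetSum_le fun j _ => ?_
  refine (MvPolynomial.totalDegree_mul _ _).trans ?_
  simp

theorem pval_injective {p q : MvPolynomial (Fin 3) ℝ} (h : ∀ x ∈ interior refTet, pval p x = pval q x) :
    p = q := by
  refine MvPolynomial.funext_set (fun _ => Ioo (0 : ℝ) (1 / 4)) (fun _ => Ioo_infinite (by norm_num))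
    fun x hx => ?_
  exact h (WithLp.toLp 2 x) (box_subset_interior_refTet fun i => hx i (mem_univ i))

/-- The chain rule for polynomials under affine maps. -/
theorem pval_pderiv_polyComp (q : MvPolynomial (Fin 3) ℝ) (j : Fin 3) (x : E3) :
    pval (MvPolynomial.pderiv j (polyComp φ q)) x =
      ∑ i, φ.linear (EuclideanSpace.single j 1) i * pval (MvPolynomial.pderiv i q) (φ x) := by
  have h1 := (hasFDerivAt_pval q (φ x)).comp x (hasFDerivAt_affineEquiv φ x)
  have h2 : pval q ∘ φ = pval (polyComp φ q) := by funext y; simp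
  rw [h2] at h1
  have h3 := h1.unique (hasFDerivAt_pval (polyComp φ q) x)
  have h4 := congrArg (fun L => L (EuclideanSpace.single j 1)) h3
  simp at h4
  rw [← h4]
  exact Finset.sum_congr rfl fun i _ => mul_comm _ _

end Affine

theorem sq_integral_mul_le {μ : Measure E3} {f g : E3 → ℝ} (hf : MemLp f 2 μ) (hg : MemLp g 2 μ) :
    (∫ x, f x * g x ∂μ) ^ 2 ≤ (∫ x, f x ^ 2 ∂μ) * ∫ x, g x ^ 2 ∂μ := by
  have hf2 : Integrable (fun x => f x ^ 2) μ := hf.integrable_sq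
  have hg2 : Integrable (fun x => g x ^ 2) μ := hg.integrable_sq
  have hfg : Integrable (fun x => f x * g x) μ := hf.integrable_mul hg
  have h : ∀ t : ℝ, 0 ≤ (∫ x, f x ^ 2 ∂μ) * (t * t) + (2 * ∫ x, f x * g x ∂μ) * t +
      ∫ x, g x ^ 2 ∂μ := by
    intro t
    have h0 : 0 ≤ ∫ x, (f x * t + g x) ^ 2 ∂μ := integral_nonneg fun x => sq_nonneg _
    have h1 : ∀ x, (f x * t + g x) ^ 2 = (t * t) * f x ^ 2 + (2 * t) * (f x * g x) + g x ^ 2 :=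
      fun x => by ring
    simp only [h1] at h0
    rw [integral_add (by exact (hf2.const_mul _).add (hfg.const_mul _)) hg2,
      integral_add (hf2.const_mul _) (hfg.const_mul _), integral_const_mul, integral_const_mul] at h0
    linarith
  have := discrim_le_zero h
  rw [discrim] at this
  nlinarith

/-! ### Finite-dimensional estimates on the reference tetrahedron -/

/-- The inclusion of kernels lets `T` factor through the joint map `ℓ` into the finite-dimensional
space of functions on `ι`. Expanding in unit vectors and using Cauchy–Schwarz gives the bound. This
replaces equivalence of norms and does not need `V` to be finite-dimensional. -/
theorem exists_bound_of_ker_le {V : Type*} [AddCommGroup V] [Module ℝ V] {ι : Type*} [Fintype ι]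
    (ℓ : ι → V →ₗ[ℝ] ℝ) (T : V →ₗ[ℝ] MvPolynomial (Fin 3) ℝ)
    (h : ∀ q, (∀ j, ℓ j q = 0) → T q = 0) :
    ∃ C : ℝ, 0 < C ∧ ∀ q, ∀ y ∈ refTet, pval (T q) y ^ 2 ≤ C * ∑ j, ℓ j q ^ 2 := by
  classical
  set L : V →ₗ[ℝ] (ι → ℝ) := LinearMap.pi ℓ with hL
  have hker : L.ker ≤ T.ker := fun q hq => by
    rw [LinearMap.mem_ker] at hq ⊢
    exact h q fun j => congrFun hq j
  obtain ⟨M, hM⟩ := LinearMap.exists_extend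
    (((L.ker).liftQ T hker).comp (L.quotKerEquivRange.symm : L.range →ₗ[ℝ] V ⧸ L.ker))
  have hTM : ∀ q, T q = M (L q) := by
    intro q
    have := congrArg (fun F => F ⟨L q, LinearMap.mem_range_self L q⟩) hM
    simp only [LinearMap.comp_apply, Submodule.subtype_apply, LinearEquiv.coe_coe] at this
    rw [this]
    have h2 : L.quotKerEquivRange.symm ⟨L q, LinearMap.mem_range_self L q⟩ =
        Submodule.Quotient.mk q := by
      rw [LinearEquiv.symm_apply_eq]
      rfl
    rw [h2]
    rfl
  have hb : ∀ j, ∃ C, ∀ y ∈ refTet, ‖pval (M (Pi.single j 1)) y‖ ≤ C := fun j =>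
    isCompact_refTet.exists_bound_of_continuousOn (continuous_pval _).continuousOn
  choose C hC using hb
  have hC0 : ∀ j, 0 ≤ C j := fun j => (norm_nonneg _).trans (hC j 0 zero_mem_refTet)
  have hCs : 0 ≤ ∑ j, C j ^ 2 := Finset.sum_nonneg fun j _ => sq_nonneg _
  refine ⟨∑ j, C j ^ 2 + 1, by linarith, fun q y hy => ?_⟩
  have hexp : T q = ∑ j, ℓ j q • M (Pi.single j 1) := by
    rw [hTM, ← LinearMap.sum_single_apply (fun _ => ℝ) (L q)]
    simp only [map_sum]
    refine Finset.sum_congr rfl fun j _ => ?_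
    rw [← map_smul]
    congr 1
    ext i; simp [hL, Pi.single_apply]
  rw [hexp, pval_sum]
  calc (∑ j, pval (ℓ j q • M (Pi.single j 1)) y) ^ 2
      = (∑ j, pval (M (Pi.single j 1)) y * ℓ j q) ^ 2 := by
        congr 1; exact Finset.sum_congr rfl fun j _ => by rw [pval_smul, mul_comm]
    _ ≤ (∑ j, pval (M (Pi.single j 1)) y ^ 2) * ∑ j, ℓ j q ^ 2 :=
        Finset.sum_mul_sq_le_sq_mul_sq _ _ _
    _ ≤ _ := by
        refine mul_le_mul_of_nonneg_right ?_ (Finset.sum_nonneg fun j _ => sq_nonneg _)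
        have : ∑ j, pval (M (Pi.single j 1)) y ^ 2 ≤ ∑ j, C j ^ 2 :=
          Finset.sum_le_sum fun j _ => by
            rw [← sq_abs]; exact pow_le_pow_left₀ (abs_nonneg _) (hC j y hy) 2
        linarith

/-- The functionals are the moments against monomials. If all of them vanish then `∫ q ^ 2 = 0`,
hence `q = 0`; conversely each moment is bounded by the `L²` norm. -/
theorem exists_inverse_estimate (N : ℕ) : ∃ C : ℝ, 0 < C ∧ ∀ q ∈ Poly N, ∀ y ∈ refTet,
    pval q y ^ 2 ≤ C * ∫ x in refTet, pval q x ^ 2 := by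
  have hi : ∀ q, IntegrableOn (pval q) refTet := integrableOn_pval isBounded_refTet
  set e : (Fin 3 → ℕ) → (Fin 3 →₀ ℕ) := fun α => Finsupp.equivFunOnFinite.symm α with he
  set b : multiIndices N → MvPolynomial (Fin 3) ℝ := fun α => MvPolynomial.monomial (e α) 1 with hb
  let ℓ : multiIndices N → (Poly N) →ₗ[ℝ] ℝ := fun α =>
    { toFun := fun q => ∫ x in refTet, pval (b α * q) x
      map_add' := fun p q => by
        rw [← integral_add (hi _) (hi _)]
        simp [mul_add]
      map_smul' := fun a q => by
        rw [RingHom.id_apply, smul_eq_mul, ← integral_const_mul]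
        congr 1; funext x; simp }
  have hker : ∀ q : Poly N, (∀ α, ℓ α q = 0) → (Poly N).subtype q = 0 := by
    rintro ⟨q, hq⟩ hz
    have hexp : q = ∑ α : multiIndices N, q.coeff (e α) • b α := by
      rw [Finset.sum_coe_sort (multiIndices N) fun α =>
        q.coeff (e α) • (MvPolynomial.monomial (e α) (1 : ℝ))]
      ext m
      rw [MvPolynomial.coeff_sum]
      simp only [MvPolynomial.coeff_smul, MvPolynomial.coeff_monomial, smul_eq_mul, mul_ite, mul_one,
        mul_zero]
      by_cases hm : q.coeff m = 0
      · rw [hm, eq_comm]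
        refine Finset.sum_eq_zero fun α _ => ?_
        split_ifs with h
        · rw [h, hm]
        · rfl
      · have hme : m = e (Finsupp.equivFunOnFinite m) := by simp [he]
        rw [Finset.sum_eq_single (Finsupp.equivFunOnFinite m)]
        · rw [← hme]; simp
        · intro α _ hα
          rw [if_neg]
          intro h
          apply hα
          rw [← h]; simp [he]
        · intro h
          exact absurd (mem_multiIndices.2 (by simpa using mem_poly_iff.1 hq m hm)) h
    have hzero : ∫ x in refTet, pval q x ^ 2 = 0 := by
      have h1 : ∀ x, pval q x ^ 2 = ∑ α : multiIndices N, q.coeff (e α) * pval (b α * q) x := by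
        intro x
        conv_lhs => rw [sq]; lhs; rw [hexp]
        rw [pval_sum, Finset.sum_mul]
        refine Finset.sum_congr rfl fun α _ => ?_
        simp; ring
      simp only [h1]
      rw [integral_finsetSum _ fun α _ => (hi _).const_mul _]
      refine Finset.sum_eq_zero fun α _ => ?_
      rw [integral_const_mul]
      have := hz α
      simp only [ℓ, LinearMap.coe_mk, AddHom.coe_mk] at this
      rw [this, mul_zero]
    have hq2 : IntegrableOn (fun x => pval q x ^ 2) refTet := by
      have h2 : (fun x => pval q x ^ 2) = pval (q * q) := by funext x; simp [sq]
      rw [h2]; exact hi _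
    have hae := (integral_eq_zero_iff_of_nonneg (fun x => sq_nonneg _) hq2).1 hzero
    have hon : ∀ x ∈ interior refTet, pval q x = pval 0 x := by
      have h1 : (fun x => pval q x) =ᵐ[volume.restrict (interior refTet)] fun x => pval 0 x := by
        refine ae_restrict_of_ae_restrict_of_subset interior_subset ?_
        filter_upwards [hae] with x hx
        simpa using hx
      exact Measure.eqOn_open_of_ae_eq h1 isOpen_interior (continuous_pval q).continuousOn
        (continuous_pval 0).continuousOn
    exact pval_injective hon
  obtain ⟨C, hC, hbound⟩ := exists_bound_of_ker_le ℓ (Poly N).subtype hker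
  set A : ℝ := ∑ α : multiIndices N, ∫ x in refTet, pval (b α) x ^ 2 with hA
  have hA0 : 0 ≤ A := Finset.sum_nonneg fun α _ => integral_nonneg fun x => sq_nonneg _
  refine ⟨C * A + 1, by positivity, fun q hq y hy => ?_⟩
  have h1 := hbound ⟨q, hq⟩ y hy
  have hI : 0 ≤ ∫ x in refTet, pval q x ^ 2 := integral_nonneg fun x => sq_nonneg _
  have hcs : ∀ α, (ℓ α ⟨q, hq⟩) ^ 2 ≤
      (∫ x in refTet, pval (b α) x ^ 2) * ∫ x in refTet, pval q x ^ 2 := by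
    intro α
    have := sq_integral_mul_le
      (memLp_of_continuous isBounded_refTet (continuous_pval (b α)))
      (memLp_of_continuous isBounded_refTet (continuous_pval q))
    simpa [ℓ] using this
  calc pval q y ^ 2 ≤ C * ∑ α, ℓ α ⟨q, hq⟩ ^ 2 := h1
    _ ≤ C * (A * ∫ x in refTet, pval q x ^ 2) := by
        gcongr
        rw [hA, Finset.sum_mul]
        exact Finset.sum_le_sum fun α _ => hcs α
    _ ≤ _ := by nlinarith

/-! ### Bounds for the element space on the reference tetrahedron -/

/-- Evaluation of polynomials as a linear map. -/
def evalAt (x : E3) : MvPolynomial (Fin 3) ℝ →ₗ[ℝ] ℝ where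
  toFun q := pval q x
  map_add' p q := by simp
  map_smul' a q := by simp

@[simp] theorem evalAt_apply (x : E3) (q : MvPolynomial (Fin 3) ℝ) : evalAt x q = pval q x := rfl

/-- The partial derivative of polynomials as a linear map. -/
def pderivLin (i : Fin 3) : MvPolynomial (Fin 3) ℝ →ₗ[ℝ] MvPolynomial (Fin 3) ℝ :=
  (MvPolynomial.pderiv (R := ℝ) i : MvPolynomial (Fin 3) ℝ →ₗ[ℝ] MvPolynomial (Fin 3) ℝ)

@[simp] theorem pderivLin_apply (i : Fin 3) (q : MvPolynomial (Fin 3) ℝ) :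
    pderivLin i q = MvPolynomial.pderiv i q := rfl

section Reference

variable {R : RefElement} {p : ℕ} (hR : R.Conditions p)

include hR

theorem RefElement.Conditions.eq_zero {q : MvPolynomial (Fin 3) ℝ} (hq : q ∈ R.U)
    (h : ∀ x ∈ R.Q, pval q x = 0) : q = 0 := by
  have h1 : (⟨q, hq⟩ : R.U) = 0 := hR.c1.1 (by funext x; simpa using h x x.2)
  exact congrArg Subtype.val h1

theorem RefElement.Conditions.exists_interp (f : E3 → ℝ) :
    ∃ q ∈ R.U, ∀ x ∈ R.Q, pval q x = f x := by
  obtain ⟨q, hq⟩ := hR.c1.2 fun x => f x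
  exact ⟨q, q.2, fun x hx => congrFun hq ⟨x, hx⟩⟩

theorem RefElement.Conditions.exists_le_poly : ∃ N, R.U ≤ Poly N := by
  let L : R.U →ₗ[ℝ] (R.Q → ℝ) := LinearMap.pi fun x => (evalAt x).comp R.U.subtype
  have hL : Function.Injective L := hR.c1.1
  have : Module.Finite ℝ R.U := Module.Finite.of_injective L hL
  obtain ⟨s, hs⟩ := (Submodule.fg_iff_finiteDimensional R.U).2 this
  refine ⟨s.sup MvPolynomial.totalDegree, ?_⟩
  rw [← hs, Submodule.span_le]
  intro q hq
  exact (MvPolynomial.mem_restrictTotalDegree _ _ _).2 (Finset.le_sup (f := MvPolynomial.totalDegree) hq)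

/-- By C1 the nodal values determine an element of `U`, so they control its derivatives. -/
theorem RefElement.Conditions.exists_nodal_bound : ∃ C : ℝ, 0 < C ∧ ∀ q ∈ R.U, ∀ i, ∀ y ∈ refTet,
    pval (MvPolynomial.pderiv i q) y ^ 2 ≤ C * ∑ x ∈ R.Q, pval q x ^ 2 := by
  have h : ∀ i, ∃ C : ℝ, 0 < C ∧ ∀ q : R.U, ∀ y ∈ refTet,
      pval (((pderivLin i).comp R.U.subtype) q) y ^ 2 ≤ C * ∑ x : R.Q, ((evalAt x).comp R.U.subtype q) ^ 2 :=
    fun i => exists_bound_of_ker_le (fun x : R.Q => (evalAt x).comp R.U.subtype) _ fun q hq => by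
      have : (q : MvPolynomial (Fin 3) ℝ) = 0 := hR.eq_zero q.2 fun x hx => hq ⟨x, hx⟩
      simp [this]
  choose C hC0 hC using h
  refine ⟨∑ i, C i, Finset.sum_pos (fun i _ => hC0 i) Finset.univ_nonempty, fun q hq i y hy => ?_⟩
  have h1 := hC i ⟨q, hq⟩ y hy
  simp only [LinearMap.comp_apply, Submodule.subtype_apply, evalAt_apply, pderivLin_apply] at h1
  rw [Finset.sum_coe_sort R.Q fun x => pval q x ^ 2] at h1
  refine h1.trans (mul_le_mul_of_nonneg_right ?_ (Finset.sum_nonneg fun _ _ => sq_nonneg _))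
  exact Finset.single_le_sum (fun i _ => (hC0 i).le) (Finset.mem_univ i)

/-- By C7 the gradients at the stiffness points determine an element of `U` up to a constant, so
they control its gradient everywhere and, once the value at the origin is subtracted, the function
itself. -/
theorem RefElement.Conditions.exists_gradient_bound : ∃ C : ℝ, 0 < C ∧ ∀ q ∈ R.U, ∀ y ∈ refTet,
    (pval q y - pval q 0) ^ 2 ≤
        C * ∑ x ∈ R.Q', ∑ j, pval (MvPolynomial.pderiv j q) x ^ 2 ∧
      ∀ i, pval (MvPolynomial.pderiv i q) y ^ 2 ≤
        C * ∑ x ∈ R.Q', ∑ j, pval (MvPolynomial.pderiv j q) x ^ 2 := by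
  let ℓ : R.Q' × Fin 3 → R.U →ₗ[ℝ] ℝ := fun a =>
    (evalAt a.1).comp ((pderivLin a.2).comp R.U.subtype)
  have hker : ∀ q : R.U, (∀ a, ℓ a q = 0) → ∃ a, (q : MvPolynomial (Fin 3) ℝ) = MvPolynomial.C a :=
    fun q hq => hR.c7 q q.2 fun x hx i => hq (⟨x, hx⟩, i)
  have hsum : ∀ q : R.U, ∑ a, ℓ a q ^ 2 =
      ∑ x ∈ R.Q', ∑ j, pval (MvPolynomial.pderiv j (q : MvPolynomial (Fin 3) ℝ)) x ^ 2 := by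
    intro q
    rw [Fintype.sum_prod_type, ← Finset.sum_coe_sort R.Q' fun x =>
      ∑ j, pval (MvPolynomial.pderiv j (q : MvPolynomial (Fin 3) ℝ)) x ^ 2]
    rfl
  have h : ∀ i, ∃ C : ℝ, 0 < C ∧ ∀ q : R.U, ∀ y ∈ refTet,
      pval (((pderivLin i).comp R.U.subtype) q) y ^ 2 ≤ C * ∑ a, ℓ a q ^ 2 :=
    fun i => exists_bound_of_ker_le ℓ _ fun q hq => by
      obtain ⟨a, ha⟩ := hker q hq
      simp [ha]
  let T : R.U →ₗ[ℝ] MvPolynomial (Fin 3) ℝ :=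
    R.U.subtype - (Algebra.linearMap ℝ (MvPolynomial (Fin 3) ℝ)).comp ((evalAt 0).comp R.U.subtype)
  have hT : ∀ (q : R.U) y, pval (T q) y = pval q y - pval q 0 := by
    intro q y
    simp only [T, LinearMap.sub_apply, LinearMap.comp_apply, Submodule.subtype_apply, evalAt_apply,
      Algebra.linearMap_apply, pval_sub, MvPolynomial.algebraMap_eq, pval_C]
  obtain ⟨C0, hC00, hC0⟩ := exists_bound_of_ker_le ℓ T fun q hq => by
    obtain ⟨a, ha⟩ := hker q hq
    refine pval_injective fun y _ => ?_
    rw [hT, ha]; simp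
  choose C hC0' hC using h
  have hCs : 0 < ∑ i, C i := Finset.sum_pos (fun i _ => hC0' i) Finset.univ_nonempty
  refine ⟨C0 + ∑ i, C i, by positivity, fun q hq y hy => ?_⟩
  have hnn : 0 ≤ ∑ x ∈ R.Q', ∑ j, pval (MvPolynomial.pderiv j q) x ^ 2 :=
    Finset.sum_nonneg fun _ _ => Finset.sum_nonneg fun _ _ => sq_nonneg _
  constructor
  · have h1 := hC0 ⟨q, hq⟩ y hy
    rw [hsum, hT] at h1
    exact h1.trans (mul_le_mul_of_nonneg_right (by linarith) hnn)
  · intro i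
    have h1 := hC i ⟨q, hq⟩ y hy
    rw [hsum] at h1
    refine h1.trans (mul_le_mul_of_nonneg_right ?_ hnn)
    have := Finset.single_le_sum (fun i _ => (hC0' i).le) (Finset.mem_univ i)
    linarith

end Reference

/-! ### Bounds on physical elements -/

/-- The ratio of the volumes of an affine image of the reference tetrahedron and the latter. -/
def jac (φ : E3 ≃ᵃ[ℝ] E3) : ℝ := volume.real (φ '' refTet) / volume.real refTet

theorem jac_pos (φ : E3 ≃ᵃ[ℝ] E3) : 0 < jac φ :=
  div_pos (ENNReal.toReal_pos ((isOpen_interior.measure_pos volume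
    (interior_image_refTet_nonempty φ)).trans_le (measure_mono interior_subset)).ne'
      (isCompact_image_refTet φ).measure_lt_top.ne) volume_refTet_pos

theorem integral_image_refTet (φ : E3 ≃ᵃ[ℝ] E3) (f : E3 → ℝ) :
    ∫ x in φ '' refTet, f x = jac φ * ∫ x in refTet, f (φ x) := setIntegral_image_refTet φ f

theorem integral_le_of_forall_jac_mul_le (φ : E3 ≃ᵃ[ℝ] E3) {f : E3 → ℝ} (hf : Continuous f) {X : ℝ}
    (h : ∀ x ∈ refTet, jac φ * f (φ x) ≤ X) :
    ∫ x in φ '' refTet, f x ≤ volume.real refTet * X := by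
  rw [integral_image_refTet, ← integral_const_mul]
  have h1 : IntegrableOn (fun x => jac φ * f (φ x)) refTet :=
    (continuous_const.mul (hf.comp (continuous_affineEquiv φ))).continuousOn.integrableOn_compact
      isCompact_refTet
  have h2 : IntegrableOn (fun _ : E3 => X) refTet :=
    continuousOn_const.integrableOn_compact isCompact_refTet
  refine (setIntegral_mono_on h1 h2 isClosed_refTet.measurableSet h).trans_eq ?_
  simp

/-- Quantitative nondegeneracy of an affine image of the reference tetrahedron: diameter at most
`D` and inverse Jacobian matrix of size at most `γ / D`. -/
structure ShapeBound (φ : E3 ≃ᵃ[ℝ] E3) (γ D : ℝ) : Prop where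
  pos : 0 < D
  dist_le : ∀ x ∈ φ '' refTet, ∀ y ∈ φ '' refTet, dist x y ≤ D
  inv_le : ∀ i j, |φ.symm.linear (EuclideanSpace.single j 1) i| ≤ γ / D

theorem ShapeBound.linear_le {φ : E3 ≃ᵃ[ℝ] E3} {γ D : ℝ} (h : ShapeBound φ γ D) (i j : Fin 3) :
    |φ.linear (EuclideanSpace.single j 1) i| ≤ D := by
  have h1 := h.dist_le _ (mem_image_of_mem φ (single_mem_refTet j)) _
    (mem_image_of_mem φ zero_mem_refTet)
  rw [affineEquiv_apply φ (EuclideanSpace.single j 1), dist_eq_norm, add_sub_cancel_right] at h1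
  exact (PiLp.norm_apply_le _ i).trans h1

/-- The inverse map takes a segment of length `ρ` in the inscribed ball to a vector between two
points of the reference tetrahedron, whose components are at most one in size. The entries of the
inverse matrix are therefore at most `1 / ρ`, and shape regularity bounds this by `γ` over the
diameter. -/
theorem shapeBound_of_ball {φ : E3 ≃ᵃ[ℝ] E3} {γ ρ : ℝ} {z : E3} (hρ : 0 < ρ)
    (hb : Metric.closedBall z ρ ⊆ φ '' refTet) (hd : Metric.diam (φ '' refTet) ≤ γ * ρ) :
    ShapeBound φ γ (Metric.diam (φ '' refTet)) := by
  have hbd := (isCompact_image_refTet φ).isBounded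
  have hdist : ∀ x ∈ φ '' refTet, ∀ y ∈ φ '' refTet, dist x y ≤ Metric.diam (φ '' refTet) :=
    fun x hx y hy => Metric.dist_le_diam_of_mem hbd hx hy
  have hnorm : ∀ j : Fin 3, ‖ρ • (EuclideanSpace.single j (1 : ℝ) : E3)‖ = ρ := fun j => by
    simp [norm_smul, abs_of_pos hρ]
  have hz : z ∈ φ '' refTet := hb (by simp [hρ.le])
  have hzj : ∀ j : Fin 3, z + ρ • EuclideanSpace.single j (1 : ℝ) ∈ φ '' refTet := fun j =>
    hb (by simp [norm_smul, abs_of_pos hρ])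
  have hpos : 0 < Metric.diam (φ '' refTet) := by
    refine lt_of_lt_of_le hρ ?_
    have := hdist _ (hzj 0) _ hz
    rwa [dist_eq_norm, add_sub_cancel_left, hnorm] at this
  refine ⟨hpos, hdist, fun i j => ?_⟩
  obtain ⟨a, ha, hza⟩ := hz
  obtain ⟨b, hb', hzb⟩ := hzj j
  have hab : ρ • φ.symm.linear (EuclideanSpace.single j 1) = b - a := by
    have h1 : φ.symm (z + ρ • EuclideanSpace.single j (1 : ℝ)) = b := by rw [← hzb]; simp
    have h2 : φ.symm z = a := by rw [← hza]; simp
    rw [affineEquiv_apply] at h1 h2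
    rw [← h1, ← h2, map_add, map_smul]
    abel
  have h1 := abs_sub_le_of_mem_refTet hb' ha i
  have h2 : ρ * φ.symm.linear (EuclideanSpace.single j 1) i = b i - a i := by
    have := congrArg (fun v : E3 => v i) hab
    simpa using this
  rw [← h2, abs_mul, abs_of_pos hρ] at h1
  rw [le_div_iff₀ hpos]
  calc _ ≤ |φ.symm.linear (EuclideanSpace.single j 1) i| * (γ * ρ) := by gcongr
    _ = γ * (ρ * |φ.symm.linear (EuclideanSpace.single j 1) i|) := by ring
    _ ≤ γ * 1 := by
        refine mul_le_mul_of_nonneg_left h1 ?_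
        have := hpos.trans_le hd
        exact ((mul_pos_iff_of_pos_right hρ).1 this).le
    _ = γ := mul_one _

theorem polyComp_symm_polyComp (φ : E3 ≃ᵃ[ℝ] E3) (P : MvPolynomial (Fin 3) ℝ) :
    polyComp φ.symm (polyComp φ P) = P := pval_injective fun x _ => by simp

theorem polyComp_polyComp_symm (φ : E3 ≃ᵃ[ℝ] E3) (P : MvPolynomial (Fin 3) ℝ) :
    polyComp φ (polyComp φ.symm P) = P := pval_injective fun x _ => by simp

theorem polyComp_sub (φ : E3 ≃ᵃ[ℝ] E3) (P P' : MvPolynomial (Fin 3) ℝ) :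
    polyComp φ (P - P') = polyComp φ P - polyComp φ P' := by simp [polyComp]

theorem sq_sum_mul_le {a b : Fin 3 → ℝ} {K : ℝ} (ha : ∀ i, |a i| ≤ K) :
    (∑ i, a i * b i) ^ 2 ≤ 3 * K ^ 2 * ∑ i, b i ^ 2 := by
  refine (Finset.sum_mul_sq_le_sq_mul_sq _ _ _).trans
    (mul_le_mul_of_nonneg_right ?_ (Finset.sum_nonneg fun _ _ => sq_nonneg _))
  refine (Finset.sum_le_sum fun i _ => ?_ : _ ≤ ∑ i : Fin 3, K ^ 2).trans_eq (by simp)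
  rw [← sq_abs]; exact pow_le_pow_left₀ (abs_nonneg _) (ha i) 2

section Physical

variable {φ : E3 ≃ᵃ[ℝ] E3} {γ D : ℝ} (hs : ShapeBound φ γ D)

include hs

theorem ShapeBound.pderiv_polyComp_sq_le (P : MvPolynomial (Fin 3) ℝ) (j : Fin 3) (x : E3) :
    pval (MvPolynomial.pderiv j (polyComp φ P)) x ^ 2 ≤
      3 * D ^ 2 * ∑ i, pval (MvPolynomial.pderiv i P) (φ x) ^ 2 := by
  rw [pval_pderiv_polyComp]
  exact sq_sum_mul_le fun i => hs.linear_le i j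

theorem ShapeBound.pderiv_sq_le (P : MvPolynomial (Fin 3) ℝ) (i : Fin 3) (x : E3) :
    pval (MvPolynomial.pderiv i P) (φ x) ^ 2 ≤
      3 * (γ / D) ^ 2 * ∑ j, pval (MvPolynomial.pderiv j (polyComp φ P)) x ^ 2 := by
  have h := pval_pderiv_polyComp φ.symm (polyComp φ P) i (φ x)
  rw [polyComp_symm_polyComp] at h
  rw [h]
  simp only [AffineEquiv.symm_apply_apply]
  exact sq_sum_mul_le fun j => hs.inv_le j i

end Physical

/-- The sum of the squares of the gradient of a polynomial at the points of the stiffness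
quadrature. -/
def gradSum (R : RefElement) (φ : E3 ≃ᵃ[ℝ] E3) (P : MvPolynomial (Fin 3) ℝ) : ℝ :=
  ∑ x ∈ R.Q', ∑ i, pval (MvPolynomial.pderiv i P) (φ x) ^ 2

theorem gradSum_nonneg (R : RefElement) (φ : E3 ≃ᵃ[ℝ] E3) (P : MvPolynomial (Fin 3) ℝ) :
    0 ≤ gradSum R φ P := Finset.sum_nonneg fun _ _ => Finset.sum_nonneg fun _ _ => sq_nonneg _

section PhysicalBounds

variable {R : RefElement} {p : ℕ} (hR : R.Conditions p) (γ : ℝ)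

include hR

/-- Pulling gradients back costs a factor `D` and pushing them forward a factor `γ / D`. For
gradients the powers of `D` cancel, and for function values one factor `D` survives; this is the
order gained by subtracting a constant. -/
theorem exists_physical_gradient_bound : ∃ C : ℝ, 0 < C ∧ ∀ (φ : E3 ≃ᵃ[ℝ] E3) (D : ℝ),
    ShapeBound φ γ D → ∀ P, polyComp φ P ∈ R.U → ∀ y ∈ refTet,
    (pval P (φ y) - pval P (φ 0)) ^ 2 ≤ C * D ^ 2 * gradSum R φ P ∧
      ∀ i, pval (MvPolynomial.pderiv i P) (φ y) ^ 2 ≤ C * gradSum R φ P := by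
  obtain ⟨C, hC, h⟩ := hR.exists_gradient_bound
  refine ⟨9 * C + 81 * γ ^ 2 * C, by positivity, fun φ D hs P hP y hy => ?_⟩
  have hD := hs.pos
  have hsum : ∑ x ∈ R.Q', ∑ j, pval (MvPolynomial.pderiv j (polyComp φ P)) x ^ 2 ≤
      9 * D ^ 2 * gradSum R φ P := by
    rw [gradSum, Finset.mul_sum]
    refine Finset.sum_le_sum fun x _ => ?_
    refine (Finset.sum_le_sum fun j _ => hs.pderiv_polyComp_sq_le P j x).trans_eq ?_
    simp; ring
  have hg := gradSum_nonneg R φ P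
  obtain ⟨h1, h2⟩ := h _ hP y hy
  simp only [pval_polyComp] at h1
  constructor
  · refine h1.trans ((mul_le_mul_of_nonneg_left hsum hC.le).trans ?_)
    have : 0 ≤ 81 * γ ^ 2 * C * D ^ 2 * gradSum R φ P := by positivity
    linarith
  · intro i
    refine (hs.pderiv_sq_le P i y).trans ?_
    have h3 : ∑ j, pval (MvPolynomial.pderiv j (polyComp φ P)) y ^ 2 ≤
        3 * (C * (9 * D ^ 2 * gradSum R φ P)) := by
      refine (Finset.sum_le_sum fun j _ =>
        (h2 j).trans (mul_le_mul_of_nonneg_left hsum hC.le)).trans_eq ?_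
      simp
    refine (mul_le_mul_of_nonneg_left h3 (by positivity)).trans ?_
    have h4 : 3 * (γ / D) ^ 2 * (3 * (C * (9 * D ^ 2 * gradSum R φ P))) =
        81 * γ ^ 2 * C * gradSum R φ P := by field_simp; ring
    rw [h4]
    have : 0 ≤ 9 * C * gradSum R φ P := by positivity
    linarith

theorem exists_physical_nodal_bound : ∃ C : ℝ, 0 < C ∧ ∀ (φ : E3 ≃ᵃ[ℝ] E3) (D : ℝ),
    ShapeBound φ γ D → ∀ P, polyComp φ P ∈ R.U → ∀ y ∈ refTet, ∀ i,
      D ^ 2 * pval (MvPolynomial.pderiv i P) (φ y) ^ 2 ≤ C * ∑ x ∈ R.Q, pval P (φ x) ^ 2 := by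
  obtain ⟨C, hC, h⟩ := hR.exists_nodal_bound
  refine ⟨9 * γ ^ 2 * C + 1, by positivity, fun φ D hs P hP y hy i => ?_⟩
  have hD := hs.pos
  have h1 : ∑ j, pval (MvPolynomial.pderiv j (polyComp φ P)) y ^ 2 ≤
      3 * (C * ∑ x ∈ R.Q, pval P (φ x) ^ 2) := by
    refine (Finset.sum_le_sum fun j _ => h _ hP j y hy).trans_eq ?_
    simp
  have h2 := (hs.pderiv_sq_le P i y).trans (mul_le_mul_of_nonneg_left h1 (by positivity))
  have hnn : 0 ≤ ∑ x ∈ R.Q, pval P (φ x) ^ 2 := Finset.sum_nonneg fun _ _ => sq_nonneg _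
  calc D ^ 2 * pval (MvPolynomial.pderiv i P) (φ y) ^ 2
      ≤ D ^ 2 * (3 * (γ / D) ^ 2 * (3 * (C * ∑ x ∈ R.Q, pval P (φ x) ^ 2))) := by gcongr
    _ = 9 * γ ^ 2 * C * ∑ x ∈ R.Q, pval P (φ x) ^ 2 := by field_simp; ring
    _ ≤ _ := by linarith

end PhysicalBounds

theorem exists_physical_inverse_estimate (N : ℕ) : ∃ C : ℝ, 0 < C ∧ ∀ (φ : E3 ≃ᵃ[ℝ] E3),
    ∀ P ∈ Poly N, ∀ y ∈ refTet, jac φ * pval P (φ y) ^ 2 ≤ C * ∫ x in φ '' refTet, pval P x ^ 2 := by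
  obtain ⟨C, hC, h⟩ := exists_inverse_estimate N
  refine ⟨C, hC, fun φ P hP y hy => ?_⟩
  have h1 := h _ (polyComp_mem φ hP) y hy
  simp only [pval_polyComp] at h1
  rw [integral_image_refTet φ fun x => pval P x ^ 2]
  have := mul_le_mul_of_nonneg_left h1 (jac_pos φ).le
  linarith

/-! ### Quadrature errors on a single element -/

/-- The error of a quadrature rule on an affine image of the reference tetrahedron. -/
def quadErr (Q : Finset E3) (wt : E3 → ℝ) (φ : E3 ≃ᵃ[ℝ] E3) (f : E3 → ℝ) : ℝ :=
  (∫ x in φ '' refTet, f x) - ∑ x ∈ Q, jac φ * wt x * f (φ x)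

theorem quadErr_add (Q : Finset E3) (wt : E3 → ℝ) (φ : E3 ≃ᵃ[ℝ] E3) {f g : E3 → ℝ}
    (hf : IntegrableOn f (φ '' refTet)) (hg : IntegrableOn g (φ '' refTet)) :
    quadErr Q wt φ (fun x => f x + g x) = quadErr Q wt φ f + quadErr Q wt φ g := by
  unfold quadErr
  rw [integral_add hf hg]
  simp only [mul_add, Finset.sum_add_distrib]
  ring

theorem quadErr_sum (Q : Finset E3) (wt : E3 → ℝ) (φ : E3 ≃ᵃ[ℝ] E3) {ι : Type*} (s : Finset ι)
    {f : ι → E3 → ℝ} (hf : ∀ i ∈ s, IntegrableOn (f i) (φ '' refTet)) :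
    quadErr Q wt φ (fun x => ∑ i ∈ s, f i x) = ∑ i ∈ s, quadErr Q wt φ (f i) := by
  unfold quadErr
  rw [integral_finsetSum _ hf, Finset.sum_sub_distrib, Finset.sum_comm]
  simp only [Finset.mul_sum]

theorem abs_integral_mul_le {μ : Measure E3} {a b : E3 → ℝ} (ha : MemLp a 2 μ) (hb : MemLp b 2 μ)
    {A B M W : ℝ} (hA : 0 ≤ A) (hB : 0 ≤ B)
    (haI : ∫ x, a x ^ 2 ∂μ ≤ A ^ 2 * M) (hbI : ∫ x, b x ^ 2 ∂μ ≤ B ^ 2 * W) :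
    |∫ x, a x * b x ∂μ| ≤ A * B * (√M * √W) := by
  calc |∫ x, a x * b x ∂μ| ≤ √((∫ x, a x ^ 2 ∂μ) * ∫ x, b x ^ 2 ∂μ) :=
        Real.abs_le_sqrt (sq_integral_mul_le ha hb)
    _ = √(∫ x, a x ^ 2 ∂μ) * √(∫ x, b x ^ 2 ∂μ) :=
        Real.sqrt_mul (integral_nonneg fun _ => sq_nonneg _) _
    _ ≤ √(A ^ 2 * M) * √(B ^ 2 * W) := by gcongr
    _ = _ := by
        rw [Real.sqrt_mul (sq_nonneg _), Real.sqrt_mul (sq_nonneg _), Real.sqrt_sq hA,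
          Real.sqrt_sq hB]
        ring

theorem abs_sum_quad_le {Q : Finset E3} {wt : E3 → ℝ} (hwt : ∀ x ∈ Q, 0 < wt x)
    (φ : E3 ≃ᵃ[ℝ] E3) {a b : E3 → ℝ} {A B M W : ℝ} (hA : 0 ≤ A) (hB : 0 ≤ B)
    (haQ : ∀ x ∈ Q, jac φ * a (φ x) ^ 2 ≤ A ^ 2 * M)
    (hbQ : ∀ x ∈ Q, jac φ * b (φ x) ^ 2 ≤ B ^ 2 * W) :
    |∑ x ∈ Q, jac φ * wt x * (a (φ x) * b (φ x))| ≤ (∑ x ∈ Q, wt x) * (A * B * (√M * √W)) := by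
  rw [Finset.sum_mul]
  refine (Finset.abs_sum_le_sum_abs _ _).trans (Finset.sum_le_sum fun x hx => ?_)
  have hj := (jac_pos φ).le
  have h1 : jac φ * wt x * (a (φ x) * b (φ x)) =
      wt x * ((√(jac φ) * a (φ x)) * (√(jac φ) * b (φ x))) := by
    have := Real.mul_self_sqrt hj
    linear_combination (-(wt x * (a (φ x) * b (φ x)))) * this
  rw [h1, abs_mul, abs_of_pos (hwt x hx)]
  refine mul_le_mul_of_nonneg_left ?_ (hwt x hx).le
  have key : ∀ (f A M : ℝ), 0 ≤ A → jac φ * f ^ 2 ≤ A ^ 2 * M → |√(jac φ) * f| ≤ A * √M := by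
    intro f A M hA h
    have h2 : |√(jac φ) * f| ≤ √(A ^ 2 * M) := by
      refine Real.abs_le_sqrt ?_
      rw [mul_pow, Real.sq_sqrt hj]; exact h
    rwa [Real.sqrt_mul (sq_nonneg _), Real.sqrt_sq hA] at h2
  rw [abs_mul]
  calc _ ≤ (A * √M) * (B * √W) := by
        gcongr
        · exact key _ _ _ hA (haQ x hx)
        · exact key _ _ _ hB (hbQ x hx)
    _ = _ := by ring

theorem abs_quadErr_mul_le {Q : Finset E3} {wt : E3 → ℝ} (hwt : ∀ x ∈ Q, 0 < wt x)
    (φ : E3 ≃ᵃ[ℝ] E3) {a b : E3 → ℝ} (ha : MemLp a 2 (volume.restrict (φ '' refTet)))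
    (hb : MemLp b 2 (volume.restrict (φ '' refTet))) {A B M W : ℝ} (hA : 0 ≤ A) (hB : 0 ≤ B)
    (haI : ∫ x in φ '' refTet, a x ^ 2 ≤ A ^ 2 * M)
    (haQ : ∀ x ∈ Q, jac φ * a (φ x) ^ 2 ≤ A ^ 2 * M)
    (hbI : ∫ x in φ '' refTet, b x ^ 2 ≤ B ^ 2 * W)
    (hbQ : ∀ x ∈ Q, jac φ * b (φ x) ^ 2 ≤ B ^ 2 * W) :
    |quadErr Q wt φ fun x => a x * b x| ≤ (1 + ∑ x ∈ Q, wt x) * (A * B * (√M * √W)) := by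
  unfold quadErr
  refine (abs_sub _ _).trans ?_
  rw [add_mul, one_mul]
  exact add_le_add (abs_integral_mul_le ha hb hA hB haI hbI) (abs_sum_quad_le hwt φ hA hB haQ hbQ)

/-! ### Exactness of the quadrature rules on physical elements -/

section Exactness

variable {R : RefElement} {p : ℕ} (hR : R.Conditions p) (φ : E3 ≃ᵃ[ℝ] E3)

include hR

theorem quadErr_mass_eq_zero {P P' : MvPolynomial (Fin 3) ℝ} (hP : P ∈ Poly (p - 2))
    (hP' : polyComp φ P' ∈ R.U) : quadErr R.Q R.wt φ (fun x => pval P x * pval P' x) = 0 := by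
  have h := hR.c5 _ (polyComp_mem φ hP) _ hP'
  simp only [pval_mul, pval_polyComp] at h
  rw [quadErr, integral_image_refTet, h, Finset.mul_sum, sub_eq_zero]
  exact Finset.sum_congr rfl fun x _ => by ring

/-- A physical partial derivative is a combination, with constant coefficients, of the reference
ones, so C8 is needed for every reference direction at once. -/
theorem quadErr_stiff_eq_zero {P P' : MvPolynomial (Fin 3) ℝ} (hP : P ∈ Poly (p - 1))
    (hP' : polyComp φ P' ∈ R.U) (i : Fin 3) :
    quadErr R.Q' R.wt' φ (fun x => pval P x * pval (MvPolynomial.pderiv i P') x) = 0 := by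
  have hd : ∀ x, pval (MvPolynomial.pderiv i P') (φ x) =
      ∑ j, φ.symm.linear (EuclideanSpace.single i 1) j *
        pval (MvPolynomial.pderiv j (polyComp φ P')) x := fun x => by
    have h := pval_pderiv_polyComp φ.symm (polyComp φ P') i (φ x)
    rwa [polyComp_symm_polyComp, AffineEquiv.symm_apply_apply] at h
  have hc : ∀ x, pval P (φ x) * pval (MvPolynomial.pderiv i P') (φ x) =
      ∑ j, φ.symm.linear (EuclideanSpace.single i 1) j *
        pval (polyComp φ P * MvPolynomial.pderiv j (polyComp φ P')) x := fun x => by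
    rw [hd, Finset.mul_sum]
    refine Finset.sum_congr rfl fun j _ => ?_
    rw [pval_mul, pval_polyComp]; ring
  rw [quadErr, integral_image_refTet]
  simp only [hc]
  rw [integral_finsetSum _ fun j _ => (integrableOn_pval isBounded_refTet _).const_mul _]
  simp only [integral_const_mul]
  rw [Finset.sum_congr rfl fun j _ => by rw [hR.c8 _ (polyComp_mem φ hP) _ hP' j]]
  simp only [Finset.mul_sum]
  rw [Finset.sum_comm, sub_eq_zero]
  refine Finset.sum_congr rfl fun x _ => Finset.sum_congr rfl fun j _ => by ring

end Exactness

theorem restrict_interior_image (φ : E3 ≃ᵃ[ℝ] E3) :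
    volume.restrict (interior (φ '' refTet)) = volume.restrict (φ '' refTet) :=
  Measure.restrict_congr_set (interior_image_ae_eq φ)

/-- An element is the closure of its interior, so continuity extends almost everywhere bounds to
nodes on the element boundary. -/
theorem forall_of_ae_interior (φ : E3 ≃ᵃ[ℝ] E3) {f g : E3 → ℝ} (hf : ContinuousOn f (φ '' refTet))
    (hg : ContinuousOn g (φ '' refTet))
    (h : ∀ᵐ x ∂volume.restrict (interior (φ '' refTet)), f x ≤ g x) :
    ∀ x ∈ φ '' refTet, f x ≤ g x := by
  have h1 : EqOn (fun x => max (f x - g x) 0) (fun _ => 0) (interior (φ '' refTet)) := by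
    refine Measure.eqOn_open_of_ae_eq (μ := volume) ?_ isOpen_interior
      (((hf.sub hg).sup continuousOn_const).mono interior_subset) continuousOn_const
    filter_upwards [h] with x hx
    simpa using hx
  have h2 : EqOn (fun x => max (f x - g x) 0) (fun _ => 0) (φ '' refTet) := by
    refine h1.of_subset_closure ((hf.sub hg).sup continuousOn_const) continuousOn_const
      interior_subset ?_
    rw [closure_interior_image_refTet]
  intro x hx
  have := h2 hx
  simp only [max_eq_right_iff, sub_nonpos] at this
  exact this

theorem memLp_of_continuousOn (φ : E3 ≃ᵃ[ℝ] E3) {f : E3 → ℝ} (hf : ContinuousOn f (φ '' refTet)) :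
    MemLp f 2 (volume.restrict (φ '' refTet)) := by
  have hc := isCompact_image_refTet φ
  have : IsFiniteMeasure (volume.restrict (φ '' refTet)) := ⟨by simpa using hc.measure_lt_top⟩
  obtain ⟨C, hC⟩ := hc.exists_bound_of_continuousOn hf
  exact MemLp.of_bound (hf.aestronglyMeasurable hc.isClosed.measurableSet) C
    (ae_restrict_of_forall_mem hc.isClosed.measurableSet hC)

theorem memLp_pval (φ : E3 ≃ᵃ[ℝ] E3) (q : MvPolynomial (Fin 3) ℝ) :
    MemLp (pval q) 2 (volume.restrict (φ '' refTet)) :=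
  memLp_of_continuousOn φ (continuous_pval q).continuousOn

/-- The sum of the squared `L²`-norms of the derivatives of order at most `k` on an element. -/
def localSq (φ : E3 ≃ᵃ[ℝ] E3) (k : ℕ) (w : (Fin 3 → ℕ) → E3 → ℝ) : ℝ :=
  ∑ α ∈ multiIndices k, ∫ x in φ '' refTet, w α x ^ 2

theorem localSq_nonneg (φ : E3 ≃ᵃ[ℝ] E3) (k : ℕ) (w : (Fin 3 → ℕ) → E3 → ℝ) :
    0 ≤ localSq φ k w := Finset.sum_nonneg fun _ _ => integral_nonneg fun _ => sq_nonneg _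

section LocalApprox

variable {φ : E3 ≃ᵃ[ℝ] E3} {γ D : ℝ} (hs : ShapeBound φ γ D) {k : ℕ} {v : E3 → ℝ}
  {w : (Fin 3 → ℕ) → E3 → ℝ}
  (hw : ∀ α : Fin 3 → ℕ, ∑ i, α i ≤ k → IsWeakDeriv (interior (φ '' refTet)) α v (w α))

include hs hw

/-- The right-hand side contains the full quantity of order `k` even when `j < k`. Approximations of
different degrees can thus be compared with each other under one common factor. -/
theorem exists_local_approx {j : ℕ} (hj : j ≤ k) :
    ∃ π ∈ Poly (j - 1), (∀ α : Fin 3 → ℕ, ∑ i, α i ≤ j →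
      ∫ x in φ '' refTet, (w α x - pval (polyDeriv α π) x) ^ 2 ≤
        (12 * D ^ 2) ^ (j - ∑ i, α i) * localSq φ k w) ∧
      (2 ≤ j → ContinuousOn v (φ '' refTet) → ∀ x ∈ refTet, jac φ * (v (φ x) - pval π (φ x)) ^ 2 ≤
        20 / volume.real refTet * (12 * D ^ 2) ^ j * localSq φ k w) := by
  have hO : IsOpen (interior (φ '' refTet)) := isOpen_interior
  have hOc : Convex ℝ (interior (φ '' refTet)) := (convex_image_refTet φ).interior
  have hne := interior_image_refTet_nonempty φ
  have hOb : Bornology.IsBounded (interior (φ '' refTet)) :=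
    (isCompact_image_refTet φ).isBounded.subset interior_subset
  have hD : ∀ x ∈ interior (φ '' refTet), ∀ y ∈ interior (φ '' refTet), ‖y - x‖ ≤ D :=
    fun x hx y hy => by
      rw [← dist_eq_norm]; exact hs.dist_le y (interior_subset hy) x (interior_subset hx)
  have hw' : ∀ α : Fin 3 → ℕ, ∑ i, α i ≤ j → IsWeakDeriv (interior (φ '' refTet)) α v (w α) :=
    fun α hα => hw α (hα.trans hj)
  obtain ⟨π, hπ, hπ2⟩ := bramble_hilbert hO hOc hne hOb hD hw' (M := localSq φ k w) fun β hβ => by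
    rw [restrict_interior_image]
    exact Finset.single_le_sum (f := fun α => ∫ x in φ '' refTet, w α x ^ 2)
      (fun α _ => integral_nonneg fun _ => sq_nonneg _) (mem_multiIndices.2 (by omega))
  refine ⟨π, hπ, fun α hα => ?_, fun hj2 hv x hx => ?_⟩
  · have := hπ2 α hα
    rwa [restrict_interior_image] at this
  · have hvL : MemLp v 2 (volume.restrict (interior (φ '' refTet))) := by
      rw [restrict_interior_image]; exact memLp_of_continuousOn φ hv
    have h1 := ae_sq_sub_poly_le hO hOc hne hOb hD hw' hj2 (localSq_nonneg φ k w) hπ2 hvL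
    have h2 := forall_of_ae_interior φ ((hv.sub (continuous_pval π).continuousOn).pow 2)
      continuousOn_const h1 (φ x) (mem_image_of_mem φ hx)
    have hvol : volume.real (interior (φ '' refTet)) = jac φ * volume.real refTet := by
      rw [jac, div_mul_cancel₀ _ volume_refTet_pos.ne', Measure.real, Measure.real,
        measure_congr (interior_image_ae_eq φ)]
    rw [hvol] at h2
    have hj := jac_pos φ
    have hr := volume_refTet_pos
    refine (mul_le_mul_of_nonneg_left h2 hj.le).trans_eq ?_
    field_simp

end LocalApprox

/-! ### Consistency errors on a single element -/

/-- Brings a bound into the squared form that the product estimates for quadrature errors expect,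
without taking square roots of constants. -/
theorem le_sq_mul_of_le {X c E M : ℝ} (hc : 0 ≤ c) (hM : 0 ≤ M) (h : X ≤ c * E ^ 2 * M) :
    X ≤ ((c + 1) * E) ^ 2 * M := by
  refine h.trans ?_
  have h1 : c ≤ (c + 1) ^ 2 := by nlinarith
  calc c * E ^ 2 * M ≤ (c + 1) ^ 2 * E ^ 2 * M := by gcongr
    _ = _ := by ring

theorem integral_sub_sq_le {μ : Measure E3} {f g k : E3 → ℝ} (hf : MemLp f 2 μ) (hg : MemLp g 2 μ)
    (hk : MemLp k 2 μ) :
    ∫ x, (g x - k x) ^ 2 ∂μ ≤ 2 * (∫ x, (f x - g x) ^ 2 ∂μ) + 2 * ∫ x, (f x - k x) ^ 2 ∂μ := by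
  have i1 : Integrable (fun x => (f x - g x) ^ 2) μ := (hf.sub hg).integrable_sq
  have i2 : Integrable (fun x => (f x - k x) ^ 2) μ := (hf.sub hk).integrable_sq
  have i3 : Integrable (fun x => (g x - k x) ^ 2) μ := (hg.sub hk).integrable_sq
  rw [← integral_const_mul, ← integral_const_mul, ← integral_add (i1.const_mul _) (i2.const_mul _)]
  refine integral_mono i3 (by exact (i1.const_mul _).add (i2.const_mul _)) fun x => ?_
  simp only
  nlinarith [sq_nonneg ((f x - g x) + (f x - k x))]

theorem approx_pow_le {D H : ℝ} (hD : 0 < D) (hDH : D ≤ H) (m : ℕ) :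
    2 * (12 * D ^ 2) ^ (m + 1) + 2 * (12 * D ^ 2) ^ m ≤ (2 * 12 ^ m * (12 * H ^ 2 + 1)) * (D ^ m) ^ 2 := by
  have h1 : 2 * (12 * D ^ 2) ^ (m + 1) + 2 * (12 * D ^ 2) ^ m =
      2 * 12 ^ m * (12 * D ^ 2 + 1) * (D ^ m) ^ 2 := by ring
  rw [h1]
  gcongr

/-- Two approximations of consecutive orders differ by the worse of the two orders; the surplus
power of `D` is absorbed by the bound `H` for the mesh size. -/
theorem approx_diff_le {φ : E3 ≃ᵃ[ℝ] E3} {D H : ℝ} (hD : 0 < D) (hDH : D ≤ H) {f : E3 → ℝ}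
    (hf : MemLp f 2 (volume.restrict (φ '' refTet))) {q r : MvPolynomial (Fin 3) ℝ} {m : ℕ} {M : ℝ}
    (hM : 0 ≤ M)
    (hq : ∫ x in φ '' refTet, (f x - pval q x) ^ 2 ≤ (12 * D ^ 2) ^ (m + 1) * M)
    (hr : ∫ x in φ '' refTet, (f x - pval r x) ^ 2 ≤ (12 * D ^ 2) ^ m * M) :
    ∫ x in φ '' refTet, pval (q - r) x ^ 2 ≤ (2 * 12 ^ m * (12 * H ^ 2 + 1)) * (D ^ m) ^ 2 * M := by
  have h := integral_sub_sq_le hf (memLp_pval φ q) (memLp_pval φ r)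
  simp only [pval_sub]
  calc _ ≤ _ := h
    _ ≤ 2 * ((12 * D ^ 2) ^ (m + 1) * M) + 2 * ((12 * D ^ 2) ^ m * M) := by gcongr
    _ = (2 * (12 * D ^ 2) ^ (m + 1) + 2 * (12 * D ^ 2) ^ m) * M := by ring
    _ ≤ _ := by gcongr; exact approx_pow_le hD hDH m

theorem poly_mono {m n : ℕ} (h : m ≤ n) : Poly m ≤ Poly n := fun _ hq =>
  (MvPolynomial.mem_restrictTotalDegree _ _ _).2
    (((MvPolynomial.mem_restrictTotalDegree _ _ _).1 hq).trans h)

theorem poly_mul_mem {m n : ℕ} {q r : MvPolynomial (Fin 3) ℝ} (hq : q ∈ Poly m) (hr : r ∈ Poly n) :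
    q * r ∈ Poly (m + n) :=
  (MvPolynomial.mem_restrictTotalDegree _ _ _).2 ((MvPolynomial.totalDegree_mul _ _).trans
    (add_le_add ((MvPolynomial.mem_restrictTotalDegree _ _ _).1 hq)
      ((MvPolynomial.mem_restrictTotalDegree _ _ _).1 hr)))

theorem C_mem_poly (a : ℝ) (n : ℕ) : MvPolynomial.C a ∈ Poly n :=
  (MvPolynomial.mem_restrictTotalDegree _ _ _).2 (by simp)

section Local

variable {R : RefElement} {p : ℕ} (hR : R.Conditions p) (hdeg : R.HasDegree p) (γ : ℝ)

include hR hdeg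

-- Subtracting the value `a` of `P` at one vertex gains a power of `D` from the gradient energy. It
-- therefore suffices that `π - π'` is of order `k - 1`, and exactness is needed only against
-- `P_{p-2}`.
set_option maxHeartbeats 1000000 in
theorem exists_mass_error_bound {H : ℝ} (hH : 0 < H) {k : ℕ} (hk : 2 ≤ k) (hkp : k ≤ p) :
    ∃ C : ℝ, 0 < C ∧ ∀ (φ : E3 ≃ᵃ[ℝ] E3) (D : ℝ), ShapeBound φ γ D → D ≤ H →
      ∀ (v : E3 → ℝ) (w : (Fin 3 → ℕ) → E3 → ℝ),
      (∀ α : Fin 3 → ℕ, ∑ i, α i ≤ k → IsWeakDeriv (interior (φ '' refTet)) α v (w α)) →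
      ContinuousOn v (φ '' refTet) → (∀ x, w 0 x = v x) →
      ∀ P, polyComp φ P ∈ R.U →
      |quadErr R.Q R.wt φ fun x => v x * pval P x| ≤
        C * D ^ k * (√(localSq φ k w) *
          √((∫ x in φ '' refTet, pval P x ^ 2) + jac φ * gradSum R φ P)) := by
  obtain ⟨N, hN⟩ := hR.exists_le_poly
  obtain ⟨CI, hCI, hinv⟩ := exists_physical_inverse_estimate N
  obtain ⟨CK, hCK, hinvk⟩ := exists_physical_inverse_estimate (k - 1)
  obtain ⟨CG, hCG, hgrad⟩ := exists_physical_gradient_bound hR γ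
  have hr := volume_refTet_pos
  obtain ⟨c1, hc1⟩ : ∃ c : ℝ, c = (20 / volume.real refTet + 1) * 12 ^ k := ⟨_, rfl⟩
  obtain ⟨c2, hc2⟩ : ∃ c : ℝ, c = (CK + 1) * (2 * 12 ^ (k - 1) * (12 * H ^ 2 + 1)) := ⟨_, rfl⟩
  obtain ⟨b2, hb2⟩ : ∃ c : ℝ, c = (volume.real refTet + 1) * CG := ⟨_, rfl⟩
  have hc1p : 0 < c1 := by rw [hc1]; positivity
  have hc2p : 0 < c2 := by rw [hc2]; positivity
  have hb2p : 0 < b2 := by rw [hb2]; positivity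
  have hωs : 0 ≤ ∑ x ∈ R.Q, R.wt x := Finset.sum_nonneg fun x hx => (hR.c4 x hx).le
  refine ⟨(1 + ∑ x ∈ R.Q, R.wt x) * ((c1 + 1) * (CI + 2) + (c2 + 1) * (b2 + 1)), by positivity,
    fun φ D hs hDH v w hw hv hw0 P hP => ?_⟩
  have hD := hs.pos
  have hM := localSq_nonneg φ k w
  generalize hMdef : localSq φ k w = M at hM ⊢
  obtain ⟨W, hW⟩ : ∃ W, W = (∫ x in φ '' refTet, pval P x ^ 2) + jac φ * gradSum R φ P := ⟨_, rfl⟩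
  rw [← hW]
  have hI0 : 0 ≤ ∫ x in φ '' refTet, pval P x ^ 2 := integral_nonneg fun _ => sq_nonneg _
  have hG0 : 0 ≤ jac φ * gradSum R φ P := mul_nonneg (jac_pos φ).le (gradSum_nonneg R φ P)
  have hPN : P ∈ Poly N := by
    have := polyComp_mem φ.symm (hN hP)
    rwa [polyComp_symm_polyComp] at this
  obtain ⟨π, hπ, hπ2, hπ3⟩ := exists_local_approx hs hw (j := k) le_rfl
  obtain ⟨π', hπ', hπ'2, -⟩ := exists_local_approx hs hw (j := k - 1) (by omega)
  rw [hMdef] at hπ2 hπ3 hπ'2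
  have hI1 := hπ2 0 (by simp)
  have hI2 := hπ'2 0 (by simp)
  simp only [polyDeriv_zero, Pi.zero_apply, Finset.sum_const_zero, tsub_zero, hw0] at hI1 hI2
  have hvL := memLp_of_continuousOn φ hv
  -- decomposition of the error
  obtain ⟨a, ha⟩ : ∃ a, a = pval P (φ 0) := ⟨_, rfl⟩
  have hU : ∀ {n}, n ≤ p → ∀ {q}, q ∈ Poly n → polyComp φ q ∈ R.U := fun hn _ hq =>
    hdeg.1 (poly_mono hn (polyComp_mem φ hq))
  have hint : ∀ q, IntegrableOn (pval q) (φ '' refTet) :=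
    integrableOn_pval (isCompact_image_refTet φ).isBounded
  have hmul : ∀ q r, IntegrableOn (fun x => pval q x * pval r x) (φ '' refTet) := fun q r => by
    simpa only [← pval_mul] using hint (q * r)
  have hPa : polyComp φ (P - MvPolynomial.C a) ∈ R.U := by
    rw [polyComp_sub]
    exact R.U.sub_mem hP (hU (Nat.zero_le p) (C_mem_poly a 0))
  -- The two discarded products are exact by C5 in two different ways: `π'` has degree at most `p -
  -- 2` and is paired with an element of `U`, while the constant `a` is paired with `π`, which lies
  -- in `U` because `k - 1 ≤ p`.
  have hdec : quadErr R.Q R.wt φ (fun x => v x * pval P x) =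
      quadErr R.Q R.wt φ (fun x => (v x - pval π x) * pval P x) +
      quadErr R.Q R.wt φ (fun x => pval (π - π') x * pval (P - MvPolynomial.C a) x) := by
    have e1 := quadErr_mass_eq_zero hR φ (poly_mono (by omega) hπ') hPa
    have e2 := quadErr_mass_eq_zero hR φ (C_mem_poly a (p - 2)) (hU (n := k - 1) (by omega) hπ)
    have i1 : IntegrableOn (fun x => (v x - pval π x) * pval P x) (φ '' refTet) :=
      (hvL.sub (memLp_pval φ π)).integrable_mul (memLp_pval φ P)
    have hsplit : (fun x => v x * pval P x) = fun x => ((v x - pval π x) * pval P x +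
        pval (π - π') x * pval (P - MvPolynomial.C a) x) +
        (pval π' x * pval (P - MvPolynomial.C a) x + pval (MvPolynomial.C a) x * pval π x) := by
      funext x; simp; ring
    rw [hsplit, quadErr_add _ _ _ (by exact i1.add (hmul _ _)) (by exact (hmul _ _).add (hmul _ _)),
      quadErr_add _ _ _ i1 (hmul _ _), quadErr_add _ _ _ (hmul _ _) (hmul _ _), e1, e2]
    ring
  have hD12 : (12 * D ^ 2) ^ k = 12 ^ k * (D ^ k) ^ 2 := by ring
  -- The factor `CI + 2` serves both bounds on `P`: its square exceeds one, as the integral needs,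
  -- and exceeds the inverse-estimate constant, as the nodal values need.
  have t1 := abs_quadErr_mul_le hR.c4 φ (a := fun x => v x - pval π x) (b := pval P)
    (A := (c1 + 1) * D ^ k) (B := CI + 2) (M := M) (W := W)
    (hvL.sub (memLp_pval φ π)) (memLp_pval φ P) (by positivity) (by positivity)
    (le_sq_mul_of_le hc1p.le hM (hI1.trans (by
      rw [hD12, hc1]
      have : 0 ≤ 20 / volume.real refTet * 12 ^ k * (D ^ k) ^ 2 * M := by positivity
      linarith)))
    (fun x hx => le_sq_mul_of_le hc1p.le hM ((hπ3 hk hv x (R.Q_subset x hx)).trans (by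
      rw [hD12, hc1]
      have : 0 ≤ 12 ^ k * (D ^ k) ^ 2 * M := by positivity
      linarith)))
    (by
      have : 1 ≤ (CI + 2) ^ 2 := by nlinarith
      calc _ ≤ W := by rw [hW]; linarith
        _ ≤ (CI + 2) ^ 2 * W := le_mul_of_one_le_left (by rw [hW]; positivity) this)
    (fun x hx => (hinv φ P hPN x (R.Q_subset x hx)).trans (by
      have h1 : CI ≤ (CI + 2) ^ 2 := by nlinarith
      refine mul_le_mul h1 (by rw [hW]; linarith) hI0 (sq_nonneg _)))
  have hdiffI : ∫ x in φ '' refTet, pval (π - π') x ^ 2 ≤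
      (2 * 12 ^ (k - 1) * (12 * H ^ 2 + 1)) * (D ^ (k - 1)) ^ 2 * M :=
    approx_diff_le hD hDH hvL hM (by rwa [Nat.sub_add_cancel (by omega)]) hI2
  have hdiffP : π - π' ∈ Poly (k - 1) := Submodule.sub_mem _ hπ (poly_mono (by omega) hπ')
  have hX0 : 0 ≤ (2 * 12 ^ (k - 1) * (12 * H ^ 2 + 1)) * (D ^ (k - 1)) ^ 2 * M := by positivity
  have hbx : ∀ x ∈ refTet, jac φ * pval (P - MvPolynomial.C a) (φ x) ^ 2 ≤
      CG * D ^ 2 * (jac φ * gradSum R φ P) := fun x hx => by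
    have := mul_le_mul_of_nonneg_left (hgrad φ D hs P hP x hx).1 (jac_pos φ).le
    simp only [pval_sub, pval_C, ha]
    linarith
  have hY0 : 0 ≤ CG * D ^ 2 * (jac φ * gradSum R φ P) := by positivity
  have hGW : jac φ * gradSum R φ P ≤ W := by rw [hW]; linarith
  have hW0 : 0 ≤ W := hG0.trans hGW
  have hX1 : ∫ x in φ '' refTet, pval (π - π') x ^ 2 ≤ c2 * (D ^ (k - 1)) ^ 2 * M :=
    hdiffI.trans (by rw [hc2]; linarith [mul_nonneg hCK.le hX0])
  have hX2 : ∀ x ∈ R.Q, jac φ * pval (π - π') (φ x) ^ 2 ≤ c2 * (D ^ (k - 1)) ^ 2 * M :=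
    fun x hx => (hinvk φ _ hdiffP x (R.Q_subset x hx)).trans (by
      refine (mul_le_mul_of_nonneg_left hdiffI hCK.le).trans ?_
      rw [hc2]; linarith)
  have hbW : CG * D ^ 2 * (jac φ * gradSum R φ P) ≤ CG * D ^ 2 * W :=
    mul_le_mul_of_nonneg_left hGW (by positivity)
  have hb0 : 0 ≤ CG * D ^ 2 * W := by positivity
  have hY1 : ∫ x in φ '' refTet, pval (P - MvPolynomial.C a) x ^ 2 ≤ b2 * D ^ 2 * W := by
    refine (integral_le_of_forall_jac_mul_le φ ((continuous_pval _).pow 2) hbx).trans ?_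
    rw [hb2]
    linarith [mul_le_mul_of_nonneg_left hbW hr.le]
  have hY2 : ∀ x ∈ R.Q, jac φ * pval (P - MvPolynomial.C a) (φ x) ^ 2 ≤ b2 * D ^ 2 * W :=
    fun x hx => (hbx x (R.Q_subset x hx)).trans (by
      rw [hb2]; linarith [mul_nonneg hr.le hb0])
  have t2 := abs_quadErr_mul_le hR.c4 φ (memLp_pval φ (π - π'))
    (memLp_pval φ (P - MvPolynomial.C a)) (A := (c2 + 1) * D ^ (k - 1)) (B := (b2 + 1) * D)
    (by positivity) (by positivity) (le_sq_mul_of_le hc2p.le hM hX1)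
    (fun x hx => le_sq_mul_of_le hc2p.le hM (hX2 x hx)) (le_sq_mul_of_le hb2p.le hW0 hY1)
    (fun x hx => le_sq_mul_of_le hb2p.le hW0 (hY2 x hx))
  rw [hdec]
  refine (abs_add_le _ _).trans ((add_le_add t1 t2).trans_eq ?_)
  have hDk : D ^ k = D ^ (k - 1) * D := by rw [← pow_succ, Nat.sub_add_cancel (by omega)]
  rw [hDk]
  ring

end Local

/-! ### Consistency of the stiffness form on one element -/

section Local

variable {R : RefElement} {p : ℕ} (hR : R.Conditions p) (hdeg : R.HasDegree p) (γ : ℝ)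

include hR in
theorem exists_pderiv_bound : ∃ B : ℝ, 0 < B ∧ ∀ (φ : E3 ≃ᵃ[ℝ] E3) (D : ℝ), ShapeBound φ γ D →
    ∀ P, polyComp φ P ∈ R.U → ∀ i,
      (∫ x in φ '' refTet, pval (MvPolynomial.pderiv i P) x ^ 2 ≤
        B ^ 2 * (jac φ * gradSum R φ P)) ∧
      ∀ x ∈ refTet, jac φ * pval (MvPolynomial.pderiv i P) (φ x) ^ 2 ≤
        B ^ 2 * (jac φ * gradSum R φ P) := by
  obtain ⟨CG, hCG, hgrad⟩ := exists_physical_gradient_bound hR γ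
  have hr := volume_refTet_pos
  refine ⟨(volume.real refTet + 1) * (CG + 1), by positivity, fun φ D hs P hP i => ?_⟩
  have hG0 : 0 ≤ jac φ * gradSum R φ P := mul_nonneg (jac_pos φ).le (gradSum_nonneg R φ P)
  have hx : ∀ x ∈ refTet, jac φ * pval (MvPolynomial.pderiv i P) (φ x) ^ 2 ≤
      CG * (jac φ * gradSum R φ P) := fun x hx => by
    have := mul_le_mul_of_nonneg_left ((hgrad φ D hs P hP x hx).2 i) (jac_pos φ).le
    linarith
  have h1 : (volume.real refTet + 1) * CG ≤ ((volume.real refTet + 1) * (CG + 1)) ^ 2 := by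
    have h2 : (1 : ℝ) ≤ (volume.real refTet + 1) * (CG + 1) :=
      one_le_mul_of_one_le_of_one_le (by linarith) (by linarith)
    calc _ ≤ (volume.real refTet + 1) * (CG + 1) := by gcongr; linarith
      _ ≤ _ := by rw [sq]; exact le_mul_of_one_le_left (by positivity) h2
  have h3 := mul_le_mul_of_nonneg_right h1 hG0
  have h4 := mul_nonneg hCG.le hG0
  have h5 := mul_nonneg hr.le h4
  constructor
  · refine (integral_le_of_forall_jac_mul_le φ ((continuous_pval _).pow 2) hx).trans ?_
    linarith
  · intro x hx'
    refine (hx x hx').trans ?_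
    linarith

theorem pderiv_mem_poly {n : ℕ} {q : MvPolynomial (Fin 3) ℝ} (hq : q ∈ Poly n) (i : Fin 3) :
    MvPolynomial.pderiv i q ∈ Poly (n - 1) := by
  have := polyDeriv_mem hq (Pi.single i 1)
  rw [polyDeriv_single] at this
  simpa using this

theorem pderiv_eq_zero_of_mem_poly_zero {q : MvPolynomial (Fin 3) ℝ} (hq : q ∈ Poly 0) (i : Fin 3) :
    MvPolynomial.pderiv i q = 0 := by
  rw [eq_C_of_mem_poly_zero hq]; simp

theorem sum_single (i : Fin 3) : ∑ j, (Pi.single i 1 : Fin 3 → ℕ) j = 1 := by simp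

include hR in
/-- The quadrature error of the stiffness form for a polynomial that is a good approximation at all
orders, with a variable coefficient that is well approximated by polynomials. -/
theorem exists_stiff_poly_error_bound {H : ℝ} {k : ℕ} (hk : 2 ≤ k) (hkp : k ≤ p + 1)
    {K : ℝ} (hK : 0 < K) :
    ∃ C : ℝ, 0 < C ∧ ∀ (φ : E3 ≃ᵃ[ℝ] E3) (D : ℝ), ShapeBound φ γ D → D ≤ H →
      ∀ c : E3 → ℝ, ContinuousOn c (φ '' refTet) →
      (∀ n < p, ∃ T ∈ Poly n, ∀ x ∈ φ '' refTet, |c x - pval T x| ≤ K * D ^ (n + 1)) →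
      ∀ (i : Fin 3) (g : E3 → ℝ) (M : ℝ), 0 ≤ M → MemLp g 2 (volume.restrict (φ '' refTet)) →
      ∀ π : ℕ → MvPolynomial (Fin 3) ℝ, (∀ m, π m ∈ Poly (m - 1)) →
      (∀ m, 1 ≤ m → m ≤ k → ∫ x in φ '' refTet, (g x - pval (MvPolynomial.pderiv i (π m)) x) ^ 2 ≤
        (12 * D ^ 2) ^ (m - 1) * M) →
      ∀ P, polyComp φ P ∈ R.U →
      |quadErr R.Q' R.wt' φ fun x => c x *
          (pval (MvPolynomial.pderiv i (π k)) x * pval (MvPolynomial.pderiv i P) x)| ≤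
        C * D ^ (k - 1) * (√M * √(jac φ * gradSum R φ P)) := by
  obtain ⟨CK, hCK, hinv⟩ := exists_physical_inverse_estimate k
  obtain ⟨B, hB, hPb⟩ := exists_pderiv_bound hR γ
  obtain ⟨cm, hcm⟩ : ∃ cm : ℕ → ℝ, ∀ m, cm m = (CK + 1) * (2 * 12 ^ m * (12 * H ^ 2 + 1)) :=
    ⟨_, fun m => rfl⟩
  have hcmp : ∀ m, 0 < cm m := fun m => by rw [hcm]; positivity
  have hωs : 0 ≤ ∑ x ∈ R.Q', R.wt' x := Finset.sum_nonneg fun x hx => (hR.c6 x hx).le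
  have hCpos : 0 ≤ ∑ m ∈ Finset.range (k - 1),
      (1 + ∑ x ∈ R.Q', R.wt' x) * (K * (cm m + 1) * B) :=
    Finset.sum_nonneg fun m _ => by have := hcmp m; positivity
  refine ⟨(∑ m ∈ Finset.range (k - 1), (1 + ∑ x ∈ R.Q', R.wt' x) * (K * (cm m + 1) * B)) + 1,
    by positivity, fun φ D hs hDH c hc hcT i g M hM hg π hπ hπ2 P hP => ?_⟩
  have hD := hs.pos
  obtain ⟨W, hW⟩ : ∃ W, W = jac φ * gradSum R φ P := ⟨_, rfl⟩
  have hbb := hPb φ D hs P hP i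
  rw [← hW] at hbb ⊢
  -- the increments
  set r : ℕ → MvPolynomial (Fin 3) ℝ := fun m =>
    MvPolynomial.pderiv i (π (m + 2)) - MvPolynomial.pderiv i (π (m + 1)) with hr
  have hcont : ∀ q q' : MvPolynomial (Fin 3) ℝ,
      ContinuousOn (fun x => c x * (pval q x * pval q' x)) (φ '' refTet) := fun q q' =>
    hc.mul ((continuous_pval q).mul (continuous_pval q')).continuousOn
  have hsum : (fun x => c x * (pval (MvPolynomial.pderiv i (π k)) x *
      pval (MvPolynomial.pderiv i P) x)) = fun x => ∑ m ∈ Finset.range (k - 1),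
        c x * (pval (r m) x * pval (MvPolynomial.pderiv i P) x) := by
    -- The telescoping sum starts at `π 1`, which is constant, so its derivative contributes
    -- nothing.
    have h1 := Finset.sum_range_sub (fun m => MvPolynomial.pderiv i (π (m + 1))) (k - 1)
    rw [Nat.sub_add_cancel (by omega), pderiv_eq_zero_of_mem_poly_zero (hπ (0 + 1)), sub_zero] at h1
    funext x
    rw [← Finset.mul_sum, ← Finset.sum_mul, ← pval_sum, ← h1]
  rw [hsum, quadErr_sum _ _ _ _ fun m _ =>
    (hcont _ _).integrableOn_compact (isCompact_image_refTet φ)]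
  have hterm : ∀ m ∈ Finset.range (k - 1),
      |quadErr R.Q' R.wt' φ fun x => c x * (pval (r m) x * pval (MvPolynomial.pderiv i P) x)| ≤
        (1 + ∑ x ∈ R.Q', R.wt' x) * (K * (cm m + 1) * B) * D ^ (k - 1) * (√M * √W) := by
    intro m hm
    rw [Finset.mem_range] at hm
    -- The degree is complementary to that of the increment: `T * r m` has degree at most `k - 2 ≤ p
    -- - 1` and is integrated exactly, while the remainder of `c` has order `k - 1 - m` and
    -- multiplies an increment of order `m`.
    obtain ⟨T, hT, hcT'⟩ := hcT (k - 2 - m) (by omega)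
    have hrm : r m ∈ Poly m := Submodule.sub_mem _
      (pderiv_mem_poly (hπ (m + 2)) i) (poly_mono (by omega) (pderiv_mem_poly (hπ (m + 1)) i))
    have hTr : T * r m ∈ Poly (p - 1) := poly_mono (by omega) (poly_mul_mem hT hrm)
    have hz := quadErr_stiff_eq_zero hR φ hTr hP i
    have hsplit : (fun x => c x * (pval (r m) x * pval (MvPolynomial.pderiv i P) x)) =
        fun x => ((c x - pval T x) * pval (r m) x) * pval (MvPolynomial.pderiv i P) x +
          pval (T * r m) x * pval (MvPolynomial.pderiv i P) x := by
      funext x; rw [pval_mul]; ring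
    have hac : ContinuousOn (fun x => (c x - pval T x) * pval (r m) x) (φ '' refTet) :=
      (hc.sub (continuous_pval T).continuousOn).mul (continuous_pval _).continuousOn
    have i1 : IntegrableOn (fun x => (c x - pval T x) * pval (r m) x *
        pval (MvPolynomial.pderiv i P) x) (φ '' refTet) :=
      (hac.mul (continuous_pval _).continuousOn).integrableOn_compact (isCompact_image_refTet φ)
    have i2 : IntegrableOn (fun x => pval (T * r m) x * pval (MvPolynomial.pderiv i P) x)
        (φ '' refTet) :=
      ((continuous_pval _).mul (continuous_pval _)).continuousOn.integrableOn_compact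
        (isCompact_image_refTet φ)
    rw [hsplit, quadErr_add _ _ _ i1 i2, hz, add_zero]
    have hrI : ∫ x in φ '' refTet, pval (r m) x ^ 2 ≤
        (2 * 12 ^ m * (12 * H ^ 2 + 1)) * (D ^ m) ^ 2 * M :=
      approx_diff_le hD hDH hg hM (hπ2 (m + 2) (by omega) (by omega))
        (hπ2 (m + 1) (by omega) (by omega))
    have hX0 : 0 ≤ (2 * 12 ^ m * (12 * H ^ 2 + 1)) * (D ^ m) ^ 2 * M := by positivity
    have hr1 : ∫ x in φ '' refTet, pval (r m) x ^ 2 ≤ cm m * (D ^ m) ^ 2 * M :=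
      hrI.trans (by rw [hcm]; linarith [mul_nonneg hCK.le hX0])
    have hr2 : ∀ x ∈ refTet, jac φ * pval (r m) (φ x) ^ 2 ≤ cm m * (D ^ m) ^ 2 * M := fun x hx =>
      (hinv φ _ (poly_mono (by omega) hrm) x hx).trans (by
        refine (mul_le_mul_of_nonneg_left hrI hCK.le).trans ?_
        rw [hcm]; linarith)
    have hsq : ∀ x ∈ φ '' refTet, ((c x - pval T x) * pval (r m) x) ^ 2 ≤
        (K * D ^ (k - 1 - m)) ^ 2 * pval (r m) x ^ 2 := fun x hx => by
      have h1 := hcT' x hx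
      rw [show k - 2 - m + 1 = k - 1 - m by omega] at h1
      rw [mul_pow]
      refine mul_le_mul_of_nonneg_right ?_ (sq_nonneg _)
      rw [← sq_abs]
      exact pow_le_pow_left₀ (abs_nonneg _) h1 2
    have hA : ∀ X, X ≤ cm m * (D ^ m) ^ 2 * M →
        (K * D ^ (k - 1 - m)) ^ 2 * X ≤ (K * (cm m + 1) * D ^ (k - 1)) ^ 2 * M := fun X hX => by
      refine (mul_le_mul_of_nonneg_left (le_sq_mul_of_le (hcmp m).le hM hX) (sq_nonneg _)).trans_eq ?_
      have : D ^ (k - 1) = D ^ (k - 1 - m) * D ^ m := by rw [← pow_add]; congr 1; omega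
      rw [this]; ring
    have hfin := abs_quadErr_mul_le hR.c6 φ (memLp_of_continuousOn φ hac)
      (memLp_pval φ (MvPolynomial.pderiv i P)) (A := K * (cm m + 1) * D ^ (k - 1)) (B := B)
      (M := M) (W := W) (by have := hcmp m; positivity) hB.le ?_ ?_ hbb.1
      (fun x hx => hbb.2 x (R.Q'_subset x hx))
    · refine hfin.trans_eq (by ring)
    · have i3 : IntegrableOn (fun x => (K * D ^ (k - 1 - m)) ^ 2 * pval (r m) x ^ 2) (φ '' refTet) :=
        (continuous_const.mul ((continuous_pval (r m)).pow 2)).continuousOn.integrableOn_compact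
          (isCompact_image_refTet φ)
      refine (setIntegral_mono_on ((hac.pow 2).integrableOn_compact (isCompact_image_refTet φ))
        i3 (isCompact_image_refTet φ).isClosed.measurableSet hsq).trans ?_
      rw [integral_const_mul]
      exact hA _ hr1
    · intro x hx
      have hx' := R.Q'_subset x hx
      have := mul_le_mul_of_nonneg_left (hsq _ (mem_image_of_mem φ hx')) (jac_pos φ).le
      refine this.trans ?_
      rw [mul_left_comm]
      exact hA _ (hr2 x hx')
  refine (Finset.abs_sum_le_sum_abs _ _).trans ((Finset.sum_le_sum hterm).trans ?_)
  rw [← Finset.sum_mul, ← Finset.sum_mul]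
  gcongr
  linarith

include hR hdeg

/-- The polynomial `π k` mediates between `u` and its interpolant. There are three contributions:
the approximation error of `u` under the integral, the quadrature of `∂ᵢ(PI - π k)`, which is
controlled by nodal differences through C1, and the pure quadrature error for `∂ᵢ(π k)`. The first
two also give the interpolation error. -/
theorem exists_stiff_error_bound {H : ℝ} {k : ℕ} (hk : 2 ≤ k) (hkp : k ≤ p + 1)
    {K : ℝ} (hK : 0 < K) :
    ∃ C : ℝ, 0 < C ∧ ∀ (φ : E3 ≃ᵃ[ℝ] E3) (D : ℝ), ShapeBound φ γ D → D ≤ H →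
      ∀ (u : E3 → ℝ) (w : (Fin 3 → ℕ) → E3 → ℝ),
      (∀ α : Fin 3 → ℕ, ∑ i, α i ≤ k → IsWeakDeriv (interior (φ '' refTet)) α u (w α)) →
      ContinuousOn u (φ '' refTet) →
      ∀ PI, polyComp φ PI ∈ R.U → (∀ x ∈ R.Q, pval PI (φ x) = u (φ x)) → ∀ i,
      (∫ x in φ '' refTet, (w (Pi.single i 1) x - pval (MvPolynomial.pderiv i PI) x) ^ 2 ≤
        C * (D ^ (k - 1)) ^ 2 * localSq φ k w) ∧
      ∀ c : E3 → ℝ, ContinuousOn c (φ '' refTet) → (∀ x ∈ φ '' refTet, |c x| ≤ K) →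
      (∀ n < p, ∃ T ∈ Poly n, ∀ x ∈ φ '' refTet, |c x - pval T x| ≤ K * D ^ (n + 1)) →
      ∀ P, polyComp φ P ∈ R.U →
      |(∫ x in φ '' refTet, c x * (w (Pi.single i 1) x * pval (MvPolynomial.pderiv i P) x)) -
        ∑ x ∈ R.Q', jac φ * R.wt' x * (c (φ x) * (pval (MvPolynomial.pderiv i PI) (φ x) *
          pval (MvPolynomial.pderiv i P) (φ x)))| ≤
        C * D ^ (k - 1) * (√(localSq φ k w) * √(jac φ * gradSum R φ P)) := by
  obtain ⟨C1, hC1, hpoly⟩ := exists_stiff_poly_error_bound hR γ (H := H) hk hkp hK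
  obtain ⟨B, hB, hPb⟩ := exists_pderiv_bound hR γ
  obtain ⟨CN, hCN, hnodal⟩ := exists_physical_nodal_bound hR γ
  have hr := volume_refTet_pos
  obtain ⟨c3, hc3⟩ : ∃ c : ℝ, c = CN * (R.Q.card * (20 / volume.real refTet * 12 ^ k)) := ⟨_, rfl⟩
  have hc3p : 0 ≤ c3 := by rw [hc3]; positivity
  have hωs : 0 ≤ ∑ x ∈ R.Q', R.wt' x := Finset.sum_nonneg fun x hx => (hR.c6 x hx).le
  refine ⟨C1 + K * (12 ^ (k - 1) + 1) * B + (∑ x ∈ R.Q', R.wt' x) * (K * (c3 + 1) * B) +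
    (2 * 12 ^ (k - 1) + 2 * (volume.real refTet * c3)), by positivity,
    fun φ D hs hDH u w hw hu PI hPI hPIu i => ?_⟩
  have hD := hs.pos
  have hM := localSq_nonneg φ k w
  have happ : ∀ m, ∃ π ∈ Poly (m - 1), m ≤ k → ((∀ α : Fin 3 → ℕ, ∑ i, α i ≤ m →
      ∫ x in φ '' refTet, (w α x - pval (polyDeriv α π) x) ^ 2 ≤
        (12 * D ^ 2) ^ (m - ∑ i, α i) * localSq φ k w) ∧
      (2 ≤ m → ContinuousOn u (φ '' refTet) → ∀ x ∈ refTet, jac φ * (u (φ x) - pval π (φ x)) ^ 2 ≤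
        20 / volume.real refTet * (12 * D ^ 2) ^ m * localSq φ k w)) := by
    intro m
    by_cases hm : m ≤ k
    · obtain ⟨π, h1, h2⟩ := exists_local_approx hs hw hm
      exact ⟨π, h1, fun _ => h2⟩
    · exact ⟨0, Submodule.zero_mem _, fun h => absurd h hm⟩
  choose π hπ hπ2 using happ
  generalize localSq φ k w = M at *
  have hgL : MemLp (w (Pi.single i 1)) 2 (volume.restrict (φ '' refTet)) := by
    have := (hw (Pi.single i 1) (by rw [sum_single]; omega)).1
    rwa [restrict_interior_image] at this
  have hI : ∀ m, 1 ≤ m → m ≤ k → ∫ x in φ '' refTet,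
      (w (Pi.single i 1) x - pval (MvPolynomial.pderiv i (π m)) x) ^ 2 ≤
        (12 * D ^ 2) ^ (m - 1) * M := fun m hm hmk => by
    have := (hπ2 m hmk).1 (Pi.single i 1) (by rw [sum_single]; exact hm)
    rwa [polyDeriv_single, sum_single] at this
  have hIk : ∫ x in φ '' refTet,
      (w (Pi.single i 1) x - pval (MvPolynomial.pderiv i (π k)) x) ^ 2 ≤
        12 ^ (k - 1) * (D ^ (k - 1)) ^ 2 * M := (hI k (by omega) le_rfl).trans_eq (by ring)
  -- the discrete part of the interpolation error
  have hdP : polyComp φ (PI - π k) ∈ R.U := by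
    rw [polyComp_sub]
    exact R.U.sub_mem hPI (hdeg.1 (poly_mono (by omega) (polyComp_mem φ (hπ k))))
  have hnod : ∀ x ∈ refTet, jac φ * pval (MvPolynomial.pderiv i (PI - π k)) (φ x) ^ 2 ≤
      c3 * (D ^ (k - 1)) ^ 2 * M := by
    intro x hx
    have h1 := hnodal φ D hs _ hdP x hx i
    have h2 : ∑ y ∈ R.Q, jac φ * pval (PI - π k) (φ y) ^ 2 ≤
        R.Q.card * (20 / volume.real refTet * (12 * D ^ 2) ^ k * M) := by
      rw [← nsmul_eq_mul]
      refine Finset.sum_le_card_nsmul _ _ _ fun y hy => ?_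
      rw [pval_sub, hPIu y hy]
      exact (hπ2 k le_rfl).2 hk hu y (R.Q_subset y hy)
    rw [← Finset.mul_sum] at h2
    -- Nodal differences are of order `k` by the supremum bound, and the derivative costs one power
    -- of `D`; cancelling `D ^ 2` leaves order `k - 1`.
    have h3 : D ^ 2 * (jac φ * pval (MvPolynomial.pderiv i (PI - π k)) (φ x) ^ 2) ≤
        D ^ 2 * (c3 * (D ^ (k - 1)) ^ 2 * M) := by
      calc _ = jac φ * (D ^ 2 * pval (MvPolynomial.pderiv i (PI - π k)) (φ x) ^ 2) := by ring
        _ ≤ jac φ * (CN * ∑ y ∈ R.Q, pval (PI - π k) (φ y) ^ 2) := by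
            have := (jac_pos φ).le
            gcongr
        _ = CN * (jac φ * ∑ y ∈ R.Q, pval (PI - π k) (φ y) ^ 2) := by ring
        _ ≤ CN * (R.Q.card * (20 / volume.real refTet * (12 * D ^ 2) ^ k * M)) := by gcongr
        _ = _ := by
            have : D ^ k = D ^ (k - 1) * D := by rw [← pow_succ, Nat.sub_add_cancel (by omega)]
            rw [hc3, mul_pow, ← pow_mul, mul_comm 2 k, pow_mul, this]
            ring
    exact le_of_mul_le_mul_left h3 (by positivity)
  have hnodI : ∫ x in φ '' refTet, pval (MvPolynomial.pderiv i (PI - π k)) x ^ 2 ≤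
      volume.real refTet * (c3 * (D ^ (k - 1)) ^ 2 * M) :=
    integral_le_of_forall_jac_mul_le φ ((continuous_pval _).pow 2) hnod
  constructor
  · have h1 := integral_sub_sq_le (memLp_pval φ (MvPolynomial.pderiv i (π k))) hgL
      (memLp_pval φ (MvPolynomial.pderiv i PI))
    have h2 : ∀ x, (pval (MvPolynomial.pderiv i (π k)) x - w (Pi.single i 1) x) ^ 2 =
        (w (Pi.single i 1) x - pval (MvPolynomial.pderiv i (π k)) x) ^ 2 := fun x => by ring
    have h3 : ∀ x, (pval (MvPolynomial.pderiv i (π k)) x - pval (MvPolynomial.pderiv i PI) x) ^ 2 =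
        pval (MvPolynomial.pderiv i (PI - π k)) x ^ 2 := fun x => by
      rw [map_sub, pval_sub]; ring
    simp only [h2, h3] at h1
    refine h1.trans ?_
    have h4 : 0 ≤ (C1 + K * (12 ^ (k - 1) + 1) * B +
      (∑ x ∈ R.Q', R.wt' x) * (K * (c3 + 1) * B)) * ((D ^ (k - 1)) ^ 2 * M) := by positivity
    linarith
  · intro c hc hcK hcT P hP
    have t3 := hpoly φ D hs hDH c hc hcT i _ M hM hgL π hπ hI P hP
    have hbb := hPb φ D hs P hP i
    generalize jac φ * gradSum R φ P = W at *
    have hcsq : ∀ x ∈ φ '' refTet, ∀ y, (c x * y) ^ 2 ≤ K ^ 2 * y ^ 2 := fun x hx y => by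
      rw [mul_pow, ← sq_abs (c x)]
      have := hcK x hx
      gcongr
    have hbd := (isCompact_image_refTet φ).isClosed.measurableSet
    have hgp : MemLp (fun x => w (Pi.single i 1) x - pval (MvPolynomial.pderiv i (π k)) x) 2
        (volume.restrict (φ '' refTet)) := hgL.sub (memLp_pval φ _)
    have hcg : ∀ f : E3 → ℝ, MemLp f 2 (volume.restrict (φ '' refTet)) →
        MemLp (fun x => c x * f x) 2 (volume.restrict (φ '' refTet)) := fun f hf => by
      refine MemLp.of_le_mul (c := K) hf ((hc.aestronglyMeasurable hbd).mul hf.1) ?_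
      refine ae_restrict_of_forall_mem hbd fun x hx => ?_
      rw [norm_mul]
      exact mul_le_mul_of_nonneg_right (hcK x hx) (norm_nonneg _)
    have t1 := abs_integral_mul_le (hcg _ hgp) (memLp_pval φ (MvPolynomial.pderiv i P))
      (A := K * ((12 ^ (k - 1) + 1) * D ^ (k - 1))) (B := B) (M := M) (W := W) (by positivity) hB.le
      (by
        refine (setIntegral_mono_on (hcg _ hgp).integrable_sq (hgp.integrable_sq.const_mul (K ^ 2))
          hbd fun x hx => hcsq x hx _).trans ?_
        rw [integral_const_mul, mul_pow, mul_assoc]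
        exact mul_le_mul_of_nonneg_left (le_sq_mul_of_le (by positivity) hM hIk) (sq_nonneg _))
      hbb.1
    have t2 := abs_sum_quad_le hR.c6 φ
      (a := fun x => c x * pval (MvPolynomial.pderiv i (PI - π k)) x)
      (b := pval (MvPolynomial.pderiv i P))
      (A := K * ((c3 + 1) * D ^ (k - 1))) (B := B) (M := M) (W := W) (by positivity) hB.le
      (fun x hx => by
        have hx' := R.Q'_subset x hx
        refine (mul_le_mul_of_nonneg_left (hcsq _ (mem_image_of_mem φ hx') _) (jac_pos φ).le).trans ?_
        rw [mul_left_comm, mul_pow, mul_assoc (K ^ 2)]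
        exact mul_le_mul_of_nonneg_left (le_sq_mul_of_le hc3p hM (hnod x hx')) (sq_nonneg _))
      (fun x hx => hbb.2 x (R.Q'_subset x hx))
    have hdec : (∫ x in φ '' refTet, c x * (w (Pi.single i 1) x * pval (MvPolynomial.pderiv i P) x)) -
        ∑ x ∈ R.Q', jac φ * R.wt' x * (c (φ x) * (pval (MvPolynomial.pderiv i PI) (φ x) *
          pval (MvPolynomial.pderiv i P) (φ x))) =
        (∫ x in φ '' refTet, c x * (w (Pi.single i 1) x - pval (MvPolynomial.pderiv i (π k)) x) *
          pval (MvPolynomial.pderiv i P) x) -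
        (∑ x ∈ R.Q', jac φ * R.wt' x * (c (φ x) * pval (MvPolynomial.pderiv i (PI - π k)) (φ x) *
          pval (MvPolynomial.pderiv i P) (φ x))) +
        quadErr R.Q' R.wt' φ fun x => c x *
          (pval (MvPolynomial.pderiv i (π k)) x * pval (MvPolynomial.pderiv i P) x) := by
      have i1 : IntegrableOn (fun x => c x * (w (Pi.single i 1) x -
          pval (MvPolynomial.pderiv i (π k)) x) * pval (MvPolynomial.pderiv i P) x) (φ '' refTet) :=
        (hcg _ hgp).integrable_mul (memLp_pval φ _)
      have i2 : IntegrableOn (fun x => c x * (pval (MvPolynomial.pderiv i (π k)) x *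
          pval (MvPolynomial.pderiv i P) x)) (φ '' refTet) :=
        (hc.mul ((continuous_pval _).mul (continuous_pval _)).continuousOn).integrableOn_compact
          (isCompact_image_refTet φ)
      have e1 : (fun x => c x * (w (Pi.single i 1) x * pval (MvPolynomial.pderiv i P) x)) =
          fun x => c x * (w (Pi.single i 1) x - pval (MvPolynomial.pderiv i (π k)) x) *
          pval (MvPolynomial.pderiv i P) x + c x * (pval (MvPolynomial.pderiv i (π k)) x *
          pval (MvPolynomial.pderiv i P) x) := by funext x; ring
      rw [e1, integral_add i1 i2, quadErr]
      have e2 : ∑ x ∈ R.Q', jac φ * R.wt' x * (c (φ x) * (pval (MvPolynomial.pderiv i PI) (φ x) *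
          pval (MvPolynomial.pderiv i P) (φ x))) =
          (∑ x ∈ R.Q', jac φ * R.wt' x * (c (φ x) * pval (MvPolynomial.pderiv i (PI - π k)) (φ x) *
            pval (MvPolynomial.pderiv i P) (φ x))) +
          ∑ x ∈ R.Q', jac φ * R.wt' x * (c (φ x) * (pval (MvPolynomial.pderiv i (π k)) (φ x) *
            pval (MvPolynomial.pderiv i P) (φ x))) := by
        rw [← Finset.sum_add_distrib]
        refine Finset.sum_congr rfl fun x _ => ?_
        rw [map_sub, pval_sub]; ring
      rw [e2]; ring
    rw [hdec]
    refine (abs_add_le _ _).trans ((add_le_add ((abs_sub _ _).trans (add_le_add t1 t2)) t3).trans ?_)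
    have h4 : 0 ≤ (2 * 12 ^ (k - 1) + 2 * (volume.real refTet * c3)) *
      (D ^ (k - 1) * (√M * √W)) := by positivity
    linarith

end Local

/-! ### Polynomial approximation of the coefficient -/

theorem exists_poly_eq_multilinear (m : ℕ) (f : ContinuousMultilinearMap ℝ (fun _ : Fin m => E3) ℝ)
    (x₀ : E3) : ∃ T ∈ Poly m, ∀ x, pval T x = f fun _ => x - x₀ := by
  classical
  refine ⟨∑ r : Fin m → Fin 3, f (fun l => EuclideanSpace.single (r l) 1) •
    ∏ l, (MvPolynomial.X (r l) - MvPolynomial.C (x₀ (r l))), ?_, fun x => ?_⟩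
  · refine Submodule.sum_mem _ fun r _ => Submodule.smul_mem _ _ ?_
    rw [MvPolynomial.mem_restrictTotalDegree]
    refine (MvPolynomial.totalDegree_finsetProd _ _).trans ?_
    refine (Finset.sum_le_sum fun l _ => ?_ : _ ≤ ∑ l : Fin m, 1).trans_eq (by simp)
    refine (MvPolynomial.totalDegree_sub _ _).trans ?_
    simp
  · have hx : (fun _ : Fin m => x - x₀) = fun _ : Fin m => ∑ j : Fin 3,
        (x j - x₀ j) • EuclideanSpace.single j (1 : ℝ) := by
      funext _; ext j; simp [Pi.single_apply]
    rw [hx, ContinuousMultilinearMap.map_sum, pval_sum]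
    refine Finset.sum_congr rfl fun r _ => ?_
    rw [ContinuousMultilinearMap.map_smul_univ, pval_smul, smul_eq_mul, mul_comm]
    congr 1
    simp [pval]

/-- Taylor's formula with integral remainder along segments from a fixed point; the factors `1 / n!`
and `(1 - t) ^ n` are simply bounded by one. -/
theorem exists_taylor_approx {S : Set E3} (hS : IsOpen S) (hSc : Convex ℝ S) (hne : S.Nonempty)
    {c : E3 → ℝ} {n : ℕ} (hc : ContDiffOn ℝ (n + 1) c S) {K D : ℝ}
    (hD : ∀ x ∈ S, ∀ y ∈ S, dist x y ≤ D)
    (hK : ∀ x ∈ S, ‖iteratedFDeriv ℝ (n + 1) c x‖ ≤ K) :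
    ∃ T ∈ Poly n, ∀ x ∈ S, |c x - pval T x| ≤ K * D ^ (n + 1) := by
  obtain ⟨x₀, hx₀⟩ := hne
  choose T hT hTx using fun m => exists_poly_eq_multilinear m (iteratedFDeriv ℝ m c x₀) x₀
  refine ⟨∑ k ∈ Finset.range (n + 1), (k.factorial : ℝ)⁻¹ • T k, ?_, fun x hx => ?_⟩
  · refine Submodule.sum_mem _ fun k hk => Submodule.smul_mem _ _ (poly_mono ?_ (hT k))
    exact Nat.lt_succ_iff.1 (Finset.mem_range.1 hk)
  have hseg : ∀ t ∈ Icc (0 : ℝ) 1, x₀ + t • (x - x₀) ∈ S := fun t ht =>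
    hSc.add_smul_sub_mem hx₀ hx ht
  have h := map_add_eq_sum_add_integral_iteratedFDeriv (f := c) (n := n) (x := x₀) (y := x - x₀)
    fun t ht => by
      have := hc.contDiffAt (hS.mem_nhds (hseg t ht))
      exact_mod_cast this
  rw [add_sub_cancel] at h
  have hsum : pval (∑ k ∈ Finset.range (n + 1), (k.factorial : ℝ)⁻¹ • T k) x =
      ∑ k ∈ Finset.range (n + 1), (k.factorial : ℝ)⁻¹ • iteratedFDeriv ℝ k c x₀ fun _ => x - x₀ := by
    rw [pval_sum]
    exact Finset.sum_congr rfl fun k _ => by rw [pval_smul, hTx, smul_eq_mul]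
  rw [h, hsum, add_sub_cancel_left, ← Real.norm_eq_abs, norm_smul]
  have hK0 : 0 ≤ K := (norm_nonneg _).trans (hK x₀ hx₀)
  have hxD : ‖x - x₀‖ ≤ D := by rw [← dist_eq_norm]; exact hD x hx x₀ hx₀
  have hint : ‖∫ t in (0 : ℝ)..1, (1 - t) ^ n •
      iteratedFDeriv ℝ (n + 1) c (x₀ + t • (x - x₀)) fun _ => x - x₀‖ ≤
      K * D ^ (n + 1) * |1 - 0| := by
    refine intervalIntegral.norm_integral_le_of_norm_le_const fun t ht => ?_
    rw [uIoc_of_le zero_le_one] at ht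
    have ht' : t ∈ Icc (0 : ℝ) 1 := ⟨ht.1.le, ht.2⟩
    rw [norm_smul]
    have h1 : ‖(1 - t) ^ n‖ ≤ 1 := by
      rw [norm_pow, Real.norm_eq_abs, abs_of_nonneg (by linarith [ht.2])]
      exact pow_le_one₀ (by linarith [ht.2]) (by linarith [ht.1])
    have h2 : ‖iteratedFDeriv ℝ (n + 1) c (x₀ + t • (x - x₀)) fun _ => x - x₀‖ ≤ K * D ^ (n + 1) := by
      refine (ContinuousMultilinearMap.le_opNorm _ _).trans ?_
      simp only [Finset.prod_const, Finset.card_univ, Fintype.card_fin]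
      have := hK _ (hseg t ht')
      gcongr
    calc _ ≤ 1 * (K * D ^ (n + 1)) := by
          refine mul_le_mul h1 h2 (norm_nonneg _) zero_le_one
      _ = _ := one_mul _
  have hf : ‖((n.factorial : ℝ))⁻¹‖ ≤ 1 := by
    rw [norm_inv, Real.norm_natCast]
    exact inv_le_one_of_one_le₀ (by exact_mod_cast Nat.succ_le_of_lt n.factorial_pos)
  calc _ ≤ 1 * (K * D ^ (n + 1) * |1 - 0|) := mul_le_mul hf hint (norm_nonneg _) zero_le_one
    _ = _ := by simp

/-- All derivatives up to order `p` extend continuously to the compact closure and are therefore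
bounded. Taylor's formula is used in the open element, where `c` is differentiable, and the bound
passes to the closed element by continuity. -/
theorem exists_coefficient_approx {Ω : Set E3} (hΩb : Bornology.IsBounded Ω) {p : ℕ}
    {c : E3 → ℝ} (hc : IsCkClosure Ω p c) :
    ∃ K : ℝ, 0 < K ∧ (∀ x ∈ closure Ω, |c x| ≤ K) ∧
      ∀ (φ : E3 ≃ᵃ[ℝ] E3) (D : ℝ), interior (φ '' refTet) ⊆ Ω → φ '' refTet ⊆ closure Ω →
      (∀ x ∈ φ '' refTet, ∀ y ∈ φ '' refTet, dist x y ≤ D) →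
      ∀ n < p, ∃ T ∈ Poly n, ∀ x ∈ φ '' refTet, |c x - pval T x| ≤ K * D ^ (n + 1) := by
  have hcpt : IsCompact (closure Ω) := hΩb.isCompact_closure
  obtain ⟨K0, hK0⟩ := hcpt.exists_bound_of_continuousOn hc.2.1
  have hm : ∀ m, ∃ K : ℝ, 0 ≤ K ∧ (m ≤ p → ∀ x ∈ Ω, ‖iteratedFDeriv ℝ m c x‖ ≤ K) := by
    intro m
    by_cases hm : m ≤ p
    · obtain ⟨G, hG, hGe⟩ := hc.2.2 m hm
      obtain ⟨K, hK⟩ := hcpt.exists_bound_of_continuousOn hG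
      refine ⟨max K 0, le_max_right _ _, fun _ x hx => ?_⟩
      rw [← hGe x hx]
      exact (hK x (subset_closure hx)).trans (le_max_left _ _)
    · exact ⟨0, le_rfl, fun h => absurd h hm⟩
  choose Km hKm0 hKm using hm
  have hs : 0 ≤ ∑ m ∈ Finset.range (p + 1), Km m := Finset.sum_nonneg fun m _ => hKm0 m
  refine ⟨|K0| + ∑ m ∈ Finset.range (p + 1), Km m + 1, by positivity, fun x hx => ?_, ?_⟩
  · have := hK0 x hx
    rw [Real.norm_eq_abs] at this
    linarith [le_abs_self K0]
  intro φ D hint hsub hD n hn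
  obtain ⟨T, hT, hTc⟩ := exists_taylor_approx (c := c) (n := n) isOpen_interior
    (convex_image_refTet φ).interior (interior_image_refTet_nonempty φ)
    ((hc.1.mono hint).of_le (by exact_mod_cast hn)) (D := D)
    (fun x hx y hy => hD x (interior_subset hx) y (interior_subset hy))
    (fun x hx => hKm (n + 1) hn x (hint hx))
  refine ⟨T, hT, fun x hx => ?_⟩
  have hcS : ContinuousOn c (φ '' refTet) := hc.2.1.mono hsub
  have h1 : |c x - pval T x| ≤ Km (n + 1) * D ^ (n + 1) := by
    refine forall_of_ae_interior φ ((hcS.sub (continuous_pval T).continuousOn).abs)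
      continuousOn_const ?_ x hx
    exact ae_restrict_of_forall_mem isOpen_interior.measurableSet hTc
  refine h1.trans (mul_le_mul_of_nonneg_right ?_ ?_)
  · have := Finset.single_le_sum (fun m _ => hKm0 m) (Finset.mem_range.2 (Nat.succ_lt_succ hn))
    have := abs_nonneg K0
    simp only [Nat.succ_eq_add_one] at *
    linarith
  · have := hD x hx x hx
    rw [dist_self] at this
    positivity

/-! ### Lipschitz domains -/

/-- Moving from `x` by `r / 2` in the graph direction leads above the graph, and a Lipschitz graph
stays away from a ball of comparable radius. -/
theorem exists_exterior_ball {Ω : Set E3} (hΩ : IsLipschitzDomain Ω) {x : E3} (hx : x ∈ frontier Ω) :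
    ∃ κ > 0, ∃ r₀ > 0, ∀ r, 0 < r → r < r₀ → ∃ y, Metric.ball y (κ * r) ⊆ Metric.ball x r ∧
      Disjoint (Metric.ball y (κ * r)) (closure Ω) := by
  obtain ⟨R, g, K, V, hg, hV, hxV, hgV⟩ := hΩ.2 x hx
  obtain ⟨r₀, hr₀, hball⟩ := Metric.isOpen_iff.1 hV x hxV
  have hxΩ : x ∉ Ω := by
    have := hx.2
    rwa [hΩ.1.interior_eq] at this
  have hgx : g !₂[R x 0, R x 1] ≤ R x 2 := not_lt.1 fun h => hxΩ ((hgV x hxV).2 h)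
  -- Within `κ r` of the shifted point the height drops by at most `κ r` and the graph rises by at
  -- most `K κ r`, together less than `r / 2`.
  set κ : ℝ := 1 / (2 * (K + 2)) with hκ
  have hK2 : (0 : ℝ) < K + 2 := by positivity
  have hκ0 : 0 < κ := by positivity
  have hκK : κ * (K + 2) = 1 / 2 := by rw [hκ]; field_simp
  have hκ2 : κ ≤ 1 / 2 := by
    have : (2 : ℝ) ≤ K + 2 := by simp
    nlinarith
  refine ⟨κ, hκ0, r₀, hr₀, fun r hr hrr => ?_⟩
  set y := R.symm (R x + (r / 2) • EuclideanSpace.single 2 (1 : ℝ)) with hy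
  have hRy : R y = R x + (r / 2) • EuclideanSpace.single 2 (1 : ℝ) := by rw [hy]; simp
  have hdist : dist y x = r / 2 := by
    rw [← R.dist_map, hRy, dist_eq_norm, add_sub_cancel_left, norm_smul]
    simp [abs_of_pos hr]
  have hsub : Metric.ball y (κ * r) ⊆ Metric.ball x r := by
    refine Metric.ball_subset_ball' ?_
    rw [hdist]; nlinarith
  refine ⟨y, hsub, ?_⟩
  refine Disjoint.closure_right ?_ Metric.isOpen_ball
  rw [Set.disjoint_left]
  intro z hz hzΩ
  have hzV : z ∈ V := hball (Metric.ball_subset_ball hrr.le (hsub hz))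
  have hlt := (hgV z hzV).1 hzΩ
  have hd : ‖R z - R y‖ < κ * r := by rw [← dist_eq_norm, R.dist_map]; exact hz
  have hcomp : ∀ i, |R z i - R y i| < κ * r := fun i =>
    (PiLp.norm_apply_le (R z - R y) i).trans_lt hd
  have hgd : |g !₂[R z 0, R z 1] - g !₂[R x 0, R x 1]| ≤ K * (κ * r) := by
    have h1 := hg.dist_le_mul !₂[R z 0, R z 1] !₂[R x 0, R x 1]
    rw [Real.dist_eq] at h1
    refine h1.trans (mul_le_mul_of_nonneg_left ?_ K.2)
    have h2 : dist (!₂[R z 0, R z 1] : EuclideanSpace ℝ (Fin 2)) !₂[R x 0, R x 1] ≤ ‖R z - R y‖ := by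
      rw [EuclideanSpace.dist_eq, EuclideanSpace.norm_eq]
      refine Real.sqrt_le_sqrt ?_
      rw [Fin.sum_univ_two, Fin.sum_univ_three, hRy]
      simp only [Real.dist_eq, Real.norm_eq_abs, sq_abs, PiLp.sub_apply, PiLp.add_apply]
      simp
      positivity
    exact h2.trans hd.le
  have h2 := hcomp 2
  rw [hRy] at h2
  simp at h2
  rw [abs_lt] at h2
  rw [abs_le] at hgd
  nlinarith [h2.1, hgd.1, hκK]

/-- Exterior balls exclude slits and punctures. As a consequence interiors of elements, known only
to lie in the closure, lie in `Ω`. -/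
theorem IsLipschitzDomain.interior_closure {Ω : Set E3} (hΩ : IsLipschitzDomain Ω) :
    interior (closure Ω) = Ω := by
  refine subset_antisymm (fun x hx => ?_) (hΩ.1.subset_interior_iff.2 subset_closure)
  by_contra hxΩ
  have hfr : x ∈ frontier Ω := ⟨interior_subset hx, by rwa [hΩ.1.interior_eq]⟩
  obtain ⟨κ, hκ, r₀, hr₀, h⟩ := exists_exterior_ball hΩ hfr
  obtain ⟨ε, hε, hεs⟩ := Metric.mem_nhds_iff.1 (mem_interior_iff_mem_nhds.1 hx)
  have hr : 0 < min ε r₀ / 2 := by positivity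
  obtain ⟨y, hy1, hy2⟩ := h (min ε r₀ / 2) hr (by linarith [min_le_right ε r₀])
  refine Set.disjoint_left.1 hy2 (Metric.mem_ball_self (by positivity)) (hεs ?_)
  refine Metric.ball_subset_ball (by linarith [min_le_left ε r₀]) (hy1 (Metric.mem_ball_self ?_))
  positivity

/-! ### The spaces `H¹` and `H¹₀` -/

theorem sum_multiIndices_one (F : (Fin 3 → ℕ) → ℝ) :
    ∑ α ∈ multiIndices 1, F α = F 0 + ∑ i, F (Pi.single i 1) := by
  have h : multiIndices 1 = insert 0 (Finset.univ.image fun i : Fin 3 => Pi.single i 1) := by decide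
  rw [h, Finset.sum_insert (by decide), Finset.sum_image fun i _ j _ hij => ?_]
  by_contra hne
  have := congrFun hij i
  simp [hne] at this

theorem integral_sub_mul {μ : Measure E3} {a b c : E3 → ℝ} (ha : MemLp a 2 μ) (hb : MemLp b 2 μ)
    (hc : MemLp c 2 μ) :
    ∫ x, (a x - b x) * c x ∂μ = (∫ x, a x * c x ∂μ) - ∫ x, b x * c x ∂μ := by
  have i1 : Integrable (fun x => a x * c x) μ := ha.integrable_mul hc
  have i2 : Integrable (fun x => b x * c x) μ := hb.integrable_mul hc
  rw [← integral_sub i1 i2]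
  congr 1; funext x; ring

/-- The weak gradient of a function on `Ω`. -/
def wgrad (Ω : Set E3) (u : E3 → ℝ) (i : Fin 3) : E3 → ℝ := weakDeriv Ω (Pi.single i 1) u

theorem MemH.hasWeakGrad {Ω : Set E3} {k : ℕ} (hk : 1 ≤ k) {u : E3 → ℝ} (hu : MemH Ω k u) :
    HasWeakGrad Ω u (wgrad Ω u) :=
  ⟨hu.1, fun i => weakDeriv_spec (hu.2 _ (by rw [sum_single]; exact hk))⟩

section Open

variable {Ω : Set E3} (hΩ : IsOpen Ω)

theorem HasWeakGrad.memH {u : E3 → ℝ} {G : Fin 3 → E3 → ℝ} (hu : HasWeakGrad Ω u G) : MemH Ω 1 u := by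
  refine ⟨hu.1, fun α hα => ?_⟩
  have h : α ∈ insert 0 (Finset.univ.image fun i : Fin 3 => (Pi.single i 1 : Fin 3 → ℕ)) := by
    have h1 : multiIndices 1 = insert 0 (Finset.univ.image fun i : Fin 3 => Pi.single i 1) := by
      decide
    rw [← h1]; exact mem_multiIndices.2 hα
  rw [Finset.mem_insert, Finset.mem_image] at h
  rcases h with rfl | ⟨i, -, rfl⟩
  · exact ⟨u, isWeakDeriv_zero hu.1⟩
  · exact ⟨G i, hu.2 i⟩

theorem HasWeakGrad.sub {u v : E3 → ℝ} {G F : Fin 3 → E3 → ℝ} (hu : HasWeakGrad Ω u G)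
    (hv : HasWeakGrad Ω v F) : HasWeakGrad Ω (u - v) (G - F) :=
  ⟨hu.1.sub hv.1, fun i => (hu.2 i).sub hu.1 hv.1 (hv.2 i)⟩

theorem IsTestFunction.hasWeakGrad (hΩ : IsOpen Ω) {f : E3 → ℝ} (hf : IsTestFunction Ω f) :
    HasWeakGrad Ω f fun i => MassLumped.partialDeriv i f := by
  refine hasWeakGrad_of_integral_eq (hf.memLp _) (fun i => (hf.partialDeriv i).memLp _)
    fun i ψ hψ => ?_
  exact integral_mul_partialDeriv hΩ (fun x _ => hf.1.differentiable (by simp) x)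
    hf.1.continuous.continuousOn (hf.1.continuous_fderiv (by simp)).continuousOn hψ i

include hΩ

theorem HasWeakGrad.wgrad_ae_eq {u : E3 → ℝ} {G : Fin 3 → E3 → ℝ} (hu : HasWeakGrad Ω u G)
    (i : Fin 3) : wgrad Ω u i =ᵐ[volume.restrict Ω] G i := (hu.2 i).ae_eq hΩ

theorem HasWeakGrad.normH_sq {u : E3 → ℝ} {G : Fin 3 → E3 → ℝ} (hu : HasWeakGrad Ω u G) :
    normH Ω 1 u ^ 2 = (∫ x in Ω, u x ^ 2) + ∑ i, ∫ x in Ω, G i x ^ 2 := by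
  rw [normH, Real.sq_sqrt (Finset.sum_nonneg fun _ _ => integral_nonneg fun _ => sq_nonneg _),
    sum_multiIndices_one]
  congr 1
  · refine integral_congr_ae ?_
    filter_upwards [(isWeakDeriv_zero hu.1).ae_eq hΩ] with x hx
    rw [hx]
  · refine Finset.sum_congr rfl fun i _ => integral_congr_ae ?_
    filter_upwards [hu.wgrad_ae_eq hΩ i] with x hx
    rw [← hx, wgrad]

/-- Trades the arbitrary choice hidden in `weakDeriv` for explicit integrals with any known weak
gradient. -/
theorem memH10_iff {u : E3 → ℝ} {G : Fin 3 → E3 → ℝ} (hu : HasWeakGrad Ω u G) :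
    MemH10 Ω u ↔ ∀ ε > 0, ∃ f, IsTestFunction Ω f ∧
      (∫ x in Ω, (u x - f x) ^ 2) + ∑ i, ∫ x in Ω, (G i x - partialDeriv i f x) ^ 2 < ε := by
  have key : ∀ f, IsTestFunction Ω f → normH Ω 1 (u - f) ^ 2 =
      (∫ x in Ω, (u x - f x) ^ 2) + ∑ i, ∫ x in Ω, (G i x - partialDeriv i f x) ^ 2 := fun f hf =>
    (hu.sub (hf.hasWeakGrad hΩ)).normH_sq hΩ
  have hn : ∀ v, 0 ≤ normH Ω 1 v := fun v => Real.sqrt_nonneg _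
  constructor
  · intro h ε hε
    obtain ⟨f, hf, hlt⟩ := h.2 (√ε) (by positivity)
    refine ⟨f, hf, ?_⟩
    rw [← key f hf, ← Real.sq_sqrt hε.le]
    exact pow_lt_pow_left₀ hlt (hn _) two_ne_zero
  · intro h
    refine ⟨hu.memH, fun ε hε => ?_⟩
    obtain ⟨f, hf, hlt⟩ := h (ε ^ 2) (by positivity)
    refine ⟨f, hf, ?_⟩
    rw [← key f hf] at hlt
    exact lt_of_pow_lt_pow_left₀ 2 hε.le hlt

omit hΩ in
theorem MemH10.hasWeakGrad {u : E3 → ℝ} (hu : MemH10 Ω u) : HasWeakGrad Ω u (wgrad Ω u) :=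
  hu.1.hasWeakGrad le_rfl

theorem MemH10.sub {u v : E3 → ℝ} (hu : MemH10 Ω u) (hv : MemH10 Ω v) : MemH10 Ω (u - v) := by
  have gu := hu.hasWeakGrad
  have gv := hv.hasWeakGrad
  rw [memH10_iff hΩ (gu.sub gv)]
  rw [memH10_iff hΩ gu] at hu
  rw [memH10_iff hΩ gv] at hv
  intro ε hε
  obtain ⟨f, hf, hfe⟩ := hu (ε / 4) (by positivity)
  obtain ⟨g, hg, hge⟩ := hv (ε / 4) (by positivity)
  have htest : IsTestFunction Ω (f - g) :=
    ⟨hf.1.sub hg.1, hf.2.1.sub hg.2.1, (tsupport_sub f g).trans (union_subset hf.2.2 hg.2.2)⟩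
  have hpd : ∀ i x, partialDeriv i (f - g) x = partialDeriv i f x - partialDeriv i g x := fun i x => by
    rw [partialDeriv, fderiv_sub (hf.1.differentiable (by simp) x) (hg.1.differentiable (by simp) x)]
    rfl
  have hsq : ∀ a b c d : E3 → ℝ, MemLp a 2 (volume.restrict Ω) → MemLp b 2 (volume.restrict Ω) →
      MemLp c 2 (volume.restrict Ω) → MemLp d 2 (volume.restrict Ω) →
      ∫ x in Ω, ((a x - b x) - (c x - d x)) ^ 2 ≤
        2 * (∫ x in Ω, (a x - c x) ^ 2) + 2 * ∫ x in Ω, (b x - d x) ^ 2 := by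
    intro a b c d ha hb hc hd
    have i1 : Integrable (fun x => (a x - c x) ^ 2) (volume.restrict Ω) := (ha.sub hc).integrable_sq
    have i2 : Integrable (fun x => (b x - d x) ^ 2) (volume.restrict Ω) := (hb.sub hd).integrable_sq
    have i3 : Integrable (fun x => ((a x - b x) - (c x - d x)) ^ 2) (volume.restrict Ω) :=
      ((ha.sub hb).sub (hc.sub hd)).integrable_sq
    rw [← integral_const_mul, ← integral_const_mul,
      ← integral_add (i1.const_mul _) (i2.const_mul _)]
    refine integral_mono i3 (by exact (i1.const_mul _).add (i2.const_mul _)) fun x => ?_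
    simp only
    nlinarith [sq_nonneg ((a x - c x) + (b x - d x))]
  refine ⟨f - g, htest, ?_⟩
  simp only [hpd, Pi.sub_apply]
  have h0 := hsq u v f g gu.1 gv.1 (hf.memLp _) (hg.memLp _)
  have h1 := Finset.sum_le_sum fun i (_ : i ∈ Finset.univ) =>
    hsq (wgrad Ω u i) (wgrad Ω v i) (partialDeriv i f) (partialDeriv i g) (gu.2 i).1 (gv.2 i).1
      ((hf.partialDeriv i).memLp _) ((hg.partialDeriv i).memLp _)
  rw [Finset.sum_add_distrib, ← Finset.mul_sum, ← Finset.mul_sum] at h1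
  linarith

/-- The extension by zero of a function of `H¹₀(Ω)` has a weak gradient on the whole space. -/
theorem MemH10.hasWeakGrad_indicator {u : E3 → ℝ} (hu : MemH10 Ω u) :
    HasWeakGrad univ (Ω.indicator u) fun i => Ω.indicator (wgrad Ω u i) := by
  have gu := hu.hasWeakGrad
  have hm := hΩ.measurableSet
  refine hasWeakGrad_of_integral_eq ?_ (fun i => ?_) fun i ψ hψ => ?_
  · rw [Measure.restrict_univ, memLp_indicator_iff_restrict hm]; exact gu.1
  · rw [Measure.restrict_univ, memLp_indicator_iff_restrict hm]; exact (gu.2 i).1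
  have conv : ∀ g h : E3 → ℝ, ∫ x in univ, Ω.indicator g x * h x = ∫ x in Ω, g x * h x := by
    intro g h
    rw [setIntegral_univ, ← integral_indicator hm]
    congr 1; funext x
    by_cases hx : x ∈ Ω <;> simp [hx]
  rw [conv, conv, eq_neg_iff_add_eq_zero]
  have hψL : ∀ i, MemLp (partialDeriv i ψ) 2 (volume.restrict Ω) := fun i => (hψ.partialDeriv i).memLp _
  have hψL0 : MemLp ψ 2 (volume.restrict Ω) := hψ.memLp _
  set A := ∫ x in Ω, partialDeriv i ψ x ^ 2 with hA
  set B := ∫ x in Ω, ψ x ^ 2 with hB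
  have hA0 : 0 ≤ A := integral_nonneg fun _ => sq_nonneg _
  have hB0 : 0 ≤ B := integral_nonneg fun _ => sq_nonneg _
  set S := (∫ x in Ω, u x * partialDeriv i ψ x) + ∫ x in Ω, wgrad Ω u i x * ψ x with hS
  -- For a test function in place of `u` the sum `S` vanishes by integration by parts; replacing `u`
  -- by such a function changes `S` by as little as desired.
  have hbound : ∀ ε > 0, S ^ 2 ≤ 2 * (A + B) * ε := by
    intro ε hε
    obtain ⟨f, hf, hfe⟩ := (memH10_iff hΩ gu).1 hu ε hε
    have hfL : MemLp f 2 (volume.restrict Ω) := hf.memLp _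
    have hfL1 : MemLp (partialDeriv i f) 2 (volume.restrict Ω) := (hf.partialDeriv i).memLp _
    have hzero : (∫ x in Ω, f x * partialDeriv i ψ x) + ∫ x in Ω, partialDeriv i f x * ψ x = 0 := by
      have h1 := integral_mul_partialDeriv isOpen_univ (fun x _ => hf.1.differentiable (by simp) x)
        hf.1.continuous.continuousOn (hf.1.continuous_fderiv (by simp)).continuousOn hψ i
      have h2 : ∀ g : E3 → ℝ, (∀ x ∉ Ω, g x = 0) → ∀ h : E3 → ℝ,
          ∫ x in univ, g x * h x = ∫ x in Ω, g x * h x := fun g hg h => by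
        rw [setIntegral_univ, setIntegral_eq_integral_of_forall_compl_eq_zero]
        intro x hx; rw [hg x hx, zero_mul]
      rw [h2 _ (fun x hx => hf.eq_zero hx), h2 _ (fun x hx => (hf.partialDeriv i).eq_zero hx)] at h1
      rw [h1]; ring
    have hSe : S = (∫ x in Ω, (u x - f x) * partialDeriv i ψ x) +
        ∫ x in Ω, (wgrad Ω u i x - partialDeriv i f x) * ψ x := by
      have e1 := integral_sub_mul gu.1 hfL (hψL i)
      have e2 := integral_sub_mul (gu.2 i).1 hfL1 hψL0
      rw [e1, e2, hS]
      linarith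
    have c1 := sq_integral_mul_le (gu.1.sub hfL) (hψL i)
    have c2 := sq_integral_mul_le ((gu.2 i).1.sub hfL1) hψL0
    simp only [Pi.sub_apply] at c1 c2
    have hnn : ∀ j, 0 ≤ ∫ x in Ω, (wgrad Ω u j x - partialDeriv j f x) ^ 2 :=
      fun j => integral_nonneg fun _ => sq_nonneg _
    have d1 : ∫ x in Ω, (u x - f x) ^ 2 ≤ ε := by
      have := Finset.sum_nonneg fun j (_ : j ∈ Finset.univ) => hnn j
      linarith
    have d2 : ∫ x in Ω, (wgrad Ω u i x - partialDeriv i f x) ^ 2 ≤ ε := by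
      have h1 := Finset.single_le_sum (fun j _ => hnn j) (Finset.mem_univ i)
      have h2 : 0 ≤ ∫ x in Ω, (u x - f x) ^ 2 := integral_nonneg fun _ => sq_nonneg _
      linarith
    have c1' := c1.trans (mul_le_mul_of_nonneg_right d1 hA0)
    have c2' := c2.trans (mul_le_mul_of_nonneg_right d2 hB0)
    rw [hSe]
    set X := ∫ x in Ω, (u x - f x) * partialDeriv i ψ x
    set Y := ∫ x in Ω, (wgrad Ω u i x - partialDeriv i f x) * ψ x
    nlinarith [sq_nonneg (X - Y)]
  have hS0 : S ^ 2 ≤ 0 := by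
    refine le_of_forall_pos_le_add fun ε hε => ?_
    have h1 := hbound (ε / (2 * (A + B) + 1)) (by positivity)
    refine h1.trans ?_
    rw [zero_add, mul_div_assoc', div_le_iff₀ (by positivity)]
    nlinarith
  nlinarith

/-- The Poincaré–Friedrichs inequality. -/
theorem exists_friedrichs (hΩb : Bornology.IsBounded Ω) : ∃ C : ℝ, 0 < C ∧ ∀ u, MemH10 Ω u →
    ∫ x in Ω, u x ^ 2 ≤ C * ∑ i, ∫ x in Ω, wgrad Ω u i x ^ 2 := by
  obtain ⟨r, hr⟩ := hΩb.subset_ball (0 : E3)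
  set ρ := |r| + 1 with hρ
  have hρ0 : 0 < ρ := by positivity
  have hΩr : Ω ⊆ Metric.ball 0 ρ := hr.trans (Metric.ball_subset_ball (by linarith [le_abs_self r]))
  set O := Metric.ball (0 : E3) (3 * ρ) with hO
  -- A ball disjoint from `Ω`, where the extension by zero vanishes. On `A × Ω` the Poincaré double
  -- integral of the extension already equals `|A|` times the integral of `u ^ 2`.
  set A := Metric.ball (EuclideanSpace.single 0 (2 * ρ) : E3) ρ with hAdef
  have hAO : A ⊆ O := Metric.ball_subset_ball' (by simp [abs_of_pos hρ0]; linarith)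
  have hΩO : Ω ⊆ O := hΩr.trans (Metric.ball_subset_ball (by linarith))
  have hAΩ : Disjoint A Ω := by
    refine Disjoint.mono_right hΩr (Metric.ball_disjoint_ball ?_)
    simp [abs_of_pos hρ0]; linarith
  have hAv : 0 < volume.real A := ENNReal.toReal_pos
    (Metric.isOpen_ball.measure_pos volume ⟨_, Metric.mem_ball_self hρ0⟩).ne'
    Metric.isBounded_ball.measure_lt_top.ne
  have hOv : volume O ≠ ⊤ := Metric.isBounded_ball.measure_lt_top.ne
  have hAv' : volume A ≠ ⊤ := Metric.isBounded_ball.measure_lt_top.ne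
  refine ⟨8 * (6 * ρ) ^ 2 * volume.real O / volume.real A + 1, by positivity, fun u hu => ?_⟩
  have hg := hu.hasWeakGrad_indicator hΩ
  have hgO := hg.mono (subset_univ O)
  have hp := poincare_lintegral Metric.isOpen_ball (convex_ball _ _) (D := 6 * ρ) (fun x hx z hz => by
    rw [← dist_eq_norm]
    have h1 := Metric.mem_ball.1 hx
    have h2 := Metric.mem_ball'.1 hz
    rw [dist_comm]
    have := dist_triangle x 0 z
    linarith) hgO
  have hm := hΩ.measurableSet
  have hu2 : MemLp u 2 (volume.restrict Ω) := hu.1.1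
  -- lower bound of the double integral
  have hlow : volume A * lsq Ω u ≤ ∫⁻ q : E3 × E3, ‖Ω.indicator u q.2 - Ω.indicator u q.1‖ₑ ^ 2
      ∂(volume.restrict O).prod (volume.restrict O) := by
    calc volume A * lsq Ω u = ∫⁻ q : E3 × E3, ‖u q.2‖ₑ ^ 2
          ∂(volume.restrict A).prod (volume.restrict Ω) := by
          rw [lintegral_prod_symm]
          · simp only [lintegral_const, Measure.restrict_apply_univ]
            rw [lintegral_mul_const'' _ (hu2.1.enorm.pow_const 2), lsq, mul_comm]
          · exact (hu2.1.comp_snd.enorm.pow_const 2)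
      _ = ∫⁻ q in A ×ˢ Ω, ‖Ω.indicator u q.2 - Ω.indicator u q.1‖ₑ ^ 2 ∂(volume.prod volume) := by
          rw [← Measure.prod_restrict]
          refine lintegral_congr_ae ?_
          rw [Measure.prod_restrict]
          refine (ae_restrict_of_forall_mem (Metric.isOpen_ball.measurableSet.prod hm) fun q hq => ?_)
          simp only
          rw [indicator_of_mem hq.2, indicator_of_notMem (Set.disjoint_left.1 hAΩ hq.1), sub_zero]
      _ ≤ ∫⁻ q in O ×ˢ O, ‖Ω.indicator u q.2 - Ω.indicator u q.1‖ₑ ^ 2 ∂(volume.prod volume) :=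
          lintegral_mono_set (prod_mono hAO hΩO)
      _ = _ := by rw [Measure.prod_restrict]
  have hsum : ∑ i, lsq O (Ω.indicator (wgrad Ω u i)) =
      ENNReal.ofReal (∑ i, ∫ x in Ω, wgrad Ω u i x ^ 2) := by
    rw [sum_lsq_eq fun i => (hgO.2 i).1]
    congr 1
    refine Finset.sum_congr rfl fun i _ => ?_
    have : (fun x => Ω.indicator (wgrad Ω u i) x ^ 2) = Ω.indicator fun x => wgrad Ω u i x ^ 2 := by
      funext x; by_cases hx : x ∈ Ω <;> simp [hx]
    rw [this, setIntegral_indicator hm, inter_eq_right.2 hΩO]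
  have h1 := hlow.trans hp
  rw [hsum, lsq_eq hu2] at h1
  have hs0 : 0 ≤ ∑ i, ∫ x in Ω, wgrad Ω u i x ^ 2 :=
    Finset.sum_nonneg fun i _ => integral_nonneg fun _ => sq_nonneg _
  have hu0 : 0 ≤ ∫ x in Ω, u x ^ 2 := integral_nonneg fun _ => sq_nonneg _
  have h2 := ENNReal.toReal_mono (by
    refine ENNReal.mul_ne_top (ENNReal.mul_ne_top (ENNReal.mul_ne_top (by norm_num) ?_) hOv)
      ENNReal.ofReal_ne_top
    exact ENNReal.pow_ne_top ENNReal.ofReal_ne_top) h1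
  simp only [ENNReal.toReal_mul, ENNReal.toReal_pow, ENNReal.toReal_ofReal hs0,
    ENNReal.toReal_ofReal hu0, ENNReal.toReal_ofReal (by positivity : (0 : ℝ) ≤ 6 * ρ),
    ENNReal.toReal_ofNat] at h2
  change volume.real A * _ ≤ 8 * (6 * ρ) ^ 2 * volume.real O * _ at h2
  have h3 : ∫ x in Ω, u x ^ 2 ≤
      8 * (6 * ρ) ^ 2 * volume.real O / volume.real A * ∑ i, ∫ x in Ω, wgrad Ω u i x ^ 2 := by
    rw [div_mul_eq_mul_div, le_div_iff₀ hAv]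
    linarith
  linarith

end Open

/-! ### Meshes -/

namespace TetMesh

variable {Ω : Set E3} (T : TetMesh Ω)

theorem elem_def (e : Fin T.N) : T.elem e = T.φ e '' refTet := rfl

theorem iUnion_elem : ⋃ e, T.elem e = closure Ω := T.cover

theorem elem_subset (e : Fin T.N) : T.elem e ⊆ closure Ω := by
  rw [← T.iUnion_elem]; exact subset_iUnion T.elem e

theorem isCompact_elem (e : Fin T.N) : IsCompact (T.elem e) := isCompact_image_refTet _

theorem interior_elem_subset (hΩ : IsLipschitzDomain Ω) (e : Fin T.N) :
    interior (T.elem e) ⊆ Ω :=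
  (interior_mono (T.elem_subset e)).trans hΩ.interior_closure.subset

-- A boundary point of `Ω` lies in some element but not in its interior, and the frontier of a
-- convex set is a null set. Thus the mesh itself shows that integrals over `Ω` split into element
-- integrals.
include T in
theorem volume_frontier (hΩ : IsLipschitzDomain Ω) : volume (frontier Ω) = 0 := by
  have h : frontier Ω ⊆ ⋃ e, frontier (T.elem e) := by
    intro x hx
    have hx1 : x ∈ ⋃ e, T.elem e := by rw [T.iUnion_elem]; exact hx.1
    obtain ⟨e, he⟩ := mem_iUnion.1 hx1
    refine mem_iUnion.2 ⟨e, subset_closure he, fun hi => ?_⟩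
    have := hx.2
    rw [hΩ.1.interior_eq] at this
    exact this (T.interior_elem_subset hΩ e hi)
  refine measure_mono_null h (measure_iUnion_null fun e => ?_)
  exact (convex_image_refTet (T.φ e)).addHaar_frontier volume

theorem ae_eq_iUnion_interior (hΩ : IsLipschitzDomain Ω) :
    Ω =ᵐ[volume] ⋃ e, interior (T.elem e) := by
  have h1 : (⋃ e, interior (T.elem e) : Set E3) =ᵐ[volume] ⋃ e, T.elem e :=
    Filter.EventuallyEq.countable_iUnion fun e => interior_image_ae_eq (T.φ e)
  rw [T.iUnion_elem] at h1
  refine Filter.EventuallyEq.trans ?_ h1.symm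
  refine (closure_ae_eq_of_null_frontier (T.volume_frontier hΩ)).symm

theorem setIntegral_eq_sum (hΩ : IsLipschitzDomain Ω) {f : E3 → ℝ} (hf : IntegrableOn f Ω) :
    ∫ x in Ω, f x = ∑ e, ∫ x in T.elem e, f x := by
  rw [setIntegral_congr_set (T.ae_eq_iUnion_interior hΩ),
    integral_iUnion_fintype (fun e => isOpen_interior.measurableSet) ?_ fun e =>
      hf.mono_set (T.interior_elem_subset hΩ e)]
  · exact Finset.sum_congr rfl fun e _ => by rw [elem_def, restrict_interior_image]
  · intro e e' h
    exact T.disjoint_interior e e' h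

theorem h_nonneg : 0 ≤ T.h := Real.sInf_nonneg fun _ hr => hr.1

theorem h_le (hb : Bornology.IsBounded Ω) : T.h ≤ Metric.diam (closure Ω) := by
  refine csInf_le ⟨0, fun r hr => hr.1⟩ ⟨Metric.diam_nonneg, fun e => ?_⟩
  refine ⟨T.φ e 0, fun x hx => ?_⟩
  exact Metric.dist_le_diam_of_mem hb.closure (T.elem_subset e hx)
    (T.elem_subset e (mem_image_of_mem _ zero_mem_refTet))

/-- The bound holds for every admissible radius and passes to the infimum; boundedness of `Ω`
ensures that an admissible radius exists. -/
theorem diam_elem_le (hb : Bornology.IsBounded Ω) (e : Fin T.N) :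
    Metric.diam (T.elem e) ≤ 2 * T.h := by
  have h1 : Metric.diam (T.elem e) / 2 ≤ T.h := by
    refine le_csInf ⟨Metric.diam (closure Ω), Metric.diam_nonneg, fun e => ?_⟩ fun r hr => ?_
    · refine ⟨T.φ e 0, fun x hx => ?_⟩
      exact Metric.dist_le_diam_of_mem hb.closure (T.elem_subset e hx)
        (T.elem_subset e (mem_image_of_mem _ zero_mem_refTet))
    · obtain ⟨z, hz⟩ := hr.2 e
      have := (Metric.diam_mono hz Metric.isBounded_closedBall).trans (Metric.diam_closedBall hr.1)
      linarith
  linarith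

theorem shapeBound {γ : ℝ} (hs : T.ShapeRegular γ) (e : Fin T.N) :
    ShapeBound (T.φ e) γ (Metric.diam (T.elem e)) := by
  obtain ⟨z, ρ, hρ, hb, hd⟩ := hs e
  exact shapeBound_of_ball hρ hb hd

end TetMesh

/-! ### Barycentric coordinates -/

/-- The vertices of the reference tetrahedron. -/
def vert (k : Fin 4) : E3 := ![EuclideanSpace.single 0 1, EuclideanSpace.single 1 1,
  EuclideanSpace.single 2 1, 0] k

theorem bary_vert (k l : Fin 4) : bary (vert k) l = if k = l then 1 else 0 := by
  fin_cases k <;> fin_cases l <;> simp [bary, vert]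

theorem sum_bary (x : E3) : ∑ k, bary x k = 1 := by
  simp [Fin.sum_univ_four, bary]

theorem sum_bary_smul_vert (x : E3) : ∑ k, bary x k • vert k = x := by
  ext i
  fin_cases i <;> simp [Fin.sum_univ_four, bary, vert]

theorem bary_sum_smul {a : Fin 4 → ℝ} (ha : ∑ k, a k = 1) (σ : Fin 4 → Fin 4) (l : Fin 4) :
    bary (∑ k, a k • vert (σ k)) l = ∑ k, if σ k = l then a k else 0 := by
  have h3 : a 3 = 1 - a 0 - a 1 - a 2 := by rw [Fin.sum_univ_four] at ha; linarith
  have key : ∀ (x : Fin 4 → E3) l, bary (∑ k, a k • x k) l = ∑ k, a k * bary (x k) l := by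
    intro x l
    fin_cases l <;> simp [bary, Fin.sum_univ_four, h3] <;> ring
  rw [key]
  refine Finset.sum_congr rfl fun k _ => ?_
  rw [bary_vert]; split_ifs <;> simp

theorem bary_injective {x y : E3} (h : ∀ k, bary x k = bary y k) : x = y := by
  rw [← sum_bary_smul_vert x, ← sum_bary_smul_vert y]
  exact Finset.sum_congr rfl fun k _ => by rw [h]

theorem range_vert : range vert = refVertices := by
  ext x
  simp only [mem_range, refVertices, mem_insert_iff]
  constructor
  · rintro ⟨k, rfl⟩
    fin_cases k
    · exact Or.inr ⟨0, rfl⟩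
    · exact Or.inr ⟨1, rfl⟩
    · exact Or.inr ⟨2, rfl⟩
    · exact Or.inl rfl
  · rintro (rfl | ⟨i, rfl⟩)
    · exact ⟨3, rfl⟩
    · fin_cases i
      · exact ⟨0, rfl⟩
      · exact ⟨1, rfl⟩
      · exact ⟨2, rfl⟩

theorem vert_injective : Function.Injective vert := fun k l h => by
  have := bary_vert k l
  rw [h, bary_vert] at this
  by_contra hne
  simp [hne] at this

theorem affine_sum_smul (s : E3 →ᵃ[ℝ] E3) (a : Fin 4 → ℝ) (ha : ∑ k, a k = 1) (x : Fin 4 → E3) :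
    s (∑ k, a k • x k) = ∑ k, a k • s (x k) := by
  have hs : ∀ y, s y = s.linear y + s 0 := fun y => congrFun s.decomp y
  have h2 : ∑ k, a k • s (x k) = ∑ k, (a k • s.linear (x k) + a k • s 0) :=
    Finset.sum_congr rfl fun k _ => by rw [hs (x k), smul_add]
  rw [hs, map_sum, h2, Finset.sum_add_distrib, ← Finset.sum_smul, ha, one_smul]
  simp only [map_smul]

theorem affine_eq_sum (φ : E3 ≃ᵃ[ℝ] E3) (x : E3) : φ x = ∑ k, bary x k • φ (vert k) := by
  conv_lhs => rw [← sum_bary_smul_vert x]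
  exact affine_sum_smul (φ : E3 →ᵃ[ℝ] E3) _ (sum_bary x) vert

/-- The affine map that permutes the vertices of the reference tetrahedron. -/
def permMap (σ : Equiv.Perm (Fin 4)) : E3 →ᵃ[ℝ] E3 where
  toFun x := ∑ k, bary x k • vert (σ k)
  linear :=
    { toFun := fun v => ∑ i : Fin 3, v i • (vert (σ i.castSucc) - vert (σ 3))
      map_add' := fun v w => by simp [add_smul, Finset.sum_add_distrib]
      map_smul' := fun a v => by simp [mul_smul, Finset.smul_sum] }
  map_vadd' x v := by
    ext i
    simp [Fin.sum_univ_four, Fin.sum_univ_three, bary]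
    ring

theorem permMap_apply (σ : Equiv.Perm (Fin 4)) (x : E3) :
    permMap σ x = ∑ k, bary x k • vert (σ k) := rfl

theorem bary_permMap (σ : Equiv.Perm (Fin 4)) (x : E3) (l : Fin 4) :
    bary (permMap σ x) l = bary x (σ.symm l) := by
  rw [permMap_apply, bary_sum_smul (sum_bary x) σ l, Finset.sum_eq_single (σ.symm l)]
  · simp
  · intro k _ hk
    rw [if_neg]; intro h; apply hk; rw [← h]; simp
  · simp

/-- Renumberings of the vertices are the symmetries to which C2 is applied when two elements see a
common face differently. -/
theorem permMap_image (σ : Equiv.Perm (Fin 4)) : permMap σ '' refTet = refTet := by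
  refine subset_antisymm ?_ fun x hx => ⟨permMap σ.symm x, fun k => ?_, bary_injective fun k => ?_⟩
  · rintro _ ⟨x, hx, rfl⟩ k
    rw [bary_permMap]; exact hx _
  · rw [bary_permMap]; exact hx _
  · rw [bary_permMap, bary_permMap]; simp

theorem interior_refTet : interior refTet = {x | ∀ k, 0 < bary x k} := by
  refine subset_antisymm (fun x hx k => ?_) (interior_maximal (fun x hx k => (hx k).le) ?_)
  · by_contra hk
    have hk0 : bary x k = 0 := le_antisymm (not_lt.1 hk) (interior_subset hx k)
    -- moving away from the vertex `k` leaves the tetrahedron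
    have hc : Continuous fun t : ℝ => (1 + t) • x + (-t) • vert k := by fun_prop
    have h0 : (1 + (0 : ℝ)) • x + (-(0 : ℝ)) • vert k ∈ interior refTet := by simpa using hx
    have hev := (hc.isOpen_preimage _ isOpen_interior).mem_nhds (show (0 : ℝ) ∈ _ from h0)
    obtain ⟨ε, hε, hb⟩ := Metric.mem_nhds_iff.1 hev
    have hm : (1 + ε / 2) • x + (-(ε / 2)) • vert k ∈ interior refTet :=
      hb (by simp [abs_of_pos hε]; linarith)
    have := interior_subset hm k
    rw [bary_combo (by ring), hk0, bary_vert, if_pos rfl] at this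
    linarith
  · have : {x : E3 | ∀ k, 0 < bary x k} = ⋂ k, {x | 0 < bary x k} := by ext; simp
    rw [this]
    exact isOpen_iInter_of_finite fun k => isOpen_lt continuous_const (continuous_bary k)

open Filter Topology

/-! ### Lipschitz functions vanishing outside `Ω` belong to `H¹₀(Ω)` -/

/-- The coordinate derivative of a function that is differentiable along lines. -/
def coordDeriv (i : Fin 3) (f : E3 → ℝ) (x : E3) : ℝ :=
  lineDeriv ℝ f x (EuclideanSpace.single i 1)

theorem abs_coordDeriv_le {f : E3 → ℝ} {L : ℝ≥0} (hf : LipschitzWith L f) (i : Fin 3) (x : E3) :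
    ‖coordDeriv i f x‖ ≤ L := by
  refine (norm_lineDeriv_le_of_lipschitz ℝ hf).trans ?_
  simp

theorem measurable_coordDeriv {f : E3 → ℝ} (hf : Continuous f) (i : Fin 3) :
    Measurable (coordDeriv i f) := measurable_lineDeriv hf

theorem hasWeakGrad_of_lipschitz {f : E3 → ℝ} {L : ℝ≥0} (hf : LipschitzWith L f)
    (hc : HasCompactSupport f) : HasWeakGrad univ f fun i => coordDeriv i f := by
  refine hasWeakGrad_of_integral_eq ?_ (fun i => ?_) fun i ψ hψ => ?_
  · exact hf.continuous.memLp_of_hasCompactSupport hc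
  · rw [Measure.restrict_univ]
    have hcs : HasCompactSupport (coordDeriv i f) := HasCompactSupport.intro hc fun x hx => by
      have h0 : f =ᶠ[𝓝 x] fun _ => 0 := notMem_tsupport_iff_eventuallyEq.1 hx
      rw [coordDeriv, h0.lineDeriv_eq, lineDeriv, deriv_const]
    exact hcs.memLp_of_bound (measurable_coordDeriv hf.continuous i).aestronglyMeasurable L
      (Eventually.of_forall (abs_coordDeriv_le hf i))
  · obtain ⟨K, hK⟩ := hψ.1.lipschitzWith_of_hasCompactSupport hψ.2.1 (by simp)
    have h := hf.integral_lineDeriv_mul_eq (μ := volume) hK hψ.2.1 (EuclideanSpace.single i 1)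
    have h2 : ∀ x, lineDeriv ℝ ψ x (-EuclideanSpace.single i 1) = - partialDeriv i ψ x := fun x => by
      rw [(hψ.1.differentiable (by simp) x).lineDeriv_eq_fderiv, map_neg, partialDeriv]
    simp only [h2, neg_mul, integral_neg] at h
    rw [setIntegral_univ, setIntegral_univ]
    simp only [coordDeriv]
    rw [h, neg_neg]
    congr 1; funext x; ring

section Bounded

variable {Ω : Set E3} (hΩ : IsOpen Ω) (hΩb : Bornology.IsBounded Ω)

include hΩb in
theorem tendsto_integral_sub_sq {g : E3 → ℝ} {F : ℕ → E3 → ℝ} {B : ℝ}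
    (hF : ∀ n, AEStronglyMeasurable (F n) (volume.restrict Ω))
    (hg : AEStronglyMeasurable g (volume.restrict Ω)) (hb : ∀ n x, |g x - F n x| ≤ B)
    (h : ∀ᵐ x ∂volume.restrict Ω, Tendsto (fun n => F n x) atTop (𝓝 (g x))) :
    Tendsto (fun n => ∫ x in Ω, (g x - F n x) ^ 2) atTop (𝓝 0) := by
  have : IsFiniteMeasure (volume.restrict Ω) := ⟨by simpa using hΩb.measure_lt_top⟩
  have h1 := tendsto_integral_of_dominated_convergence (μ := volume.restrict Ω)
    (F := fun n x => (g x - F n x) ^ 2) (f := fun _ => 0) (fun _ => B ^ 2)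
    (fun n => (hg.sub (hF n)).pow 2) (integrable_const _)
    (fun n => Eventually.of_forall fun x => by
      rw [Real.norm_eq_abs, abs_pow]
      exact pow_le_pow_left₀ (abs_nonneg _) (hb n x) 2) (by
      filter_upwards [h] with x hx
      have := (tendsto_const_nhds (x := g x)).sub hx
      simpa using this.pow 2)
  simpa using h1

theorem abs_mollify_le {g : E3 → ℝ} (hg : Measurable g) {B : ℝ} (hB : ∀ x, ‖g x‖ ≤ B) (n : ℕ)
    (x : E3) : |mollify univ n g x| ≤ 3 * B := by
  have h1 := (mollifier n).dist_normed_convolution_le (μ := volume) (x₀ := x) (ε := 2 * B)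
    (g := univ.indicator g) (by simpa using hg.aestronglyMeasurable) fun y _ => by
      simp only [indicator_univ]
      rw [dist_eq_norm]
      refine (norm_sub_le _ _).trans ?_
      linarith [hB x, hB y]
  simp only [indicator_univ] at h1
  have h2 : mollify univ n g x =
      convolution ((mollifier n).normed volume) g (ContinuousLinearMap.lsmul ℝ ℝ) volume x := by
    simp [mollify]
  rw [← h2, dist_eq_norm] at h1
  have h3 := norm_sub_norm_le (mollify univ n g x) (g x)
  rw [← Real.norm_eq_abs]
  linarith [hB x]

theorem eventually_isTestFunction_mollify (hΩ : IsOpen Ω) {g : E3 → ℝ} (hg : Continuous g)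
    (hc : HasCompactSupport g) (hs : tsupport g ⊆ Ω) :
    ∀ᶠ n in atTop, IsTestFunction Ω (mollify univ n g) := by
  obtain ⟨δ, hδ, hsub⟩ := IsCompact.exists_cthickening_subset_open hc hΩ hs
  obtain ⟨N, hN⟩ := exists_nat_gt (1 / δ)
  filter_upwards [eventually_ge_atTop N] with n hn
  have hrδ : (mollifier n).rOut ≤ δ := by
    change 1 / (2 * ((n : ℝ) + 1)) ≤ δ
    rw [div_le_iff₀ (by positivity)]
    rw [div_lt_iff₀ hδ] at hN
    have : (N : ℝ) ≤ n := by exact_mod_cast hn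
    nlinarith
  have hsupp : Function.support (mollify univ n g) ⊆ Metric.cthickening δ (tsupport g) := by
    refine (support_convolution_subset _).trans ?_
    rw [ContDiffBump.support_normed_eq]
    rintro _ ⟨a, ha, b, hb, rfl⟩
    refine Metric.mem_cthickening_of_dist_le _ b _ _ (subset_tsupport g (by simpa using hb)) ?_
    rw [dist_eq_norm, add_sub_cancel_right]
    rw [mem_ball_zero_iff] at ha
    linarith
  have hcl : tsupport (mollify univ n g) ⊆ Metric.cthickening δ (tsupport g) :=
    closure_minimal hsupp Metric.isClosed_cthickening
  refine ⟨contDiff_mollify isOpen_univ ?_ n, ?_, hcl.trans hsub⟩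
  · exact hg.memLp_of_hasCompactSupport hc
  · exact (IsCompact.cthickening hc).of_isClosed_subset (isClosed_tsupport _) hcl

include hΩ hΩb

/-- At fine scales the mollified functions are test functions on `Ω`; they and their derivatives
converge almost everywhere under a uniform bound, so dominated convergence gives the `H¹` limit. -/
theorem memH10_of_lipschitz_of_tsupport_subset {g : E3 → ℝ} {L : ℝ≥0} (hg : LipschitzWith L g)
    (hc : HasCompactSupport g) (hs : tsupport g ⊆ Ω) : MemH10 Ω g := by
  have hW := hasWeakGrad_of_lipschitz hg hc
  rw [memH10_iff hΩ (hW.mono (subset_univ Ω))]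
  intro ε hε
  obtain ⟨B, hB⟩ := hc.exists_bound_of_continuous hg.continuous
  have hae : ∀ {k : E3 → ℝ}, MemLp k 2 (volume.restrict univ) →
      ∀ᵐ x ∂volume.restrict Ω, Tendsto (fun n => mollify univ n k x) atTop (𝓝 (k x)) := fun hk =>
    ae_restrict_of_ae_restrict_of_subset (subset_univ Ω) (ae_tendsto_mollify isOpen_univ hk)
  have hinner : ∀ n x, x ∈ innerSet univ n := fun n x => subset_univ _
  have t0 := tendsto_integral_sub_sq hΩb (g := g) (F := fun n => mollify univ n g) (B := 4 * B)
    (fun n => (contDiff_mollify isOpen_univ hW.1 n).continuous.aestronglyMeasurable)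
    hg.continuous.aestronglyMeasurable (fun n x => by
      have h1 := abs_mollify_le hg.continuous.measurable hB n x
      have h2 := hB x
      rw [Real.norm_eq_abs] at h2
      exact (abs_sub _ _).trans (by linarith)) (hae hW.1)
  have t1 : ∀ i, Tendsto (fun n => ∫ x in Ω,
      (coordDeriv i g x - partialDeriv i (mollify univ n g) x) ^ 2) atTop (𝓝 0) := fun i => by
    have he : ∀ n x, partialDeriv i (mollify univ n g) x = mollify univ n (coordDeriv i g) x :=
      fun n x => partialDeriv_mollify isOpen_univ hW.1 hW (hinner n x) i
    simp only [he]
    refine tendsto_integral_sub_sq hΩb (B := 4 * L)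
      (fun n => (contDiff_mollify isOpen_univ (hW.2 i).1 n).continuous.aestronglyMeasurable)
      (measurable_coordDeriv hg.continuous i).aestronglyMeasurable (fun n x => ?_) (hae (hW.2 i).1)
    have h1 := abs_mollify_le (measurable_coordDeriv hg.continuous i) (abs_coordDeriv_le hg i) n x
    have h2 := abs_coordDeriv_le hg i x
    rw [Real.norm_eq_abs] at h2
    exact (abs_sub _ _).trans (by linarith)
  have t2 := t0.add (tendsto_finsetSum Finset.univ fun i _ => t1 i)
  simp only [Finset.sum_const_zero, add_zero] at t2
  obtain ⟨n, hn1, hn2⟩ := ((t2.eventually (gt_mem_nhds hε)).and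
    (eventually_isTestFunction_mollify hΩ hg.continuous hc hs)).exists
  exact ⟨_, hn2, hn1⟩

/-! ### Truncation by soft thresholding -/

omit hΩ hΩb

/-- Soft thresholding at level `δ`. -/
def softThreshold (δ t : ℝ) : ℝ := max (t - δ) (min (t + δ) 0)

theorem lipschitzWith_softThreshold (δ : ℝ) : LipschitzWith 1 (softThreshold δ) := by
  refine LipschitzWith.of_dist_le_mul fun s t => ?_
  rw [Real.dist_eq, Real.dist_eq, NNReal.coe_one, one_mul]
  refine (abs_max_sub_max_le_max _ _ _ _).trans (max_le (by simp) ?_)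
  refine (abs_min_sub_min_le_max _ _ _ _).trans (max_le (by simp) (by simp))

theorem softThreshold_of_abs_le {δ t : ℝ} (h : |t| ≤ δ) : softThreshold δ t = 0 := by
  rw [abs_le] at h
  rw [softThreshold, min_eq_right (by linarith), max_eq_right (by linarith)]

theorem abs_sub_softThreshold_le {δ : ℝ} (hδ : 0 ≤ δ) (t : ℝ) : |t - softThreshold δ t| ≤ δ := by
  rw [softThreshold, abs_le]
  rcases le_total (t + δ) 0 with h | h
  · rw [min_eq_left h, max_eq_right (by linarith)]; constructor <;> linarith
  · rw [min_eq_right h]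
    rcases le_total (t - δ) 0 with h' | h'
    · rw [max_eq_right h']; constructor <;> linarith
    · rw [max_eq_left h']; constructor <;> linarith

theorem coordDeriv_softThreshold_of_eq_zero {f : E3 → ℝ} (hf : Continuous f) {δ : ℝ} (hδ : 0 < δ)
    (i : Fin 3) {x : E3} (hx : f x = 0) : coordDeriv i (fun y => softThreshold δ (f y)) x = 0 := by
  have h : (fun y => softThreshold δ (f y)) =ᶠ[𝓝 x] fun _ => 0 := by
    have : ∀ᶠ y in 𝓝 x, |f y| < δ := (hf.abs.tendsto x).eventually (gt_mem_nhds (by simpa [hx]))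
    filter_upwards [this] with y hy
    exact softThreshold_of_abs_le hy.le
  rw [coordDeriv, h.lineDeriv_eq, lineDeriv, deriv_const]

theorem coordDeriv_softThreshold_of_lt {f : E3 → ℝ} (hf : Continuous f) {δ : ℝ} (hδ : 0 < δ)
    (i : Fin 3) {x : E3} (hx : δ < |f x|) :
    coordDeriv i (fun y => softThreshold δ (f y)) x = coordDeriv i f x := by
  have h : ∃ a : ℝ, (fun y => softThreshold δ (f y)) =ᶠ[𝓝 x] fun y => f y + a := by
    rcases lt_abs.1 hx with h | h
    · refine ⟨-δ, ?_⟩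
      filter_upwards [(hf.tendsto x).eventually (lt_mem_nhds h)] with y hy
      rw [softThreshold, min_eq_right (by linarith), max_eq_left (by linarith)]; ring
    · refine ⟨δ, ?_⟩
      have h' : f x < -δ := by linarith
      filter_upwards [(hf.tendsto x).eventually (gt_mem_nhds h')] with y hy
      rw [softThreshold, min_eq_left (by linarith), max_eq_right (by linarith)]
  obtain ⟨a, ha⟩ := h
  rw [coordDeriv, ha.lineDeriv_eq, coordDeriv, lineDeriv, lineDeriv, deriv_add_const]

include hΩ hΩb

/-- Thresholding a function that vanishes outside `Ω` yields support in `{δ ≤ |f|}`, a compact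
subset of `Ω`, whatever the boundary looks like; then `δ` tends to zero. -/
theorem memH10_of_lipschitz {f : E3 → ℝ} {L : ℝ≥0} (hf : LipschitzWith L f)
    (h0 : ∀ x ∉ Ω, f x = 0) : MemH10 Ω f := by
  have : IsFiniteMeasure (volume.restrict Ω) := ⟨by simpa using hΩb.measure_lt_top⟩
  have hcf : HasCompactSupport f := HasCompactSupport.intro hΩb.isCompact_closure fun x hx =>
    h0 x fun h => hx (subset_closure h)
  set δ : ℕ → ℝ := fun n => 1 / ((n : ℝ) + 1) with hδ
  have hδ0 : ∀ n, 0 < δ n := fun n => by positivity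
  have hδ1 : ∀ n, δ n ≤ 1 := fun n => by
    rw [hδ]; exact (div_le_one (by positivity)).2 (by simp)
  have hδt : Tendsto δ atTop (𝓝 0) := tendsto_one_div_add_atTop_nhds_zero_nat
  set F : ℕ → E3 → ℝ := fun n y => softThreshold (δ n) (f y) with hF
  have hFL : ∀ n, LipschitzWith L (F n) := fun n => by
    have h := (lipschitzWith_softThreshold (δ n)).comp hf
    rw [one_mul] at h
    exact h
  have hFsub : ∀ n, tsupport (F n) ⊆ {x | δ n ≤ |f x|} := fun n => by
    refine closure_minimal (fun x hx => ?_) (isClosed_le continuous_const hf.continuous.abs)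
    by_contra h
    exact hx (softThreshold_of_abs_le (not_le.1 h).le)
  have hFΩ : ∀ n, tsupport (F n) ⊆ Ω := fun n x hx => by
    by_contra h
    have := hFsub n hx
    simp only [mem_ofPred_eq, h0 x h, abs_zero] at this
    linarith [hδ0 n]
  have hFc : ∀ n, HasCompactSupport (F n) := fun n =>
    hΩb.isCompact_closure.of_isClosed_subset (isClosed_tsupport _) ((hFΩ n).trans subset_closure)
  have hFH : ∀ n, MemH10 Ω (F n) := fun n =>
    memH10_of_lipschitz_of_tsupport_subset hΩ hΩb (hFL n) (hFc n) (hFΩ n)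
  have hFW : ∀ n, HasWeakGrad Ω (F n) fun i => coordDeriv i (F n) := fun n =>
    (hasWeakGrad_of_lipschitz (hFL n) (hFc n)).mono (subset_univ Ω)
  -- The derivatives of the truncations converge to this function at every point. Using the limit
  -- itself as the weak gradient avoids showing that the gradient vanishes almost everywhere on the
  -- zero set.
  set G : Fin 3 → E3 → ℝ := fun i => {x | f x ≠ 0}.indicator (coordDeriv i f) with hG
  have hms : MeasurableSet {x | f x ≠ 0} := (isOpen_ne_fun hf.continuous continuous_const).measurableSet
  have hGm : ∀ i, Measurable (G i) := fun i => (measurable_coordDeriv hf.continuous i).indicator hms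
  have hGb : ∀ i x, |G i x| ≤ L := fun i x => by
    by_cases hx : f x = 0
    · simp [hG, hx]
    · have : G i x = coordDeriv i f x := indicator_of_mem (by simpa using hx) _
      rw [this]; exact abs_coordDeriv_le hf i x
  have hFt : ∀ x, Tendsto (fun n => F n x) atTop (𝓝 (f x)) := fun x => by
    rw [tendsto_iff_dist_tendsto_zero]
    refine squeeze_zero (fun _ => dist_nonneg) (fun n => ?_) hδt
    rw [dist_comm, Real.dist_eq]
    exact abs_sub_softThreshold_le (hδ0 n).le _
  have hGt : ∀ i x, Tendsto (fun n => coordDeriv i (F n) x) atTop (𝓝 (G i x)) := fun i x => by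
    by_cases hx : f x = 0
    · have h1 : G i x = 0 := by simp [hG, hx]
      rw [h1]
      refine tendsto_const_nhds.congr fun n => ?_
      exact (coordDeriv_softThreshold_of_eq_zero hf.continuous (hδ0 n) i hx).symm
    · have h1 : G i x = coordDeriv i f x := indicator_of_mem (by simpa using hx) _
      rw [h1]
      refine tendsto_const_nhds.congr' ?_
      filter_upwards [hδt.eventually (gt_mem_nhds (abs_pos.2 hx))] with n hn
      exact (coordDeriv_softThreshold_of_lt hf.continuous (hδ0 n) i hn).symm
  have hfL : MemLp f 2 (volume.restrict Ω) := hf.continuous.memLp_of_hasCompactSupport hcf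
  have hGL : ∀ i, MemLp (G i) 2 (volume.restrict Ω) := fun i =>
    MemLp.of_bound (hGm i).aestronglyMeasurable L (Eventually.of_forall (hGb i))
  obtain ⟨B, hB⟩ := hcf.exists_bound_of_continuous hf.continuous
  have hfW : HasWeakGrad Ω f G := by
    refine hasWeakGrad_of_integral_eq hfL hGL fun i ψ hψ => ?_
    have hψi : ∀ k, IsTestFunction Ω k → Integrable k (volume.restrict Ω) := fun k hk =>
      (hk.memLp (volume.restrict Ω)).integrable (by norm_num)
    have l1 : Tendsto (fun n => ∫ x in Ω, F n x * partialDeriv i ψ x) atTop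
        (𝓝 (∫ x in Ω, f x * partialDeriv i ψ x)) := by
      refine tendsto_integral_of_dominated_convergence (fun x => (B + 1) * ‖partialDeriv i ψ x‖)
        (fun n => (hFL n).continuous.aestronglyMeasurable.mul (hψi _ (hψ.partialDeriv i)).1)
        ((hψi _ (hψ.partialDeriv i)).norm.const_mul _) (fun n => Eventually.of_forall fun x => ?_)
        (Eventually.of_forall fun x => (hFt x).mul_const _)
      rw [norm_mul]
      refine mul_le_mul_of_nonneg_right ?_ (norm_nonneg _)
      have h1 := abs_sub_softThreshold_le (hδ0 n).le (f x)
      have h2 := norm_sub_norm_le (F n x) (f x)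
      rw [norm_sub_rev] at h2
      rw [← Real.norm_eq_abs] at h1
      have h3 : ‖f x - F n x‖ ≤ δ n := h1
      linarith [hB x, hδ1 n]
    have l2 : Tendsto (fun n => ∫ x in Ω, coordDeriv i (F n) x * ψ x) atTop
        (𝓝 (∫ x in Ω, G i x * ψ x)) := by
      refine tendsto_integral_of_dominated_convergence (fun x => L * ‖ψ x‖)
        (fun n => (measurable_coordDeriv (hFL n).continuous i).aestronglyMeasurable.mul (hψi _ hψ).1)
        ((hψi _ hψ).norm.const_mul _) (fun n => Eventually.of_forall fun x => ?_)
        (Eventually.of_forall fun x => (hGt i x).mul_const _)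
      rw [norm_mul]
      exact mul_le_mul_of_nonneg_right (abs_coordDeriv_le (hFL n) i x) (norm_nonneg _)
    refine tendsto_nhds_unique l1 (l2.neg.congr fun n => ?_)
    exact ((hFW n).integral_eq hψ i).symm
  rw [memH10_iff hΩ hfW]
  intro ε hε
  have t0 := tendsto_integral_sub_sq hΩb (g := f) (F := F) (B := 1)
    (fun n => (hFL n).continuous.aestronglyMeasurable) hf.continuous.aestronglyMeasurable
    (fun n x => (abs_sub_softThreshold_le (hδ0 n).le _).trans (hδ1 n)) (Eventually.of_forall hFt)
  have t1 : ∀ i, Tendsto (fun n => ∫ x in Ω, (G i x - coordDeriv i (F n) x) ^ 2) atTop (𝓝 0) :=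
    fun i => tendsto_integral_sub_sq hΩb (B := 2 * L)
      (fun n => (measurable_coordDeriv (hFL n).continuous i).aestronglyMeasurable)
      (hGm i).aestronglyMeasurable (fun n x => by
        have h1 := hGb i x
        have h2 := abs_coordDeriv_le (hFL n) i x
        rw [Real.norm_eq_abs] at h2
        exact (abs_sub _ _).trans (by linarith)) (Eventually.of_forall (hGt i))
  have t2 := t0.add (tendsto_finsetSum Finset.univ fun i _ => t1 i)
  simp only [Finset.sum_const_zero, add_zero] at t2
  obtain ⟨n, hn⟩ := (t2.eventually (gt_mem_nhds (by positivity : 0 < ε / 4))).exists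
  obtain ⟨ψ, hψ, hψe⟩ := (memH10_iff hΩ (hFW n)).1 (hFH n) (ε / 4) (by positivity)
  refine ⟨ψ, hψ, ?_⟩
  have e0 := integral_sub_sq_le (hFW n).1 hfL (hψ.memLp (volume.restrict Ω))
  have e1 := Finset.sum_le_sum fun i (_ : i ∈ Finset.univ) =>
    integral_sub_sq_le ((hFW n).2 i).1 (hGL i) ((hψ.partialDeriv i).memLp (volume.restrict Ω))
  rw [Finset.sum_add_distrib, ← Finset.mul_sum, ← Finset.mul_sum] at e1
  have s0 : ∫ x in Ω, (F n x - f x) ^ 2 = ∫ x in Ω, (f x - F n x) ^ 2 := by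
    congr 1; funext x; ring
  have s1 : ∑ i, ∫ x in Ω, (coordDeriv i (F n) x - G i x) ^ 2 =
      ∑ i, ∫ x in Ω, (G i x - coordDeriv i (F n) x) ^ 2 :=
    Finset.sum_congr rfl fun i _ => by congr 1; funext x; ring
  rw [s0] at e0
  rw [s1] at e1
  linarith

end Bounded

open Filter Topology

/-! ### Matching of boundary values -/

/-- The function `f` has the limit `a` at `x` along the set `A`, which contains balls of radius
comparable to their distance from `x`. -/
structure ApproachesAlong (f : E3 → ℝ) (x : E3) (A : Set E3) (a : ℝ) : Prop where
  exists_ball : ∃ κ > 0, ∀ᶠ r in 𝓝[>] (0 : ℝ), ∃ y, Metric.ball y (κ * r) ⊆ Metric.ball x r ∩ A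
  eventually_close : ∀ δ > 0, ∃ r > 0, ∀ᵐ z ∂volume.restrict (Metric.ball x r ∩ A), |f z - a| ≤ δ

theorem volume_real_ball (y : E3) {r : ℝ} (hr : 0 ≤ r) :
    volume.real (Metric.ball y r) = r ^ 3 * volume.real (Metric.ball (0 : E3) 1) := by
  rw [Measure.real, Measure.addHaar_ball volume y hr, ENNReal.toReal_mul,
    ENNReal.toReal_ofReal (by positivity), Measure.real]
  simp

/-- A function with a weak gradient whose energy on balls around `x` decays quadratically has at
most one limit at `x`. -/
theorem limit_unique {f : E3 → ℝ} {G : Fin 3 → E3 → ℝ} (hf : HasWeakGrad univ f G) {x : E3} {C : ℝ}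
    (hC : 0 ≤ C)
    (hG : ∀ᶠ r in 𝓝[>] (0 : ℝ), ∑ i, lsq (Metric.ball x r) (G i) ≤ ENNReal.ofReal (C * r ^ 2))
    {A B : Set E3} {a b : ℝ} (hA : ApproachesAlong f x A a) (hB : ApproachesAlong f x B b) :
    a = b := by
  by_contra hne
  have hd : 0 < |a - b| := abs_pos.2 (sub_ne_zero.2 hne)
  obtain ⟨κ, hκ, hκA⟩ := hA.exists_ball
  obtain ⟨κ', hκ', hκB⟩ := hB.exists_ball
  obtain ⟨r₁, hr₁, h₁⟩ := hA.eventually_close (|a - b| / 4) (by positivity)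
  obtain ⟨r₂, hr₂, h₂⟩ := hB.eventually_close (|a - b| / 4) (by positivity)
  set V := volume.real (Metric.ball (0 : E3) 1) with hV
  have hV0 : 0 < V := ENNReal.toReal_pos
    (Metric.isOpen_ball.measure_pos volume ⟨_, Metric.mem_ball_self one_pos⟩).ne'
    Metric.isBounded_ball.measure_lt_top.ne
  -- Values within a quarter of `|a - b|` of `a` and `b` on two balls differ by half of it, so the
  -- double integral is at least `c r ^ 6`. Poincaré allows at most `8 (2r) ^ 2 (V r ^ 3) (C r ^ 2)
  -- = 32 V C r ^ 7`.
  set c := V * κ ^ 3 * (V * κ' ^ 3) * (|a - b| / 2) ^ 2 with hc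
  have hc0 : 0 < c := by positivity
  have hsmall : ∀ᶠ r in 𝓝[>] (0 : ℝ), 32 * V * C * r < c := by
    have : Tendsto (fun r : ℝ => 32 * V * C * r) (𝓝[>] 0) (𝓝 (32 * V * C * 0)) :=
      (tendsto_id.const_mul _).mono_left nhdsWithin_le_nhds
    rw [mul_zero] at this
    exact this.eventually (gt_mem_nhds hc0)
  have hlt₁ : ∀ᶠ r in 𝓝[>] (0 : ℝ), r < r₁ := nhdsWithin_le_nhds (gt_mem_nhds hr₁)
  have hlt₂ : ∀ᶠ r in 𝓝[>] (0 : ℝ), r < r₂ := nhdsWithin_le_nhds (gt_mem_nhds hr₂)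
  obtain ⟨r, ⟨⟨⟨⟨⟨⟨hr, hsm⟩, hr1⟩, hr2⟩, y, hy⟩, y', hy'⟩, hE⟩⟩ :=
    ((((((eventually_mem_nhdsWithin.and hsmall).and hlt₁).and hlt₂).and hκA).and hκB).and hG).exists
  have hr0 : 0 < r := hr
  have hp := poincare_lintegral Metric.isOpen_ball (convex_ball x r) (D := 2 * r)
    (fun z hz w hw => by
      rw [← dist_eq_norm]
      have h1 := Metric.mem_ball.1 hw
      have h2 := Metric.mem_ball'.1 hz
      have := dist_triangle w x z
      linarith) (hf.mono (subset_univ (Metric.ball x r)))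
  have hlow : ENNReal.ofReal c * ENNReal.ofReal (r ^ 6) ≤
      ∫⁻ q : E3 × E3, ‖f q.2 - f q.1‖ₑ ^ 2
        ∂(volume.restrict (Metric.ball x r)).prod (volume.restrict (Metric.ball x r)) := by
    have hsub1 : Metric.ball y (κ * r) ⊆ Metric.ball x r₁ ∩ A :=
      fun z hz => ⟨Metric.ball_subset_ball hr1.le (hy hz).1, (hy hz).2⟩
    have hsub2 : Metric.ball y' (κ' * r) ⊆ Metric.ball x r₂ ∩ B :=
      fun z hz => ⟨Metric.ball_subset_ball hr2.le (hy' hz).1, (hy' hz).2⟩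
    have hae1 : ∀ᵐ z ∂volume.restrict (Metric.ball y (κ * r)), |f z - a| ≤ |a - b| / 4 :=
      ae_restrict_of_ae_restrict_of_subset hsub1 h₁
    have hae2 : ∀ᵐ z ∂volume.restrict (Metric.ball y' (κ' * r)), |f z - b| ≤ |a - b| / 4 :=
      ae_restrict_of_ae_restrict_of_subset hsub2 h₂
    have hvol : ∀ (z : E3) (k : ℝ), 0 < k → volume (Metric.ball z (k * r)) =
        ENNReal.ofReal (V * k ^ 3 * r ^ 3) := fun z k hk => by
      rw [← ENNReal.ofReal_toReal (Metric.isBounded_ball.measure_lt_top.ne :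
        volume (Metric.ball z (k * r)) ≠ ⊤)]
      congr 1
      have := volume_real_ball z (by positivity : 0 ≤ k * r)
      rw [Measure.real] at this
      rw [this, hV]; ring
    calc ENNReal.ofReal c * ENNReal.ofReal (r ^ 6)
        = ∫⁻ q : E3 × E3, ENNReal.ofReal ((|a - b| / 2) ^ 2)
          ∂(volume.restrict (Metric.ball y (κ * r))).prod
            (volume.restrict (Metric.ball y' (κ' * r))) := by
          rw [lintegral_const, ← univ_prod_univ, Measure.prod_prod, Measure.restrict_apply_univ,
            Measure.restrict_apply_univ, hvol _ _ hκ, hvol _ _ hκ', ← ENNReal.ofReal_mul hc0.le,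
            ← ENNReal.ofReal_mul (by positivity), ← ENNReal.ofReal_mul (by positivity), hc]
          congr 1; ring
      _ ≤ ∫⁻ q : E3 × E3, ‖f q.2 - f q.1‖ₑ ^ 2
          ∂(volume.restrict (Metric.ball y (κ * r))).prod
            (volume.restrict (Metric.ball y' (κ' * r))) := by
          refine lintegral_mono_ae ?_
          filter_upwards [Measure.quasiMeasurePreserving_fst.ae hae1,
            Measure.quasiMeasurePreserving_snd.ae hae2] with q hq1 hq2
          rw [enorm_sq_eq]
          refine ENNReal.ofReal_le_ofReal ?_
          rw [← sq_abs (f q.2 - f q.1)]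
          refine pow_le_pow_left₀ (by positivity) ?_ 2
          have h1 := abs_sub_abs_le_abs_sub (a - b) (f q.1 - f q.2)
          have h2 : |a - b - (f q.1 - f q.2)| ≤ |f q.2 - b| + |f q.1 - a| := by
            have : a - b - (f q.1 - f q.2) = (f q.2 - b) - (f q.1 - a) := by ring
            rw [this]; exact abs_sub _ _
          rw [abs_sub_comm (f q.1)] at h1
          linarith
      _ ≤ _ := by
          rw [Measure.prod_restrict, Measure.prod_restrict]
          exact lintegral_mono_set (prod_mono (fun z hz => (hy hz).1) fun z hz => (hy' hz).1)
  have hvr : volume (Metric.ball x r) = ENNReal.ofReal (V * r ^ 3) := by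
    rw [← ENNReal.ofReal_toReal (Metric.isBounded_ball.measure_lt_top.ne :
        volume (Metric.ball x r) ≠ ⊤)]
    congr 1
    have := volume_real_ball x hr0.le
    rw [Measure.real] at this
    rw [this, hV]; ring
  have hup := hlow.trans (hp.trans (mul_le_mul' le_rfl hE))
  rw [hvr, ← ENNReal.ofReal_pow (by positivity), ← ENNReal.ofReal_mul hc0.le,
    show (8 : ENNReal) = ENNReal.ofReal 8 by norm_num, ← ENNReal.ofReal_mul (by norm_num),
    ← ENNReal.ofReal_mul (by positivity), ← ENNReal.ofReal_mul (by positivity),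
    ENNReal.ofReal_le_ofReal_iff (by positivity)] at hup
  have h6 : 0 < r ^ 6 := by positivity
  have : c * r ^ 6 ≤ 32 * V * C * r * r ^ 6 := hup.trans_eq (by ring)
  have := le_of_mul_le_mul_right this h6
  linarith

theorem abs_bary_sub_le (x y : E3) (k : Fin 4) : |bary x k - bary y k| ≤ 3 * ‖x - y‖ := by
  have h : ∀ i, |x i - y i| ≤ ‖x - y‖ := fun i => PiLp.norm_apply_le (x - y) i
  have h0 := h 0
  have h1 := h 1
  have h2 := h 2
  have hn := norm_nonneg (x - y)
  rw [abs_le] at *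
  fin_cases k <;> simp [bary] <;> constructor <;> linarith

/-- Near a point of a tetrahedron, the tetrahedron looks like a cone with apex at this point. -/
theorem exists_cone (φ : E3 ≃ᵃ[ℝ] E3) {x : E3} (hx : x ∈ φ '' refTet) :
    ∃ C > 0, ∀ r > 0, ∀ y ∈ interior (φ '' refTet), dist y x < r →
      x + (C * r)⁻¹ • (y - x) ∈ interior (φ '' refTet) := by
  obtain ⟨a, ha, rfl⟩ := hx
  set Λ : ℝ := 3 * ‖LinearMap.toContinuousLinearMap (φ.symm.linear : E3 →ₗ[ℝ] E3)‖ with hΛ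
  have hΛ0 : 0 ≤ Λ := by positivity
  -- Only faces not containing `a` limit how far a nearby point may be pushed away from `a`. Since
  -- `Λ` bounds the change of a barycentric coordinate per unit distance, stretching by `(Ck k *
  -- r)⁻¹` cannot reach face `k`. For a face through `a` any value will do.
  set Ck : Fin 4 → ℝ := fun k => if bary a k = 0 then 1 else (Λ + 1) / bary a k with hCk
  have hCk0 : ∀ k, 0 < Ck k := fun k => by
    simp only [hCk]
    split_ifs with h
    · exact one_pos
    · exact div_pos (by linarith) (lt_of_le_of_ne (ha k) (Ne.symm h))
  have hC0 : 0 < ∑ k, Ck k := Finset.sum_pos (fun k _ => hCk0 k) Finset.univ_nonempty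
  refine ⟨∑ k, Ck k, hC0, fun r hr y hy hyx => ?_⟩
  rw [interior_image_refTet, interior_refTet] at hy ⊢
  obtain ⟨b, hb, rfl⟩ := hy
  set s := (∑ k, Ck k) * r with hs
  have hs0 : 0 < s := mul_pos hC0 hr
  refine ⟨(1 - s⁻¹) • a + s⁻¹ • b, fun k => ?_, ?_⟩
  · rw [bary_combo (by ring)]
    have hΔ : |bary b k - bary a k| ≤ Λ * r := by
      refine (abs_bary_sub_le b a k).trans ?_
      have h1 : b - a = LinearMap.toContinuousLinearMap (φ.symm.linear : E3 →ₗ[ℝ] E3) (φ b - φ a) := by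
        have e1 := affineEquiv_apply φ.symm (φ b)
        have e2 := affineEquiv_apply φ.symm (φ a)
        rw [AffineEquiv.symm_apply_apply] at e1 e2
        rw [map_sub]
        conv_lhs => rw [e1, e2]
        simp
      have h2 : ‖b - a‖ ≤ ‖LinearMap.toContinuousLinearMap (φ.symm.linear : E3 →ₗ[ℝ] E3)‖ * r := by
        conv_lhs => rw [h1]
        refine (ContinuousLinearMap.le_opNorm _ _).trans ?_
        rw [← dist_eq_norm]
        gcongr
      rw [hΛ, mul_assoc]
      gcongr
    by_cases hk : bary a k = 0
    · rw [hk, mul_zero, zero_add]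
      exact mul_pos (inv_pos.2 hs0) (hb k)
    · have hka : 0 < bary a k := lt_of_le_of_ne (ha k) (Ne.symm hk)
      have h1 : Ck k ≤ ∑ k, Ck k := Finset.single_le_sum (fun k _ => (hCk0 k).le) (Finset.mem_univ k)
      have h2 : (Λ + 1) * r ≤ s * bary a k := by
        have : Ck k * bary a k = Λ + 1 := by
          simp only [hCk, if_neg hk]; field_simp
        calc (Λ + 1) * r = Ck k * r * bary a k := by rw [← this]; ring
          _ ≤ (∑ k, Ck k) * r * bary a k := by gcongr
      have h3 : -(Λ * r) ≤ bary b k - bary a k := (abs_le.1 hΔ).1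
      have h4 : (1 - s⁻¹) * bary a k + s⁻¹ * bary b k =
          s⁻¹ * (s * bary a k + (bary b k - bary a k)) := by field_simp; ring
      rw [h4]
      exact mul_pos (inv_pos.2 hs0) (by nlinarith)
  · rw [affineEquiv_apply φ, affineEquiv_apply φ a, affineEquiv_apply φ b]
    simp only [map_add, map_smul]
    module

/-- A ball inside the element, contracted towards `x` by a factor proportional to `r`, remains
inside by convexity and sits in the ball of radius `r`. -/
theorem approachesAlong_elem (φ : E3 ≃ᵃ[ℝ] E3) {x : E3} (hx : x ∈ φ '' refTet) {f k : E3 → ℝ}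
    (hk : Continuous k) (hfk : ∀ᵐ z ∂volume.restrict (interior (φ '' refTet)), f z = k z) :
    ApproachesAlong f x (interior (φ '' refTet)) (k x) := by
  constructor
  · obtain ⟨z, hz⟩ := interior_image_refTet_nonempty φ
    obtain ⟨ρ, hρ, hball⟩ := Metric.isOpen_iff.1 isOpen_interior z hz
    set d := ‖z - x‖ + ρ with hd
    have hd0 : 0 < d := by positivity
    refine ⟨ρ / d, by positivity, ?_⟩
    filter_upwards [eventually_mem_nhdsWithin,
      nhdsWithin_le_nhds (gt_mem_nhds hd0)] with r hr hrd
    have hr0 : 0 < r := hr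
    set s := r / d with hs
    have hs0 : 0 < s := by positivity
    have hs1 : s < 1 := (div_lt_one hd0).2 hrd
    refine ⟨x + s • (z - x), fun w hw => ⟨?_, ?_⟩⟩
    · rw [Metric.mem_ball, dist_eq_norm] at hw ⊢
      have h1 : ‖w - x‖ ≤ ‖w - (x + s • (z - x))‖ + ‖s • (z - x)‖ := by
        have : w - x = (w - (x + s • (z - x))) + s • (z - x) := by module
        conv_lhs => rw [this]
        exact norm_add_le _ _
      rw [norm_smul, Real.norm_eq_abs, abs_of_pos hs0] at h1
      have h2 : ρ / d * r + s * ‖z - x‖ = r := by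
        rw [hs, hd]; field_simp; ring
      linarith
    · have hw' : z + s⁻¹ • (w - (x + s • (z - x))) ∈ interior (φ '' refTet) := by
        refine hball ?_
        rw [Metric.mem_ball, dist_eq_norm] at hw ⊢
        rw [add_sub_cancel_left, norm_smul, norm_inv, Real.norm_eq_abs, abs_of_pos hs0,
          inv_mul_lt_iff₀ hs0]
        refine hw.trans_eq ?_
        rw [hs]; ring
      have h3 := (convex_image_refTet φ).combo_closure_interior_mem_interior (subset_closure hx) hw'
        (by linarith : 0 ≤ 1 - s) hs0 (by ring)
      have h4 : (1 - s) • x + s • (z + s⁻¹ • (w - (x + s • (z - x)))) = w := by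
        rw [smul_add, smul_smul, mul_inv_cancel₀ hs0.ne']
        module
      rwa [h4] at h3
  · intro δ hδ
    obtain ⟨r, hr, hb⟩ := Metric.continuousAt_iff.1 (hk.continuousAt (x := x)) δ hδ
    refine ⟨r, hr, ?_⟩
    have h1 : ∀ᵐ z ∂volume.restrict (Metric.ball x r ∩ interior (φ '' refTet)), f z = k z :=
      ae_restrict_of_ae_restrict_of_subset inter_subset_right hfk
    filter_upwards [h1, ae_restrict_mem (Metric.isOpen_ball.inter isOpen_interior).measurableSet]
      with z hz hzm
    rw [hz, ← Real.dist_eq]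
    exact (hb hzm.1).le

theorem approachesAlong_exterior {Ω : Set E3} (hΩ : IsLipschitzDomain Ω) {x : E3}
    (hx : x ∈ frontier Ω) (u : E3 → ℝ) :
    ApproachesAlong (Ω.indicator u) x (closure Ω)ᶜ 0 := by
  constructor
  · obtain ⟨κ, hκ, r₀, hr₀, h⟩ := exists_exterior_ball hΩ hx
    refine ⟨κ, hκ, ?_⟩
    filter_upwards [eventually_mem_nhdsWithin, nhdsWithin_le_nhds (gt_mem_nhds hr₀)] with r hr hr'
    obtain ⟨y, hy1, hy2⟩ := h r hr hr'
    exact ⟨y, fun z hz => ⟨hy1 hz, Set.disjoint_left.1 hy2 hz⟩⟩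
  · intro δ hδ
    refine ⟨1, one_pos, ?_⟩
    refine ae_restrict_of_forall_mem
      (Metric.isOpen_ball.inter isClosed_closure.isOpen_compl).measurableSet fun z hz => ?_
    rw [indicator_of_notMem fun h => hz.2 (subset_closure h)]
    simpa using hδ.le

/-- Near a point `x` of the element, the element lies in its own homothetic copy with centre `x` and
factor proportional to `r`, and the cone estimate gives `r ^ 2`. Away from the element the
intersection is eventually empty. -/
theorem energy_elem_le (φ : E3 ≃ᵃ[ℝ] E3) {g : E3 → ℝ} {H : Fin 3 → E3 → ℝ}
    (hg : HasWeakGrad (interior (φ '' refTet)) g H) (x : E3) :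
    ∃ C ≥ 0, ∀ᶠ r in 𝓝[>] (0 : ℝ),
      lsq (Metric.ball x r ∩ interior (φ '' refTet)) g ≤ ENNReal.ofReal (C * r ^ 2) := by
  by_cases hx : x ∈ φ '' refTet
  · obtain ⟨c, hc, hcone⟩ := exists_cone φ hx
    obtain ⟨z, hz⟩ := interior_image_refTet_nonempty φ
    obtain ⟨ρ, hρ, hball⟩ := Metric.isOpen_iff.1 isOpen_interior z hz
    set D := Metric.diam (φ '' refTet) with hD
    have hbd := (isCompact_image_refTet φ).isBounded
    set K := 2 * lsq (interior (φ '' refTet)) g +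
      8 * ENNReal.ofReal D ^ 2 * ∑ i, lsq (interior (φ '' refTet)) (H i) with hK
    have hKt : K ≠ ⊤ := by
      have hl : ∀ {k : E3 → ℝ}, MemLp k 2 (volume.restrict (interior (φ '' refTet))) →
          lsq (interior (φ '' refTet)) k ≠ ⊤ := fun hk => by
        rw [lsq_eq hk]; exact ENNReal.ofReal_ne_top
      refine ENNReal.add_ne_top.2 ⟨ENNReal.mul_ne_top (by norm_num) (hl hg.1), ?_⟩
      refine ENNReal.mul_ne_top (ENNReal.mul_ne_top (by norm_num)
        (ENNReal.pow_ne_top ENNReal.ofReal_ne_top)) ?_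
      exact ENNReal.sum_ne_top.2 fun i _ => hl (hg.2 i).1
    refine ⟨c ^ 2 * K.toReal, by positivity, ?_⟩
    filter_upwards [eventually_mem_nhdsWithin,
      nhdsWithin_le_nhds (gt_mem_nhds (inv_pos.2 hc))] with r hr hrc
    have hr0 : 0 < r := hr
    have hs1 : c * r ≤ 1 := by
      have := mul_lt_mul_of_pos_left hrc hc
      rw [mul_inv_cancel₀ hc.ne'] at this
      exact this.le
    have h := lintegral_sq_cone_le isOpen_interior (convex_image_refTet φ).interior (D := D)
      (fun y hy w hw => by
        rw [← dist_eq_norm]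
        exact Metric.dist_le_diam_of_mem hbd (interior_subset hw) (interior_subset hy))
      hg hρ hball (ξ := x) (by rwa [closure_interior_image_refTet]) (mul_pos hc hr0) hs1
    calc lsq (Metric.ball x r ∩ interior (φ '' refTet)) g
        ≤ ∫⁻ y in {y | x + (c * r)⁻¹ • (y - x) ∈ interior (φ '' refTet)}, ‖g y‖ₑ ^ 2 :=
          lintegral_mono_set fun y hy => hcone r hr0 y hy.2 hy.1
      _ ≤ ENNReal.ofReal ((c * r) ^ 2) * K := h
      _ = _ := by
          rw [← ENNReal.ofReal_toReal hKt, ← ENNReal.ofReal_mul (sq_nonneg _),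
            ENNReal.toReal_ofReal ENNReal.toReal_nonneg]
          congr 1; ring
  · refine ⟨0, le_rfl, ?_⟩
    have hopen : (φ '' refTet)ᶜ ∈ 𝓝 x :=
      (isCompact_image_refTet φ).isClosed.isOpen_compl.mem_nhds hx
    obtain ⟨ε, hε, hb⟩ := Metric.mem_nhds_iff.1 hopen
    filter_upwards [nhdsWithin_le_nhds (gt_mem_nhds hε)] with r hr
    have he : Metric.ball x r ∩ interior (φ '' refTet) = ∅ := by
      rw [← Set.disjoint_iff_inter_eq_empty, Set.disjoint_left]
      intro y hy hy'
      exact hb (Metric.ball_subset_ball hr.le hy) (interior_subset hy')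
    rw [he, lsq]
    simp

/-! ### Agreement across elements and vanishing boundary values -/

section Matching

variable {Ω : Set E3} (hΩ : IsLipschitzDomain Ω) (T : TetMesh Ω) {u : E3 → ℝ} (hu : MemH10 Ω u)
  {H : Fin 3 → Fin 3 → E3 → ℝ} (hH : ∀ i, HasWeakGrad Ω (wgrad Ω u i) (H i))

include hΩ T hH

theorem energy_ball_le (x : E3) : ∃ C ≥ 0, ∀ᶠ r in 𝓝[>] (0 : ℝ),
    ∑ i, lsq (Metric.ball x r) (Ω.indicator (wgrad Ω u i)) ≤ ENNReal.ofReal (C * r ^ 2) := by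
  have h := fun (i : Fin 3) (e : Fin T.N) => energy_elem_le (T.φ e)
    ((hH i).mono (T.interior_elem_subset hΩ e)) x
  choose C hC0 hC using h
  have hC0' : ∀ i e, 0 ≤ C i e := hC0
  refine ⟨∑ i, ∑ e, C i e, Finset.sum_nonneg fun i _ => Finset.sum_nonneg fun e _ => hC0' i e, ?_⟩
  filter_upwards [eventually_all.2 fun i => eventually_all.2 fun e => hC i e] with r hr
  rw [Finset.sum_mul, ENNReal.ofReal_sum_of_nonneg fun i _ => mul_nonneg
    (Finset.sum_nonneg fun e _ => hC0' i e) (sq_nonneg _)]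
  refine Finset.sum_le_sum fun i _ => ?_
  rw [Finset.sum_mul, ENNReal.ofReal_sum_of_nonneg fun e _ => mul_nonneg (hC0' i e) (sq_nonneg _)]
  have hind : lsq (Metric.ball x r) (Ω.indicator (wgrad Ω u i)) =
      lsq (Metric.ball x r ∩ Ω) (wgrad Ω u i) := by
    rw [lsq, lsq, inter_comm, ← Measure.restrict_restrict hΩ.1.measurableSet,
      ← lintegral_indicator hΩ.1.measurableSet]
    congr 1; funext y
    by_cases hy : y ∈ Ω <;> simp [hy]
  have hae : (Metric.ball x r ∩ Ω : Set E3) =ᵐ[volume]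
      (⋃ e, Metric.ball x r ∩ interior (T.elem e) : Set E3) := by
    rw [← inter_iUnion]
    exact (EventuallyEq.refl _ _).inter (T.ae_eq_iUnion_interior hΩ)
  rw [hind, lsq, Measure.restrict_congr_set hae]
  refine (lintegral_iUnion_le _ _).trans ?_
  rw [tsum_fintype]
  exact Finset.sum_le_sum fun e _ => hr i e

include hu

/-- The matching works at any common point, also when the elements share only an edge or a vertex,
where a trace argument through one common face would not apply. -/
theorem value_eq_of_mem_inter {k k' : E3 → ℝ} (hk : Continuous k) (hk' : Continuous k')
    {e e' : Fin T.N} (hke : ∀ᵐ x ∂volume.restrict (interior (T.elem e)), u x = k x)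
    (hke' : ∀ᵐ x ∂volume.restrict (interior (T.elem e')), u x = k' x) {x : E3}
    (hx : x ∈ T.elem e) (hx' : x ∈ T.elem e') : k x = k' x := by
  obtain ⟨C, hC, hE⟩ := energy_ball_le hΩ T hH x
  have hind : ∀ {k : E3 → ℝ} {e : Fin T.N},
      (∀ᵐ x ∂volume.restrict (interior (T.elem e)), u x = k x) →
      ∀ᵐ x ∂volume.restrict (interior (T.elem e)), Ω.indicator u x = k x := fun h => by
    filter_upwards [h, ae_restrict_mem isOpen_interior.measurableSet] with y hy hym
    rw [indicator_of_mem (T.interior_elem_subset hΩ _ hym), hy]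
  exact limit_unique (hu.hasWeakGrad_indicator hΩ.1) hC hE
    (approachesAlong_elem (T.φ e) hx hk (hind hke))
    (approachesAlong_elem (T.φ e') hx' hk' (hind hke'))

/-- Same comparison with the exterior of `Ω` as the second set, where the extension by zero has the
limit zero. -/
theorem value_eq_zero {k : E3 → ℝ} (hk : Continuous k)
    {e : Fin T.N} (hke : ∀ᵐ x ∂volume.restrict (interior (T.elem e)), u x = k x) {x : E3}
    (hx : x ∈ T.elem e) (hx' : x ∉ Ω) : k x = 0 := by
  obtain ⟨C, hC, hE⟩ := energy_ball_le hΩ T hH x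
  have hind : ∀ᵐ x ∂volume.restrict (interior (T.elem e)), Ω.indicator u x = k x := by
    filter_upwards [hke, ae_restrict_mem isOpen_interior.measurableSet] with y hy hym
    rw [indicator_of_mem (T.interior_elem_subset hΩ _ hym), hy]
  have hfr : x ∈ frontier Ω := ⟨T.elem_subset e hx, by rwa [hΩ.1.interior_eq]⟩
  exact limit_unique (hu.hasWeakGrad_indicator hΩ.1) hC hE
    (approachesAlong_elem (T.φ e) hx hk hind) (approachesAlong_exterior hΩ hfr u)

end Matching

open Filter Topology

/-! ### Conformity of nodal interpolation -/

/-- The face conformity condition holds for intersections of faces. -/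
theorem RefElement.Conditions.eq_zero_on_face {R : RefElement} {p : ℕ} (hR : R.Conditions p)
    {K : Finset (Fin 4)} (hK : K.Nonempty) {q : MvPolynomial (Fin 3) ℝ} (hq : q ∈ R.U)
    (h : ∀ x ∈ R.Q, (∀ l ∈ K, bary x l = 0) → pval q x = 0) :
    ∀ x ∈ refTet, (∀ l ∈ K, bary x l = 0) → pval q x = 0 := by
  classical
  induction hK using Finset.Nonempty.cons_induction generalizing q with
  | singleton k =>
    intro x hx hxk
    refine hR.c3 k q hq (fun y hy hyk => h y hy fun l hl => ?_) x ⟨hx, hxk k (by simp)⟩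
    rw [Finset.mem_singleton.1 hl]; exact hyk.2
  | cons k K hk hKne ih =>
    intro x hx hxk
    -- The interpolant `q'` keeps the nodal values of `q` on the larger intersection face and drops
    -- the others. Then `q - q'` is covered by the induction hypothesis, and `q'` vanishes at all
    -- nodes of the new face, so C3 applies to it.
    obtain ⟨q', hq', hq'Q⟩ := hR.exists_interp fun y => if ∀ l ∈ K, bary y l = 0 then pval q y else 0
    have h1 : pval (q - q') x = 0 := by
      refine ih (R.U.sub_mem hq hq') (fun y hy hyK => ?_) x hx fun l hl =>
        hxk l (Finset.mem_cons_of_mem hl)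
      rw [pval_sub, hq'Q y hy, if_pos hyK, sub_self]
    have h2 : pval q' x = 0 := by
      refine hR.c3 k q' hq' (fun y hy hyk => ?_) x ⟨hx, hxk k (Finset.mem_cons_self k K)⟩
      rw [hq'Q y hy]
      split_ifs with hyK
      · refine h y hy fun l hl => ?_
        rcases Finset.mem_cons.1 hl with rfl | hl
        · exact hyk.2
        · exact hyK l hl
      · rfl
    rw [pval_sub, h2, sub_zero] at h1
    exact h1

section Mesh

variable {Ω : Set E3} (T : TetMesh Ω)

/-- The common face of two elements, in terms of a subset of the vertices of the first element and a
renumbering of the vertices. -/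
theorem TetMesh.exists_common_face {e e' : Fin T.N} (he : e ≠ e') :
    ∃ (S : Finset (Fin 4)) (σ : Equiv.Perm (Fin 4)), Sᶜ.Nonempty ∧
      (∀ x, (∀ k ∉ S, bary x k = 0) → T.φ e' (permMap σ x) = T.φ e x) ∧
      ∀ x, T.φ e x ∈ T.elem e ∩ T.elem e' → ∀ k ∉ S, bary x k = 0 := by
  classical
  set S : Finset (Fin 4) := Finset.univ.filter fun k => T.φ e (vert k) ∈ T.φ e' '' refVertices with hS
  have hmap : ∀ k ∈ S, ∃ l, T.φ e' (vert l) = T.φ e (vert k) := fun k hk => by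
    obtain ⟨y, hy, hyk⟩ := (Finset.mem_filter.1 hk).2
    rw [← range_vert] at hy
    obtain ⟨l, rfl⟩ := hy
    exact ⟨l, hyk⟩
  have hf : ∃ f : Fin 4 → Fin 4, ∀ k ∈ S, T.φ e' (vert (f k)) = T.φ e (vert k) := by
    choose! f hf using hmap
    exact ⟨f, hf⟩
  obtain ⟨f, hf⟩ := hf
  have hinj : InjOn f S := fun k hk l hl hkl => by
    have h1 := hf k hk
    rw [hkl, hf l hl] at h1
    exact (vert_injective ((T.φ e).injective h1)).symm
  -- The matching of common vertices is extended arbitrarily to a permutation of all four; the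
  -- remaining vertices carry zero weight on the common face.
  obtain ⟨g, hg⟩ := Finset.exists_equiv_extend_of_card_eq (t := (Finset.univ : Finset (Fin 4)))
    (by simp) (s := S) (f := f) (by simp) hinj
  set σ : Equiv.Perm (Fin 4) := g.trans (Equiv.subtypeUnivEquiv fun x => Finset.mem_univ x) with hσ
  have hσf : ∀ k ∈ S, σ k = f k := fun k hk => hg k hk
  have hperm : ∀ x, (∀ k ∉ S, bary x k = 0) → T.φ e' (permMap σ x) = T.φ e x := fun x hx => by
    rw [permMap_apply, affine_eq_sum (T.φ e) x]
    refine (affine_sum_smul (T.φ e' : E3 →ᵃ[ℝ] E3) _ (sum_bary x) _).trans ?_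
    refine Finset.sum_congr rfl fun k _ => ?_
    by_cases hk : k ∈ S
    · rw [hσf k hk]
      exact congrArg (fun z => bary x k • z) (hf k hk)
    · rw [hx k hk, zero_smul, zero_smul]
  refine ⟨S, σ, ?_, hperm, ?_⟩
  · rw [Finset.nonempty_iff_ne_empty]
    intro hemp
    have hall : ∀ k, k ∈ S := fun k => by
      by_contra hk
      have := Finset.mem_compl.2 hk
      rw [hemp] at this
      simp at this
    have heq : T.elem e ⊆ T.elem e' := by
      rintro _ ⟨x, hx, rfl⟩
      rw [← hperm x fun k hk => absurd (hall k) hk]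
      refine mem_image_of_mem _ ?_
      rw [← permMap_image σ]
      exact mem_image_of_mem _ hx
    obtain ⟨z, hz⟩ := interior_image_refTet_nonempty (T.φ e)
    exact Set.disjoint_left.1 (T.disjoint_interior e e' he) hz (interior_mono heq hz)
  · intro x hx k hk
    -- Vanishing of one barycentric coordinate is a convex condition. It holds at the common
    -- vertices, hence on their convex hull, which conformity identifies with the intersection.
    have hconv : Convex ℝ {y : E3 | bary ((T.φ e).symm y) k = 0} := by
      intro y hy z hz a b _ _ hab
      have h1 : (T.φ e).symm (a • y + b • z) = a • (T.φ e).symm y + b • (T.φ e).symm z := by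
        rw [affineEquiv_apply _ (a • y + b • z), affineEquiv_apply _ y, affineEquiv_apply _ z, map_add,
          map_smul, map_smul, smul_add, smul_add, add_add_add_comm, ← add_smul, hab, one_smul]
      simp only [mem_ofPred_eq] at hy hz ⊢
      rw [h1, bary_combo hab, hy, hz]; ring
    have h2 : T.φ e '' refVertices ∩ T.φ e' '' refVertices ⊆
        {y : E3 | bary ((T.φ e).symm y) k = 0} := by
      rintro _ ⟨⟨v, hv, rfl⟩, hv'⟩
      rw [← range_vert] at hv
      obtain ⟨l, rfl⟩ := hv
      simp only [mem_ofPred_eq, AffineEquiv.symm_apply_apply]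
      rw [bary_vert, if_neg]
      rintro rfl
      exact hk (Finset.mem_filter.2 ⟨Finset.mem_univ _, hv'⟩)
    have h3 : T.φ e x ∈ convexHull ℝ (T.φ e '' refVertices ∩ T.φ e' '' refVertices) := by
      rw [← T.conforming e e' he]; exact hx
    have h4 := convexHull_min h2 hconv h3
    simpa using h4

/-- If a point of an element is not in `Ω`, then neither is any point of the smallest face that
contains it. -/
theorem TetMesh.face_notMem (hΩ : IsLipschitzDomain Ω) (e : Fin T.N) {x z : E3} (hx : x ∈ refTet)
    (hxΩ : T.φ e x ∉ Ω) (hz : z ∈ refTet) (hzx : ∀ k, bary x k = 0 → bary z k = 0) :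
    T.φ e z ∉ Ω := by
  intro hzΩ
  apply hxΩ
  have hφ := continuous_affineEquiv (T.φ e)
  -- a point `x'` of `Ω` in the relative interior of the face
  have hτ : ∀ᶠ τ in 𝓝[>] (0 : ℝ), T.φ e ((1 - τ) • z + τ • x) ∈ Ω := by
    have hc : Continuous fun τ : ℝ => T.φ e ((1 - τ) • z + τ • x) := hφ.comp (by fun_prop)
    have h0 : T.φ e ((1 - (0 : ℝ)) • z + (0 : ℝ) • x) ∈ Ω := by simpa using hzΩ
    exact nhdsWithin_le_nhds ((hΩ.1.preimage hc).mem_nhds h0)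
  obtain ⟨τ, ⟨hτΩ, hτ0⟩, hτ1⟩ := ((hτ.and eventually_mem_nhdsWithin).and
    (nhdsWithin_le_nhds (gt_mem_nhds (one_pos : (0 : ℝ) < 1)))).exists
  have hτ0' : 0 < τ := hτ0
  set x' := (1 - τ) • z + τ • x with hx'
  have hbx' : ∀ k, bary x' k = (1 - τ) * bary z k + τ * bary x k := fun k =>
    bary_combo (by ring) z x k
  have hx'pos : ∀ k, bary x k ≠ 0 → bary x' k ≠ 0 := fun k hk => by
    rw [hbx']
    have h1 : 0 < bary x k := lt_of_le_of_ne (hx k) (Ne.symm hk)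
    have h2 := hz k
    have : 0 ≤ (1 - τ) * bary z k := mul_nonneg (by linarith) h2
    have := mul_pos hτ0' h1
    linarith
  have hx'T : x' ∈ refTet := fun k => by
    rw [hbx']
    have := mul_nonneg (by linarith : 0 ≤ 1 - τ) (hz k)
    have := mul_nonneg hτ0'.le (hx k)
    linarith
  -- a point `a` of the face on the other side of `x`
  have hη : ∀ᶠ η in 𝓝[>] (0 : ℝ), ∀ k, 0 ≤ (1 + η) * bary x k + (-η) * bary x' k := by
    refine eventually_all.2 fun k => ?_
    by_cases hk : bary x k = 0
    · refine Eventually.of_forall fun η => ?_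
      rw [hbx', hk, hzx k hk]; simp
    · have h1 : 0 < bary x k := lt_of_le_of_ne (hx k) (Ne.symm hk)
      have hc : Continuous fun η : ℝ => (1 + η) * bary x k + (-η) * bary x' k := by fun_prop
      have h0 := (hc.tendsto 0).eventually (lt_mem_nhds (show 0 < (1 + (0 : ℝ)) * bary x k +
        (-(0 : ℝ)) * bary x' k by simpa using h1))
      exact nhdsWithin_le_nhds (h0.mono fun η h => h.le)
  obtain ⟨η, hηk, hη0⟩ := (hη.and eventually_mem_nhdsWithin).exists
  have hη0' : 0 < η := hη0
  set a := (1 + η) • x + (-η) • x' with ha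
  have hba : ∀ k, bary a k = (1 + η) * bary x k + (-η) * bary x' k := fun k =>
    bary_combo (by ring) x x' k
  have haT : a ∈ refTet := fun k => by rw [hba]; exact hηk k
  -- a neighbourhood of `x'` is covered by elements that contain the face
  have hnear : ∀ᶠ w in 𝓝 (T.φ e x'), w ∈ Ω ∧ ∀ e', T.φ e x' ∉ T.elem e' → w ∉ T.elem e' := by
    refine Eventually.and (hΩ.1.mem_nhds hτΩ) (eventually_all.2 fun e' => ?_)
    by_cases h : T.φ e x' ∈ T.elem e'
    · exact Eventually.of_forall fun w hw => absurd h hw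
    · filter_upwards [(T.isCompact_elem e').isClosed.isOpen_compl.mem_nhds h] with w hw _ using hw
  obtain ⟨ε, hε, hball⟩ := Metric.mem_nhds_iff.1 hnear
  -- With this `s` one has `x = (1 - s) a + s x'`. A ball about the image of `x` is thus the
  -- contraction, centred at the image of `a`, of a ball about the image of `x'`. Every element that
  -- contains `x'` contains `a` too and is convex, so the contracted ball is covered by the mesh and
  -- `x` would be an interior point of the closure.
  set s := η / (1 + η) with hs
  have hs0 : 0 < s := by positivity
  have hs1 : 1 - s = 1 / (1 + η) := by rw [hs]; field_simp; ring
  have key : Metric.ball (T.φ e x) (s * ε) ⊆ closure Ω := by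
    intro y hy
    set w := T.φ e x' + s⁻¹ • (y - T.φ e x) with hw
    have hwb : w ∈ Metric.ball (T.φ e x') ε := by
      rw [Metric.mem_ball, dist_eq_norm] at hy ⊢
      rw [hw, add_sub_cancel_left, norm_smul, norm_inv, Real.norm_eq_abs, abs_of_pos hs0,
        inv_mul_lt_iff₀ hs0]
      exact hy
    obtain ⟨hwΩ, hwe⟩ := hball hwb
    have hwU : w ∈ ⋃ e', T.elem e' := by rw [T.iUnion_elem]; exact subset_closure hwΩ
    obtain ⟨e', hwe'⟩ := mem_iUnion.1 hwU
    have hxe' : T.φ e x' ∈ T.elem e' := by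
      by_contra h
      exact hwe e' h hwe'
    have hae' : T.φ e a ∈ T.elem e' := by
      by_cases hee : e = e'
      · rw [← hee]; exact mem_image_of_mem _ haT
      · obtain ⟨S, σ, -, hperm, hface⟩ := T.exists_common_face hee
        have h1 := hface x' ⟨mem_image_of_mem _ hx'T, hxe'⟩
        have h2 : ∀ k ∉ S, bary a k = 0 := fun k hk => by
          have hxk : bary x k = 0 := by
            by_contra h
            exact hx'pos k h (h1 k hk)
          rw [hba, hxk, h1 k hk]; ring
        rw [← hperm a h2]
        refine mem_image_of_mem _ ?_
        rw [← permMap_image σ]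
        exact mem_image_of_mem _ haT
    have hconv := convex_image_refTet (T.φ e') hae' hwe' (by rw [hs1]; positivity : 0 ≤ 1 - s) hs0.le
      (by ring)
    refine T.elem_subset e' ?_
    have hy' : (1 - s) • T.φ e a + s • w = y := by
      have hφa : T.φ e a = (1 + η) • T.φ e x + (-η) • T.φ e x' := by
        rw [affineEquiv_apply _ a, affineEquiv_apply _ x, affineEquiv_apply _ x', ha, map_add,
          map_smul, map_smul]
        module
      rw [hφa, hw, smul_add s, smul_smul s, mul_inv_cancel₀ hs0.ne', one_smul, smul_add,
        smul_smul, smul_smul, hs1]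
      have e1 : 1 / (1 + η) * (1 + η) = 1 := by field_simp
      have e2 : 1 / (1 + η) * -η = -s := by rw [hs]; field_simp
      rw [e1, e2]
      module
    rw [hy'] at hconv
    exact hconv
  have hint : T.φ e x ∈ interior (closure Ω) :=
    mem_interior_iff_mem_nhds.2 (mem_of_superset (Metric.ball_mem_nhds _ (by positivity)) key)
  rwa [hΩ.interior_closure] at hint

end Mesh

/-! ### Gluing the local interpolants -/

section Interpolation

variable {R : RefElement} {p : ℕ} (hR : R.Conditions p) {Ω : Set E3} (T : TetMesh Ω)
  {k : Fin T.N → E3 → ℝ} {q : Fin T.N → MvPolynomial (Fin 3) ℝ} (hq : ∀ e, q e ∈ R.U)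
  (hqk : ∀ e, ∀ x ∈ R.Q, pval (q e) x = k e (T.φ e x))

include hR hq hqk

/-- By C2 the polynomial of the second element, pulled back by the renumbering of vertices, belongs
to `U`, and the renumbering permutes the nodes. The two polynomials agree at the nodes of the common
face, hence on that face. -/
theorem interp_conforming (hk : ∀ e e' x, x ∈ T.elem e → x ∈ T.elem e' → k e x = k e' x)
    {e e' : Fin T.N} {x x' : E3} (hx : x ∈ refTet) (hx' : x' ∈ refTet)
    (h : T.φ e x = T.φ e' x') : pval (q e) x = pval (q e') x' := by
  by_cases he : e = e'
  · subst he
    rw [(T.φ e).injective h]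
  obtain ⟨S, σ, hS, hperm, hface⟩ := T.exists_common_face he
  obtain ⟨hQ, hU⟩ := hR.c2 (permMap σ) (permMap_image σ)
  obtain ⟨r, hr, hrq⟩ := hU (q e') (hq e')
  have hxS : ∀ l ∈ Sᶜ, bary x l = 0 := fun l hl => by
    refine hface x ⟨mem_image_of_mem _ hx, ?_⟩ l (Finset.mem_compl.1 hl)
    rw [h]; exact mem_image_of_mem _ hx'
  have h0 : pval (r - q e) x = 0 := by
    refine hR.eq_zero_on_face hS (R.U.sub_mem hr (hq e)) (fun y hy hyS => ?_) x hx hxS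
    have hyp := hperm y fun l hl => hyS l (Finset.mem_compl.2 hl)
    have hy' : permMap σ y ∈ R.Q := by
      have : permMap σ y ∈ permMap σ '' (R.Q : Set E3) := mem_image_of_mem _ hy
      rwa [hQ] at this
    rw [pval_sub, hrq, hqk e' _ hy', hqk e y hy, hyp, sub_eq_zero]
    refine hk e' e _ ?_ (mem_image_of_mem _ (R.Q_subset y hy))
    rw [← hyp]; exact mem_image_of_mem _ (R.Q_subset _ hy')
  rw [pval_sub, hrq, sub_eq_zero] at h0
  rw [← h0]
  congr 1
  apply (T.φ e').injective
  rw [hperm x fun l hl => hxS l (Finset.mem_compl.2 hl), h]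

/-- The smallest face containing a point outside `Ω` lies wholly outside `Ω`, including its nodes,
so the interpolated values there are zero and face conformity extends this to the face. -/
theorem interp_boundary (hΩ : IsLipschitzDomain Ω) (hk : ∀ e x, x ∈ T.elem e → x ∉ Ω → k e x = 0)
    {e : Fin T.N} {x : E3} (hx : x ∈ refTet) (hxΩ : T.φ e x ∉ Ω) : pval (q e) x = 0 := by
  classical
  set K : Finset (Fin 4) := Finset.univ.filter fun l => bary x l = 0 with hKdef
  have hK : K.Nonempty := by
    rw [Finset.nonempty_iff_ne_empty]
    intro hemp
    apply hxΩ
    apply T.interior_elem_subset hΩ e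
    rw [T.elem_def, interior_image_refTet, interior_refTet]
    refine mem_image_of_mem _ fun l => lt_of_le_of_ne (hx l) fun h => ?_
    have : l ∈ K := Finset.mem_filter.2 ⟨Finset.mem_univ _, h.symm⟩
    rw [hemp] at this
    simp at this
  refine hR.eq_zero_on_face hK (hq e) (fun y hy hyK => ?_) x hx fun l hl => (Finset.mem_filter.1 hl).2
  rw [hqk e y hy]
  refine hk e _ (mem_image_of_mem _ (R.Q_subset y hy)) ?_
  exact T.face_notMem hΩ e hx hxΩ (R.Q_subset y hy) fun l hl =>
    hyK l (Finset.mem_filter.2 ⟨Finset.mem_univ _, hl⟩)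

end Interpolation

/-! ### Lipschitz continuity of piecewise Lipschitz functions -/

/-- The estimate is propagated along the segment from `x` to `y`: the parameters for which it holds
form a closed set, and from each of them one can advance. The pieces need not be convex, so the
complement of `Ω` is allowed among them. -/
theorem lipschitzWith_of_closed_cover {ι : Type*} [Finite ι] {S : ι → Set E3}
    (hS : ∀ i, IsClosed (S i)) (hcov : ⋃ i, S i = univ) {f : E3 → ℝ} {L : ℝ≥0}
    (hf : ∀ i, LipschitzOnWith L f (S i)) : LipschitzWith L f := by
  have hcont : Continuous f :=
    (locallyFinite_of_finite S).continuous hcov hS fun i => (hf i).continuousOn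
  refine LipschitzWith.of_dist_le_mul fun y x => ?_
  rw [dist_comm y x]
  set c : ℝ → E3 := fun t => x + t • (y - x) with hc
  have hcc : Continuous c := by fun_prop
  have hcd : ∀ s t : ℝ, dist (c s) (c t) = |s - t| * dist x y := fun s t => by
    rw [dist_eq_norm, hc, dist_eq_norm, norm_sub_rev x y, ← Real.norm_eq_abs, ← norm_smul]
    congr 1; simp only; module
  set A : Set ℝ := {t | dist (f (c t)) (f x) ≤ L * (t * dist x y)} with hA
  have hAc : IsClosed A := isClosed_le ((hcont.comp hcc).dist continuous_const) (by fun_prop)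
  have h1 : (1 : ℝ) ∈ A := by
    refine (hAc.inter isClosed_Icc).mem_of_ge_of_forall_exists_gt (a := 0) (by simp [hA, hc])
      zero_le_one fun t ht => ?_
    -- Finitely many closed pieces cover the segment, so one of them is met at parameters
    -- arbitrarily close to the right of `t`; being closed it also contains the point at `t`.
    have hfreq : ∃ i, ∃ᶠ s in 𝓝[>] t, c s ∈ S i := by
      by_contra hno
      push Not at hno
      have hall : ∀ᶠ s in 𝓝[>] t, ∀ i, c s ∉ S i := eventually_all.2 hno
      obtain ⟨s, hs⟩ := hall.exists
      have : c s ∈ ⋃ i, S i := by rw [hcov]; trivial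
      obtain ⟨i, hi⟩ := mem_iUnion.1 this
      exact hs i hi
    obtain ⟨i, hi⟩ := hfreq
    have hti : c t ∈ S i := (hS i).mem_of_frequently_of_tendsto hi
      ((hcc.tendsto t).mono_left nhdsWithin_le_nhds)
    have hIoc : ∀ᶠ s in 𝓝[>] t, s ∈ Ioc t 1 := Ioc_mem_nhdsGT ht.2.2
    obtain ⟨s, hsi, hs⟩ := (hi.and_eventually hIoc).exists
    refine ⟨s, ?_, hs⟩
    have h2 := (hf i).dist_le_mul _ hsi _ hti
    rw [hcd, abs_of_pos (sub_pos.2 hs.1)] at h2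
    have h3 : dist (f (c t)) (f x) ≤ L * (t * dist x y) := ht.1
    have h4 := dist_triangle (f (c s)) (f (c t)) (f x)
    change dist (f (c s)) (f x) ≤ L * (s * dist x y)
    nlinarith
  have h2 : dist (f (c 1)) (f x) ≤ L * (1 * dist x y) := h1
  have h3 : c 1 = y := by rw [hc]; simp
  rwa [h3, one_mul] at h2

theorem exists_lipschitzOnWith_pval (φ : E3 ≃ᵃ[ℝ] E3) (P : MvPolynomial (Fin 3) ℝ) :
    ∃ L : ℝ≥0, LipschitzOnWith L (pval P) (φ '' refTet) := by
  obtain ⟨C, hC⟩ := (isCompact_image_refTet φ).exists_bound_of_continuousOn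
    ((contDiff_pval P).continuous_fderiv (by simp)).continuousOn
  refine ⟨C.toNNReal, (convex_image_refTet φ).lipschitzOnWith_of_nnnorm_fderiv_le
    (fun x _ => (contDiff_pval P).differentiable (by simp) x) fun x hx => ?_⟩
  rw [← NNReal.coe_le_coe, coe_nnnorm]
  exact (hC x hx).trans (Real.le_coe_toNNReal C)

/-- Compatibility makes the pointwise definition unambiguous. The elements and the complement of `Ω`
form a finite closed cover on whose members the function is Lipschitz, and it vanishes off `Ω`. -/
theorem exists_global_interp {R : RefElement} {Ω : Set E3} (hΩ : IsLipschitzDomain Ω)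
    (hΩb : Bornology.IsBounded Ω) (T : TetMesh Ω) {q : Fin T.N → MvPolynomial (Fin 3) ℝ}
    (hq : ∀ e, q e ∈ R.U)
    (hconf : ∀ e e' x x', x ∈ refTet → x' ∈ refTet → T.φ e x = T.φ e' x' →
      pval (q e) x = pval (q e') x')
    (hbd : ∀ e x, x ∈ refTet → T.φ e x ∉ Ω → pval (q e) x = 0) :
    ∃ I, T.MemUh R.U I ∧ ∀ e, ∀ x ∈ refTet, I (T.φ e x) = pval (q e) x := by
  classical
  have hex : ∀ y : E3, ∃ a : ℝ, (∀ e x, x ∈ refTet → T.φ e x = y → a = pval (q e) x) ∧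
      (y ∉ Ω → a = 0) := by
    intro y
    by_cases hy : ∃ e, y ∈ T.elem e
    · obtain ⟨e, x, hx, rfl⟩ := hy
      exact ⟨pval (q e) x, fun e' x' hx' h => hconf e e' x x' hx hx' h.symm, hbd e x hx⟩
    · exact ⟨0, fun e x hx h => absurd ⟨e, x, hx, h⟩ hy, fun _ => rfl⟩
  choose I hI hI0 using hex
  have hIe : ∀ e, ∀ x ∈ refTet, I (T.φ e x) = pval (q e) x := fun e x hx => hI _ e x hx rfl
  refine ⟨I, ⟨?_, fun e => ⟨q e, hq e, hIe e⟩⟩, hIe⟩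
  choose L hL using fun e => exists_lipschitzOnWith_pval (T.φ e) (polyComp (T.φ e).symm (q e))
  set S : Option (Fin T.N) → Set E3 := fun o => o.elim Ωᶜ T.elem with hS
  have hlip : LipschitzWith (∑ e, L e) I := by
    refine lipschitzWith_of_closed_cover (S := S) ?_ ?_ ?_
    · rintro (_ | e)
      · exact hΩ.1.isClosed_compl
      · exact (T.isCompact_elem e).isClosed
    · rw [eq_univ_iff_forall]
      intro x
      by_cases hx : x ∈ Ω
      · have : x ∈ ⋃ e, T.elem e := by rw [T.iUnion_elem]; exact subset_closure hx
        obtain ⟨e, he⟩ := mem_iUnion.1 this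
        exact mem_iUnion.2 ⟨some e, he⟩
      · exact mem_iUnion.2 ⟨none, hx⟩
    · rintro (_ | e)
      · refine LipschitzOnWith.of_dist_le_mul fun x hx y hy => ?_
        rw [hI0 x hx, hI0 y hy, dist_self]
        positivity
      · have h1 : LipschitzOnWith (L e) I (T.elem e) := by
          have h2 : ∀ z ∈ T.elem e, I z = pval (polyComp (T.φ e).symm (q e)) z := by
            rintro _ ⟨x, hx, rfl⟩
            rw [hIe e x hx]; simp
          intro x hx y hy
          rw [h2 x hx, h2 y hy]
          exact hL e hx hy
        exact h1.weaken (Finset.single_le_sum (fun _ _ => zero_le) (Finset.mem_univ e))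
  exact memH10_of_lipschitz hΩ.1 hΩb hlip hI0

/-! ### Discrete functions as piecewise polynomials -/

theorem uniqueDiffOn_image_refTet (φ : E3 ≃ᵃ[ℝ] E3) : UniqueDiffOn ℝ (φ '' refTet) :=
  uniqueDiffOn_convex (convex_image_refTet φ) (interior_image_refTet_nonempty φ)

theorem inner_gradientWithin_pval (φ : E3 ≃ᵃ[ℝ] E3) {f g : E3 → ℝ} {P P' : MvPolynomial (Fin 3) ℝ}
    (hf : ∀ x ∈ φ '' refTet, f x = pval P x) (hg : ∀ x ∈ φ '' refTet, g x = pval P' x) {x : E3}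
    (hx : x ∈ φ '' refTet) :
    inner ℝ (gradientWithin f (φ '' refTet) x) (gradientWithin g (φ '' refTet) x) =
      ∑ i, pval (MvPolynomial.pderiv i P) x * pval (MvPolynomial.pderiv i P') x := by
  have key : ∀ {f : E3 → ℝ} {P : MvPolynomial (Fin 3) ℝ}, (∀ x ∈ φ '' refTet, f x = pval P x) →
      ∀ i, gradientWithin f (φ '' refTet) x i = pval (MvPolynomial.pderiv i P) x := by
    intro f P hf i
    have h1 : fderivWithin ℝ f (φ '' refTet) x = ∑ i, pval (MvPolynomial.pderiv i P) x •
        (EuclideanSpace.proj i : E3 →L[ℝ] ℝ) := by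
      rw [fderivWithin_congr hf (hf x hx)]
      exact (hasFDerivAt_pval P x).hasFDerivWithinAt.fderivWithin (uniqueDiffOn_image_refTet φ x hx)
    have h2 : gradientWithin f (φ '' refTet) x i =
        inner ℝ (gradientWithin f (φ '' refTet) x) (EuclideanSpace.single i 1) := by
      rw [EuclideanSpace.inner_single_right]; simp
    rw [h2, gradientWithin, InnerProductSpace.toDual_symm_apply, h1]
    simp
  rw [PiLp.inner_apply]
  refine Finset.sum_congr rfl fun i _ => ?_
  rw [key hf, key hg]
  simp [mul_comm]

namespace TetMesh

variable {Ω : Set E3} (T : TetMesh Ω)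

/-- `w` coincides on each element `e` with the polynomial `P e`, whose pull-back lies in `U`. -/
def IsPiecewise (U : Submodule ℝ (MvPolynomial (Fin 3) ℝ)) (w : E3 → ℝ)
    (P : Fin T.N → MvPolynomial (Fin 3) ℝ) : Prop :=
  ∀ e, polyComp (T.φ e) (P e) ∈ U ∧ ∀ x ∈ T.elem e, w x = pval (P e) x

variable {T} {U : Submodule ℝ (MvPolynomial (Fin 3) ℝ)} {w w' : E3 → ℝ}
  {P P' : Fin T.N → MvPolynomial (Fin 3) ℝ}

theorem isPiecewise_of_pullback {q : Fin T.N → MvPolynomial (Fin 3) ℝ} (hq : ∀ e, q e ∈ U)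
    (hw : ∀ e, ∀ x ∈ refTet, w (T.φ e x) = pval (q e) x) :
    T.IsPiecewise U w fun e => polyComp (T.φ e).symm (q e) := by
  refine fun e => ⟨by rw [polyComp_polyComp_symm]; exact hq e, ?_⟩
  rintro _ ⟨x, hx, rfl⟩
  rw [hw e x hx]; simp

theorem MemUh.exists_isPiecewise (hw : T.MemUh U w) : ∃ P, T.IsPiecewise U w P := by
  choose q hq hqw using hw.2
  exact ⟨_, isPiecewise_of_pullback hq hqw⟩

theorem IsPiecewise.memUh (h : T.IsPiecewise U w P) (hw : MemH10 Ω w) : T.MemUh U w :=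
  ⟨hw, fun e => ⟨_, (h e).1, fun x hx => by
    rw [(h e).2 _ (mem_image_of_mem _ hx), pval_polyComp]⟩⟩

theorem IsPiecewise.sub (h : T.IsPiecewise U w P) (h' : T.IsPiecewise U w' P') :
    T.IsPiecewise U (w - w') (P - P') := fun e =>
  ⟨by rw [Pi.sub_apply, polyComp_sub]; exact U.sub_mem (h e).1 (h' e).1, fun x hx => by
    rw [Pi.sub_apply, Pi.sub_apply, pval_sub, (h e).2 x hx, (h' e).2 x hx]⟩

theorem IsPiecewise.stiffForm_eq (R : RefElement) (c : E3 → ℝ) (h : T.IsPiecewise U w P)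
    (h' : T.IsPiecewise U w' P') :
    T.stiffForm R c w w' = ∑ e, ∑ i, ∑ x ∈ R.Q', jac (T.φ e) * R.wt' x * (c (T.φ e x) *
      (pval (MvPolynomial.pderiv i (P e)) (T.φ e x) *
        pval (MvPolynomial.pderiv i (P' e)) (T.φ e x))) := by
  refine Finset.sum_congr rfl fun e _ => ?_
  rw [Finset.sum_comm]
  refine Finset.sum_congr rfl fun x hx => ?_
  have := inner_gradientWithin_pval (T.φ e) (h e).2 (h' e).2
    (mem_image_of_mem _ (R.Q'_subset x hx))
  rw [elem_def, this, Finset.mul_sum, Finset.mul_sum]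
  rfl

theorem IsPiecewise.massForm_eq (R : RefElement) (v : E3 → ℝ) (h : T.IsPiecewise U w P) :
    T.massForm R v w = ∑ e, ∑ x ∈ R.Q, jac (T.φ e) * R.wt x * (v (T.φ e x) *
      pval (P e) (T.φ e x)) := by
  refine Finset.sum_congr rfl fun e _ => Finset.sum_congr rfl fun x hx => ?_
  rw [(h e).2 _ (mem_image_of_mem _ (R.Q_subset x hx))]
  rfl

theorem IsPiecewise.weakGrad_ae_eq (hΩ : IsLipschitzDomain Ω) {G : Fin 3 → E3 → ℝ}
    (h : T.IsPiecewise U w P) (hw : HasWeakGrad Ω w G) (e : Fin T.N) (i : Fin 3) :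
    ∀ᵐ x ∂volume.restrict (T.elem e), G i x = pval (MvPolynomial.pderiv i (P e)) x := by
  have hb : Bornology.IsBounded (interior (T.elem e)) :=
    (T.isCompact_elem e).isBounded.subset interior_subset
  have h1 := isWeakDeriv_pval isOpen_interior hb (P e) (Pi.single i 1)
  rw [polyDeriv_single] at h1
  have h2 : IsWeakDeriv (interior (T.elem e)) (Pi.single i 1) (pval (P e)) (G i) := by
    refine ⟨((hw.2 i).mono (T.interior_elem_subset hΩ e)).1, fun f hf => ?_⟩
    rw [← ((hw.2 i).mono (T.interior_elem_subset hΩ e)).2 f hf]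
    exact setIntegral_congr_fun isOpen_interior.measurableSet fun x hx => by
      simp only [(h e).2 x (interior_subset hx)]
  have h3 := h2.unique isOpen_interior h1
  rwa [elem_def, restrict_interior_image] at h3

end TetMesh

/-! ### Sobolev norms and the mesh -/

theorem IsWeakDeriv.congr_left {O : Set E3} {α : Fin 3 → ℕ} {u u' g : E3 → ℝ}
    (h : IsWeakDeriv O α u g) (hu : ∀ᵐ x ∂volume.restrict O, u x = u' x) : IsWeakDeriv O α u' g := by
  refine ⟨h.1, fun f hf => ?_⟩
  rw [← h.2 f hf]
  refine integral_congr_ae ?_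
  filter_upwards [hu] with x hx
  rw [hx]

theorem MemH.mono {Ω : Set E3} {k l : ℕ} (hkl : k ≤ l) {u : E3 → ℝ} (hu : MemH Ω l u) :
    MemH Ω k u := ⟨hu.1, fun α hα => hu.2 α (hα.trans hkl)⟩

theorem TetMesh.sum_localSq {Ω : Set E3} (hΩ : IsLipschitzDomain Ω) (T : TetMesh Ω) {k : ℕ}
    {u : E3 → ℝ} {w : (Fin 3 → ℕ) → E3 → ℝ}
    (hw : ∀ α : Fin 3 → ℕ, ∑ i, α i ≤ k → IsWeakDeriv Ω α u (w α)) :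
    ∑ e, localSq (T.φ e) k w = normH Ω k u ^ 2 := by
  rw [normH, Real.sq_sqrt (Finset.sum_nonneg fun _ _ => integral_nonneg fun _ => sq_nonneg _)]
  simp only [localSq]
  rw [Finset.sum_comm]
  refine Finset.sum_congr rfl fun α hα => ?_
  have h := hw α (mem_multiIndices.1 hα)
  have hi : IntegrableOn (fun x => w α x ^ 2) Ω := h.1.integrable_sq
  have h1 : ∫ x in Ω, weakDeriv Ω α u x ^ 2 = ∫ x in Ω, w α x ^ 2 := by
    refine integral_congr_ae ?_
    filter_upwards [h.ae_eq hΩ.1] with x hx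
    rw [hx]
  rw [h1, T.setIntegral_eq_sum hΩ hi]
  rfl

/-- The interpolant of a function of `H¹₀ ∩ H²` in the discrete space. -/
theorem TetMesh.exists_interpolant {Ω : Set E3} (hΩ : IsLipschitzDomain Ω)
    (hΩb : Bornology.IsBounded Ω) {R : RefElement} {p : ℕ} (hR : R.Conditions p) (T : TetMesh Ω)
    {u : E3 → ℝ} (hu : MemH10 Ω u) (hu2 : MemH Ω 2 u) :
    ∃ (I : E3 → ℝ) (P : Fin T.N → MvPolynomial (Fin 3) ℝ) (k : Fin T.N → E3 → ℝ),
      MemH10 Ω I ∧ T.IsPiecewise R.U I P ∧ (∀ e, Continuous (k e)) ∧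
      (∀ e, ∀ᵐ x ∂volume.restrict (interior (T.elem e)), u x = k e x) ∧
      ∀ e, ∀ x ∈ R.Q, pval (P e) (T.φ e x) = k e (T.φ e x) := by
  have hg := hu.hasWeakGrad
  have hH : ∀ i, HasWeakGrad Ω (wgrad Ω u i)
      fun j => weakDeriv Ω (Pi.single i 1 + Pi.single j 1) u := fun i =>
    ⟨(hg.2 i).1, fun j => (hg.2 i).chain (weakDeriv_spec (hu2.2 _ (by
      simp only [Pi.add_apply, Finset.sum_add_distrib, sum_single]; norm_num)))⟩
  have hk : ∀ e : Fin T.N, ∃ k : E3 → ℝ, Continuous k ∧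
      ∀ᵐ x ∂volume.restrict (interior (T.elem e)), u x = k x := fun e => by
    have hs := T.interior_elem_subset hΩ e
    exact exists_continuous_representative isOpen_interior (convex_image_refTet (T.φ e)).interior
      (interior_image_refTet_nonempty (T.φ e))
      ((T.isCompact_elem e).isBounded.subset interior_subset) (hg.mono hs) fun i => (hH i).mono hs
  choose k hkc hke using hk
  -- Nodal values are taken from the continuous representatives, since `u` is determined only almost
  -- everywhere.
  have hq : ∀ e, ∃ q ∈ R.U, ∀ x ∈ R.Q, pval q x = k e (T.φ e x) := fun e =>
    hR.exists_interp fun x => k e (T.φ e x)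
  choose q hq hqk using hq
  obtain ⟨I, hI, hIq⟩ := exists_global_interp hΩ hΩb T hq
    (fun e e' x x' hx hx' h => interp_conforming hR T hq hqk
      (fun e e' x hx hx' => value_eq_of_mem_inter hΩ T hu hH (hkc e) (hkc e') (hke e) (hke e') hx hx')
      hx hx' h)
    (fun e x hx hxΩ => interp_boundary hR T hq hqk hΩ
      (fun e x hx hx' => value_eq_zero hΩ T hu hH (hkc e) (hke e) hx hx') hx hxΩ)
  refine ⟨I, _, k, hI.1, isPiecewise_of_pullback hq hIq, hkc, hke, fun e x hx => ?_⟩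
  rw [pval_polyComp, AffineEquiv.symm_apply_apply, hqk e x hx]

/-! ### The error estimate -/

/-- The discrete gradient energy of a piecewise polynomial. -/
def TetMesh.energy {Ω : Set E3} (T : TetMesh Ω) (R : RefElement)
    (P : Fin T.N → MvPolynomial (Fin 3) ℝ) : ℝ := ∑ e, jac (T.φ e) * gradSum R (T.φ e) (P e)

theorem TetMesh.energy_nonneg {Ω : Set E3} (T : TetMesh Ω) (R : RefElement)
    (P : Fin T.N → MvPolynomial (Fin 3) ℝ) : 0 ≤ T.energy R P :=
  Finset.sum_nonneg fun _ _ => mul_nonneg (jac_pos _).le (gradSum_nonneg _ _ _)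

theorem sum_mul_sqrt_le {n : ℕ} {C d h : ℝ} {m : ℕ} {D L G : Fin n → ℝ} (hC : 0 ≤ C)
    (hD0 : ∀ e, 0 ≤ D e) (hD : ∀ e, D e ≤ 2 * h) (hL : ∀ e, 0 ≤ L e) (hG : ∀ e, 0 ≤ G e)
    (hd : 0 ≤ d) (hLd : ∑ e, L e = d ^ 2) :
    ∑ e, C * D e ^ m * (√(L e) * √(G e)) ≤ C * ((2 * h) ^ m * d) * √(∑ e, G e) := by
  -- Without elements nothing fixes the sign of `h`; otherwise any diameter shows that it is
  -- nonnegative.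
  by_cases hn : n = 0
  · subst hn
    simp at hLd ⊢
  have hh : 0 ≤ 2 * h := (hD0 ⟨0, Nat.pos_of_ne_zero hn⟩).trans (hD _)
  calc ∑ e, C * D e ^ m * (√(L e) * √(G e)) ≤ ∑ e, C * (2 * h) ^ m * (√(L e) * √(G e)) := by
        gcongr with e
        · exact hD0 e
        · exact hD e
    _ = C * (2 * h) ^ m * ∑ e, √(L e) * √(G e) := by rw [Finset.mul_sum]
    _ ≤ C * (2 * h) ^ m * (√(∑ e, L e) * √(∑ e, G e)) := by
        gcongr
        exact Real.sum_sqrt_mul_sqrt_le _ hL hG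
    _ = _ := by rw [hLd, Real.sqrt_sq hd]; ring

/-! ### Coercivity and consistency of the discrete forms -/

section Estimate

variable {Ω : Set E3} (hΩ : IsLipschitzDomain Ω) (hΩb : Bornology.IsBounded Ω) {p : ℕ}
  {R : RefElement} (hR : R.Conditions p)

include hΩ in
theorem TetMesh.IsPiecewise.integral_wgrad_sq_le {T : TetMesh Ω} {w : E3 → ℝ}
    {P : Fin T.N → MvPolynomial (Fin 3) ℝ} {γ B : ℝ} (hB : ∀ (φ : E3 ≃ᵃ[ℝ] E3) (D : ℝ),
      ShapeBound φ γ D → ∀ P, polyComp φ P ∈ R.U → ∀ i,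
      (∫ x in φ '' refTet, pval (MvPolynomial.pderiv i P) x ^ 2 ≤ B ^ 2 * (jac φ * gradSum R φ P)) ∧
      ∀ x ∈ refTet, jac φ * pval (MvPolynomial.pderiv i P) (φ x) ^ 2 ≤
        B ^ 2 * (jac φ * gradSum R φ P)) (hs : T.ShapeRegular γ) (hP : T.IsPiecewise R.U w P)
    (hw : MemH10 Ω w) (i : Fin 3) : ∫ x in Ω, wgrad Ω w i x ^ 2 ≤ B ^ 2 * T.energy R P := by
  have hi : IntegrableOn (fun x => wgrad Ω w i x ^ 2) Ω := (hw.hasWeakGrad.2 i).1.integrable_sq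
  rw [T.setIntegral_eq_sum hΩ hi, TetMesh.energy, Finset.mul_sum]
  refine Finset.sum_le_sum fun e _ => ?_
  have h1 : ∫ x in T.elem e, wgrad Ω w i x ^ 2 =
      ∫ x in T.elem e, pval (MvPolynomial.pderiv i (P e)) x ^ 2 := by
    refine integral_congr_ae ?_
    filter_upwards [hP.weakGrad_ae_eq hΩ hw.hasWeakGrad e i] with x hx
    rw [hx]
  rw [h1]
  exact ((hB (T.φ e) _ (T.shapeBound hs e) (P e) (hP e).1 i).1)

-- The smallest stiffness weight times `c₀` works; the lower bound of `c` extends to the closure by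
-- continuity, which covers quadrature points on the boundary. An empty set of points makes the
-- energy zero, and any positive constant serves.
include hR in
theorem exists_stiffForm_coercive {c : E3 → ℝ} (hc : ContinuousOn c (closure Ω)) {c₀ : ℝ}
    (hc₀ : 0 < c₀) (hcb : ∀ x ∈ Ω, c₀ ≤ c x) : ∃ κ : ℝ, 0 < κ ∧ ∀ (T : TetMesh Ω) (w : E3 → ℝ)
      (P : Fin T.N → MvPolynomial (Fin 3) ℝ), T.IsPiecewise R.U w P →
      κ * T.energy R P ≤ T.stiffForm R c w w := by
  obtain ⟨m₀, hm, hmle⟩ : ∃ m₀ : ℝ, 0 < m₀ ∧ ∀ x ∈ R.Q', m₀ ≤ R.wt' x := by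
    rcases R.Q'.eq_empty_or_nonempty with h | h
    · exact ⟨1, one_pos, by simp [h]⟩
    · obtain ⟨y, hy, hmin⟩ := R.Q'.exists_min_image R.wt' h
      exact ⟨R.wt' y, hR.c6 y hy, hmin⟩
  have hcl : ∀ x ∈ closure Ω, c₀ ≤ c x := fun x hx =>
    le_on_closure hcb continuousOn_const hc hx
  refine ⟨m₀ * c₀, by positivity, fun T w P hP => ?_⟩
  rw [hP.stiffForm_eq R c hP, TetMesh.energy, Finset.mul_sum]
  refine Finset.sum_le_sum fun e _ => ?_
  rw [gradSum, Finset.sum_comm, Finset.mul_sum, Finset.mul_sum]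
  refine Finset.sum_le_sum fun i _ => ?_
  rw [Finset.mul_sum, Finset.mul_sum]
  refine Finset.sum_le_sum fun x hx => ?_
  have h1 := hcl _ (T.elem_subset e (mem_image_of_mem (T.φ e) (R.Q'_subset x hx)))
  have h2 := hmle x hx
  have hj := jac_pos (T.φ e)
  set a := pval (MvPolynomial.pderiv i (P e)) (T.φ e x)
  calc m₀ * c₀ * (jac (T.φ e) * a ^ 2) ≤ R.wt' x * c (T.φ e x) * (jac (T.φ e) * a ^ 2) := by
        gcongr
        exact (hR.c6 x hx).le
    _ = _ := by ring

include hΩ hΩb in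
theorem TetMesh.IsPiecewise.integral_eq_sum {T : TetMesh Ω} {w : E3 → ℝ}
    {P : Fin T.N → MvPolynomial (Fin 3) ℝ} (hP : T.IsPiecewise R.U w P) (hw : MemH10 Ω w)
    {c u : E3 → ℝ} (hc : ContinuousOn c (closure Ω)) (hu : MemH10 Ω u) :
    ∫ x in Ω, c x * ∑ i, weakDeriv Ω (Pi.single i 1) u x * weakDeriv Ω (Pi.single i 1) w x =
      ∑ e, ∑ i, ∫ x in T.elem e, c x * (weakDeriv Ω (Pi.single i 1) u x *
        pval (MvPolynomial.pderiv i (P e)) x) := by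
  obtain ⟨K, hK⟩ := hΩb.isCompact_closure.exists_bound_of_continuousOn hc
  have hi : ∀ i : Fin 3, IntegrableOn (fun x => c x * (weakDeriv Ω (Pi.single i 1) u x *
      weakDeriv Ω (Pi.single i 1) w x)) Ω := fun i => by
    have h1 : Integrable (fun x => weakDeriv Ω (Pi.single i 1) u x *
      weakDeriv Ω (Pi.single i 1) w x) (volume.restrict Ω) :=
      (hu.hasWeakGrad.2 i).1.integrable_mul (hw.hasWeakGrad.2 i).1
    refine h1.bdd_mul (c := K)
      ((hc.mono subset_closure).aestronglyMeasurable hΩ.1.measurableSet) ?_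
    exact ae_restrict_of_forall_mem hΩ.1.measurableSet fun x hx => hK x (subset_closure hx)
  simp only [Finset.mul_sum]
  rw [integral_finsetSum _ fun i _ => hi i, Finset.sum_comm]
  refine Finset.sum_congr rfl fun i _ => ?_
  rw [T.setIntegral_eq_sum hΩ (hi i)]
  refine Finset.sum_congr rfl fun e _ => integral_congr_ae ?_
  filter_upwards [hP.weakGrad_ae_eq hΩ hw.hasWeakGrad e i] with x hx
  rw [← hx, wgrad]

include hΩ hΩb hR in
/-- The discrete problem is consistent: the residual of a suitable interpolant of the exact
solution, and the error of the interpolant itself, are of optimal order. -/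
theorem exists_consistency_bound (hdeg : R.HasDegree p) {c : E3 → ℝ} (hc : IsCkClosure Ω p c)
    (γ : ℝ) {k l : ℕ} (hk : 2 ≤ k) (hkp : k ≤ p + 1) (hl : 2 ≤ l) (hlp : l ≤ p) :
    ∃ C : ℝ, 0 < C ∧ ∀ T : TetMesh Ω, T.ShapeRegular γ → ∀ u v : E3 → ℝ,
      ContinuousOn v (closure Ω) → MemH Ω l v → IsWeakSolution Ω c v u → MemH Ω k u →
      ∃ (I : E3 → ℝ) (Q : Fin T.N → MvPolynomial (Fin 3) ℝ), MemH10 Ω I ∧ T.IsPiecewise R.U I Q ∧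
        (∀ i, ∑ e, ∫ x in T.elem e, (wgrad Ω u i x - pval (MvPolynomial.pderiv i (Q e)) x) ^ 2 ≤
          C * ((2 * T.h) ^ (k - 1) * normH Ω k u) ^ 2) ∧
        ∀ (w : E3 → ℝ) (P : Fin T.N → MvPolynomial (Fin 3) ℝ), MemH10 Ω w →
          T.IsPiecewise R.U w P →
          T.massForm R v w - T.stiffForm R c I w ≤
            C * ((2 * T.h) ^ l * normH Ω l v) * √((∫ x in Ω, w x ^ 2) + T.energy R P) +
            C * ((2 * T.h) ^ (k - 1) * normH Ω k u) * √(T.energy R P) := by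
  obtain ⟨K, hK, hcK, happ⟩ := exists_coefficient_approx hΩb hc
  obtain ⟨H, hHe⟩ : ∃ H : ℝ, H = 2 * Metric.diam (closure Ω) + 1 := ⟨_, rfl⟩
  have hH : 0 < H := by rw [hHe]; have := Metric.diam_nonneg (s := closure Ω); linarith
  obtain ⟨Cm, hCm, hmass⟩ := exists_mass_error_bound hR hdeg γ hH hl hlp
  obtain ⟨Cs, hCs, hstiff⟩ := exists_stiff_error_bound hR hdeg γ (H := H) hk hkp hK
  refine ⟨Cm + 3 * Cs, by positivity, fun T hs u v hvc hv hsol hu => ?_⟩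
  obtain ⟨I, Q, f, hI, hQ, hfc, hfu, hQf⟩ := T.exists_interpolant hΩ hΩb hR hsol.1 (hu.mono hk)
  have hD0 : ∀ e, 0 ≤ Metric.diam (T.elem e) := fun e => Metric.diam_nonneg
  have hD : ∀ e, Metric.diam (T.elem e) ≤ 2 * T.h := T.diam_elem_le hΩb
  have hDH : ∀ e, Metric.diam (T.elem e) ≤ H := fun e => by
    have := T.h_le hΩb; have := hD e; rw [hHe]; linarith
  have hwu : ∀ α : Fin 3 → ℕ, ∑ i, α i ≤ k → IsWeakDeriv Ω α u (weakDeriv Ω α u) :=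
    fun α hα => weakDeriv_spec (hu.2 α hα)
  have hLu := T.sum_localSq hΩ hwu
  have hnu : 0 ≤ normH Ω k u := Real.sqrt_nonneg _
  have hnv : 0 ≤ normH Ω l v := Real.sqrt_nonneg _
  have hh := T.h_nonneg
  have hst := fun e => hstiff (T.φ e) _ (T.shapeBound hs e) (hDH e) (f e)
    (fun α => weakDeriv Ω α u)
    (fun α hα => ((hwu α hα).mono (T.interior_elem_subset hΩ e)).congr_left (hfu e))
    (hfc e).continuousOn (Q e) (hQ e).1 (hQf e)
  refine ⟨I, Q, hI, hQ, fun i => ?_, fun w P hw hP => ?_⟩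
  · calc _ ≤ ∑ e, Cs * ((2 * T.h) ^ (k - 1)) ^ 2 *
          localSq (T.φ e) k (fun α => weakDeriv Ω α u) := by
          refine Finset.sum_le_sum fun e _ => ((hst e i).1).trans ?_
          have := localSq_nonneg (T.φ e) k (fun α => weakDeriv Ω α u)
          have := hD0 e
          have := hD e
          gcongr
      _ = Cs * ((2 * T.h) ^ (k - 1) * normH Ω k u) ^ 2 := by rw [← Finset.mul_sum, hLu]; ring
      _ ≤ _ := by gcongr; linarith
  · classical
    -- The derivative of order zero is taken to be `v` itself, because quadrature uses point values
    -- and the chosen weak derivative agrees with `v` only almost everywhere.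
    obtain ⟨wv, hwvd⟩ : ∃ wv : (Fin 3 → ℕ) → E3 → ℝ,
      wv = fun α => if α = 0 then v else weakDeriv Ω α v := ⟨_, rfl⟩
    have hwv : ∀ α : Fin 3 → ℕ, ∑ i, α i ≤ l → IsWeakDeriv Ω α v (wv α) := fun α hα => by
      by_cases h0 : α = 0
      · subst h0; rw [hwvd]; simpa using isWeakDeriv_zero hv.1
      · simp only [hwvd, if_neg h0]; exact weakDeriv_spec (hv.2 α hα)
    have hLv := T.sum_localSq hΩ hwv
    have hvm : MemLp v 2 (volume.restrict Ω) := hv.1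
    have hwm : MemLp w 2 (volume.restrict Ω) := hw.1.1
    have e1 : ∫ x in Ω, v x * w x = ∑ e, ∫ x in T.elem e, v x * pval (P e) x := by
      have hi : IntegrableOn (fun x => v x * w x) Ω := hvm.integrable_mul hwm
      rw [T.setIntegral_eq_sum hΩ hi]
      refine Finset.sum_congr rfl fun e _ =>
        setIntegral_congr_fun (T.isCompact_elem e).measurableSet fun x hx => ?_
      simp only [(hP e).2 x hx]
    have e2 : ∫ x in Ω, w x ^ 2 = ∑ e, ∫ x in T.elem e, pval (P e) x ^ 2 := by
      have hi : IntegrableOn (fun x => w x ^ 2) Ω := hwm.integrable_sq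
      rw [T.setIntegral_eq_sum hΩ hi]
      refine Finset.sum_congr rfl fun e _ =>
        setIntegral_congr_fun (T.isCompact_elem e).measurableSet fun x hx => ?_
      simp only [(hP e).2 x hx]
    have e3 := hP.integral_eq_sum hΩ hΩb hw hc.2.1 hsol.1
    have e4 := hsol.2 w hw
    rw [e3, e1] at e4
    have hG : ∀ e, 0 ≤ jac (T.φ e) * gradSum R (T.φ e) (P e) := fun e =>
      mul_nonneg (jac_pos _).le (gradSum_nonneg _ _ _)
    -- The weak equation trades the exact product of `v` and `w` for the exact stiffness integral of
    -- `u` and `w`, so the residual becomes a sum of local errors.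
    have hid : T.massForm R v w - T.stiffForm R c I w =
        (∑ e, -quadErr R.Q R.wt (T.φ e) fun x => v x * pval (P e) x) +
        ∑ e, ∑ i, ((∫ x in T.elem e, c x * (weakDeriv Ω (Pi.single i 1) u x *
          pval (MvPolynomial.pderiv i (P e)) x)) -
          ∑ x ∈ R.Q', jac (T.φ e) * R.wt' x * (c (T.φ e x) *
            (pval (MvPolynomial.pderiv i (Q e)) (T.φ e x) *
              pval (MvPolynomial.pderiv i (P e)) (T.φ e x)))) := by
      rw [hP.massForm_eq R v, hQ.stiffForm_eq R c hP]
      simp only [quadErr, neg_sub, Finset.sum_sub_distrib]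
      rw [e4]
      simp only [TetMesh.elem_def]
      ring
    rw [hid]
    have b1 : ∑ e, -quadErr R.Q R.wt (T.φ e) (fun x => v x * pval (P e) x) ≤
        Cm * ((2 * T.h) ^ l * normH Ω l v) * √((∫ x in Ω, w x ^ 2) + T.energy R P) := by
      rw [e2, TetMesh.energy, ← Finset.sum_add_distrib]
      refine le_trans (Finset.sum_le_sum fun e _ => (neg_le_abs _).trans
        (hmass (T.φ e) _ (T.shapeBound hs e) (hDH e) v wv
          (fun α hα => (hwv α hα).mono (T.interior_elem_subset hΩ e))
          (hvc.mono (T.elem_subset e)) (fun x => by simp [hwvd]) (P e) (hP e).1)) ?_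
      exact sum_mul_sqrt_le hCm.le hD0 hD (fun e => localSq_nonneg _ _ _)
        (fun e => add_nonneg (integral_nonneg fun _ => sq_nonneg _) (hG e)) hnv hLv
    have b2 : ∑ e, ∑ i, ((∫ x in T.elem e, c x * (weakDeriv Ω (Pi.single i 1) u x *
          pval (MvPolynomial.pderiv i (P e)) x)) -
          ∑ x ∈ R.Q', jac (T.φ e) * R.wt' x * (c (T.φ e x) *
            (pval (MvPolynomial.pderiv i (Q e)) (T.φ e x) *
              pval (MvPolynomial.pderiv i (P e)) (T.φ e x)))) ≤
        3 * Cs * ((2 * T.h) ^ (k - 1) * normH Ω k u) * √(T.energy R P) := by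
      have h1 : ∀ i : Fin 3, ∑ e, ((∫ x in T.elem e, c x * (weakDeriv Ω (Pi.single i 1) u x *
          pval (MvPolynomial.pderiv i (P e)) x)) -
          ∑ x ∈ R.Q', jac (T.φ e) * R.wt' x * (c (T.φ e x) *
            (pval (MvPolynomial.pderiv i (Q e)) (T.φ e x) *
              pval (MvPolynomial.pderiv i (P e)) (T.φ e x)))) ≤
          Cs * ((2 * T.h) ^ (k - 1) * normH Ω k u) * √(T.energy R P) := fun i => by
        refine le_trans (Finset.sum_le_sum fun e _ => (le_abs_self _).trans
          ((hst e i).2 c (hc.2.1.mono (T.elem_subset e))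
            (fun x hx => hcK x (T.elem_subset e hx))
            (happ (T.φ e) _ (T.interior_elem_subset hΩ e) (T.elem_subset e)
              (T.shapeBound hs e).dist_le) (P e) (hP e).1)) ?_
        exact sum_mul_sqrt_le hCs.le hD0 hD (fun e => localSq_nonneg _ _ _) hG hnu hLu
      rw [Finset.sum_comm]
      refine (Finset.sum_le_sum fun i _ => h1 i).trans ?_
      rw [Finset.sum_const, Finset.card_univ, Fintype.card_fin, nsmul_eq_mul]
      apply le_of_eq; push_cast; ring
    refine (add_le_add b1 b2).trans ?_
    gcongr <;> linarith

end Estimate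

/-! ### From consistency to the error in the energy and `H¹` norms -/

section ErrorBound

variable {Ω : Set E3} (hΩ : IsLipschitzDomain Ω) (hΩb : Bornology.IsBounded Ω) {p : ℕ}
  {R : RefElement} (hR : R.Conditions p)

include hΩ in
theorem TetMesh.IsPiecewise.integral_wgrad_sub_sq_le {T : TetMesh Ω} {u w w' : E3 → ℝ}
    {P' : Fin T.N → MvPolynomial (Fin 3) ℝ} (hP' : T.IsPiecewise R.U w' P') (hu : MemH10 Ω u) (hw : MemH10 Ω w) (hw' : MemH10 Ω w')
    (i : Fin 3) :
    ∫ x in Ω, wgrad Ω (u - w) i x ^ 2 ≤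
      2 * (∑ e, ∫ x in T.elem e, (wgrad Ω u i x - pval (MvPolynomial.pderiv i (P' e)) x) ^ 2) +
      2 * ∫ x in Ω, wgrad Ω (w - w') i x ^ 2 := by
  have gu := (hu.hasWeakGrad.2 i).1
  have gw := (hw.hasWeakGrad.2 i).1
  have gw' := (hw'.hasWeakGrad.2 i).1
  have e1 : ∫ x in Ω, wgrad Ω (u - w) i x ^ 2 = ∫ x in Ω, (wgrad Ω u i x - wgrad Ω w i x) ^ 2 := by
    refine integral_congr_ae ?_
    filter_upwards [(hu.hasWeakGrad.sub hw.hasWeakGrad).wgrad_ae_eq hΩ.1 i] with x hx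
    rw [hx]; rfl
  have e2 : ∫ x in Ω, wgrad Ω (w - w') i x ^ 2 =
      ∫ x in Ω, (wgrad Ω w' i x - wgrad Ω w i x) ^ 2 := by
    refine integral_congr_ae ?_
    filter_upwards [(hw.hasWeakGrad.sub hw'.hasWeakGrad).wgrad_ae_eq hΩ.1 i] with x hx
    rw [hx, Pi.sub_apply, Pi.sub_apply]; ring
  have e3 : ∑ e, ∫ x in T.elem e, (wgrad Ω u i x - pval (MvPolynomial.pderiv i (P' e)) x) ^ 2 =
      ∫ x in Ω, (wgrad Ω w' i x - wgrad Ω u i x) ^ 2 := by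
    have hi : IntegrableOn (fun x => (wgrad Ω w' i x - wgrad Ω u i x) ^ 2) Ω :=
      (gw'.sub gu).integrable_sq
    rw [T.setIntegral_eq_sum hΩ hi]
    refine Finset.sum_congr rfl fun e _ => integral_congr_ae ?_
    filter_upwards [hP'.weakGrad_ae_eq hΩ hw'.hasWeakGrad e i] with x hx
    rw [← hx]; ring
  rw [e1, e2, e3]
  exact integral_sub_sq_le gw' gu gw

-- Strang's argument for `w = uh - I`: coercivity and the residual bound give an inequality that is
-- linear in the square root of the energy, and one such factor cancels. The triangle inequality
-- through `I` and Friedrichs' inequality for `u - uh` finish the estimate.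
include hΩ hΩb hR in
theorem exists_error_bound (hdeg : R.HasDegree p) {c : E3 → ℝ} (hc : IsCkClosure Ω p c)
    {c₀ : ℝ} (hc₀ : 0 < c₀) (hcb : ∀ x ∈ Ω, c₀ ≤ c x)
    (γ : ℝ) {k l : ℕ} (hk : 2 ≤ k) (hkp : k ≤ p + 1) (hl : 2 ≤ l) (hlp : l ≤ p) :
    ∃ C : ℝ, 0 < C ∧ ∀ T : TetMesh Ω, T.ShapeRegular γ → ∀ u v uh : E3 → ℝ,
      ContinuousOn v (closure Ω) → MemH Ω l v → IsWeakSolution Ω c v u → MemH Ω k u →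
      T.IsDiscreteSolution R c v uh →
      normH Ω 1 (u - uh) ≤
        C * ((2 * T.h) ^ (k - 1) * normH Ω k u + (2 * T.h) ^ l * normH Ω l v) := by
  obtain ⟨C, hC, hcons⟩ := exists_consistency_bound hΩ hΩb hR hdeg hc γ hk hkp hl hlp
  obtain ⟨κ, hκ, hcoer⟩ := exists_stiffForm_coercive hR hc.2.1 hc₀ hcb
  obtain ⟨F, hF, hfried⟩ := exists_friedrichs hΩ.1 hΩb
  obtain ⟨B, hB, hBd⟩ := exists_pderiv_bound hR γ
  -- Friedrichs' inequality and the three gradient bounds give `∫ w ^ 2 ≤ 3 F B ^ 2 S`, where `S` is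
  -- the energy of `w`; the additional one accounts for the energy itself.
  obtain ⟨M, hM⟩ : ∃ M : ℝ, M = 3 * F * B ^ 2 + 1 := ⟨_, rfl⟩
  have hM1 : 1 ≤ M := by
    have : 0 ≤ 3 * F * B ^ 2 := by positivity
    rw [hM]; linarith
  obtain ⟨A, hA⟩ : ∃ A : ℝ, A = C * √M / κ := ⟨_, rfl⟩
  have hA0 : 0 ≤ A := by rw [hA]; positivity
  -- Three partial derivatives, each bounded by twice the interpolation error plus twice the
  -- discrete error, and `F + 1` for passing from gradients to the `H¹` norm.
  refine ⟨√(6 * (F + 1) * (C + B ^ 2 * A ^ 2)), by positivity,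
    fun T hs u v uh hvc hv hsol hu hdisc => ?_⟩
  obtain ⟨I, Q, hI, hQ, hQu, hres⟩ := hcons T hs u v hvc hv hsol hu
  obtain ⟨P, hP⟩ := hdisc.1.exists_isPiecewise
  have huh : MemH10 Ω uh := hdisc.1.1
  have hwP := hP.sub hQ
  have hw : MemH10 Ω (uh - I) := huh.sub hΩ.1 hI
  have hS := T.energy_nonneg R (P - Q)
  have hnu : 0 ≤ normH Ω k u := Real.sqrt_nonneg _
  have hnv : 0 ≤ normH Ω l v := Real.sqrt_nonneg _
  have hh := T.h_nonneg
  obtain ⟨a, ha⟩ : ∃ a : ℝ, a = (2 * T.h) ^ (k - 1) * normH Ω k u := ⟨_, rfl⟩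
  obtain ⟨b, hb⟩ : ∃ b : ℝ, b = (2 * T.h) ^ l * normH Ω l v := ⟨_, rfl⟩
  have ha0 : 0 ≤ a := by rw [ha]; positivity
  have hb0 : 0 ≤ b := by rw [hb]; positivity
  have hgrad : ∀ i, ∫ x in Ω, wgrad Ω (uh - I) i x ^ 2 ≤ B ^ 2 * T.energy R (P - Q) :=
    hwP.integral_wgrad_sq_le hΩ hBd hs hw
  have hres := hres _ _ hw hwP
  rw [← ha, ← hb] at hres ⊢
  simp only [← ha] at hQu
  have hsplit : T.stiffForm R c (uh - I) (uh - I) =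
      T.stiffForm R c uh (uh - I) - T.stiffForm R c I (uh - I) := by
    rw [hwP.stiffForm_eq R c hwP, hP.stiffForm_eq R c hwP, hQ.stiffForm_eq R c hwP]
    simp only [← Finset.sum_sub_distrib]
    refine Finset.sum_congr rfl fun e _ => Finset.sum_congr rfl fun i _ =>
      Finset.sum_congr rfl fun x _ => ?_
    rw [Pi.sub_apply, map_sub, pval_sub]
    ring
  have hen := hcoer T _ _ hwP
  rw [hsplit, hdisc.2 _ (hwP.memUh hw)] at hen
  obtain ⟨S, hSe⟩ : ∃ S : ℝ, S = T.energy R (P - Q) := ⟨_, rfl⟩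
  rw [← hSe] at hS hen hres
  simp only [← hSe] at hgrad
  have hL2 : (∫ x in Ω, (uh - I) x ^ 2) + S ≤ M * S := by
    have h1 := hfried _ hw
    have h2 := Finset.sum_le_sum fun i (_ : i ∈ Finset.univ) => hgrad i
    rw [Finset.sum_const, Finset.card_univ, Fintype.card_fin, nsmul_eq_mul] at h2
    push_cast at h2
    have h3 := h1.trans (mul_le_mul_of_nonneg_left h2 hF.le)
    rw [hM]; linarith
  have hsqrt : √((∫ x in Ω, (uh - I) x ^ 2) + S) ≤ √M * √S := by
    rw [← Real.sqrt_mul (by linarith)]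
    exact Real.sqrt_le_sqrt hL2
  have hsM : 1 ≤ √M := Real.one_le_sqrt.2 hM1
  have hkey : κ * S ≤ C * √M * (a + b) * √S := by
    calc κ * S ≤ C * b * (√M * √S) + C * a * √S :=
          (hen.trans hres).trans (by gcongr)
      _ ≤ C * b * (√M * √S) + C * a * (√M * √S) := by
          gcongr
          exact le_mul_of_one_le_left (Real.sqrt_nonneg _) hsM
      _ = _ := by ring
  have hSb : S ≤ A ^ 2 * (a + b) ^ 2 := by
    have h1 : κ * √S * √S ≤ C * √M * (a + b) * √S := by
      rwa [mul_assoc, Real.mul_self_sqrt hS]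
    have h2 : √S ≤ A * (a + b) := by
      rcases (Real.sqrt_nonneg S).eq_or_lt with h | h
      · rw [← h]; positivity
      · have h3 := le_of_mul_le_mul_right h1 h
        rw [hA, div_mul_eq_mul_div, le_div_iff₀ hκ]
        linarith
    calc S = √S ^ 2 := (Real.sq_sqrt hS).symm
      _ ≤ (A * (a + b)) ^ 2 := by gcongr
      _ = _ := by ring
  have hsub : MemH10 Ω (u - uh) := hsol.1.sub hΩ.1 huh
  have hn := hsub.hasWeakGrad.normH_sq hΩ.1
  have hg : ∀ i, ∫ x in Ω, wgrad Ω (u - uh) i x ^ 2 ≤ 2 * (C * a ^ 2) + 2 * (B ^ 2 * S) := fun i => by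
    have h1 := hQ.integral_wgrad_sub_sq_le hΩ hsol.1 huh hI i
    have h2 := hQu i
    have h3 := hgrad i
    linarith
  have hgs := Finset.sum_le_sum fun i (_ : i ∈ Finset.univ) => hg i
  rw [Finset.sum_const, Finset.card_univ, Fintype.card_fin, nsmul_eq_mul] at hgs
  push_cast at hgs
  have hfr := hfried _ hsub
  have hsq : normH Ω 1 (u - uh) ^ 2 ≤ 6 * (F + 1) * (C + B ^ 2 * A ^ 2) * (a + b) ^ 2 := by
    rw [hn]
    have h1 : a ^ 2 ≤ (a + b) ^ 2 := by gcongr; linarith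
    calc _ ≤ (F + 1) * ∑ i, ∫ x in Ω, wgrad Ω (u - uh) i x ^ 2 := by linarith
      _ ≤ (F + 1) * (3 * (2 * (C * a ^ 2) + 2 * (B ^ 2 * S))) := by gcongr
      _ ≤ (F + 1) * (3 * (2 * (C * (a + b) ^ 2) + 2 * (B ^ 2 * (A ^ 2 * (a + b) ^ 2)))) := by gcongr
      _ = _ := by ring
  refine le_of_sq_le_sq ?_ (by positivity)
  rw [mul_pow, Real.sq_sqrt (by positivity)]
  exact hsq

/-- Surplus powers of the mesh size are absorbed into a bound that is at least one, which allows the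
common exponent in the final estimate. -/
theorem two_mul_pow_le {h H : ℝ} (hh : 0 ≤ h) (hH : h ≤ H) (hH1 : 1 ≤ H) {m n q : ℕ} (hmn : m ≤ n)
    (hnq : n ≤ q) : (2 * h) ^ n ≤ (2 * H) ^ q * h ^ m := by
  obtain ⟨d, rfl⟩ := Nat.exists_eq_add_of_le hmn
  calc (2 * h) ^ (m + d) = 2 ^ (m + d) * (h ^ d * h ^ m) := by rw [mul_pow, pow_add h]; ring
    _ ≤ 2 ^ q * (H ^ q * h ^ m) := by
        gcongr
        · norm_num
        · exact (pow_le_pow_left₀ hh hH d).trans (pow_le_pow_right₀ hH1 (by omega))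
    _ = _ := by ring

end ErrorBound

end MassLumped

end

/-! ### One constant for all smoothness indices -/

theorem mainTheorem1
    (Ω : Set MassLumped.E3) (hΩ : MassLumped.IsLipschitzDomain Ω) (hΩb : Bornology.IsBounded Ω)
    (p : ℕ) (hp : 2 ≤ p)
    (c : MassLumped.E3 → ℝ) (hc : MassLumped.IsCkClosure Ω p c)
    (c₀ c₁ : ℝ) (hc₀ : 0 < c₀) (hcb : ∀ x ∈ Ω, c₀ ≤ c x ∧ c x ≤ c₁)
    (R : MassLumped.RefElement) (hdeg : R.HasDegree p) (hR : R.Conditions p)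
    (γ : ℝ) :
    ∃ C : ℝ, 0 < C ∧
      ∀ T : MassLumped.TetMesh Ω, T.ShapeRegular γ →
      ∀ (ku kv : ℕ), 2 ≤ ku → 2 ≤ kv →
      ∀ u v uh : MassLumped.E3 → ℝ,
        ContinuousOn v (closure Ω) → MassLumped.MemH Ω kv v →
        MassLumped.IsWeakSolution Ω c v u → MassLumped.MemH Ω ku u →
        T.IsDiscreteSolution R c v uh →
        MassLumped.normH Ω 1 (u - uh) ≤
          C * T.h ^ (min p (min (ku - 1) kv)) *
            (MassLumped.normH Ω (min (p + 1) ku) u + MassLumped.normH Ω (min p kv) v) := by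
  -- Inadmissible pairs receive the constant one so that a constant can be chosen for all pairs.
  have hex : ∀ k l : ℕ, ∃ C : ℝ, 0 < C ∧ (2 ≤ k → k ≤ p + 1 → 2 ≤ l → l ≤ p →
      ∀ T : MassLumped.TetMesh Ω, T.ShapeRegular γ → ∀ u v uh : MassLumped.E3 → ℝ,
        ContinuousOn v (closure Ω) → MassLumped.MemH Ω l v → MassLumped.IsWeakSolution Ω c v u →
        MassLumped.MemH Ω k u → T.IsDiscreteSolution R c v uh →
        MassLumped.normH Ω 1 (u - uh) ≤ C * ((2 * T.h) ^ (k - 1) * MassLumped.normH Ω k u +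
          (2 * T.h) ^ l * MassLumped.normH Ω l v)) := by
    intro k l
    by_cases h : 2 ≤ k ∧ k ≤ p + 1 ∧ 2 ≤ l ∧ l ≤ p
    · obtain ⟨C, hC, hb⟩ := MassLumped.exists_error_bound hΩ hΩb hR hdeg hc hc₀
        (fun x hx => (hcb x hx).1) γ h.1 h.2.1 h.2.2.1 h.2.2.2
      exact ⟨C, hC, fun _ _ _ _ => hb⟩
    · exact ⟨1, one_pos, fun h1 h2 h3 h4 => absurd ⟨h1, h2, h3, h4⟩ h⟩
  choose C hC hbound using hex
  -- After truncation at `p + 1` and `p` only finitely many index pairs occur, so the sum of their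
  -- constants serves all `ku` and `kv`.
  obtain ⟨A, hA⟩ : ∃ A : ℝ, A = ∑ k ∈ Finset.range (p + 2), ∑ l ∈ Finset.range (p + 1), C k l :=
    ⟨_, rfl⟩
  obtain ⟨H, hHe⟩ : ∃ H : ℝ, H = Metric.diam (closure Ω) + 1 := ⟨_, rfl⟩
  have hH1 : 1 ≤ H := by
    have := Metric.diam_nonneg (s := closure Ω)
    rw [hHe]; linarith
  have hle : ∀ k ≤ p + 1, ∀ l ≤ p, C k l ≤ A := fun k hk l hl => by
    rw [hA]
    calc C k l ≤ ∑ l ∈ Finset.range (p + 1), C k l :=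
          Finset.single_le_sum (f := C k) (fun l _ => (hC k l).le)
            (Finset.mem_range.2 (Nat.lt_succ_of_le hl))
      _ ≤ _ := Finset.single_le_sum (f := fun k => ∑ l ∈ Finset.range (p + 1), C k l)
          (fun k _ => Finset.sum_nonneg fun l _ => (hC k l).le)
          (Finset.mem_range.2 (Nat.lt_succ_of_le hk))
  have hA0 : 0 < A := (hC 0 0).trans_le (hle 0 (Nat.zero_le _) 0 (Nat.zero_le _))
  refine ⟨A * (2 * H) ^ p, by positivity,
    fun T hs ku kv hku hkv u v uh hvc hv hsol hu hdisc => ?_⟩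
  have hh := T.h_nonneg
  have hhH : T.h ≤ H := by
    have := T.h_le hΩb
    rw [hHe]; linarith
  have hnu : 0 ≤ MassLumped.normH Ω (min (p + 1) ku) u := Real.sqrt_nonneg _
  have hnv : 0 ≤ MassLumped.normH Ω (min p kv) v := Real.sqrt_nonneg _
  have hb := hbound (min (p + 1) ku) (min p kv) (by omega) (by omega) (by omega) (by omega) T hs
    u v uh hvc (hv.mono (by omega)) hsol (hu.mono (by omega)) hdisc
  have h1 : (2 * T.h) ^ (min (p + 1) ku - 1) ≤ (2 * H) ^ p * T.h ^ (min p (min (ku - 1) kv)) :=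
    MassLumped.two_mul_pow_le hh hhH hH1 (by omega) (by omega)
  have h2 : (2 * T.h) ^ (min p kv) ≤ (2 * H) ^ p * T.h ^ (min p (min (ku - 1) kv)) :=
    MassLumped.two_mul_pow_le hh hhH hH1 (by omega) (by omega)
  calc _ ≤ _ := hb
    _ ≤ A * (((2 * H) ^ p * T.h ^ (min p (min (ku - 1) kv))) *
          MassLumped.normH Ω (min (p + 1) ku) u +
        ((2 * H) ^ p * T.h ^ (min p (min (ku - 1) kv))) * MassLumped.normH Ω (min p kv) v) := by
        gcongr
        exact hle _ (by omega) _ (by omega)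
    _ = _ := by ring
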